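/- **Setting.** Let $d,k,l\in\mathbb N$, $T>0$, and let all $L^p$ spaces on $\mathbb R^d$ refer to Lebesgue measure $m(dx)=dx$; $\|\cdot\|_p$ is the $L^p$ norm, $(\cdot,\cdot)$ the $L^2$ inner product, $|\cdot|$ the Euclidean norm on vectors and on matrices. Let $\sigma:\mathbb R^d\to\mathbb R^{d\times k}$ be measurable and bounded, $a=\sigma\sigma^*$, $b,\hat b:\mathbb R^d\to\mathbb R^d$ and $c:\mathbb R^d\to[0,\infty)$ measurable, with $a_{ij},\ \sum_j a_{ij}b_j,\ \sum_j a_{ij}\hat b_j,\ c\in L^1_{\rm loc}$. For $u,v\in C_0^\infty(\mathbb R^d)$ put $$\mathcal E^a(u,v)=\sum_{i,j}\int a_{ij}\,\partial_iu\,\partial_jv\,dx,\qquad \mathcal E^{a,\hat b}(u,v)=\mathcal E^a(u,v)+\int cuv\,dx+\sum_{i}\int\Big(\sum_ja_{ij}\hat b_j\Big)\partial_iu\;v\,dx,$$ $D_\sigma u=(\nabla u)\sigma$, and for a form $\mathcal Q$ write $\mathcal Q_\gamma=\mathcal Q+\gamma(\cdot,\cdot)$, $\mathcal Q(u)=\mathcal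 Q(u,u)$. **Assumptions on the operator.** (A1) $\mathcal E^a$ is closable on $L^2$. (Hence $D_\sigma$ is closable from $L^2$ to $L^2(\mathbb R^d;\mathbb R^k)$; its closure is again written $D_\sigma$, with domain $F^a$.) (A2′) $\sigma$ is bounded; with $\frac1q+\frac1d=\frac12$ there is a constant such that $\|u\|_q\le \mathrm{const}\cdot\mathcal E^a(u,u)^{1/2}$ for all $u\in C_0^\infty(\mathbb R^d)$; moreover $|\hat b\sigma|\in L^d+L^\infty$ and $c\in L^{d/2}+L^\infty$. (A3) $|b\sigma|\in L^2$, and there is $\alpha\ge0$ with $\int\langle b\sigma,(\nabla u^2)\sigma\rangle\,dx\ge-\alpha\|u\|_2^2$ for $u\in C_0^\infty(\mathbb R^d)$. *The constant $c_2$.* Say that $c_2\ge0$ is admissible if (A2) holds with it: $\mathcal E^{a,\hat b}_{c_2}$ is a coercive closed form (nonnegative and closable on $C_0^\infty$, with the weak sector condition), and for some $c_1,c_3>0$ one has $c_1\mathcal E^a(u)\le\mathcal E^{a,\hat b}_{c_2}(u)$ and $\int cu^2\,dx\le c_3(\mathcal E^a(u)+\|u\|_2^2)$ for $u\in C_0^\infty$.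 For an admissible $c_2$, $F\subset F^a$ denotes the closure of $C_0^\infty$ in $L^2$ with respect to the symmetric part of $\mathcal E^{a,\hat b}_{c_2+1}$. On $F$, $$\mathcal E^{a,\hat b}(u,v)=\int\langle D_\sigma u,D_\sigma v\rangle\,dx+\int cuv\,dx+\int\langle\hat b\sigma,D_\sigma u\rangle v\,dx,\qquad \mathcal E(u,v)=\mathcal E^{a,\hat b}(u,v)+\int\langle b\sigma,D_\sigma u\rangle v\,dx\ \ (v\text{ bounded}).$$ (A4) $(P_t)_{t\ge0}$ is a positivity preserving $C_0$-semigroup on $L^1$ such that, for some $C_T>0$, $\|P_tf\|_\infty\le C_T\|f\|_\infty$ for all $t\in[0,T]$ and $f\in L^1\cap L^\infty$; it therefore extends to $L^2$, where its generator is $(L,\mathcal D(L))$. Bounded elements of $\mathcal D(L)$ lie in $F$; for every bounded $u\in F$ there are uniformly bounded $u_n\in\mathcal D(L)$ with $\mathcal E^{a,\hat b}_{c_2+1}(u_n-u)\to0$; and $\mathcal E(u,v)=-(Lu,v)$ for bounded $u,v\in\mathcal D(L)$. (H6) If $u\in L^2$ has a weak gradient $\nabla u\in L^1_{\rm loc}$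 and $\mathcal E^a(u)=\int|(\nabla u)\sigma|^2dx<\infty$, then $u\in F$. **Assumptions on the data.** $\phi\in L^2(\mathbb R^d;\mathbb R^l)$, $f:[0,T]\times\mathbb R^d\times\mathbb R^l\times\mathbb R^{l\times k}\to\mathbb R^l$ is measurable, $C>0$, $\mu\in L^1([0,T];\mathbb R)$, and for all $t,x,y,y',z,z'$: (H1) $|f(t,x,y,z)-f(t,x,y,z')|\le C|z-z'|$; (H2) $\langle y-y',f(t,x,y,z)-f(t,x,y',z)\rangle\le\mu_t|y-y'|^2$; (H3) $y\mapsto f(t,x,y,z)$ is continuous; (H4) for each $r>0$, $f'^{,r}(t,x)=\sup_{|y|\le r}|f(t,x,y,0)-f(t,x,0,0)|$ belongs to $L^1([0,T];L^2)$; (H5) with $f^0(t,x)=f(t,x,0,0)$: $\|\phi\|_\infty<\infty$, $\|f^0\|_\infty<\infty$, $|\phi|\in L^2$, $|f^0|\in L^2([0,T];L^2)$. **Solutions.** Let $\hat F=C([0,T];L^2)\cap L^2((0,T);F)$ and, for $u\in\hat F^l$, $$\|u\|_T^2=\sup_{t\le T}\|u_t\|_2^2+\int_0^T\sum_{i=1}^l\mathcal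 E^{a,\hat b}_{c_2+1}(u^i_t)\,dt .$$ Consider the system $$(\partial_t+L)u+f(\cdot,\cdot,u,D_\sigma u)=0\ \text{ on }[0,T]\times\mathbb R^d,\qquad u_T=\phi. \tag{3.1}$$ A *strong solution* of (3.1) with (measurable) data $(\phi,f)$ is a $u$ with components in $\hat F\cap L^1((0,T);\mathcal D(L))$, $L^2$-differentiable on $[0,T]$ with $\partial_tu\in L^1((0,T);L^2)$, such that $f(\cdot,\cdot,u,D_\sigma u)\in L^1([0,T];L^2)$ and (3.1) holds a.e. A *generalized solution* of (3.1) is a $u\in\hat F^l$ with $f(\cdot,\cdot,u,D_\sigma u)\in L^1([0,T];L^2)$ for which there are strong solutions $u_n$ with data $(\phi_n,f_n)$ such that $\|u_n-u\|_T\to0$, $\|\phi_n-\phi\|_2\to0$ and $f_n(\cdot,\cdot,u_n,D_\sigma u_n)\to f(\cdot,\cdot,u,D_\sigma u)$ in $L^1([0,T];L^2)$. **Theorem 3.11.** Assume $\sigma$ bounded, (A1), (A2′) and (A3). Then an admissible $c_2$ exists. Moreover, for every admissible $c_2$ and every $(P_t)$ such that (A4) and (H6) hold, and for every $C>0$ and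 $\mu\in L^1([0,T];\mathbb R)$, there are constants $K_1,K_2>0$ such that for all $\phi,f$ satisfying (H1)–(H5) with this $C$ and $\mu$, equation (3.1) has a unique generalized solution $u$, and $$\|u\|_T^2\le K_1\Big(\|\phi\|_2^2+\int_0^T\|f^0_t\|_2^2\,dt\Big),\qquad \|u\|_\infty\le K_2\big(\|\phi\|_\infty+\|f^0\|_\infty\big).$$ (So $K_1,K_2$ depend on $\phi$ and $f$ only through $C$ and $\mu$, and not on $u$.) -/

import Mathlib

open MeasureTheory Filter Set Topology
open scoped NNReal ENNReal ContDiff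

/-- `ℝ^d` with its Euclidean norm. -/
abbrev Rn (d : ℕ) : Type := EuclideanSpace ℝ (Fin d)

/-- Real `l × k` matrices with the trace scalar product and its norm `(∑ zᵢⱼ²)^(1/2)`. -/
abbrev Mat (l k : ℕ) : Type := EuclideanSpace ℝ (Fin l × Fin k)

/-- `L¹(ℝ^d, dx)`. -/
abbrev L1 (d : ℕ) : Type := Lp ℝ 1 (volume : Measure (Rn d))

/-- `L²(ℝ^d, dx)`. -/
abbrev L2 (d : ℕ) : Type := Lp ℝ 2 (volume : Measure (Rn d))

/-- `L²(ℝ^d, dx; ℝ^k)`. -/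
abbrev L2v (d k : ℕ) : Type := Lp (Rn k) 2 (volume : Measure (Rn d))

/-- `φ ∈ C₀^∞(ℝ^d)`: smooth with compact support. -/
def IsTest {d : ℕ} (φ : Rn d → ℝ) : Prop := ContDiff ℝ ∞ φ ∧ HasCompactSupport φ

/-- The row vector `v A ∈ ℝ^k`, for a row vector `v ∈ ℝ^d` and a `d × k` matrix `A`. -/
noncomputable def rowMul {d k : ℕ} (v : Rn d) (A : Matrix (Fin d) (Fin k) ℝ) : Rn k :=
  WithLp.toLp 2 (Matrix.vecMul v.ofLp A)

/-- The coefficients of the operator, with the standing assumptions on them; `a = σ σ*`. -/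
structure Coefficients (d k : ℕ) where
  σ : Rn d → Matrix (Fin d) (Fin k) ℝ
  b : Rn d → Rn d
  bHat : Rn d → Rn d
  c : Rn d → ℝ
  measurable_σ : ∀ i j, Measurable fun x => σ x i j
  measurable_b : Measurable b
  measurable_bHat : Measurable bHat
  measurable_c : Measurable c
  c_nonneg : ∀ x, 0 ≤ c x
  locInt_a : ∀ i j, LocallyIntegrable fun x => (σ x * (σ x).transpose) i j
  locInt_ab : ∀ i, LocallyIntegrable fun x => ∑ j, (σ x * (σ x).transpose) i j * b x j
  locInt_abHat : ∀ i, LocallyIntegrable fun x => ∑ j, (σ x * (σ x).transpose) i j * bHat x j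
  locInt_c : LocallyIntegrable c

namespace Coefficients

variable {d k : ℕ} (𝒞 : Coefficients d k)

/-- The diffusion matrix `a = σ σ*`. -/
def a (x : Rn d) : Matrix (Fin d) (Fin d) ℝ := 𝒞.σ x * (𝒞.σ x).transpose

/-- `b σ`. -/
noncomputable def bσ (x : Rn d) : Rn k := rowMul (𝒞.b x) (𝒞.σ x)

/-- `b̂ σ`. -/
noncomputable def bHatσ (x : Rn d) : Rn k := rowMul (𝒞.bHat x) (𝒞.σ x)

/-- `D_σ φ = (∇φ) σ` for smooth `φ`. -/
noncomputable def DTest (φ : Rn d → ℝ) (x : Rn d) : Rn k := rowMul (gradient φ x) (𝒞.σ x)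

/-- `𝓔^a(φ, ψ) = ∑ ∫ a_ij ∂ᵢφ ∂ⱼψ dx` on test functions. -/
noncomputable def formATest (φ ψ : Rn d → ℝ) : ℝ :=
  ∑ i, ∑ j, ∫ x, 𝒞.a x i j * gradient φ x i * gradient ψ x j

/-- `𝓔^{a,b̂}(φ, ψ)` on test functions. -/
noncomputable def formTest (φ ψ : Rn d → ℝ) : ℝ :=
  𝒞.formATest φ ψ + (∫ x, 𝒞.c x * φ x * ψ x)
    + ∑ i, ∫ x, (∑ j, 𝒞.a x i j * 𝒞.bHat x j) * gradient φ x i * ψ x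

/-- `𝓔^{a,b̂}_γ(φ, ψ) = 𝓔^{a,b̂}(φ, ψ) + γ (φ, ψ)` on test functions. -/
noncomputable def formTestAdd (γ : ℝ) (φ ψ : Rn d → ℝ) : ℝ :=
  𝒞.formTest φ ψ + γ * ∫ x, φ x * ψ x

end Coefficients

/-- A bilinear form `Q` on `C₀^∞(ℝ^d)` is closable on `L²`: a `Q`-Cauchy sequence that tends to `0`
in `L²` satisfies `Q(φₙ, φₙ) → 0`. -/
def IsClosableForm {d : ℕ} (Q : (Rn d → ℝ) → (Rn d → ℝ) → ℝ) : Prop :=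
  ∀ φ : ℕ → Rn d → ℝ, (∀ n, IsTest (φ n)) →
    Tendsto (fun n => eLpNorm (φ n) 2 volume) atTop (𝓝 0) →
    (∀ ε > 0, ∃ N, ∀ m ≥ N, ∀ n ≥ N, Q (φ m - φ n) (φ m - φ n) < ε) →
    Tendsto (fun n => Q (φ n) (φ n)) atTop (𝓝 0)

namespace Coefficients

variable {d k : ℕ} (𝒞 : Coefficients d k)

/-- `w = D_σ u`: the pair `(u, w)` is a limit in `L² × L²` of pairs `(φₙ, D_σ φₙ)`, `φₙ ∈ C₀^∞`.
If `𝓔^a` is closable, then `w` is determined by `u`, and the `u` that possess such a `w` form the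
closure `F^a` of `C₀^∞` with respect to `𝓔^a₁`. -/
def IsDσ (u : L2 d) (w : L2v d k) : Prop :=
  ∃ φ : ℕ → Rn d → ℝ, (∀ n, IsTest (φ n)) ∧
    Tendsto (fun n => eLpNorm (fun x => φ n x - u x) 2 volume) atTop (𝓝 0) ∧
    Tendsto (fun n => eLpNorm (fun x => 𝒞.DTest (φ n) x - w x) 2 volume) atTop (𝓝 0)

open Classical in
/-- `D_σ u` for `u ∈ F^a` (and `0` for other `u`, where it is never used). -/
noncomputable def Dσ (u : L2 d) : L2v d k :=
  if h : ∃ w, 𝒞.IsDσ u w then h.choose else 0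

/-- `u ∈ F`: the closure of `C₀^∞` with respect to (the symmetric part of) `𝓔^{a,b̂}_{c₂+1}`. -/
def MemF (c₂ : ℝ) (u : L2 d) : Prop :=
  ∃ φ : ℕ → Rn d → ℝ, (∀ n, IsTest (φ n)) ∧
    Tendsto (fun n => eLpNorm (fun x => φ n x - u x) 2 volume) atTop (𝓝 0) ∧
    ∀ ε > 0, ∃ N, ∀ m ≥ N, ∀ n ≥ N,
      𝒞.formTestAdd (c₂ + 1) (φ m - φ n) (φ m - φ n) < ε

/-- `𝓔^{a,b̂}(u, v) = ∫ ⟨D_σ u, D_σ v⟩ + ∫ c u v + ∫ ⟨b̂σ, D_σ u⟩ v` for `u, v ∈ F`. -/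
noncomputable def formHat (u v : L2 d) : ℝ :=
  (∫ x, inner ℝ (𝒞.Dσ u x) (𝒞.Dσ v x)) + (∫ x, 𝒞.c x * u x * v x)
    + ∫ x, inner ℝ (𝒞.bHatσ x) (𝒞.Dσ u x) * v x

/-- `𝓔^{a,b̂}_{c₂+1}(u) = 𝓔^{a,b̂}(u, u) + (c₂ + 1) ‖u‖₂²`. -/
noncomputable def energy (c₂ : ℝ) (u : L2 d) : ℝ := 𝒞.formHat u u + (c₂ + 1) * ‖u‖ ^ 2

/-- `𝓔(u, v) = 𝓔^{a,b̂}(u, v) + ∫ ⟨bσ, D_σ u⟩ v` for `u ∈ F` and bounded `v ∈ F`. -/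
noncomputable def form (u v : L2 d) : ℝ :=
  𝒞.formHat u v + ∫ x, inner ℝ (𝒞.bσ x) (𝒞.Dσ u x) * v x

/-- `σ` is bounded. -/
def BddSigma : Prop := ∃ M : ℝ, ∀ x i j, |𝒞.σ x i j| ≤ M

/-- (A1): `𝓔^a` is closable on `L²`. -/
def CondA1 : Prop := IsClosableForm 𝒞.formATest

/-- (A2) with constant `c₂`: `𝓔^{a,b̂}_{c₂}` is (the restriction to the core `C₀^∞` of) a coercive
closed form, i.e. nonnegative, closable, and with the weak sector condition, it dominates `𝓔^a`, and
`∫ c u² ≤ c₃ (𝓔^a(u, u) + ‖u‖₂²)`. -/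
structure CondA2 (c₂ : ℝ) : Prop where
  c₂_nonneg : 0 ≤ c₂
  nonneg : ∀ φ, IsTest φ → 0 ≤ 𝒞.formTestAdd c₂ φ φ
  closable : IsClosableForm (𝒞.formTestAdd c₂)
  sector : ∃ K : ℝ, ∀ φ ψ, IsTest φ → IsTest ψ →
    |𝒞.formTestAdd (c₂ + 1) φ ψ| ≤
      K * √(𝒞.formTestAdd (c₂ + 1) φ φ) * √(𝒞.formTestAdd (c₂ + 1) ψ ψ)
  lower : ∃ c₁ > 0, ∀ φ, IsTest φ → c₁ * 𝒞.formATest φ φ ≤ 𝒞.formTestAdd c₂ φ φ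
  upper_c : ∃ c₃ > 0, ∀ φ, IsTest φ →
    ∫ x, 𝒞.c x * φ x ^ 2 ≤ c₃ * (𝒞.formATest φ φ + ∫ x, φ x ^ 2)

/-- (A2′): the Sobolev inequality with `1/q + 1/d = 1/2`, and `|b̂σ| ∈ L^d + L^∞`,
`c ∈ L^{d/2} + L^∞`. -/
structure CondA2' : Prop where
  bdd : 𝒞.BddSigma
  sobolev : ∃ q : ℝ≥0∞, q⁻¹ + (d : ℝ≥0∞)⁻¹ = 2⁻¹ ∧ ∃ C : ℝ, 0 ≤ C ∧
    ∀ φ, IsTest φ → eLpNorm φ q volume ≤ ENNReal.ofReal (C * √(𝒞.formATest φ φ))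
  bHat_mem : ∃ g h : Rn d → ℝ, MemLp g d volume ∧ MemLp h ⊤ volume ∧
    ∀ᵐ x, ‖𝒞.bHatσ x‖ = g x + h x
  c_mem : ∃ g h : Rn d → ℝ, MemLp g ((d : ℝ≥0∞) / 2) volume ∧ MemLp h ⊤ volume ∧
    ∀ᵐ x, 𝒞.c x = g x + h x

/-- (A3): `|bσ| ∈ L²` and `∫ ⟨bσ, (∇φ²)σ⟩ ≥ -α ‖φ‖₂²`. -/
structure CondA3 : Prop where
  memLp : MemLp 𝒞.bσ 2 volume
  lower : ∃ α : ℝ, 0 ≤ α ∧ ∀ φ, IsTest φ →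
    -α * ∫ x, φ x ^ 2 ≤ ∫ x, inner ℝ (𝒞.bσ x) (𝒞.DTest (fun y => φ y ^ 2) x)

end Coefficients

/-- `v = P_t u` for the extension of `P_t` from `L¹ ∩ L²` to `L²`: the pair `(u, v)` is a limit in
`L² × L²` of pairs `(fₙ, P_t fₙ)` with `fₙ ∈ L¹`. -/
def IsL2Ext {d : ℕ} (P : ℝ≥0 → L1 d →L[ℝ] L1 d) (t : ℝ≥0) (u v : L2 d) : Prop :=
  ∃ f : ℕ → L1 d,
    Tendsto (fun n => eLpNorm (fun x => f n x - u x) 2 volume) atTop (𝓝 0) ∧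
    Tendsto (fun n => eLpNorm (fun x => P t (f n) x - v x) 2 volume) atTop (𝓝 0)

/-- `u ∈ 𝒟(L)` and `L u = g`, where `L` is the `L²`-generator of `(P_t)`. -/
def IsGenerator {d : ℕ} (P : ℝ≥0 → L1 d →L[ℝ] L1 d) (u g : L2 d) : Prop :=
  ∃ v : ℝ≥0 → L2 d, (∀ t, IsL2Ext P t u (v t)) ∧
    Tendsto (fun t : ℝ≥0 => (t : ℝ)⁻¹ • (v t - u)) (𝓝[>] 0) (𝓝 g)

/-- `u` is (essentially) bounded. -/
def IsBdd {d : ℕ} (u : L2 d) : Prop := MemLp u ⊤ (volume : Measure (Rn d))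

/-- A positivity preserving `C₀`-semigroup on `L¹(ℝ^d, dx)`. -/
structure IsPosC0Semigroup {d : ℕ} (P : ℝ≥0 → L1 d →L[ℝ] L1 d) : Prop where
  zero : P 0 = ContinuousLinearMap.id ℝ (L1 d)
  add : ∀ s t, P (s + t) = (P s).comp (P t)
  cont : ∀ f, Tendsto (fun t => P t f) (𝓝[>] 0) (𝓝 f)
  pos : ∀ t f, 0 ≤ f → 0 ≤ P t f

namespace Coefficients

variable {d k : ℕ} (𝒞 : Coefficients d k)

/-- (A4): `(P_t)` is a positivity preserving `C₀`-semigroup on `L¹`, bounded in the sup norm for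
`t ≤ T`, whose `L²`-generator is associated with `𝓔`. -/
structure CondA4 (c₂ T : ℝ) (P : ℝ≥0 → L1 d →L[ℝ] L1 d) : Prop where
  semigroup : IsPosC0Semigroup P
  bdd : ∃ C_T > 0, ∀ t : ℝ≥0, (t : ℝ) ≤ T → ∀ f : L1 d, MemLp f ⊤ volume →
    eLpNorm (P t f) ⊤ volume ≤ ENNReal.ofReal C_T * eLpNorm f ⊤ volume
  domain : ∀ u g, IsGenerator P u g → IsBdd u → 𝒞.MemF c₂ u
  approx : ∀ u, 𝒞.MemF c₂ u → IsBdd u → ∃ w : ℕ → L2 d,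
    (∀ n, ∃ g, IsGenerator P (w n) g) ∧
    (∃ M : ℝ, ∀ n, ∀ᵐ x, |w n x| ≤ M) ∧
    Tendsto (fun n => 𝒞.energy c₂ (w n - u)) atTop (𝓝 0)
  assoc : ∀ u g v h, IsGenerator P u g → IsGenerator P v h → IsBdd u → IsBdd v →
    𝒞.form u v = -inner ℝ g v

/-- (H6): every `u ∈ L²` that has a weak gradient `∇u ∈ L¹_loc` with
`𝓔^a(u) = ∫ |(∇u) σ|² dx < ∞` belongs to `F`. -/
def CondH6 (c₂ : ℝ) : Prop :=
  ∀ (u : L2 d) (g : Rn d → Rn d), LocallyIntegrable g volume →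
    (∀ φ, IsTest φ → ∀ i, ∫ x, u x * gradient φ x i = -∫ x, g x i * φ x) →
    MemLp (fun x => rowMul (g x) (𝒞.σ x)) 2 volume → 𝒞.MemF c₂ u

/-- `u ∈ F̂ = C([0,T]; L²) ∩ L²((0,T); F)`. -/
structure MemFhat (c₂ T : ℝ) (u : ℝ → L2 d) : Prop where
  cont : ContinuousOn u (Icc 0 T)
  mem : ∀ᵐ t ∂(volume.restrict (Icc 0 T)), 𝒞.MemF c₂ (u t)
  meas : AEStronglyMeasurable (fun t => 𝒞.Dσ (u t)) (volume.restrict (Icc 0 T))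
  int : IntegrableOn (fun t => 𝒞.energy c₂ (u t)) (Icc 0 T)

/-- `‖u‖_T² = sup_{t ≤ T} ‖u_t‖₂² + ∫₀ᵀ 𝓔^{a,b̂}_{c₂+1}(u_t) dt` for `u ∈ F̂^l`. -/
noncomputable def normTSq (c₂ T : ℝ) {l : ℕ} (u : Fin l → ℝ → L2 d) : ℝ :=
  (⨆ t : Icc (0 : ℝ) T, ∑ i, ‖u i t‖ ^ 2) + ∫ t in Icc 0 T, ∑ i, 𝒞.energy c₂ (u i t)

/-- The matrix `D_σ u(x)`, whose rows are `D_σ uⁱ(x)`. -/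
noncomputable def DσMat {l : ℕ} (u : Fin l → L2 d) (x : Rn d) : Mat l k :=
  WithLp.toLp 2 fun p => 𝒞.Dσ (u p.1) x p.2

end Coefficients

/-- The `ℝ^l`-valued function with components `wⁱ`. -/
noncomputable def vec {d l : ℕ} (w : Fin l → L2 d) (x : Rn d) : Rn l :=
  WithLp.toLp 2 fun i => w i x

/-- The nonlinearities `f(t, x, y, z)`. -/
abbrev Nonlin (d k l : ℕ) : Type := ℝ → Rn d → Rn l → Mat l k → Rn l

/-- Joint measurability of `f`. -/
def Nonlin.IsMeasurable {d k l : ℕ} (f : Nonlin d k l) : Prop :=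
  Measurable fun p : ℝ × Rn d × Rn l × Mat l k => f p.1 p.2.1 p.2.2.1 p.2.2.2

namespace Coefficients

variable {d k l : ℕ} (𝒞 : Coefficients d k)

/-- `f(t, ·, u, D_σ u)` belongs to `L¹([0,T]; L²)`, and `gⁱ` is its `i`-th component there. -/
def IsSubst (T : ℝ) (f : Nonlin d k l) (u g : Fin l → ℝ → L2 d) : Prop :=
  (∀ i, IntegrableOn (g i) (Icc 0 T)) ∧
  ∀ᵐ t ∂(volume.restrict (Icc 0 T)), ∀ i, ∀ᵐ x,
    g i t x = f t x (vec (fun j => u j t) x) (𝒞.DσMat (fun j => u j t) x) i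

/-- `u` is a strong solution of `(∂_t + L) u + g = 0`, `u_T = φ`, for `g ∈ L¹([0,T]; L²)`:
`u ∈ F̂ ∩ L¹((0,T); 𝒟(L))` is `L²`-differentiable on `[0,T]` with `∂_t u ∈ L¹((0,T); L²)`. -/
def IsLinStrongSol (c₂ T : ℝ) (P : ℝ≥0 → L1 d →L[ℝ] L1 d)
    (φ : L2 d) (g u : ℝ → L2 d) : Prop :=
  𝒞.MemFhat c₂ T u ∧ u T = φ ∧ ∃ u' Lu : ℝ → L2 d,
    (∀ t ∈ Icc 0 T, HasDerivWithinAt u (u' t) (Icc 0 T) t) ∧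
    IntegrableOn u' (Icc 0 T) ∧ IntegrableOn Lu (Icc 0 T) ∧
    ∀ᵐ t ∂(volume.restrict (Icc 0 T)), IsGenerator P (u t) (Lu t) ∧ u' t + Lu t + g t = 0

/-- `u` is a strong solution of `(∂_t + L) u + f(·, ·, u, D_σ u) = 0`, `u_T = φ`, and
`g = f(·, ·, u, D_σ u)`. -/
def IsStrongSol (c₂ T : ℝ) (P : ℝ≥0 → L1 d →L[ℝ] L1 d)
    (φ : Fin l → L2 d) (f : Nonlin d k l) (u g : Fin l → ℝ → L2 d) : Prop :=
  f.IsMeasurable ∧ 𝒞.IsSubst T f u g ∧ ∀ i, 𝒞.IsLinStrongSol c₂ T P (φ i) (g i) (u i)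

/-- `u` is a generalized solution of `(∂_t + L) u + f(·, ·, u, D_σ u) = 0`, `u_T = φ`. -/
def IsGeneralizedSol (c₂ T : ℝ) (P : ℝ≥0 → L1 d →L[ℝ] L1 d)
    (φ : Fin l → L2 d) (f : Nonlin d k l) (u : Fin l → ℝ → L2 d) : Prop :=
  (∀ i, 𝒞.MemFhat c₂ T (u i)) ∧ ∃ g, 𝒞.IsSubst T f u g ∧
    ∃ (uₙ gₙ : ℕ → Fin l → ℝ → L2 d) (φₙ : ℕ → Fin l → L2 d) (fₙ : ℕ → Nonlin d k l),
      (∀ n, 𝒞.IsStrongSol c₂ T P (φₙ n) (fₙ n) (uₙ n) (gₙ n)) ∧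
      Tendsto (fun n => 𝒞.normTSq c₂ T (fun i t => uₙ n i t - u i t)) atTop (𝓝 0) ∧
      (∀ i, Tendsto (fun n => ‖φₙ n i - φ i‖) atTop (𝓝 0)) ∧
      ∀ i, Tendsto (fun n => ∫ t in Icc 0 T, ‖gₙ n i t - g i t‖) atTop (𝓝 0)

end Coefficients

namespace Nonlin

variable {d k l : ℕ} (f : Nonlin d k l)

/-- `f⁰` as a function on `[0,T] × ℝ^d`. -/
def f0 (p : ℝ × Rn d) : Rn l := f p.1 p.2 0 0

/-- `f'^{,r}(t, x) = sup_{|y| ≤ r} |f(t, x, y, 0) - f(t, x, 0, 0)|`. -/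
noncomputable def fsup (r t : ℝ) (x : Rn d) : ℝ :=
  sSup ((fun y : Rn l => ‖f t x y 0 - f t x 0 0‖) '' Metric.closedBall 0 r)

/-- The measure `dt × dx` on `[0,T] × ℝ^d`. -/
noncomputable def slab (d : ℕ) (T : ℝ) : Measure (ℝ × Rn d) :=
  (volume.restrict (Icc 0 T)).prod volume

/-- (H1)–(H5), with Lipschitz constant `C` and monotonicity function `μ`. -/
structure CondH (T C : ℝ) (μ : ℝ → ℝ) (φ : Fin l → L2 d) : Prop where
  H1 : ∀ t ∈ Icc 0 T, ∀ x y z z', ‖f t x y z - f t x y z'‖ ≤ C * ‖z - z'‖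
  H2 : ∀ t ∈ Icc 0 T, ∀ x y y' z,
    inner ℝ (y - y') (f t x y z - f t x y' z) ≤ μ t * ‖y - y'‖ ^ 2
  H3 : ∀ t ∈ Icc 0 T, ∀ x z, Continuous fun y => f t x y z
  H4 : ∀ r > 0, ∫⁻ t in Icc 0 T, eLpNorm (f.fsup r t) 2 volume < ⊤
  H5_φ : MemLp (vec φ) ⊤ volume
  H5_f0 : MemLp f.f0 ⊤ (slab d T)
  H5_f0_sq : MemLp f.f0 2 (slab d T)

end Nonlin

open ContinuousLinearMap (comp_apply norm_id_le intervalIntegral_comp_comm mul)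
open Filter.Eventually (of_forall)
open Real (norm_of_nonneg norm_eq_abs sq_sqrt sqrt_nonneg sqrt_zero sqrt_sq exp exp_pos dist_eq)
open intervalIntegral (integral_congr integral_add_adjacent_intervals integral_same integral_symm
  integral_of_le integral_mono_on integral_mono_ae_restrict)
open RingHom (id_apply)
open TopologicalSpace (denseSeq denseRange_denseSeq)
open ENNReal (ofReal ofReal_le_ofReal ofReal_ne_top toReal_mono ofReal_mul ofReal_toReal
  toReal_nonneg)
open MeasureTheory.Lp (aestronglyMeasurable memLp coeFn_add coeFn_zero coeFn_smul coeFn_sub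
  coeFn_le)
open ENNReal.Tendsto (const_mul)
open EuclideanSpace (norm_sq_eq proj)
open Finset (sum_le_sum sum_congr sum_mul sum_comm mul_sum sum_nonneg sum_add_distrib sum_insert
  single_le_sum sum_sub_distrib)
open MeasureTheory.L2 (inner_def integrable_inner)
open L1 (integrable_coeFn)
open HasDerivWithinAt (scomp)
open Real.HolderConjugate (two_two)
open WithLp (toLp)
open PiLp (continuous_toLp)
open Fintype (card_fin)

variable {d k l : ℕ} {Q : Coefficients d k} {c₂ T C : ℝ} {P : ℝ≥0 → L1 d →L[ℝ] L1 d}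
  {S : ℝ → L2 d →L[ℝ] L2 d} {f : Nonlin d k l} {μ : ℝ → ℝ}

notation:50 f:51 " ⇝ " a:51 => Tendsto f atTop (𝓝 a)

notation:50 f:51 " ∈L¹ " T:51 => IntegrableOn f (Icc 0 T)

section

variable {α E : Type*} [MeasurableSpace α] {ν : Measure α} [NormedAddCommGroup E] {p : ℝ≥0∞}

theorem ae_add (f g : Lp E p ν) : ∀ᵐ x ∂ν, (f + g) x = f x + g x := coeFn_add f g

theorem ae_sub (f g : Lp E p ν) : ∀ᵐ x ∂ν, (f - g) x = f x - g x := coeFn_sub f g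

theorem ae_smul [NormedSpace ℝ E] (c : ℝ) (f : Lp E p ν) : ∀ᵐ x ∂ν, (c • f) x = c • f x :=
  coeFn_smul c f

theorem ae_zero : ∀ᵐ x ∂ν, (0 : Lp E p ν) x = 0 := coeFn_zero E p ν

end

/-- Lebesgue measure on `[0, T]`. -/
notation "dt" T:max => Measure.restrict (volume : Measure ℝ) (Icc 0 T)

theorem ae_mem_Icc {a b : ℝ} : ∀ᵐ t ∂(volume.restrict (Icc a b)), t ∈ Icc a b :=
  ae_restrict_mem measurableSet_Icc

theorem integrableOn_const_Icc {a b : ℝ} (c : ℝ) : IntegrableOn (fun _ : ℝ => c) (Icc a b) :=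
  continuousOn_const.integrableOn_Icc

section Semigroup

variable {E : Type*} [NormedAddCommGroup E] [NormedSpace ℝ E]

/-- A strongly continuous semigroup, extended by the identity to negative times. -/
structure IsC0Semigroup (S : ℝ → E →L[ℝ] E) : Prop where
  of_nonpos : ∀ t ≤ 0, S t = ContinuousLinearMap.id ℝ E
  add : ∀ s t, 0 ≤ s → 0 ≤ t → S (s + t) = (S s).comp (S t)
  cont : Continuous fun p : ℝ × E => S p.1 p.2

/-- `u` is in the domain of the generator `L` of `S`, and `L u = g`. -/
def HasGen (S : ℝ → E →L[ℝ] E) (u g : E) : Prop :=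
  Tendsto (fun t : ℝ => t⁻¹ • (S t u - u)) (𝓝[>] 0) (𝓝 g)

/-- The mild solution of `u' + L u + g = 0`, `u T = φ`. -/
noncomputable def mild (S : ℝ → E →L[ℝ] E) (T : ℝ) (φ : E) (g : ℝ → E) (t : ℝ) : E :=
  S (T - t) φ + ∫ s in t..T, S (s - t) (g s)

section

variable {S : ℝ → E →L[ℝ] E}

theorem semigroup_bound_of_bound_near_zero
    (hadd : ∀ s t, 0 ≤ s → 0 ≤ t → S (s + t) = (S s).comp (S t))
    {δ M : ℝ} (hδ : 0 < δ) (hM : ∀ t ≤ δ, ‖S t‖ ≤ M) (T : ℝ) : ∃ K, ∀ t ≤ T, ‖S t‖ ≤ K := by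
  have key : ∀ n : ℕ, ∃ K, ∀ t ≤ (n + 1) * δ, ‖S t‖ ≤ K := by
    intro n
    induction n with
    | zero => exact ⟨M, fun t ht => hM t (by simpa using ht)⟩
    | succ n ih =>
      obtain ⟨K, hK⟩ := ih
      refine ⟨max K (M * K), fun t ht => ?_⟩
      by_cases h : t ≤ (n + 1) * δ
      · exact (hK t h).trans (le_max_left _ _)
      · push Not at h
        have h1 : 0 ≤ t - δ := by nlinarith [(Nat.cast_nonneg n : (0 : ℝ) ≤ n)]
        have : S t = (S δ).comp (S (t - δ)) := by rw [← hadd δ (t - δ) hδ.le h1]; congr 1; ring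
        rw [this]
        refine le_trans (ContinuousLinearMap.opNorm_comp_le _ _) (le_trans ?_ (le_max_right _ _))
        have h2 : t - δ ≤ (n + 1) * δ := by push_cast at ht; linarith
        exact mul_le_mul (hM δ le_rfl) (hK _ h2) (norm_nonneg _) ((norm_nonneg _).trans (hM δ le_rfl))
  obtain ⟨n, hn⟩ := exists_nat_gt (T / δ)
  obtain ⟨K, hK⟩ := key n
  refine ⟨K, fun t ht => hK t ?_⟩
  have : T < n * δ := by rwa [div_lt_iff₀ hδ] at hn
  nlinarith

theorem IsC0Semigroup.of_bound
    (h0 : ∀ t ≤ 0, S t = ContinuousLinearMap.id ℝ E)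
    (hadd : ∀ s t, 0 ≤ s → 0 ≤ t → S (s + t) = (S s).comp (S t))
    (hb : ∀ T, ∃ M, ∀ t ≤ T, ‖S t‖ ≤ M)
    (hc : ∀ x, Tendsto (fun t => S t x) (𝓝[>] 0) (𝓝 x)) :
    IsC0Semigroup S := by
  refine ⟨h0, hadd, ?_⟩
  have hc0 : ∀ x, Tendsto (fun t => S t x) (𝓝 0) (𝓝 x) := by
    intro x
    rw [← nhdsLE_sup_nhdsGT (0 : ℝ)]
    refine Tendsto.sup ?_ (hc x)
    refine tendsto_const_nhds.congr' ?_
    filter_upwards [self_mem_nhdsWithin] with t ht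
    rw [h0 t ht]; rfl
  have hmax : ∀ t, S t = S (max t 0) := by
    intro t
    rcases le_total t 0 with h | h
    · rw [max_eq_right h, h0 t h, h0 0 le_rfl]
    · rw [max_eq_left h]
  have gen : ∀ T M, (∀ t ≤ T, ‖S t‖ ≤ M) → ∀ x a b, 0 ≤ a → 0 ≤ b → a ≤ T → b ≤ T →
      ‖S b x - S a x‖ ≤ M * ‖S |b - a| x - x‖ := by
    intro T M hM x
    have aux : ∀ a b, 0 ≤ a → a ≤ b → b ≤ T → ‖S b x - S a x‖ ≤ M * ‖S |b - a| x - x‖ := by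
      intro a b ha hab hb'
      have : S b = (S a).comp (S (b - a)) := by
        rw [← hadd a (b - a) ha (by linarith)]; congr 1; ring
      rw [abs_of_nonneg (by linarith), this, comp_apply, ← map_sub]
      exact (S a).le_of_opNorm_le (hM a (by linarith)) _
    intro a b ha hb haT hbT
    rcases le_total a b with h | h
    · exact aux a b ha h hbT
    · rw [norm_sub_rev, abs_sub_comm]; exact aux b a hb h haT
  have hct : ∀ x, Continuous fun t => S t x := by
    intro x
    have hfun : (fun t => S t x) = fun t => S (max t 0) x := by ext t; rw [hmax t]
    rw [hfun, continuous_iff_continuousAt]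
    intro t
    obtain ⟨M, hM⟩ := hb (max t 0 + 1)
    have hlim : Tendsto (fun s => M * ‖S |max s 0 - max t 0| x - x‖) (𝓝 t) (𝓝 0) := by
      have h1 : Tendsto (fun s : ℝ => |max s 0 - max t 0|) (𝓝 t) (𝓝 0) := by
        have : Continuous fun s : ℝ => |max s 0 - max t 0| := by fun_prop
        simpa using this.tendsto t
      have h2 := ((hc0 x).comp h1).sub_const x
      simpa using (h2.norm.const_mul M)
    refine tendsto_iff_norm_sub_tendsto_zero.2
      (squeeze_zero' (of_forall fun _ => norm_nonneg _) ?_ hlim)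
    filter_upwards [Iio_mem_nhds (show t < t + 1 by linarith)] with s hs
    refine gen (max t 0 + 1) M hM x _ _ (le_max_right _ _) (le_max_right _ _) (by linarith) ?_
    have hs' : s < t + 1 := hs
    exact max_le (by linarith [le_max_left t 0]) (by linarith [le_max_right t 0])
  rw [continuous_iff_continuousAt]
  rintro ⟨t, x⟩
  obtain ⟨M, hM⟩ := hb (t + 1)
  have hlim : Tendsto (fun p : ℝ × E => M * ‖p.2 - x‖ + ‖S p.1 x - S t x‖) (𝓝 (t, x)) (𝓝 0) := by
    have h1 : Continuous fun p : ℝ × E => M * ‖p.2 - x‖ + ‖S p.1 x - S t x‖ := by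
      have := (hct x).comp (continuous_fst (X := ℝ) (Y := E))
      have h2 : Continuous fun p : ℝ × E => S p.1 x := this
      fun_prop
    simpa using h1.tendsto (t, x)
  refine tendsto_iff_norm_sub_tendsto_zero.2
    (squeeze_zero' (of_forall fun _ => norm_nonneg _) ?_ hlim)
  have : ∀ᶠ p : ℝ × E in 𝓝 (t, x), p.1 < t + 1 :=
    (continuous_fst.tendsto (t, x)).eventually (Iio_mem_nhds (show t < t + 1 by linarith))
  filter_upwards [this] with p hp
  have : S p.1 p.2 - S t x = S p.1 (p.2 - x) + (S p.1 x - S t x) := by rw [map_sub]; abel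
  rw [this]
  exact (norm_add_le _ _).trans (by gcongr; exact (S p.1).le_of_opNorm_le (hM _ hp.le) _)

end

namespace IsC0Semigroup

variable {S : ℝ → E →L[ℝ] E}

section

variable (hS : IsC0Semigroup S)

include hS

theorem exists_bound [CompleteSpace E] (T : ℝ) : ∃ M, 1 ≤ M ∧ ∀ t ≤ T, ‖S t‖ ≤ M := by
  obtain ⟨C, hC⟩ := banach_steinhaus (g := fun t : Icc (0 : ℝ) T => S t) (by
    intro x
    have hc : Continuous fun t : Icc (0 : ℝ) T => ‖S t x‖ :=
      (hS.cont.comp (continuous_subtype_val.prodMk continuous_const)).norm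
    obtain ⟨C, hC⟩ := (isCompact_univ.image hc).bddAbove
    exact ⟨C, fun t => hC ⟨t, trivial, rfl⟩⟩)
  refine ⟨max C 1, le_max_right _ _, fun t ht => ?_⟩
  rcases le_total t 0 with h | h
  · rw [hS.of_nonpos t h]
    exact norm_id_le.trans (le_max_right _ _)
  · exact (hC ⟨t, h, ht⟩).trans (le_max_left _ _)

theorem continuous_apply (x : E) : Continuous fun t => S t x :=
  hS.cont.comp (continuous_id.prodMk continuous_const)

theorem zero_apply (x : E) : S 0 x = x := by rw [hS.of_nonpos 0 le_rfl]; rfl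

theorem comm {s t : ℝ} (hs : 0 ≤ s) (ht : 0 ≤ t) (x : E) : S s (S t x) = S t (S s x) := by
  rw [← comp_apply, ← hS.add s t hs ht, add_comm, hS.add t s ht hs]; rfl

theorem aestronglyMeasurable {ν : Measure ℝ} {g : ℝ → E} (hg : AEStronglyMeasurable g ν) (t : ℝ) :
    AEStronglyMeasurable (fun s => S (s - t) (g s)) ν := by
  have h1 : AEStronglyMeasurable (fun s : ℝ => s - t) ν :=
    (continuous_id.sub continuous_const).aestronglyMeasurable
  exact hS.cont.comp_aestronglyMeasurable (h1.prodMk hg)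

theorem intervalIntegrable [CompleteSpace E] {g : ℝ → E} {a b t : ℝ}
    (hg : IntervalIntegrable g volume a b) :
    IntervalIntegrable (fun s => S (s - t) (g s)) volume a b := by
  obtain ⟨M, hM1, hM⟩ := hS.exists_bound (max a b - t)
  have hc : IntervalIntegrable (fun s => M * ‖g s‖) volume a b := hg.norm.const_mul M
  refine hc.mono_fun (hS.aestronglyMeasurable hg.aestronglyMeasurable_restrict_uIoc t) ?_
  filter_upwards [ae_restrict_mem measurableSet_uIoc] with s hs
  rw [norm_of_nonneg (by positivity)]
  refine (S _).le_of_opNorm_le (hM _ ?_) _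
  have := hs.2
  linarith

theorem hasGen_hasDerivWithinAt {u g : E} (h : HasGen S u g) {t : ℝ} (ht : 0 ≤ t) :
    HasDerivWithinAt (fun r => S r u) (S t g) (Ioi t) t := by
  rw [hasDerivWithinAt_iff_tendsto_slope' (by simp)]
  have h1 : Tendsto (fun r => S t ((r - t)⁻¹ • (S (r - t) u - u))) (𝓝[>] t) (𝓝 (S t g)) := by
    refine ((S t).continuous.tendsto g).comp (h.comp ?_)
    refine tendsto_nhdsWithin_iff.2 ⟨?_, ?_⟩
    · have : Continuous fun r : ℝ => r - t := by fun_prop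
      simpa using (this.tendsto t).mono_left nhdsWithin_le_nhds
    · filter_upwards [self_mem_nhdsWithin] with r hr using sub_pos.2 (show t < r from hr)
  refine h1.congr' ?_
  filter_upwards [self_mem_nhdsWithin] with r hr
  have hr' : t < r := hr
  have : S r = (S t).comp (S (r - t)) := by
    rw [← hS.add t (r - t) ht (by linarith)]; congr 1; ring
  simp [slope_def_module, this]

section

variable [CompleteSpace E]

theorem hasGen_integral {u g : E} (h : HasGen S u g) {a b : ℝ} (ha : 0 ≤ a)
    (hab : a ≤ b) : ∫ r in a..b, S r g = S b u - S a u :=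
  intervalIntegral.integral_eq_sub_of_hasDeriv_right_of_le hab
    (hS.continuous_apply u).continuousOn
    (fun t ht => hS.hasGen_hasDerivWithinAt h (ha.trans ht.1.le))
    ((hS.continuous_apply g).intervalIntegrable _ _)

theorem hasGen_hasDerivAt {u g : E} (h : HasGen S u g) {t : ℝ} (ht : 0 < t) :
    HasDerivAt (fun r => S r u) (S t g) t := by
  have h1 : HasDerivAt (fun r => u + ∫ s in (0 : ℝ)..r, S s g) (S t g) t :=
    ((hS.continuous_apply g).integral_hasStrictDerivAt 0 t).hasDerivAt.const_add u
  refine h1.congr_of_eventuallyEq ?_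
  filter_upwards [Ioi_mem_nhds ht] with r hr
  rw [hS.hasGen_integral h le_rfl (le_of_lt hr), hS.zero_apply]; abel

/-- The average `ε⁻¹ ∫₀^ε S r h dr`. -/
noncomputable def avg (S : ℝ → E →L[ℝ] E) (ε : ℝ) (h : E) : E := ε⁻¹ • ∫ r in (0 : ℝ)..ε, S r h

theorem hasGen_avg {ε : ℝ} (hε : 0 < ε) (h : E) :
    HasGen S (avg S ε h) (ε⁻¹ • (S ε h - h)) := by
  have hi : ∀ a b, IntervalIntegrable (fun r => S r h) volume a b := fun a b =>
    (hS.continuous_apply h).intervalIntegrable a b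
  have key : ∀ t > 0, t⁻¹ • (S t (avg S ε h) - avg S ε h)
      = ε⁻¹ • (t⁻¹ • (∫ r in ε..(ε + t), S r h) - t⁻¹ • ∫ r in (0 : ℝ)..t, S r h) := by
    intro t ht
    have h1 : S t (∫ r in (0 : ℝ)..ε, S r h) = ∫ r in t..(ε + t), S r h := by
      rw [← intervalIntegral_comp_comm _ (hi _ _)]
      have : ∀ r ∈ uIcc 0 ε, S t (S r h) = S (r + t) h := by
        intro r hr
        rw [uIcc_of_le hε.le] at hr
        rw [add_comm r t, hS.add t r ht.le hr.1]; rfl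
      rw [integral_congr this,
        intervalIntegral.integral_comp_add_right (fun r => S r h)]
      simp
    have h2 : (∫ r in t..(ε + t), S r h) - ∫ r in (0 : ℝ)..ε, S r h
        = (∫ r in ε..(ε + t), S r h) - ∫ r in (0 : ℝ)..t, S r h := by
      have e1 := integral_add_adjacent_intervals (hi 0 t) (hi t (ε + t))
      have e2 := integral_add_adjacent_intervals (hi 0 ε) (hi ε (ε + t))
      rw [sub_eq_sub_iff_add_eq_add, add_comm, e1, ← e2, add_comm]
    simp only [avg, map_smul]
    rw [← smul_sub, h1, h2, smul_comm, smul_sub t⁻¹]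
  have lim : ∀ a, Tendsto (fun t : ℝ => t⁻¹ • ∫ r in a..(a + t), S r h) (𝓝[>] 0) (𝓝 (S a h)) := by
    intro a
    have h1 : HasDerivAt (fun r => ∫ s in a..r, S s h) (S a h) a :=
      ((hS.continuous_apply h).integral_hasStrictDerivAt a a).hasDerivAt
    have := (hasDerivAt_iff_tendsto_slope_zero.1 h1).mono_left
      (nhdsWithin_mono (0 : ℝ) (show Ioi (0 : ℝ) ⊆ {0}ᶜ from fun t ht => ne_of_gt ht))
    simpa only [integral_same, sub_zero] using this
  have l0 := lim 0
  simp only [zero_add, hS.zero_apply] at l0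
  refine Tendsto.congr' ?_ (((lim ε).sub l0).const_smul ε⁻¹)
  filter_upwards [self_mem_nhdsWithin] with t ht using (key t ht).symm

theorem tendsto_avg (h : E) : Tendsto (fun ε => avg S ε h) (𝓝[>] 0) (𝓝 h) := by
  have h1 : HasDerivAt (fun r => ∫ s in (0 : ℝ)..r, S s h) (S 0 h) 0 :=
    ((hS.continuous_apply h).integral_hasStrictDerivAt 0 0).hasDerivAt
  have := (hasDerivAt_iff_tendsto_slope_zero.1 h1).mono_left
    (nhdsWithin_mono (0 : ℝ) (show Ioi (0 : ℝ) ⊆ {0}ᶜ from fun t ht => ne_of_gt ht))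
  simpa [avg, hS.zero_apply] using this

end

end

theorem norm_mild_le {M : ℝ} (hM : ∀ t ≤ T, ‖S t‖ ≤ M) {φ : E}
    {g : ℝ → E} (hg : g ∈L¹ T) {t : ℝ} (ht : t ∈ Icc 0 T) :
    ‖mild S T φ g t‖ ≤ M * (‖φ‖ + ∫ s in t..T, ‖g s‖) := by
  have hgi : IntervalIntegrable g volume t T :=
    (intervalIntegrable_iff_integrableOn_Icc_of_le ht.2).2 (hg.mono_set (Icc_subset_Icc_left ht.1))
  rw [mul_add]
  refine (norm_add_le _ _).trans (add_le_add ((S _).le_of_opNorm_le (hM _ (by linarith [ht.1])) _) ?_)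
  rw [← intervalIntegral.integral_const_mul]
  refine intervalIntegral.norm_integral_le_of_norm_le ht.2 ?_ (hgi.norm.const_mul M)
  filter_upwards with s hs
  exact (S _).le_of_opNorm_le (hM _ (by linarith [hs.2, ht.1])) _

theorem mild_sub (hS : IsC0Semigroup S) [CompleteSpace E] {φ ψ : E} {g h : ℝ → E} (hg : g ∈L¹ T)
    (hh : h ∈L¹ T) {t : ℝ} (ht : t ∈ Icc 0 T) :
    mild S T (φ - ψ) (fun s => g s - h s) t = mild S T φ g t - mild S T ψ h t := by
  have hi : ∀ {g : ℝ → E}, g ∈L¹ T →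
      IntervalIntegrable (fun s => S (s - t) (g s)) volume t T := fun hg =>
    hS.intervalIntegrable ((intervalIntegrable_iff_integrableOn_Icc_of_le ht.2).2
      (hg.mono_set (Icc_subset_Icc_left ht.1)))
  simp only [mild, map_sub]
  rw [intervalIntegral.integral_sub (hi hg) (hi hh)]
  abel

end IsC0Semigroup

end Semigroup

namespace IsC0Semigroup

variable {E : Type*} [NormedAddCommGroup E] [NormedSpace ℝ E] {S : ℝ → E →L[ℝ] E}

theorem hasDerivAt_apply (hS : IsC0Semigroup S) [CompleteSpace E] {v : ℝ → E}
    {v' b : E} {s t : ℝ} (hst : t < s) (hv : HasDerivAt v v' s) (hb : HasGen S (v s) b) :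
    HasDerivAt (fun r => S (r - t) (v r)) (S (s - t) (b + v')) s := by
  have h1 : HasDerivAt (fun r => S (r - t) (v s)) (S (s - t) b) s := by
    have := (hS.hasGen_hasDerivAt hb (sub_pos.2 hst)).scomp s ((hasDerivAt_id s).sub_const t)
    simpa [Function.comp_def] using this
  rw [hasDerivAt_iff_tendsto_slope] at h1 hv ⊢
  have hc : Tendsto (fun r : ℝ => (r - t, slope v s r)) (𝓝[≠] s) (𝓝 (s - t, v')) := by
    refine Tendsto.prodMk_nhds ?_ hv
    have : Continuous fun r : ℝ => r - t := by fun_prop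
    exact (this.tendsto s).mono_left nhdsWithin_le_nhds
  have h2 := (hS.cont.tendsto (s - t, v')).comp hc
  have h3 := h1.add h2
  rw [map_add]
  refine h3.congr fun r => ?_
  simp only [slope_def_module, Function.comp_apply, map_smul, map_sub, ← smul_add]
  congr 1
  abel

theorem hasGen_unique {u g h : E} (hg : HasGen S u g) (hh : HasGen S u h) : g = h :=
  tendsto_nhds_unique hg hh

theorem eq_mild (hS : IsC0Semigroup S) [CompleteSpace E]
    {u u' Lu g : ℝ → E} (hd : ∀ t ∈ Icc 0 T, HasDerivWithinAt u (u' t) (Icc 0 T) t)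
    (hu' : u' ∈L¹ T) (hg : g ∈L¹ T)
    (hae : ∀ᵐ t ∂(dt T), HasGen S (u t) (Lu t) ∧ u' t + Lu t + g t = 0)
    {t : ℝ} (ht : t ∈ Icc 0 T) : u t = mild S T (u T) g t := by
  have hgi : IntervalIntegrable g volume t T :=
    (intervalIntegrable_iff_integrableOn_Icc_of_le ht.2).2 (hg.mono_set (Icc_subset_Icc_left ht.1))
  have hui : IntervalIntegrable u' volume t T :=
    (intervalIntegrable_iff_integrableOn_Icc_of_le ht.2).2 (hu'.mono_set (Icc_subset_Icc_left ht.1))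
  have huc : ContinuousOn u (Icc 0 T) := fun s hs => (hd s hs).continuousWithinAt
  have key : ∀ ε > 0, avg S ε (u t) = avg S ε (mild S T (u T) g t) := by
    intro ε hε
    obtain ⟨M, hM1, hM⟩ := hS.exists_bound ε
    obtain ⟨A, hA⟩ : ∃ A : E →L[ℝ] E, ∀ x, A x = avg S ε x := by
      refine ⟨LinearMap.mkContinuous ⟨⟨avg S ε, fun x y => ?_⟩, fun c x => ?_⟩ (|ε⁻¹| * (M * |ε|))
        (fun x => ?_), fun x => rfl⟩
      · simp only [avg, map_add]
        rw [intervalIntegral.integral_add ((hS.continuous_apply x).intervalIntegrable _ _)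
          ((hS.continuous_apply y).intervalIntegrable _ _), smul_add]
      · simp only [avg, map_smul, intervalIntegral.integral_smul, id_apply]
        rw [smul_comm]
      · change ‖avg S ε x‖ ≤ _
        rw [avg, norm_smul, mul_assoc, norm_eq_abs]
        gcongr
        have := intervalIntegral.norm_integral_le_of_norm_le_const (a := (0 : ℝ)) (b := ε)
          (f := fun r => S r x) (C := M * ‖x‖) (fun r hr => by
            rw [uIoc_of_le hε.le] at hr
            exact (S r).le_of_opNorm_le (hM r hr.2) x)
        simpa [mul_assoc, mul_comm, mul_left_comm] using this
    have hSA : ∀ r, 0 ≤ r → ∀ x, S r (A x) = A (S r x) := by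
      intro r hr x
      rw [hA, hA, avg, avg, map_smul,
        ← intervalIntegral_comp_comm _ ((hS.continuous_apply x).intervalIntegrable _ _)]
      congr 1
      refine integral_congr fun s hs => ?_
      rw [uIcc_of_le hε.le] at hs
      exact hS.comm hr hs.1 x
    set B : E → E := fun x => ε⁻¹ • (S ε x - x) with hB
    have hgenA : ∀ x, HasGen S (A x) (B x) := fun x => by rw [hA]; exact hS.hasGen_avg hε x
    have hAL : ∀ x y, HasGen S x y → B x = A y := by
      intro x y hxy
      refine hasGen_unique (hgenA x) ?_
      refine ((A.continuous.tendsto y).comp hxy).congr' ?_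
      filter_upwards [self_mem_nhdsWithin] with r hr
      simp [hSA r (le_of_lt hr)]
    have hBc : Continuous B := by fun_prop
    have hF : ∫ s in t..T, S (s - t) (B (u s) + A (u' s))
        = S (T - t) (A (u T)) - S (t - t) (A (u t)) := by
      refine intervalIntegral.integral_eq_sub_of_hasDerivAt_of_le
        (f := fun s => S (s - t) (A (u s))) ht.2 ?_ (fun s hs => ?_) ?_
      · refine hS.cont.comp_continuousOn ((Continuous.continuousOn (by fun_prop)).prodMk ?_)
        exact A.continuous.comp_continuousOn (huc.mono (Icc_subset_Icc_left ht.1))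
      · have h1 : HasDerivAt u (u' s) s :=
          (hd s ⟨ht.1.trans hs.1.le, hs.2.le⟩).hasDerivAt
            (Icc_mem_nhds (lt_of_le_of_lt ht.1 hs.1) hs.2)
        exact hS.hasDerivAt_apply hs.1 (A.hasFDerivAt.comp_hasDerivAt s h1) (hgenA _)
      · refine hS.intervalIntegrable (IntervalIntegrable.add ?_ ?_)
        · refine ContinuousOn.intervalIntegrable ?_
          rw [uIcc_of_le ht.2]
          exact hBc.comp_continuousOn (huc.mono (Icc_subset_Icc_left ht.1))
        · exact ⟨A.integrable_comp hui.1, A.integrable_comp hui.2⟩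
    have hG : ∫ s in t..T, S (s - t) (B (u s) + A (u' s)) = -∫ s in t..T, A (S (s - t) (g s)) := by
      rw [← intervalIntegral.integral_neg]
      refine intervalIntegral.integral_congr_ae_restrict ?_
      have hsub : uIoc t T ⊆ Icc 0 T := by
        rw [uIoc_of_le ht.2]
        exact fun s hs => ⟨ht.1.trans hs.1.le, hs.2⟩
      filter_upwards [ae_restrict_of_ae_restrict_of_subset hsub hae,
        ae_restrict_mem measurableSet_uIoc] with s hs hs2
      rw [uIoc_of_le ht.2] at hs2
      rw [hAL _ _ hs.1, ← map_add, hSA _ (by linarith [hs2.1]), ← map_neg, ← map_neg]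
      congr 2
      rw [eq_neg_iff_add_eq_zero, add_comm (Lu s)]; exact hs.2
    rw [hF, intervalIntegral_comp_comm A (hS.intervalIntegrable hgi)] at hG
    simp only [sub_self, hS.zero_apply] at hG
    rw [hSA _ (by linarith [ht.2])] at hG
    rw [← hA, ← hA, mild, map_add]
    rw [sub_eq_iff_eq_add] at hG
    rw [hG]; abel
  refine tendsto_nhds_unique (hS.tendsto_avg (u t)) ((hS.tendsto_avg _).congr' ?_)
  filter_upwards [self_mem_nhdsWithin] with ε hε using (key ε hε).symm

theorem continuous_duhamel (hS : IsC0Semigroup S) (T : ℝ)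
    {θ : ℝ → ℝ} (hθ : Continuous θ) (h : E) :
    Continuous fun t => ∫ s in t..T, θ s • S (s - t) h := by
  have hc : Continuous (Function.uncurry fun t s : ℝ => θ s • S (s - t) h) := by
    have := hS.continuous_apply h
    have h2 : Continuous fun p : ℝ × ℝ => S (p.2 - p.1) h := this.comp (by fun_prop)
    exact (hθ.comp continuous_snd).smul h2
  have := (intervalIntegral.continuous_parametric_intervalIntegral_of_continuous
    (μ := volume) (a₀ := T) hc continuous_id).neg
  refine this.congr fun t => ?_
  rw [integral_symm T t]; simp

section

variable (hS : IsC0Semigroup S) [CompleteSpace E] {θ : ℝ → ℝ} (hθ : Continuous θ) {h Lh : E}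
  (hh : HasGen S h Lh) {t : ℝ}

include hS hθ hh

theorem hasDerivWithinAt_duhamel (ht : t ∈ Icc 0 T) :
    HasDerivWithinAt (fun t => ∫ s in t..T, θ s • S (s - t) h)
      (-(∫ s in t..T, θ s • S (s - t) Lh) - θ t • h) (Icc 0 T) t := by
  set R : ℝ → E := fun r => h + ∫ s in (0 : ℝ)..r, S s Lh with hR
  have hRd : ∀ r, HasDerivAt R (S r Lh) r := fun r =>
    ((hS.continuous_apply Lh).integral_hasStrictDerivAt 0 r).hasDerivAt.const_add h
  have hRc : Continuous R := continuous_iff_continuousAt.2 fun r => (hRd r).continuousAt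
  have hRpos : ∀ r, 0 ≤ r → R r = S r h := by
    intro r hr
    simp only [hR, hS.hasGen_integral hh le_rfl hr, hS.zero_apply]; abel
  have hRneg : ∀ r, r ≤ 0 → R r = h + r • Lh := by
    intro r hr
    simp only [hR]
    have : ∫ s in (0 : ℝ)..r, S s Lh = ∫ s in (0 : ℝ)..r, Lh := by
      refine integral_congr fun s hs => ?_
      rw [uIcc_of_ge hr] at hs
      simp [hS.of_nonpos s hs.2]
    rw [this]; simp
  have hcont : ∀ {f : ℝ → E}, Continuous f → ∀ t, Continuous fun s => θ s • f (s - t) := by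
    intro f hf t
    exact hθ.smul (hf.comp (by fun_prop))
  have hsplit : ∀ x ∈ Icc 0 T, ∫ s in x..T, θ s • S (s - x) h
      = (∫ s in (0 : ℝ)..T, θ s • R (s - x)) - ((∫ s in (0 : ℝ)..x, θ s) • h
        + ((∫ s in (0 : ℝ)..x, s * θ s) - x * ∫ s in (0 : ℝ)..x, θ s) • Lh) := by
    intro x hx
    have e1 : ∫ s in x..T, θ s • S (s - x) h = ∫ s in x..T, θ s • R (s - x) := by
      refine integral_congr fun s hs => ?_
      rw [uIcc_of_le hx.2] at hs
      simp only [hRpos (s - x) (by linarith [hs.1])]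
    have e2 : ∫ s in (0 : ℝ)..x, θ s • R (s - x) = (∫ s in (0 : ℝ)..x, θ s) • h
        + ((∫ s in (0 : ℝ)..x, s * θ s) - x * ∫ s in (0 : ℝ)..x, θ s) • Lh := by
      have : ∀ s ∈ uIcc 0 x, θ s • R (s - x) = θ s • h + (s * θ s - x * θ s) • Lh := by
        intro s hs
        rw [uIcc_of_le hx.1] at hs
        rw [hRneg _ (by linarith [hs.2]), smul_add, smul_smul]; ring_nf
      have c1 : Continuous fun s : ℝ => s * θ s := continuous_id.mul hθ
      have c2 : Continuous fun s : ℝ => x * θ s := continuous_const.mul hθ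
      rw [integral_congr this, intervalIntegral.integral_add,
        intervalIntegral.integral_smul_const, intervalIntegral.integral_smul_const,
        intervalIntegral.integral_sub (c1.intervalIntegrable _ _) (c2.intervalIntegrable _ _),
        intervalIntegral.integral_const_mul]
      · exact (hθ.smul continuous_const).intervalIntegrable _ _
      · exact ((c1.sub c2).smul continuous_const).intervalIntegrable _ _
    rw [e1, ← e2, eq_sub_iff_add_eq, add_comm]
    exact integral_add_adjacent_intervals
      ((hcont hRc x).intervalIntegrable _ _) ((hcont hRc x).intervalIntegrable _ _)
  have d1 : HasDerivAt (fun x => ∫ s in (0 : ℝ)..T, θ s • R (s - x))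
      (∫ s in (0 : ℝ)..T, θ s • (-(S (s - t) Lh))) t := by
    have hc2 : ContinuousOn (fun p : ℝ × ℝ => ‖θ p.2 • (-(S (p.2 - p.1) Lh))‖)
        (Icc (t - 1) (t + 1) ×ˢ Icc 0 T) := by
      have := (hS.continuous_apply Lh)
      have h2 : Continuous fun p : ℝ × ℝ => S (p.2 - p.1) Lh := this.comp (by fun_prop)
      exact ((hθ.comp continuous_snd).smul h2.neg).norm.continuousOn
    obtain ⟨C, hC⟩ := (isCompact_Icc.prod isCompact_Icc).bddAbove_image hc2
    have := intervalIntegral.hasDerivAt_integral_of_dominated_loc_of_deriv_le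
      (μ := volume) (a := 0) (b := T) (bound := fun _ => C)
      (F := fun x s => θ s • R (s - x)) (F' := fun x s => θ s • (-(S (s - x) Lh))) (x₀ := t)
      (s := Icc (t - 1) (t + 1)) (Icc_mem_nhds (by linarith) (by linarith))
      (of_forall fun x => (hcont hRc x).aestronglyMeasurable)
      ((hcont hRc t).intervalIntegrable _ _)
      ((hcont (hS.continuous_apply Lh).neg t).aestronglyMeasurable)
      (of_forall fun s hs x hx => by
        rw [uIoc_of_le (ht.1.trans ht.2)] at hs
        exact hC ⟨(x, s), ⟨hx, Ioc_subset_Icc_self hs⟩, rfl⟩)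
      (by simp)
      (of_forall fun s _ x _ => by
        have := (hRd (s - x)).scomp x ((hasDerivAt_id x).const_sub s)
        simpa [Function.comp_def, Pi.smul_def] using this.const_smul (θ s))
    exact this.2
  have dθ :=
    (hθ.integral_hasStrictDerivAt 0 t).hasDerivAt
  have dsθ : HasDerivAt (fun x => ∫ s in (0 : ℝ)..x, s * θ s) (t * θ t) t :=
    ((continuous_id.mul hθ).integral_hasStrictDerivAt 0 t).hasDerivAt
  have d2 := d1.sub ((dθ.smul_const h).add ((dsθ.sub ((hasDerivAt_id t).mul dθ)).smul_const Lh))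
  refine (d2.hasDerivWithinAt.congr (fun x hx => hsplit x hx) (hsplit t ht)).congr_deriv ?_
  have e3 : ∫ s in (0 : ℝ)..t, θ s • S (s - t) Lh = (∫ s in (0 : ℝ)..t, θ s) • Lh := by
    rw [← intervalIntegral.integral_smul_const]
    refine integral_congr fun s hs => ?_
    rw [uIcc_of_le ht.1] at hs
    simp [hS.of_nonpos (s - t) (by linarith [hs.2])]
  have e4 := integral_add_adjacent_intervals (μ := volume)
    ((hcont (hS.continuous_apply Lh) t).intervalIntegrable 0 t)
    ((hcont (hS.continuous_apply Lh) t).intervalIntegrable t T)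
  simp only [smul_neg, intervalIntegral.integral_neg]
  rw [← e4, e3]
  simp only [id]
  module

theorem hasGen_duhamel (ht : t ≤ T) :
    HasGen S (∫ s in t..T, θ s • S (s - t) h) (∫ s in t..T, θ s • S (s - t) Lh) := by
  have hcont : ∀ x, Continuous fun s => θ s • S (s - t) x := fun x =>
    hθ.smul ((hS.continuous_apply x).comp (by fun_prop))
  obtain ⟨M, hM1, hM⟩ := hS.exists_bound (T - t)
  have key : ∀ δ > 0, δ⁻¹ • (S δ (∫ s in t..T, θ s • S (s - t) h) - ∫ s in t..T, θ s • S (s - t) h)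
      - ∫ s in t..T, θ s • S (s - t) Lh
      = ∫ s in t..T, θ s • S (s - t) (δ⁻¹ • (S δ h - h) - Lh) := by
    intro δ hδ
    rw [← intervalIntegral_comp_comm _ ((hcont h).intervalIntegrable _ _),
      ← intervalIntegral.integral_sub, ← intervalIntegral.integral_smul,
      ← intervalIntegral.integral_sub]
    · refine integral_congr fun s hs => ?_
      rw [uIcc_of_le ht] at hs
      simp only [map_smul, map_sub, hS.comm hδ.le (show 0 ≤ s - t by linarith [hs.1])]
      module
    · exact (((ContinuousLinearMap.continuous _).comp (hcont h)).sub (hcont h)).const_smul _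
        |>.intervalIntegrable _ _
    · exact (hcont Lh).intervalIntegrable _ _
    · exact ((ContinuousLinearMap.continuous _).comp (hcont h)).intervalIntegrable _ _
    · exact (hcont h).intervalIntegrable _ _
  have hθb : Continuous fun s => ‖θ s‖ := hθ.norm
  have hlim : Tendsto (fun δ : ℝ => (∫ s in t..T, ‖θ s‖ * M) * ‖δ⁻¹ • (S δ h - h) - Lh‖)
      (𝓝[>] 0) (𝓝 0) := by
    have := (tendsto_iff_norm_sub_tendsto_zero.1 hh).const_mul (∫ s in t..T, ‖θ s‖ * M)
    simpa using this
  refine tendsto_iff_norm_sub_tendsto_zero.2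
    (squeeze_zero' (of_forall fun _ => norm_nonneg _) ?_ hlim)
  filter_upwards [self_mem_nhdsWithin] with δ hδ
  rw [key δ hδ, ← intervalIntegral.integral_mul_const]
  refine intervalIntegral.norm_integral_le_of_norm_le ht ?_
    (((hθb.mul continuous_const).mul continuous_const).intervalIntegrable _ _)
  filter_upwards with s hs
  rw [norm_smul, mul_assoc]
  gcongr
  exact (S _).le_of_opNorm_le (hM _ (by linarith [hs.2])) _

end

end IsC0Semigroup

/-- A map into a separable metric space is measurable if its distances to all points are. -/
theorem stronglyMeasurable_of_edist {Ω X : Type*} [MeasurableSpace Ω] [MetricSpace X]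
    [SecondCountableTopology X] [Nonempty X] {v : Ω → X}
    (h : ∀ a, Measurable fun z => edist (v z) a) : StronglyMeasurable v := by
  let : MeasurableSpace X := borel X
  have : BorelSpace X := ⟨rfl⟩
  refine Measurable.stronglyMeasurable (measurable_of_isOpen fun U hU => ?_)
  have hcover : U = ⋃ (n : ℕ) (q : ℚ) (_ : Metric.eball (denseSeq X n)
      (ofReal q) ⊆ U), Metric.eball (denseSeq X n) (ofReal q) := by
    apply Subset.antisymm
    · intro x hx
      obtain ⟨ε, hε, hball⟩ := Metric.isOpen_iff.1 hU x hx
      obtain ⟨q, hq0, hq⟩ := exists_rat_btwn (half_pos hε)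
      have hq0' : (0 : ℝ) < q := by exact_mod_cast hq0
      obtain ⟨n, hn⟩ := (denseRange_denseSeq X).exists_dist_lt x hq0'
      simp only [mem_iUnion, exists_prop]
      refine ⟨n, q, ?_, ?_⟩
      · intro y hy
        apply hball
        have hy' : dist y (denseSeq X n) < q := by
          rw [Metric.mem_eball, edist_dist] at hy
          exact (ENNReal.ofReal_lt_ofReal_iff hq0').1 hy
        have := dist_triangle_right y x (denseSeq X n)

        exact Metric.mem_ball.2 (by linarith)
      · rw [Metric.mem_eball, edist_dist]
        exact (ENNReal.ofReal_lt_ofReal_iff hq0').2 hn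
    · simp
  rw [hcover]
  simp only [preimage_iUnion]
  refine MeasurableSet.iUnion fun n => MeasurableSet.iUnion fun q => MeasurableSet.iUnion fun _ => ?_
  exact measurableSet_lt (h _) measurable_const

instance instSecondCountableLpTwo {E : Type*} [NormedAddCommGroup E]
    [SecondCountableTopology E] : SecondCountableTopology (Lp E 2 (volume : Measure (Rn d))) :=
  haveI : Fact ((2 : ℝ≥0∞) ≠ ⊤) := ⟨by norm_num⟩
  inferInstance

/-- Slices of a jointly measurable function form a measurable `L²`-valued map. -/
theorem stronglyMeasurable_slice {Ω : Type*} [MeasurableSpace Ω] {E : Type*}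
    [NormedAddCommGroup E] [SecondCountableTopology E] [MeasurableSpace E] [BorelSpace E]
    {h : Ω × Rn d → E} (hh : Measurable h) {v : Ω → Lp E 2 (volume : Measure (Rn d))}
    (hv : ∀ z, v z =ᵐ[volume] fun x => h (z, x)) : StronglyMeasurable v := by
  refine stronglyMeasurable_of_edist fun a => ?_
  obtain ⟨a', ha', haa'⟩ := (memLp a).1
  have hm : Measurable fun p : Ω × Rn d => ‖h p - a' p.2‖ₑ ^ (2 : ℝ) :=
    ((hh.sub (ha'.measurable.comp measurable_snd)).enorm).pow_const _
  have : (fun z => edist (v z) a) = fun z => (∫⁻ x, ‖h (z, x) - a' x‖ₑ ^ (2 : ℝ)) ^ (1 / 2 : ℝ) := by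
    ext z
    rw [Lp.edist_def, eLpNorm_eq_lintegral_rpow_enorm_toReal (by norm_num) (by norm_num)]
    simp only [ENNReal.toReal_ofNat]
    congr 1
    refine lintegral_congr_ae ?_
    filter_upwards [hv z, haa'] with x h1 h2
    simp only [Pi.sub_apply, h1, h2]
  rw [this]
  exact (hm.lintegral_prod_right').pow_const _

/-- A pointwise defined representative of an `L²` function, by Lebesgue differentiation. -/
noncomputable def evalL2 (v : L2 d) (x : Rn d) : ℝ :=
  limsup (fun n : ℕ => ⨍ y in Metric.closedBall x (1 / ((n : ℝ) + 1)), v y) atTop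

theorem evalL2_ae (v : L2 d) : v =ᵐ[volume] evalL2 v := by
  have hl : LocallyIntegrable v volume := (memLp v).locallyIntegrable (by norm_num)
  filter_upwards [IsUnifLocDoublingMeasure.ae_tendsto_average (μ := (volume : Measure (Rn d))) hl 1]
    with x hx
  have h1 : Tendsto (fun n : ℕ => 1 / ((n : ℝ) + 1)) atTop (𝓝[>] 0) :=
    tendsto_nhdsWithin_iff.2 ⟨tendsto_one_div_add_atTop_nhds_zero_nat,
      of_forall fun n => by simp only [mem_Ioi]; positivity⟩
  refine (Tendsto.limsup_eq (hx (fun _ => x) _ h1 (of_forall fun n => ?_))).symm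
  exact Metric.mem_closedBall_self (by positivity)

theorem measurable_evalL2 {Ω : Type*} [MeasurableSpace Ω] {v : Ω → L2 d}
    (hv : StronglyMeasurable v) : Measurable fun p : Ω × Rn d => evalL2 (v p.1) p.2 := by
  refine Measurable.limsup fun n => ?_
  set r : ℝ := 1 / ((n : ℝ) + 1) with hr
  have hr0 : 0 < r := by positivity
  have hfix : ∀ w : L2 d, Measurable fun x : Rn d => ⨍ y in Metric.closedBall x r, w y := by
    intro w
    obtain ⟨w', hw', hww'⟩ := (memLp w).1
    have hset : MeasurableSet {p : Rn d × Rn d | dist p.2 p.1 ≤ r} :=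
      measurableSet_le (by fun_prop) measurable_const
    have h1 : StronglyMeasurable fun p : Rn d × Rn d =>
        {p : Rn d × Rn d | dist p.2 p.1 ≤ r}.indicator (fun p => w' p.2) p :=
      (hw'.comp_measurable measurable_snd).indicator hset
    have h2 := (h1.integral_prod_right' (ν := (volume : Measure (Rn d)))).measurable
    have h3 : Measurable fun x : Rn d => (volume (Metric.closedBall x r)).toReal := by
      have : (fun x : Rn d => (volume (Metric.closedBall x r)).toReal)
          = fun _ => (volume (Metric.closedBall (0 : Rn d) r)).toReal := by
        ext x; rw [Measure.addHaar_closedBall_center]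
      rw [this]; exact measurable_const
    have h4 : (fun x : Rn d => ⨍ y in Metric.closedBall x r, w y) = fun x =>
        ((volume (Metric.closedBall x r)).toReal)⁻¹ * ∫ y,
          {p : Rn d × Rn d | dist p.2 p.1 ≤ r}.indicator (fun p => w' p.2) (x, y) := by
      ext x
      rw [setAverage_eq, smul_eq_mul]
      congr 1
      rw [← integral_indicator Metric.isClosed_closedBall.measurableSet]
      refine integral_congr_ae ?_
      filter_upwards [hww'] with y hy
      simp [indicator, hy]
    rw [h4]
    exact h3.inv.mul h2
  have hcont : ∀ x : Rn d, Continuous fun w : L2 d => ⨍ y in Metric.closedBall x r, w y := by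
    intro x
    simp only [setAverage_eq]
    suffices h : Continuous fun w : L2 d => ∫ y in Metric.closedBall x r, w y from
      (continuous_const (y := (volume.real (Metric.closedBall x r))⁻¹)).smul h
    have : IsFiniteMeasure (volume.restrict (Metric.closedBall x r)) :=
      ⟨by simpa using (isCompact_closedBall x r).measure_lt_top⟩
    have hs : volume (Metric.closedBall x r) ≠ ⊤ := (isCompact_closedBall x r).measure_lt_top.ne
    have h1 : (fun w : L2 d => ∫ y in Metric.closedBall x r, w y) = fun w =>
        inner ℝ (indicatorConstLp 2 Metric.isClosed_closedBall.measurableSet hs (1 : ℝ)) w := by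
      ext w
      rw [L2.inner_indicatorConstLp_one (𝕜 := ℝ)]
    rw [h1]
    exact continuous_const.inner continuous_id
  have hlim : ∀ p : Ω × Rn d, (fun m => ⨍ y in Metric.closedBall p.2 r, hv.approx m p.1 y) ⇝ (⨍ y in Metric.closedBall p.2 r, v p.1 y) := fun p =>
    ((hcont p.2).tendsto _).comp (hv.tendsto_approx p.1)
  refine measurable_of_tendsto_metrizable (fun m => ?_) (tendsto_pi_nhds.2 hlim)
  exact ((hv.approx m).comp Prod.fst measurable_fst).measurable_bind
    (fun (w : L2 d) (p : Ω × Rn d) => ⨍ y in Metric.closedBall p.2 r, w y)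
    (fun w => (hfix w).comp measurable_snd)

section BoundedMultiplier

variable {X E : Type*} [MeasurableSpace X] {ν : Measure X} [NormedAddCommGroup E]

theorem tendsto_eLpNorm_two_of_dominated {f : ℕ → X → E} {a : X → E} {g : X → ℝ}
    (hf : ∀ n, AEStronglyMeasurable (f n) ν) (ha : AEStronglyMeasurable a ν) (hg : MemLp g 2 ν)
    (hbound : ∀ n, ∀ᵐ x ∂ν, ‖f n x - a x‖ ≤ g x)
    (hlim : ∀ᵐ x ∂ν, (fun n => f n x) ⇝ a x) :
    (fun n => eLpNorm (fun x => f n x - a x) 2 ν) ⇝ 0 := by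
  have key : (fun n => ∫⁻ x, ‖f n x - a x‖ₑ ^ (2 : ℝ) ∂ν) ⇝ (∫⁻ _, 0 ∂ν) := by
    refine tendsto_lintegral_of_dominated_convergence' (fun x => ‖g x‖ₑ ^ (2 : ℝ))
      (fun n => (((hf n).sub ha).enorm).pow_const _) (fun n => ?_) ?_ ?_
    · filter_upwards [hbound n] with x hx
      gcongr
      rw [← ofReal_norm, ← ofReal_norm]
      exact ofReal_le_ofReal (hx.trans (le_abs_self _))
    · have := (eLpNorm_lt_top_iff_lintegral_rpow_enorm_lt_top (p := 2) (by norm_num) (by norm_num)).1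
        hg.2
      simpa using this.ne
    · filter_upwards [hlim] with x hx
      have h1 : (fun n => ‖f n x - a x‖ₑ) ⇝ 0 := by
        have := (hx.sub_const (a x)).enorm
        simpa using this
      simpa [Function.comp_def] using ((ENNReal.continuous_rpow_const (y := 2)).tendsto _).comp h1
  simp only [lintegral_zero] at key
  have h2 := ((ENNReal.continuous_rpow_const (y := (1 / 2 : ℝ))).tendsto _).comp key
  simp only [ENNReal.zero_rpow_of_pos (show (0 : ℝ) < 1 / 2 by norm_num)] at h2
  refine h2.congr fun n => ?_
  rw [eLpNorm_eq_lintegral_rpow_enorm_toReal (by norm_num) (by norm_num)]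
  simp

section

variable [NormedSpace ℝ E] {A : ℕ → X → E} {a : X → E} {B : ℕ → X → ℝ} {b : X → ℝ} {M : ℝ}
  (hA : ∀ n, AEStronglyMeasurable (A n) ν) (ha : MemLp a 2 ν)
  (hAa : (fun n => eLpNorm (fun x => A n x - a x) 2 ν) ⇝ 0) (hB : ∀ n, AEStronglyMeasurable (B n) ν)
  (hBM : ∀ n, ∀ᵐ x ∂ν, |B n x| ≤ M)

include hA ha hAa hB hBM

theorem tendsto_eLpNorm_smul_of_ae
    (hBb : ∀ᵐ x ∂ν, (fun n => B n x) ⇝ b x) :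
    (fun n => eLpNorm (fun x => B n x • A n x - b x • a x) 2 ν) ⇝ 0 := by
  have hb : AEStronglyMeasurable b ν := aestronglyMeasurable_of_tendsto_ae atTop hB hBb
  have hbM : ∀ᵐ x ∂ν, |b x| ≤ M := by
    filter_upwards [hBb, ae_all_iff.2 hBM] with x hx hM
    exact le_of_tendsto hx.abs (of_forall fun n => hM _)
  have h1 : (fun n => eLpNorm (fun x => B n x • a x - b x • a x) 2 ν) ⇝ 0 := by
    refine tendsto_eLpNorm_two_of_dominated (g := fun x => 2 * M * ‖a x‖)
      (fun n => (hB _).smul ha.1) (hb.smul ha.1) (ha.norm.const_mul _) (fun n => ?_) ?_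
    · filter_upwards [hBM n, hbM] with x h1 h2
      rw [← sub_smul, norm_smul]
      gcongr
      exact (abs_sub _ _).trans (by linarith)
    · filter_upwards [hBb] with x hx using hx.smul_const _
  have h2 : (fun n => ofReal M * eLpNorm (fun x => A n x - a x) 2 ν) ⇝ 0 := by
    have := const_mul (a := ofReal M) hAa (Or.inr ofReal_ne_top)
    simpa using this
  have h3 := h2.add h1
  rw [add_zero] at h3
  refine tendsto_of_tendsto_of_tendsto_of_le_of_le tendsto_const_nhds h3 (fun _ => zero_le)
    fun n => ?_
  have e : (fun x => B n x • A n x - b x • a x)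
      = (fun x => B n x • (A n x - a x)) + fun x => B n x • a x - b x • a x := by
    ext x; simp [smul_sub]
  rw [e]
  refine (eLpNorm_add_le ((hB _).smul ((hA _).sub ha.1)) (((hB _).smul ha.1).sub (hb.smul ha.1))
    (by norm_num)).trans (add_le_add ?_ le_rfl)
  refine eLpNorm_le_mul_eLpNorm_of_ae_le_mul ?_ 2
  filter_upwards [hBM n] with x hx
  rw [Pi.smul_apply', norm_smul]
  exact mul_le_mul_of_nonneg_right hx (norm_nonneg _)

theorem tendsto_eLpNorm_smul_of_bounded
    (hBb : TendstoInMeasure ν B atTop b) :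
    (fun n => eLpNorm (fun x => B n x • A n x - b x • a x) 2 ν) ⇝ 0 := by
  refine tendsto_of_subseq_tendsto fun ns hns => ?_
  obtain ⟨ms, hms, hlim⟩ := (hBb.comp hns).exists_seq_tendsto_ae
  exact ⟨ms, tendsto_eLpNorm_smul_of_ae (fun n => hA _) ha
    (hAa.comp (hns.comp hms.tendsto_atTop)) (fun n => hB _) (fun n => hBM _) hlim⟩

end

end BoundedMultiplier

/-- The pointwise product `L² × L² → L¹`. -/
noncomputable def mulL : L2 d →L[ℝ] L2 d →L[ℝ] L1 d :=
  (mul ℝ ℝ).holderL volume 2 2 1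

theorem coeFn_mulL (u v : L2 d) : mulL u v =ᵐ[volume] fun x => u x * v x :=
  (mul ℝ ℝ).coeFn_holder u v

/-- The pointwise scalar product `L²(ℝ^d; ℝ^k) × L²(ℝ^d; ℝ^k) → L¹`. -/
noncomputable def dotL : L2v d k →L[ℝ] L2v d k →L[ℝ] L1 d :=
  (innerSL ℝ : Rn k →L[ℝ] Rn k →L[ℝ] ℝ).holderL volume 2 2 1

theorem coeFn_dotL (u v : L2v d k) : dotL u v =ᵐ[volume] fun x => inner ℝ (u x) (v x) :=
  (innerSL ℝ : Rn k →L[ℝ] Rn k →L[ℝ] ℝ).coeFn_holder u v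

section

variable {x : Rn d}

theorem gradient_add' {φ ψ : Rn d → ℝ} (hφ : DifferentiableAt ℝ φ x)
    (hψ : DifferentiableAt ℝ ψ x) :
    gradient (fun y => φ y + ψ y) x = gradient φ x + gradient ψ x := by
  simp only [gradient]
  rw [fderiv_fun_add hφ hψ, map_add]

theorem gradient_const_mul' {φ : Rn d → ℝ} (c : ℝ) (hφ : DifferentiableAt ℝ φ x) :
    gradient (fun y => c * φ y) x = c • gradient φ x := by
  simp only [gradient]
  rw [fderiv_const_mul hφ, map_smul]

theorem gradient_mul' {φ ψ : Rn d → ℝ} (hφ : DifferentiableAt ℝ φ x)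
    (hψ : DifferentiableAt ℝ ψ x) :
    gradient (fun y => φ y * ψ y) x = φ x • gradient ψ x + ψ x • gradient φ x := by
  simp only [gradient]
  rw [fderiv_fun_mul hφ hψ, map_add, map_smul, map_smul]

theorem gradient_comp' {g : ℝ → ℝ} {φ : Rn d → ℝ} (hg : DifferentiableAt ℝ g (φ x))
    (hφ : DifferentiableAt ℝ φ x) :
    gradient (fun y => g (φ y)) x = deriv g (φ x) • gradient φ x := by
  simp only [gradient]
  have : fderiv ℝ (fun y => g (φ y)) x = deriv g (φ x) • fderiv ℝ φ x := by
    have h1 := (hg.hasDerivAt.comp_hasFDerivAt x hφ.hasFDerivAt).fderiv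
    exact h1
  rw [this, map_smul]

end

theorem rowMul_add (v w : Rn d) (A : Matrix (Fin d) (Fin k) ℝ) :
    rowMul (v + w) A = rowMul v A + rowMul w A := by
  ext j; simp [rowMul, Matrix.add_vecMul]

theorem rowMul_smul (c : ℝ) (v : Rn d) (A : Matrix (Fin d) (Fin k) ℝ) :
    rowMul (c • v) A = c • rowMul v A := by
  ext j; simp [rowMul, Matrix.smul_vecMul]

theorem norm_rowMul_le {M : ℝ} (v : Rn d) (A : Matrix (Fin d) (Fin k) ℝ) (hA : ∀ i j, |A i j| ≤ M) :
    ‖rowMul v A‖ ≤ √(k * (d * M ^ 2)) * ‖v‖ := by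
  refine abs_le_of_sq_le_sq' ?_ (by positivity) |>.2
  rw [mul_pow, sq_sqrt (by positivity), norm_sq_eq, norm_sq_eq]
  have h : ∀ j, ‖rowMul v A j‖ ^ 2 ≤ d * M ^ 2 * ∑ i, ‖v i‖ ^ 2 := by
    intro j
    have h1 : rowMul v A j = ∑ i, v i * A i j := by simp [rowMul, Matrix.vecMul, dotProduct]
    rw [h1, norm_eq_abs, sq_abs]
    refine (Finset.sum_mul_sq_le_sq_mul_sq _ _ _).trans ?_
    rw [mul_comm]
    simp only [norm_eq_abs, sq_abs]
    gcongr
    calc ∑ i, A i j ^ 2 ≤ ∑ _i : Fin d, M ^ 2 :=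
          sum_le_sum fun i _ => sq_le_sq' (abs_le.1 (hA i j)).1 (abs_le.1 (hA i j)).2
      _ = d * M ^ 2 := by simp
  calc ∑ j, ‖rowMul v A j‖ ^ 2 ≤ ∑ _j : Fin k, d * M ^ 2 * ∑ i, ‖v i‖ ^ 2 :=
        sum_le_sum fun j _ => h j
    _ = _ := by simp; ring

theorem inner_rowMul_rowMul (v w : Rn d) (A : Matrix (Fin d) (Fin k) ℝ) :
    inner ℝ (rowMul v A) (rowMul w A) = ∑ i, ∑ j, (A * A.transpose) i j * v i * w j := by
  have h1 : inner ℝ (rowMul v A) (rowMul w A)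
      = ∑ j, (∑ i, v i * A i j) * ∑ i', w i' * A i' j := by
    simp only [rowMul, PiLp.inner_apply, Matrix.vecMul, dotProduct, RCLike.inner_apply,
      conj_trivial]
    exact sum_congr rfl fun j _ => mul_comm _ _
  rw [h1]
  simp only [Finset.sum_mul_sum]
  simp only [Matrix.mul_apply, Matrix.transpose_apply, sum_mul]
  rw [sum_comm]
  refine sum_congr rfl fun i _ => ?_
  rw [sum_comm]
  exact sum_congr rfl fun i' _ => sum_congr rfl fun j _ => by ring

namespace IsTest

theorem differentiable {φ : Rn d → ℝ} (hφ : IsTest φ) : Differentiable ℝ φ :=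
  hφ.1.differentiable (by simp)

theorem zero : IsTest (0 : Rn d → ℝ) := ⟨contDiff_const, HasCompactSupport.zero⟩

theorem add {φ ψ : Rn d → ℝ} (hφ : IsTest φ) (hψ : IsTest ψ) : IsTest (φ + ψ) :=
  ⟨hφ.1.add hψ.1, hφ.2.add hψ.2⟩

theorem const_mul {φ : Rn d → ℝ} (hφ : IsTest φ) (c : ℝ) : IsTest fun x => c * φ x :=
  ⟨contDiff_const.mul hφ.1, hφ.2.mul_left⟩

section

variable {φ ψ : Rn d → ℝ} (hφ : IsTest φ) (hψ : IsTest ψ)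

include hφ hψ

theorem sub : IsTest (φ - ψ) := by
  have := hφ.add (hψ.const_mul (-1))
  convert this using 1
  ext x; simp [sub_eq_add_neg]

theorem mul : IsTest fun x => φ x * ψ x :=
  ⟨hφ.1.mul hψ.1, hφ.2.mul_right⟩

end

section

variable {φ : Rn d → ℝ} (hφ : IsTest φ)

include hφ

theorem comp {g : ℝ → ℝ} (hg : ContDiff ℝ ∞ g) (h0 : g 0 = 0) :
    IsTest fun x => g (φ x) :=
  ⟨hg.comp hφ.1, hφ.2.comp_left h0⟩

theorem memLp (p : ℝ≥0∞) : MemLp φ p volume :=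
  hφ.1.continuous.memLp_of_hasCompactSupport hφ.2

theorem continuous_gradient : Continuous (gradient φ) :=
  (InnerProductSpace.toDual ℝ (Rn d)).symm.continuous.comp (hφ.1.continuous_fderiv (by simp))

theorem hasCompactSupport_gradient :
    HasCompactSupport (gradient φ) :=
  (hφ.2.fderiv (𝕜 := ℝ)).comp_left (g := (InnerProductSpace.toDual ℝ (Rn d)).symm) (map_zero _)

end

end IsTest

namespace Coefficients

variable (Q)

theorem measurable_rowMul {v : Rn d → Rn d} (hv : Measurable v) :
    Measurable fun x => rowMul (v x) (Q.σ x) := by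
  refine (WithLp.measurable_toLp 2 (Fin k → ℝ)).comp (measurable_pi_lambda _ fun j => ?_)
  simp only [Matrix.vecMul, dotProduct]
  refine Finset.measurable_sum _ fun i _ => Measurable.mul ?_ (Q.measurable_σ i j)
  exact (proj (𝕜 := ℝ) i).continuous.measurable.comp hv

theorem measurable_bHatσ : Measurable Q.bHatσ := Q.measurable_rowMul Q.measurable_bHat

variable {Q}

section

variable {φ : Rn d → ℝ} (hφ : IsTest φ) {ν : Measure (Rn d)}

include hφ

theorem _root_.IsTest.aesm :
    AEStronglyMeasurable φ ν := hφ.1.continuous.aestronglyMeasurable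

theorem aesm_DTest :
    AEStronglyMeasurable (Q.DTest φ) ν :=
  (Q.measurable_rowMul hφ.continuous_gradient.measurable).aestronglyMeasurable

end

theorem memLp_DTest (hσ : Q.BddSigma) {φ : Rn d → ℝ} (hφ : IsTest φ) (p : ℝ≥0∞) :
    MemLp (Q.DTest φ) p volume := by
  obtain ⟨M, hM⟩ := hσ
  have h1 : MemLp (gradient φ) p volume :=
    hφ.continuous_gradient.memLp_of_hasCompactSupport hφ.hasCompactSupport_gradient
  exact h1.of_le_mul (aesm_DTest hφ)
    (of_forall fun x => norm_rowMul_le _ _ (hM x))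

theorem DTest_add {φ ψ : Rn d → ℝ} (hφ : IsTest φ) (hψ : IsTest ψ) (x : Rn d) :
    Q.DTest (φ + ψ) x = Q.DTest φ x + Q.DTest ψ x := by
  simp only [DTest]
  rw [← rowMul_add, ← gradient_add' (hφ.differentiable x) (hψ.differentiable x)]
  rfl

theorem DTest_const_mul {φ : Rn d → ℝ} (hφ : IsTest φ) (c : ℝ) (x : Rn d) :
    Q.DTest (fun x => c * φ x) x = c • Q.DTest φ x := by
  simp only [DTest]
  rw [← rowMul_smul, ← gradient_const_mul' c (hφ.differentiable x)]

theorem DTest_mul {φ ψ : Rn d → ℝ} (hφ : IsTest φ) (hψ : IsTest ψ) (x : Rn d) :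
    Q.DTest (fun x => φ x * ψ x) x = φ x • Q.DTest ψ x + ψ x • Q.DTest φ x := by
  simp only [DTest]
  rw [← rowMul_smul, ← rowMul_smul, ← rowMul_add,
    ← gradient_mul' (hφ.differentiable x) (hψ.differentiable x)]

theorem DTest_comp {φ : Rn d → ℝ} (hφ : IsTest φ) {g : ℝ → ℝ} (hg : Differentiable ℝ g)
    (x : Rn d) : Q.DTest (fun x => g (φ x)) x = deriv g (φ x) • Q.DTest φ x := by
  simp only [DTest]
  rw [← rowMul_smul, ← gradient_comp' (hg _) (hφ.differentiable x)]

section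

variable {φ ψ : Rn d → ℝ} (hφ : IsTest φ) (hψ : IsTest ψ)

include hφ hψ

theorem formATest_eq :
    Q.formATest φ ψ = ∫ x, inner ℝ (Q.DTest φ x) (Q.DTest ψ x) := by
  have hi : ∀ i j, Integrable fun x => Q.a x i j * gradient φ x i * gradient ψ x j := by
    intro i j
    have h1 : Continuous fun x => gradient φ x i * gradient ψ x j :=
      ((proj (𝕜 := ℝ) i).continuous.comp hφ.continuous_gradient).mul
        ((proj (𝕜 := ℝ) j).continuous.comp hψ.continuous_gradient)
    have h2 : HasCompactSupport fun x => gradient φ x i * gradient ψ x j :=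
      (hφ.hasCompactSupport_gradient.comp_left (g := fun v : Rn d => v i) rfl).mul_right
    have := (Q.locInt_a i j).integrable_smul_left_of_hasCompactSupport h1 h2
    refine this.congr (of_forall fun x => ?_)
    simp only [smul_eq_mul, a]; ring
  simp only [DTest, inner_rowMul_rowMul, formATest]
  change _ = ∫ x, ∑ i, ∑ j, Q.a x i j * gradient φ x i * gradient ψ x j
  rw [integral_finsetSum _ fun i _ => integrable_finsetSum _ fun j _ => hi i j]
  exact sum_congr rfl fun i _ => (integral_finsetSum _ fun j _ => hi i j).symm

theorem formTest_eq :
    Q.formTest φ ψ = (∫ x, inner ℝ (Q.DTest φ x) (Q.DTest ψ x)) + (∫ x, Q.c x * φ x * ψ x)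
      + ∫ x, inner ℝ (Q.bHatσ x) (Q.DTest φ x) * ψ x := by
  rw [formTest, formATest_eq hφ hψ]
  congr 1
  have hi : ∀ i, Integrable fun x => (∑ j, Q.a x i j * Q.bHat x j) * gradient φ x i * ψ x := by
    intro i
    have h1 : Continuous fun x => gradient φ x i * ψ x :=
      ((proj (𝕜 := ℝ) i).continuous.comp hφ.continuous_gradient).mul
        hψ.1.continuous
    have h2 : HasCompactSupport fun x => gradient φ x i * ψ x := hψ.2.mul_left
    have := (Q.locInt_abHat i).integrable_smul_left_of_hasCompactSupport h1 h2
    refine this.congr (of_forall fun x => ?_)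
    simp only [smul_eq_mul, a]; ring
  rw [← integral_finsetSum _ fun i _ => hi i]
  congr 1
  ext x
  rw [← sum_mul]
  congr 1
  rw [bHatσ, DTest, inner_rowMul_rowMul, sum_comm]
  refine sum_congr rfl fun i _ => ?_
  rw [sum_mul]
  refine sum_congr rfl fun j _ => ?_
  have : (Q.σ x * (Q.σ x).transpose) j i = Q.a x i j := by
    rw [a, Matrix.mul_apply, Matrix.mul_apply]
    exact sum_congr rfl fun _ _ => by simp [mul_comm]
  rw [this]

end

end Coefficients

/-- `|m| ∈ L^d + L^∞`. -/
def IsLdWeight {E : Type*} [NormedAddCommGroup E] (m : Rn d → E) : Prop :=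
  ∃ g h : Rn d → ℝ, MemLp g d volume ∧ MemLp h ⊤ volume ∧ ∀ᵐ x, ‖m x‖ ≤ |g x| + |h x|

namespace Coefficients

theorem CondA2'.isLdWeight_bHatσ (h : Q.CondA2') : IsLdWeight Q.bHatσ := by
  obtain ⟨g, h', hg, hh, he⟩ := h.bHat_mem
  refine ⟨g, h', hg, hh, ?_⟩
  filter_upwards [he] with x hx
  rw [hx]
  exact add_le_add (le_abs_self _) (le_abs_self _)

theorem CondA2'.isLdWeight_sqrt_c (h : Q.CondA2') : IsLdWeight fun x => √(Q.c x) := by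
  obtain ⟨g, h', hg, hh, he⟩ := h.c_mem
  refine ⟨fun x => ‖g x‖ ^ ((2⁻¹ : ℝ≥0∞).toReal), fun x => ‖h' x‖ ^ ((2⁻¹ : ℝ≥0∞).toReal), ?_, ?_, ?_⟩
  · have := hg.norm_rpow_div 2⁻¹
    rwa [ENNReal.div_eq_inv_mul, inv_inv, ENNReal.mul_div_cancel (by norm_num) (by norm_num)] at this
  · have := hh.norm_rpow_div 2⁻¹
    rwa [ENNReal.top_div_of_ne_top (by norm_num)] at this
  · filter_upwards [he] with x hx
    have e : (2⁻¹ : ℝ≥0∞).toReal = 1 / 2 := by simp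
    simp only [e, ← Real.sqrt_eq_rpow]
    rw [norm_of_nonneg (sqrt_nonneg _), abs_of_nonneg (sqrt_nonneg _),
      abs_of_nonneg (sqrt_nonneg _)]
    rw [Real.sqrt_le_left (by positivity)]
    rw [hx, add_sq, sq_sqrt (norm_nonneg _), sq_sqrt (norm_nonneg _)]
    have := le_abs_self (g x)
    have := le_abs_self (h' x)
    simp only [norm_eq_abs]
    have : 0 ≤ √|g x| * √|h' x| := by positivity
    linarith

theorem sqrt_formATest (hσ : Q.BddSigma) {φ : Rn d → ℝ} (hφ : IsTest φ) :
    ofReal √(Q.formATest φ φ) = eLpNorm (Q.DTest φ) 2 volume := by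
  have hm := memLp_DTest hσ hφ 2
  rw [formATest_eq hφ hφ, hm.eLpNorm_eq_integral_rpow_norm (by norm_num) (by norm_num)]
  congr 1
  rw [Real.sqrt_eq_rpow]
  simp

theorem CondA2'.weight_bound (h : Q.CondA2') {E : Type*} [NormedAddCommGroup E] [NormedSpace ℝ E]
    {m : Rn d → E} (hm : IsLdWeight m) {δ : ℝ} (hδ : 0 < δ) :
    ∃ C : ℝ, 0 ≤ C ∧ ∀ φ, IsTest φ → eLpNorm (fun x => φ x • m x) 2 volume ≤
      ofReal δ * eLpNorm (Q.DTest φ) 2 volume + ofReal C * eLpNorm φ 2 volume := by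
  obtain ⟨q, hq, Cs, hCs, hsob⟩ := h.sobolev
  obtain ⟨g₀, h', hg₀, hh, hb₀⟩ := hm
  obtain ⟨g, hgm, hgg⟩ := hg₀.1
  have hg : MemLp g d volume := (memLp_congr_ae hgg).1 hg₀
  have hb : ∀ᵐ x, ‖m x‖ ≤ |g x| + |h' x| := by
    filter_upwards [hb₀, hgg] with x h1 h2
    rwa [← h2]
  have : ENNReal.HolderTriple d q 2 := ⟨by rw [add_comm]; exact hq⟩
  obtain ⟨N, hN⟩ := hg.eLpNorm_indicator_norm_ge_le hgm (ε := δ / (Cs + 1)) (by positivity)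
  obtain ⟨H, hH⟩ : ∃ H : ℝ, ∀ᵐ x, |h' x| ≤ H := by
    refine ⟨(eLpNorm h' ⊤ volume).toReal, ?_⟩
    filter_upwards [ae_le_eLpNormEssSup (f := h') (μ := volume)] with x hx
    have := toReal_mono hh.2.ne (hx.trans_eq (eLpNorm_exponent_top).symm)
    simpa using this
  set G : Rn d → ℝ := {x | N ≤ ‖g x‖₊}.indicator g with hG
  have hGm : AEStronglyMeasurable G volume := by
    refine hgm.aestronglyMeasurable.indicator ?_
    exact measurableSet_le measurable_const hgm.nnnorm.measurable.subtype_coe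
  refine ⟨|N| + |H|, by positivity, fun φ hφ => ?_⟩
  have h1 : eLpNorm (fun x => φ x • m x) 2 volume
      ≤ eLpNorm ((fun x => ‖(G • φ) x‖) + fun x => (|N| + |H|) * ‖φ x‖) 2 volume := by
    refine eLpNorm_mono_ae_real ?_
    filter_upwards [hb, hH] with x h1 h2
    rw [norm_smul, Pi.add_apply, Pi.smul_apply', norm_smul]
    have hgx : |g x| ≤ ‖G x‖ + |N| := by
      by_cases hx : N ≤ ‖g x‖₊
      · rw [hG, indicator_of_mem (by exact hx)]
        simp
      · have : ‖g x‖ < N := by simpa using hx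
        have := le_abs_self N
        rw [norm_eq_abs] at *
        linarith [abs_nonneg (G x)]
    have : ‖m x‖ ≤ ‖G x‖ + (|N| + |H|) := by linarith [le_abs_self H]
    nlinarith [norm_nonneg (φ x)]
  refine h1.trans ((eLpNorm_add_le (hGm.smul hφ.aesm).norm
    (hφ.aesm.norm.const_mul _) (by norm_num)).trans (add_le_add ?_ ?_))
  · rw [eLpNorm_norm]
    refine (eLpNorm_smul_le_mul_eLpNorm (p := d) (q := q) hφ.aesm hGm).trans ?_
    refine (mul_le_mul' hN (hsob φ hφ)).trans ?_
    rw [ofReal_mul hCs, sqrt_formATest h.bdd hφ, ← mul_assoc,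
      ← ofReal_mul (by positivity)]
    gcongr
    rw [div_mul_eq_mul_div, div_le_iff₀ (by positivity)]
    nlinarith
  · refine (eLpNorm_le_mul_eLpNorm_of_ae_le_mul (c := |N| + |H|) (g := φ)
      (of_forall fun x => ?_) 2)
    rw [norm_mul, norm_norm, norm_of_nonneg (by positivity)]

variable (Q) in
/-- The graph of `D_σ` on test functions. -/
noncomputable def dGraph : Submodule ℝ (L2 d × L2v d k) where
  carrier := {p | ∃ φ, IsTest φ ∧ p.1 =ᵐ[volume] φ ∧ p.2 =ᵐ[volume] Q.DTest φ}
  add_mem' := by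
    rintro p q ⟨φ, hφ, h1, h2⟩ ⟨ψ, hψ, h3, h4⟩
    refine ⟨φ + ψ, hφ.add hψ, ?_, ?_⟩
    · exact (coeFn_add _ _).trans (h1.add h3)
    · refine (coeFn_add _ _).trans ((h2.add h4).trans (of_forall fun x => ?_))
      exact (DTest_add hφ hψ x).symm
  zero_mem' := by
    refine ⟨0, IsTest.zero, coeFn_zero _ _ _, (coeFn_zero _ _ _).trans
      (of_forall fun x => ?_)⟩
    have := DTest_const_mul (Q := Q) IsTest.zero 0 x
    rw [zero_smul] at this
    rw [Pi.zero_apply, ← this]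
    congr 1
    ext y; simp
  smul_mem' := by
    rintro c p ⟨φ, hφ, h1, h2⟩
    refine ⟨fun x => c * φ x, hφ.const_mul c, ?_, ?_⟩
    · exact (coeFn_smul _ _).trans (h1.const_smul c)
    · exact (coeFn_smul _ _).trans ((h2.const_smul c).trans
        (of_forall fun x => (DTest_const_mul hφ c x).symm))

/-- The closure of `D_σ`, as the closed subspace of pairs `(u, D_σ u)`. -/
noncomputable abbrev FGraph (Q : Coefficients d k) : Submodule ℝ (L2 d × L2v d k) := Q.dGraph.topologicalClosure

/-- The pair `(φ, D_σ φ)` of a test function. -/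
noncomputable def testPair (hσ : Q.BddSigma) {φ : Rn d → ℝ} (hφ : IsTest φ) : Q.FGraph :=
  ⟨((hφ.memLp 2).toLp φ, (memLp_DTest hσ hφ 2).toLp (Q.DTest φ)), Submodule.le_topologicalClosure _
    ⟨φ, hφ, MemLp.coeFn_toLp (hφ.memLp 2), MemLp.coeFn_toLp (memLp_DTest hσ hφ 2)⟩⟩

section

variable (hσ : Q.BddSigma)

include hσ

theorem coeFn_testPair_fst {φ : Rn d → ℝ} (hφ : IsTest φ) :
    (testPair hσ hφ).1.1 =ᵐ[volume] φ :=
  MemLp.coeFn_toLp (hφ.memLp 2)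

theorem coeFn_testPair_snd {φ : Rn d → ℝ} (hφ : IsTest φ) :
    (testPair hσ hφ).1.2 =ᵐ[volume] Q.DTest φ :=
  MemLp.coeFn_toLp (memLp_DTest hσ hφ 2)

theorem tendsto_testPair_iff {φ : ℕ → Rn d → ℝ} (hφ : ∀ n, IsTest (φ n))
    (u : L2 d) (w : L2v d k) :
    (fun n => (testPair hσ (hφ n)).1) ⇝ (u, w) ↔
    (fun n => eLpNorm (fun x => φ n x - u x) 2 volume) ⇝ 0 ∧
    (fun n => eLpNorm (fun x => Q.DTest (φ n) x - w x) 2 volume) ⇝ 0 := by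
  rw [Prod.tendsto_iff, Lp.tendsto_Lp_iff_tendsto_eLpNorm', Lp.tendsto_Lp_iff_tendsto_eLpNorm']
  have h1 : ∀ n, eLpNorm (⇑(testPair hσ (hφ n)).1.1 - ⇑u) 2 volume
      = eLpNorm (fun x => φ n x - u x) 2 volume := fun n => eLpNorm_congr_ae
    ((coeFn_testPair_fst hσ (hφ n)).sub (EventuallyEq.refl _ _))
  have h2 : ∀ n, eLpNorm (⇑(testPair hσ (hφ n)).1.2 - ⇑w) 2 volume
      = eLpNorm (fun x => Q.DTest (φ n) x - w x) 2 volume := fun n => eLpNorm_congr_ae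
    ((coeFn_testPair_snd hσ (hφ n)).sub (EventuallyEq.refl _ _))
  simp only [h1, h2]

theorem exists_testPair_eq {p : L2 d × L2v d k} (hp : p ∈ Q.dGraph) :
    ∃ (φ : Rn d → ℝ) (hφ : IsTest φ), (testPair hσ hφ).1 = p := by
  obtain ⟨φ, hφ, h1, h2⟩ := hp
  exact ⟨φ, hφ, Prod.ext (Lp.ext ((coeFn_testPair_fst hσ hφ).trans h1.symm))
    (Lp.ext ((coeFn_testPair_snd hσ hφ).trans h2.symm))⟩

theorem exists_testPair_tendsto (p : Q.FGraph) :
    ∃ (φ : ℕ → Rn d → ℝ) (hφ : ∀ n, IsTest (φ n)),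
      (fun n => testPair hσ (hφ n)) ⇝ p := by
  obtain ⟨s, hs, hlim⟩ := mem_closure_iff_seq_limit.1
    (show p.1 ∈ closure (Q.dGraph : Set (L2 d × L2v d k)) from p.2)
  choose φ hφ hφs using fun n => exists_testPair_eq hσ (hs n)
  refine ⟨φ, hφ, ?_⟩
  rw [tendsto_subtype_rng]
  simpa only [hφs] using hlim

theorem isDσ_iff (u : L2 d) (w : L2v d k) :
    Q.IsDσ u w ↔ (u, w) ∈ Q.FGraph := by
  constructor
  · rintro ⟨φ, hφ, h1, h2⟩
    exact mem_closure_of_tendsto ((tendsto_testPair_iff hσ hφ u w).2 ⟨h1, h2⟩)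
      (of_forall fun n => ⟨φ n, hφ n, coeFn_testPair_fst hσ (hφ n),
        coeFn_testPair_snd hσ (hφ n)⟩)
  · intro h
    obtain ⟨φ, hφ, hlim⟩ := exists_testPair_tendsto hσ ⟨(u, w), h⟩
    rw [tendsto_subtype_rng] at hlim
    exact ⟨φ, hφ, (tendsto_testPair_iff hσ hφ u w).1 hlim⟩

end

section

variable (h : Q.CondA2') {E : Type*} [NormedAddCommGroup E] [NormedSpace ℝ E] {m : Rn d → E}
  (hmm : AEStronglyMeasurable m volume) (hm : IsLdWeight m)

include h hmm hm

theorem CondA2'.weight_bound_graph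
    {δ : ℝ} (hδ : 0 < δ) : ∃ C : ℝ, 0 ≤ C ∧ ∀ p : Q.FGraph,
      eLpNorm (fun x => p.1.1 x • m x) 2 volume ≤ ofReal (δ * ‖p.1.2‖ + C * ‖p.1.1‖) := by
  obtain ⟨C, hC, hb⟩ := h.weight_bound hm hδ
  refine ⟨C, hC, fun p => ?_⟩
  obtain ⟨φ, hφ, hlim⟩ := exists_testPair_tendsto h.bdd p
  have hb' : ∀ n, eLpNorm (fun x => φ n x • m x) 2 volume
      ≤ ofReal (δ * ‖(testPair h.bdd (hφ n)).1.2‖ + C * ‖(testPair h.bdd (hφ n)).1.1‖) := by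
    intro n
    refine (hb _ (hφ n)).trans_eq ?_
    rw [ENNReal.ofReal_add (by positivity) (by positivity), ofReal_mul hδ.le,
      ofReal_mul hC, Lp.norm_def, Lp.norm_def, ofReal_toReal (memLp _).2.ne,
      ofReal_toReal (memLp _).2.ne, eLpNorm_congr_ae (coeFn_testPair_fst h.bdd (hφ n)),
      eLpNorm_congr_ae (coeFn_testPair_snd h.bdd (hφ n))]
  have hlim1 : (fun n => (testPair h.bdd (hφ n)).1.1) ⇝ p.1.1 :=
    ((continuous_fst.comp continuous_subtype_val).tendsto p).comp hlim
  obtain ⟨ns, hns, hae⟩ := (tendstoInMeasure_of_tendsto_Lp hlim1).exists_seq_tendsto_ae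
  have hae' : ∀ᵐ x, (fun n => φ (ns n) x • m x) ⇝ (p.1.1 x • m x) := by
    filter_upwards [hae, ae_all_iff.2 fun n => coeFn_testPair_fst h.bdd (hφ (ns n))] with x h1 h2
    simp only [h2] at h1
    exact h1.smul_const _
  refine (Lp.eLpNorm_lim_le_liminf_eLpNorm
    (fun n => (hφ (ns n)).aesm.smul hmm) _ hae').trans ?_
  have hR : (fun n => ofReal (δ * ‖(testPair h.bdd (hφ (ns n))).1.2‖
      + C * ‖(testPair h.bdd (hφ (ns n))).1.1‖)) ⇝ (ofReal (δ * ‖p.1.2‖ + C * ‖p.1.1‖)) := by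
    have hc : Continuous fun p : Q.FGraph => ofReal (δ * ‖p.1.2‖ + C * ‖p.1.1‖) :=
      ENNReal.continuous_ofReal.comp (by fun_prop)
    exact (hc.tendsto p).comp (hlim.comp hns.tendsto_atTop)
  rw [← hR.liminf_eq]
  exact liminf_le_liminf (of_forall fun n => hb' (ns n))

/-- Multiplication by a weight in `L^d + L^∞`, from the domain of `D_σ` to `L²`. -/
theorem CondA2'.exists_mulWeight :
    ∃ A : Q.FGraph →L[ℝ] Lp E 2 (volume : Measure (Rn d)),
      (∀ p, A p =ᵐ[volume] fun x => p.1.1 x • m x) ∧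
      ∀ δ > 0, ∃ C : ℝ, 0 ≤ C ∧ ∀ p, ‖A p‖ ≤ δ * ‖p.1.2‖ + C * ‖p.1.1‖ := by
  have hmem : ∀ p : Q.FGraph, MemLp (fun x => p.1.1 x • m x) 2 volume := by
    intro p
    obtain ⟨C, hC, hb⟩ := h.weight_bound_graph hmm hm one_pos
    exact ⟨(memLp _).1.smul hmm, (hb p).trans_lt ENNReal.ofReal_lt_top⟩
  have hbound : ∀ δ > 0, ∃ C : ℝ, 0 ≤ C ∧ ∀ p, ‖(hmem p).toLp‖ ≤ δ * ‖p.1.2‖ + C * ‖p.1.1‖ := by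
    intro δ hδ
    obtain ⟨C, hC, hb⟩ := h.weight_bound_graph hmm hm hδ
    refine ⟨C, hC, fun p => ?_⟩
    rw [Lp.norm_toLp]
    exact ENNReal.toReal_le_of_le_ofReal (by positivity) (hb p)
  obtain ⟨C, hC, hb⟩ := hbound 1 one_pos
  refine ⟨LinearMap.mkContinuous ⟨⟨fun p => (hmem p).toLp _, fun p q => ?_⟩, fun c p => ?_⟩ (1 + C)
    (fun p => ?_), fun p => MemLp.coeFn_toLp (hmem p), hbound⟩
  · apply Lp.ext
    filter_upwards [MemLp.coeFn_toLp (hmem (p + q)), MemLp.coeFn_toLp (hmem p),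
      MemLp.coeFn_toLp (hmem q), ae_add (hmem p).toLp (hmem q).toLp,
      ae_add p.1.1 q.1.1] with x h1 h2 h3 h4 h5
    rw [h1, h4, h2, h3, ← add_smul]
    congr 1
  · apply Lp.ext
    filter_upwards [MemLp.coeFn_toLp (hmem (c • p)), MemLp.coeFn_toLp (hmem p),
      ae_smul c (hmem p).toLp, ae_smul c p.1.1] with x h1 h2 h3 h4
    rw [h1, id_apply, h3, h2, ← smul_assoc]
    congr 1
  · refine (hb p).trans ?_
    have h1 : ‖p.1.2‖ ≤ ‖p‖ := norm_snd_le p.1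
    have h2 : ‖p.1.1‖ ≤ ‖p‖ := norm_fst_le p.1
    nlinarith

end

/-- `u ↦ √c u` on the domain of `D_σ`. -/
noncomputable def CondA2'.sqrtC (h : Q.CondA2') : Q.FGraph →L[ℝ] L2 d :=
  (h.exists_mulWeight Q.measurable_c.sqrt.aestronglyMeasurable h.isLdWeight_sqrt_c).choose

/-- `u ↦ u (b̂σ)` on the domain of `D_σ`. -/
noncomputable def CondA2'.mulBHat (h : Q.CondA2') : Q.FGraph →L[ℝ] L2v d k :=
  (h.exists_mulWeight Q.measurable_bHatσ.aestronglyMeasurable h.isLdWeight_bHatσ).choose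

section

variable (h : Q.CondA2')

include h

theorem CondA2'.coeFn_sqrtC (p : Q.FGraph) :
    h.sqrtC p =ᵐ[volume] fun x => p.1.1 x * √(Q.c x) :=
  (h.exists_mulWeight Q.measurable_c.sqrt.aestronglyMeasurable h.isLdWeight_sqrt_c).choose_spec.1 p

theorem CondA2'.coeFn_mulBHat (p : Q.FGraph) :
    h.mulBHat p =ᵐ[volume] fun x => p.1.1 x • Q.bHatσ x :=
  (h.exists_mulWeight Q.measurable_bHatσ.aestronglyMeasurable h.isLdWeight_bHatσ).choose_spec.1 p

theorem CondA2'.norm_mulBHat_le : ∀ δ > 0, ∃ C : ℝ, 0 ≤ C ∧ ∀ p : Q.FGraph,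
    ‖h.mulBHat p‖ ≤ δ * ‖p.1.2‖ + C * ‖p.1.1‖ :=
  (h.exists_mulWeight Q.measurable_bHatσ.aestronglyMeasurable h.isLdWeight_bHatσ).choose_spec.2

/-- The form `𝓔^{a,b̂}` on the domain of `D_σ`. -/
noncomputable def CondA2'.bil (h : Q.CondA2') (p q : Q.FGraph) : ℝ :=
  inner ℝ p.1.2 q.1.2 + inner ℝ (h.sqrtC p) (h.sqrtC q) + inner ℝ p.1.2 (h.mulBHat q)

theorem CondA2'.bil_eq (p q : Q.FGraph) :
    h.bil p q = (∫ x, inner ℝ (p.1.2 x) (q.1.2 x)) + (∫ x, Q.c x * p.1.1 x * q.1.1 x)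
      + ∫ x, inner ℝ (Q.bHatσ x) (p.1.2 x) * q.1.1 x := by
  simp only [bil, inner_def]
  have e : ∀ {a b c b' c' : ℝ}, b = b' → c = c' → a + b + c = a + b' + c' := by
    rintro _ _ _ _ _ rfl rfl; rfl
  refine e ?_ ?_
  · refine integral_congr_ae ?_
    filter_upwards [h.coeFn_sqrtC p, h.coeFn_sqrtC q] with x h1 h2
    rw [h1, h2]
    simp only [RCLike.inner_apply, conj_trivial]
    nth_rewrite 3 [← Real.mul_self_sqrt (Q.c_nonneg x)]
    ring
  · refine integral_congr_ae ?_
    filter_upwards [h.coeFn_mulBHat q] with x h1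
    rw [h1, inner_smul_right, real_inner_comm]
    ring

theorem CondA2'.bil_testPair {φ ψ : Rn d → ℝ} (hφ : IsTest φ) (hψ : IsTest ψ) :
    h.bil (testPair h.bdd hφ) (testPair h.bdd hψ) = Q.formTest φ ψ := by
  rw [h.bil_eq, formTest_eq hφ hψ]
  have e : ∀ {a b c a' b' c' : ℝ}, a = a' → b = b' → c = c' → a + b + c = a' + b' + c' := by
    rintro _ _ _ _ _ _ rfl rfl rfl; rfl
  refine e ?_ ?_ ?_
  · refine integral_congr_ae ?_
    filter_upwards [coeFn_testPair_snd h.bdd hφ, coeFn_testPair_snd h.bdd hψ] with x h1 h2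
    rw [h1, h2]
  · refine integral_congr_ae ?_
    filter_upwards [coeFn_testPair_fst h.bdd hφ, coeFn_testPair_fst h.bdd hψ] with x h1 h2
    rw [h1, h2]
  · refine integral_congr_ae ?_
    filter_upwards [coeFn_testPair_snd h.bdd hφ, coeFn_testPair_fst h.bdd hψ] with x h1 h2
    rw [h1, h2]

end

theorem formATest_testPair (hσ : Q.BddSigma) {φ : Rn d → ℝ} (hφ : IsTest φ) :
    Q.formATest φ φ = ‖(testPair hσ hφ).1.2‖ ^ 2 := by
  rw [formATest_eq hφ hφ, ← real_inner_self_eq_norm_sq, inner_def]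
  refine integral_congr_ae ?_
  filter_upwards [coeFn_testPair_snd hσ hφ] with x h1
  rw [h1]

theorem integral_mul_testPair (hσ : Q.BddSigma) {φ ψ : Rn d → ℝ} (hφ : IsTest φ) (hψ : IsTest ψ) :
    ∫ x, φ x * ψ x = inner ℝ (testPair hσ hφ).1.1 (testPair hσ hψ).1.1 := by
  rw [inner_def]
  refine integral_congr_ae ?_
  filter_upwards [coeFn_testPair_fst hσ hφ, coeFn_testPair_fst hσ hψ] with x h1 h2
  rw [h1, h2]
  simp [mul_comm]

theorem norm_sq_le_of_pair {X Y : Type*} [NormedAddCommGroup X] [NormedAddCommGroup Y] (p : X × Y) :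
    ‖p‖ ^ 2 ≤ ‖p.1‖ ^ 2 + ‖p.2‖ ^ 2 := by
  rw [Prod.norm_def]
  rcases max_cases ‖p.1‖ ‖p.2‖ with h | h <;> rw [h.1] <;> nlinarith [sq_nonneg ‖p.1‖, sq_nonneg ‖p.2‖]

theorem testPair_sub (hσ : Q.BddSigma) {φ ψ : Rn d → ℝ} (hφ : IsTest φ) (hψ : IsTest ψ) :
    testPair hσ (hφ.sub hψ) = testPair hσ hφ - testPair hσ hψ := by
  have hD : ∀ x, Q.DTest (φ - ψ) x = Q.DTest φ x - Q.DTest ψ x := by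
    intro x
    have h := DTest_add (Q := Q) hφ (hψ.const_mul (-1)) x
    have e : φ + (fun x => -1 * ψ x) = φ - ψ := by ext y; simp [sub_eq_add_neg]
    rw [e, DTest_const_mul hψ] at h
    rw [h]; simp [sub_eq_add_neg]
  refine Subtype.ext (Prod.ext (Lp.ext ?_) (Lp.ext ?_))
  · filter_upwards [coeFn_testPair_fst hσ (hφ.sub hψ), coeFn_testPair_fst hσ hφ,
      coeFn_testPair_fst hσ hψ, ae_sub (testPair hσ hφ).1.1 (testPair hσ hψ).1.1]
      with x h1 h2 h3 h4
    rw [h1, Submodule.coe_sub, Prod.fst_sub, h4, Pi.sub_apply, h2, h3]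
  · filter_upwards [coeFn_testPair_snd hσ (hφ.sub hψ), coeFn_testPair_snd hσ hφ,
      coeFn_testPair_snd hσ hψ, ae_sub (testPair hσ hφ).1.2 (testPair hσ hψ).1.2]
      with x h1 h2 h3 h4
    rw [h1, Submodule.coe_sub, Prod.snd_sub, h4, h2, h3, hD]

section

variable (h : Q.CondA2')

include h

theorem CondA2'.formTestAdd_eq (γ : ℝ) {φ ψ : Rn d → ℝ} (hφ : IsTest φ)
    (hψ : IsTest ψ) : Q.formTestAdd γ φ ψ = h.bil (testPair h.bdd hφ) (testPair h.bdd hψ)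
      + γ * inner ℝ (testPair h.bdd hφ).1.1 (testPair h.bdd hψ).1.1 := by
  rw [formTestAdd, h.bil_testPair, integral_mul_testPair h.bdd]

theorem CondA2'.continuous_bil :
    Continuous fun pq : Q.FGraph × Q.FGraph => h.bil pq.1 pq.2 := by
  unfold bil; fun_prop

theorem CondA2'.abs_bil_le :
    ∃ K : ℝ, 0 ≤ K ∧ ∀ p q : Q.FGraph, |h.bil p q| ≤ K * ‖p‖ * ‖q‖ := by
  refine ⟨1 + ‖h.sqrtC‖ * ‖h.sqrtC‖ + ‖h.mulBHat‖, by positivity, fun p q => ?_⟩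
  have h1 : ∀ p : Q.FGraph, ‖p.1.2‖ ≤ ‖p‖ := fun p => norm_snd_le p.1
  have e1 : |inner ℝ p.1.2 q.1.2| ≤ ‖p‖ * ‖q‖ :=
    (abs_real_inner_le_norm _ _).trans (mul_le_mul (h1 p) (h1 q) (norm_nonneg _) (norm_nonneg _))
  have e2 : |inner ℝ (h.sqrtC p) (h.sqrtC q)| ≤ (‖h.sqrtC‖ * ‖p‖) * (‖h.sqrtC‖ * ‖q‖) :=
    (abs_real_inner_le_norm _ _).trans (mul_le_mul (h.sqrtC.le_opNorm p) (h.sqrtC.le_opNorm q)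
      (norm_nonneg _) (by positivity))
  have e3 : |inner ℝ p.1.2 (h.mulBHat q)| ≤ ‖p‖ * (‖h.mulBHat‖ * ‖q‖) :=
    (abs_real_inner_le_norm _ _).trans (mul_le_mul (h1 p) (h.mulBHat.le_opNorm q)
      (norm_nonneg _) (by positivity))
  unfold bil
  refine (abs_add_le _ _).trans ((add_le_add ((abs_add_le _ _).trans (add_le_add e1 e2)) e3).trans ?_)
  apply le_of_eq; ring

/-- Gårding's inequality for the form. -/
theorem CondA2'.garding : ∃ C : ℝ, 0 ≤ C ∧ ∀ p : Q.FGraph,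
    1 / 4 * ‖p.1.2‖ ^ 2 ≤ h.bil p p + C * ‖p.1.1‖ ^ 2 := by
  obtain ⟨C, hC, hb⟩ := h.norm_mulBHat_le (1 / 2) (by norm_num)
  refine ⟨C ^ 2, by positivity, fun p => ?_⟩
  have e3 : |inner ℝ p.1.2 (h.mulBHat p)| ≤ ‖p.1.2‖ * (1 / 2 * ‖p.1.2‖ + C * ‖p.1.1‖) :=
    (abs_real_inner_le_norm _ _).trans (mul_le_mul_of_nonneg_left (hb p) (norm_nonneg _))
  have e4 := (abs_le.1 e3).1
  unfold bil
  rw [real_inner_self_eq_norm_sq, real_inner_self_eq_norm_sq]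
  nlinarith [sq_nonneg (‖p.1.2‖ / 2 - C * ‖p.1.1‖), sq_nonneg ‖h.sqrtC p‖]

end

theorem tendsto_testPair_zero (hσ : Q.BddSigma) (hA1 : Q.CondA1) {φ : ℕ → Rn d → ℝ}
    (hφ : ∀ n, IsTest (φ n)) (h0 : (fun n => eLpNorm (φ n) 2 volume) ⇝ 0)
    (hC : ∀ ε > 0, ∃ N, ∀ m ≥ N, ∀ n ≥ N, Q.formATest (φ m - φ n) (φ m - φ n) < ε) :
    (fun n => testPair hσ (hφ n)) ⇝ 0 := by
  have h1 := hA1 φ hφ h0 hC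
  have h2 : (fun n => (testPair hσ (hφ n)).1.1) ⇝ 0 := by
    rw [tendsto_zero_iff_norm_tendsto_zero]
    have := (ENNReal.tendsto_toReal ENNReal.zero_ne_top).comp h0
    refine this.congr fun n => ?_
    rw [Lp.norm_def, Function.comp_apply, eLpNorm_congr_ae (coeFn_testPair_fst hσ (hφ n))]
  have h3 : (fun n => (testPair hσ (hφ n)).1.2) ⇝ 0 := by
    rw [tendsto_zero_iff_norm_tendsto_zero]
    have := h1.sqrt
    rw [sqrt_zero] at this
    refine this.congr fun n => ?_
    rw [formATest_testPair hσ (hφ n), sqrt_sq (norm_nonneg _)]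
  rw [tendsto_subtype_rng]
  exact h2.prodMk_nhds h3

theorem exists_condA2 (hA1 : Q.CondA1) (h : Q.CondA2') : ∃ c₂, Q.CondA2 c₂ := by
  obtain ⟨C, hC, hG⟩ := h.garding
  obtain ⟨K, hK, hbK⟩ := h.abs_bil_le
  have low : ∀ φ, IsTest φ → 1 / 4 * Q.formATest φ φ ≤ Q.formTestAdd C φ φ := by
    intro φ hφ
    rw [h.formTestAdd_eq C hφ hφ, formATest_testPair h.bdd hφ, real_inner_self_eq_norm_sq]
    exact hG _
  have hnn : ∀ φ, IsTest φ → 0 ≤ Q.formATest φ φ := fun φ hφ => by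
    rw [formATest_testPair h.bdd hφ]; positivity
  refine ⟨C, hC, fun φ hφ => ?_, ?_, ?_, ⟨1 / 4, by norm_num, low⟩, ?_⟩
  · have := low φ hφ
    have := hnn φ hφ
    linarith
  · intro φ hφ h0 hCau
    have hlim := tendsto_testPair_zero h.bdd hA1 hφ h0 (fun ε hε => by
      obtain ⟨N, hN⟩ := hCau (1 / 4 * ε) (by positivity)
      refine ⟨N, fun m hm n hn => ?_⟩
      have := low _ ((hφ m).sub (hφ n))
      have := hN m hm n hn
      linarith)
    have hc : Continuous fun p : Q.FGraph => h.bil p p + C * inner ℝ p.1.1 p.1.1 := by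
      have := h.continuous_bil.comp (continuous_id.prodMk continuous_id)
      have h2 : Continuous fun p : Q.FGraph => h.bil p p := this
      fun_prop
    have h2 := (hc.tendsto 0).comp hlim
    have e0 : h.bil 0 0 + C * inner ℝ (0 : Q.FGraph).1.1 (0 : Q.FGraph).1.1 = 0 := by
      simp [CondA2'.bil]
    rw [e0] at h2
    exact h2.congr fun n => (h.formTestAdd_eq C (hφ n) (hφ n)).symm
  · have hQ : ∀ φ (hφ : IsTest φ), ‖testPair h.bdd hφ‖ ≤ 2 * √(Q.formTestAdd (C + 1) φ φ) := by
      intro φ hφ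
      rw [← sqrt_sq (norm_nonneg (testPair h.bdd hφ)),
        show (2 : ℝ) = √(2 ^ 2) by rw [sqrt_sq (by norm_num)], ← Real.sqrt_mul (by norm_num)]
      apply Real.sqrt_le_sqrt
      have h1 : ‖testPair h.bdd hφ‖ ^ 2 ≤ _ := norm_sq_le_of_pair (testPair h.bdd hφ).1
      have h2 := hG (testPair h.bdd hφ)
      rw [h.formTestAdd_eq _ hφ hφ, real_inner_self_eq_norm_sq]
      nlinarith [sq_nonneg ‖(testPair h.bdd hφ).1.1‖]
    refine ⟨(K + (C + 1)) * 4, fun φ ψ hφ hψ => ?_⟩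
    have h1 := hQ φ hφ
    have h2 := hQ ψ hψ
    have e1 := hbK (testPair h.bdd hφ) (testPair h.bdd hψ)
    have e2 : |inner ℝ (testPair h.bdd hφ).1.1 (testPair h.bdd hψ).1.1|
        ≤ ‖testPair h.bdd hφ‖ * ‖testPair h.bdd hψ‖ :=
      (abs_real_inner_le_norm _ _).trans (mul_le_mul (norm_fst_le (testPair h.bdd hφ).1)
        (norm_fst_le (testPair h.bdd hψ).1) (norm_nonneg _) (norm_nonneg _))
    rw [h.formTestAdd_eq _ hφ hψ]
    refine (abs_add_le _ _).trans ?_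
    rw [abs_mul, abs_of_nonneg (show 0 ≤ C + 1 by linarith)]
    calc _ ≤ (K + (C + 1)) * (‖testPair h.bdd hφ‖ * ‖testPair h.bdd hψ‖) := by nlinarith
      _ ≤ (K + (C + 1)) * ((2 * √(Q.formTestAdd (C + 1) φ φ)) * (2 * √(Q.formTestAdd (C + 1) ψ ψ))) := by
          gcongr
      _ = _ := by ring
  · refine ⟨‖h.sqrtC‖ ^ 2 + 1, by positivity, fun φ hφ => ?_⟩
    have e1 : ∫ x, Q.c x * φ x ^ 2 = ‖h.sqrtC (testPair h.bdd hφ)‖ ^ 2 := by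
      rw [← real_inner_self_eq_norm_sq, inner_def]
      refine integral_congr_ae ?_
      filter_upwards [h.coeFn_sqrtC (testPair h.bdd hφ), coeFn_testPair_fst h.bdd hφ] with x h1 h2
      rw [h1, h2]
      simp only [RCLike.inner_apply, conj_trivial]
      nth_rewrite 1 [← Real.mul_self_sqrt (Q.c_nonneg x)]
      ring
    have e2 : ∫ x, φ x ^ 2 = ‖(testPair h.bdd hφ).1.1‖ ^ 2 := by
      rw [← real_inner_self_eq_norm_sq, ← integral_mul_testPair h.bdd hφ hφ]
      simp only [sq]
    rw [e1, e2, formATest_testPair h.bdd hφ]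
    have h1 := h.sqrtC.le_opNorm (testPair h.bdd hφ)
    have h2 : ‖testPair h.bdd hφ‖ ^ 2 ≤ _ := norm_sq_le_of_pair (testPair h.bdd hφ).1
    have h3 : ‖h.sqrtC (testPair h.bdd hφ)‖ ^ 2 ≤ ‖h.sqrtC‖ ^ 2 * ‖testPair h.bdd hφ‖ ^ 2 := by
      rw [← mul_pow]; gcongr
    nlinarith [sq_nonneg ‖h.sqrtC‖, sq_nonneg ‖(testPair h.bdd hφ).1.1‖,
      sq_nonneg ‖(testPair h.bdd hφ).1.2‖]

section

variable (hσ : Q.BddSigma) (hA1 : Q.CondA1)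

include hσ hA1

theorem FGraph_eq_zero {p : Q.FGraph} (hp : p.1.1 = 0) :
    p = 0 := by
  obtain ⟨φ, hφ, hlim⟩ := exists_testPair_tendsto hσ p
  have h1 : (fun n => ‖(testPair hσ (hφ n)).1.1‖) ⇝ 0 := by
    have := ((continuous_fst.comp continuous_subtype_val).tendsto p).comp hlim
    simpa [hp] using this.norm
  have h0 : (fun n => eLpNorm (φ n) 2 volume) ⇝ 0 := by
    have := ENNReal.tendsto_ofReal h1
    rw [ENNReal.ofReal_zero] at this
    refine this.congr fun n => ?_
    rw [Lp.norm_def, ofReal_toReal (memLp _).2.ne,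
      eLpNorm_congr_ae (coeFn_testPair_fst hσ (hφ n))]
  refine tendsto_nhds_unique hlim (tendsto_testPair_zero hσ hA1 hφ h0 fun ε hε => ?_)
  obtain ⟨N, hN⟩ := Metric.cauchySeq_iff.1 hlim.cauchySeq (√ε) (Real.sqrt_pos.2 hε)
  refine ⟨N, fun m hm n hn => ?_⟩
  rw [formATest_testPair hσ ((hφ m).sub (hφ n)), testPair_sub hσ (hφ m) (hφ n)]
  have h2 := hN m hm n hn
  rw [dist_eq_norm] at h2
  have h3 : ‖(testPair hσ (hφ m) - testPair hσ (hφ n)).1.2‖ < √ε :=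
    (norm_snd_le (testPair hσ (hφ m) - testPair hσ (hφ n)).1).trans_lt h2
  calc _ < √ε ^ 2 := by gcongr
    _ = ε := sq_sqrt hε.le

theorem FGraph_ext {p q : Q.FGraph} (hp : p.1.1 = q.1.1) :
    p = q := by
  rw [← sub_eq_zero]
  exact FGraph_eq_zero hσ hA1 (by simp [hp])

theorem Dσ_eq (p : Q.FGraph) : Q.Dσ p.1.1 = p.1.2 := by
  have h : ∃ w, Q.IsDσ p.1.1 w := ⟨p.1.2, (isDσ_iff hσ _ _).2 p.2⟩
  rw [Dσ, dif_pos h]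
  have h2 := (isDσ_iff hσ _ _).1 h.choose_spec
  exact congrArg (fun p : Q.FGraph => p.1.2)
    (FGraph_ext hσ hA1 (p := ⟨(p.1.1, h.choose), h2⟩) (q := p) rfl)

end

theorem CondA2'.formHat_eq (h : Q.CondA2') (hA1 : Q.CondA1) (p q : Q.FGraph) :
    Q.formHat p.1.1 q.1.1 = h.bil p q := by
  rw [h.bil_eq, formHat, Dσ_eq h.bdd hA1, Dσ_eq h.bdd hA1]

theorem CondA2'.energy_eq (h : Q.CondA2') (hA1 : Q.CondA1) (c₂ : ℝ) (p : Q.FGraph) :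
    Q.energy c₂ p.1.1 = h.bil p p + (c₂ + 1) * ‖p.1.1‖ ^ 2 := by
  rw [energy, h.formHat_eq hA1]

section

variable (h2 : Q.CondA2 c₂) (h : Q.CondA2')

include h2 h

theorem CondA2.coercive :
    ∃ c₁ > 0, ∀ p : Q.FGraph, c₁ * ‖p.1.2‖ ^ 2 ≤ h.bil p p + c₂ * ‖p.1.1‖ ^ 2 := by
  obtain ⟨c₁, hc₁, hl⟩ := h2.lower
  refine ⟨c₁, hc₁, fun p => ?_⟩
  obtain ⟨φ, hφ, hlim⟩ := exists_testPair_tendsto h.bdd p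
  have hc : Continuous fun p : Q.FGraph => h.bil p p := h.continuous_bil.comp (continuous_id.prodMk continuous_id)
  have hc1 : Continuous fun p : Q.FGraph => h.bil p p + c₂ * ‖p.1.1‖ ^ 2 := by fun_prop
  have hc2 : Continuous fun p : Q.FGraph => c₁ * ‖p.1.2‖ ^ 2 := by fun_prop
  refine le_of_tendsto_of_tendsto' ((hc2.tendsto p).comp hlim) ((hc1.tendsto p).comp hlim) fun n => ?_
  have := hl _ (hφ n)
  rw [formATest_testPair h.bdd (hφ n), h.formTestAdd_eq _ (hφ n) (hφ n),
    real_inner_self_eq_norm_sq] at this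
  exact this

theorem CondA2.memF_iff (u : L2 d) :
    Q.MemF c₂ u ↔ ∃ p : Q.FGraph, p.1.1 = u := by
  obtain ⟨c₁, hc₁, hl⟩ := h2.coercive h
  constructor
  · rintro ⟨φ, hφ, h1, hC⟩
    have hcau : CauchySeq fun n => (testPair h.bdd (hφ n)).1.2 := by
      refine Metric.cauchySeq_iff.2 fun ε hε => ?_
      obtain ⟨N, hN⟩ := hC (c₁ * ε ^ 2) (by positivity)
      refine ⟨N, fun m hm n hn => ?_⟩
      have h3 := hN m hm n hn
      rw [h.formTestAdd_eq _ ((hφ m).sub (hφ n)) ((hφ m).sub (hφ n)), real_inner_self_eq_norm_sq,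
        testPair_sub h.bdd (hφ m) (hφ n)] at h3
      have h4 := hl (testPair h.bdd (hφ m) - testPair h.bdd (hφ n))
      have h5 : ‖(testPair h.bdd (hφ m) - testPair h.bdd (hφ n)).1.2‖ ^ 2 < ε ^ 2 := by
        have : c₁ * ‖(testPair h.bdd (hφ m) - testPair h.bdd (hφ n)).1.2‖ ^ 2 < c₁ * ε ^ 2 := by
          nlinarith [sq_nonneg ‖(testPair h.bdd (hφ m) - testPair h.bdd (hφ n)).1.1‖]
        exact lt_of_mul_lt_mul_left this hc₁.le
      rw [dist_eq_norm]
      exact lt_of_pow_lt_pow_left₀ 2 hε.le h5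
    obtain ⟨w, hw⟩ := cauchySeq_tendsto_of_complete hcau
    rw [Lp.tendsto_Lp_iff_tendsto_eLpNorm'] at hw
    have hw' : (fun n => eLpNorm (fun x => Q.DTest (φ n) x - w x) 2 volume) ⇝ 0 :=
      hw.congr fun n => eLpNorm_congr_ae
        ((coeFn_testPair_snd h.bdd (hφ n)).sub (EventuallyEq.refl _ _))
    exact ⟨⟨(u, w), (isDσ_iff h.bdd u w).1 ⟨φ, hφ, h1, hw'⟩⟩, rfl⟩
  · rintro ⟨p, rfl⟩
    obtain ⟨φ, hφ, hlim⟩ := exists_testPair_tendsto h.bdd p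
    have hlim' : (fun n => (testPair h.bdd (hφ n)).1) ⇝ (p.1.1, p.1.2) :=
      tendsto_subtype_rng.1 hlim
    refine ⟨φ, hφ, ((tendsto_testPair_iff h.bdd hφ _ _).1 hlim').1, fun ε hε => ?_⟩
    have hc : Continuous fun p : Q.FGraph => h.bil p p := h.continuous_bil.comp (continuous_id.prodMk continuous_id)
    have hc1 : Continuous fun p : Q.FGraph => h.bil p p + (c₂ + 1) * inner ℝ p.1.1 p.1.1 := by
      fun_prop
    have e0 : h.bil 0 0 + (c₂ + 1) * inner ℝ (0 : Q.FGraph).1.1 (0 : Q.FGraph).1.1 = 0 := by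
      simp [CondA2'.bil]
    have h3 : ∀ᶠ q : Q.FGraph in 𝓝 0, h.bil q q + (c₂ + 1) * inner ℝ q.1.1 q.1.1 < ε := by
      have := hc1.tendsto 0
      rw [e0] at this
      exact this.eventually (Iio_mem_nhds hε)
    obtain ⟨δ, hδ, hball⟩ := Metric.eventually_nhds_iff.1 h3
    obtain ⟨N, hN⟩ := Metric.cauchySeq_iff.1 hlim.cauchySeq δ hδ
    refine ⟨N, fun m hm n hn => ?_⟩
    rw [h.formTestAdd_eq _ ((hφ m).sub (hφ n)) ((hφ m).sub (hφ n)), testPair_sub h.bdd (hφ m) (hφ n)]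
    refine hball (y := testPair h.bdd (hφ m) - testPair h.bdd (hφ n)) ?_
    have := hN m hm n hn
    rw [dist_eq_norm] at this
    rwa [dist_zero_right]

end

section

variable {u : Rn d → ℝ} {w : Rn d → Rn k}

theorem exists_tendsto_FGraph {q : ℕ → Q.FGraph}
    (hu : MemLp u 2 volume) (hw : MemLp w 2 volume)
    (h1 : (fun n => eLpNorm (fun x => (q n).1.1 x - u x) 2 volume) ⇝ 0)
    (h2 : (fun n => eLpNorm (fun x => (q n).1.2 x - w x) 2 volume) ⇝ 0) :
    ∃ p : Q.FGraph, p.1.1 =ᵐ[volume] u ∧ p.1.2 =ᵐ[volume] w ∧ q ⇝ p := by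
  have hlim : (fun n => (q n).1) ⇝ (hu.toLp u, hw.toLp w) := by
    rw [Prod.tendsto_iff, Lp.tendsto_Lp_iff_tendsto_eLpNorm', Lp.tendsto_Lp_iff_tendsto_eLpNorm']
    refine ⟨h1.congr fun n => eLpNorm_congr_ae ?_, h2.congr fun n => eLpNorm_congr_ae ?_⟩
    · filter_upwards [hu.coeFn_toLp] with x hx
      simp [hx]
    · filter_upwards [hw.coeFn_toLp] with x hx
      simp [hx]
  refine ⟨⟨(hu.toLp u, hw.toLp w), ?_⟩, hu.coeFn_toLp, hw.coeFn_toLp, tendsto_subtype_rng.2 hlim⟩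
  exact (Submodule.isClosed_topologicalClosure _).mem_of_tendsto hlim
    (of_forall fun n => (q n).2)

theorem exists_tendsto_testPair (hσ : Q.BddSigma) {χ : ℕ → Rn d → ℝ} (hχ : ∀ n, IsTest (χ n)) (hu : MemLp u 2 volume) (hw : MemLp w 2 volume)
    (h1 : (fun n => eLpNorm (fun x => χ n x - u x) 2 volume) ⇝ 0)
    (h2 : (fun n => eLpNorm (fun x => Q.DTest (χ n) x - w x) 2 volume) ⇝ 0) :
    ∃ p : Q.FGraph, p.1.1 =ᵐ[volume] u ∧ p.1.2 =ᵐ[volume] w ∧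
      (fun n => testPair hσ (hχ n)) ⇝ p := by
  refine exists_tendsto_FGraph hu hw (h1.congr fun n => eLpNorm_congr_ae ?_)
    (h2.congr fun n => eLpNorm_congr_ae ?_)
  · filter_upwards [coeFn_testPair_fst hσ (hχ n)] with x hx
    simp [hx]
  · filter_upwards [coeFn_testPair_snd hσ (hχ n)] with x hx
    simp [hx]

end

theorem exists_testPair_tendsto_ae (hσ : Q.BddSigma) (p : Q.FGraph) :
    ∃ (φ : ℕ → Rn d → ℝ) (hφ : ∀ n, IsTest (φ n)),
      (fun n => testPair hσ (hφ n)) ⇝ p ∧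
      ∀ᵐ x, (fun n => φ n x) ⇝ (p.1.1 x) := by
  obtain ⟨φ, hφ, hlim⟩ := exists_testPair_tendsto hσ p
  have h1 := ((tendsto_testPair_iff hσ hφ p.1.1 p.1.2).1 (tendsto_subtype_rng.1 hlim)).1
  have h2 : TendstoInMeasure volume φ atTop p.1.1 :=
    tendstoInMeasure_of_tendsto_eLpNorm (p := 2) (by norm_num)
      (fun n => (hφ n).aesm) (memLp _).1 h1
  obtain ⟨ns, hns, hae⟩ := h2.exists_seq_tendsto_ae
  exact ⟨fun n => φ (ns n), fun n => hφ _, hlim.comp hns.tendsto_atTop, hae⟩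

section

variable {ψ : ℝ → ℝ} {K : ℝ}

theorem abs_le_of_abs_deriv_le (hψ : Differentiable ℝ ψ)
    (hK : ∀ x, |deriv ψ x| ≤ K) (x y : ℝ) : |ψ x - ψ y| ≤ K * |x - y| :=
  Convex.norm_image_sub_le_of_norm_deriv_le (s := univ) (fun z _ => hψ z) (fun z _ => hK z)
    convex_univ (mem_univ _) (mem_univ _)

/-- The chain rule for `D_σ`, together with convergence of the approximations. -/
theorem exists_comp_tendsto (hσ : Q.BddSigma) (hψ : ContDiff ℝ ∞ ψ) (h0 : ψ 0 = 0) (hK : ∀ x, |deriv ψ x| ≤ K) (p : Q.FGraph) {φ : ℕ → Rn d → ℝ}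
    (hφ : ∀ n, IsTest (φ n)) (hlim : (fun n => testPair hσ (hφ n)) ⇝ p)
    (hae : ∀ᵐ x, (fun n => φ n x) ⇝ (p.1.1 x)) :
    ∃ q : Q.FGraph, q.1.1 =ᵐ[volume] (fun x => ψ (p.1.1 x)) ∧
      q.1.2 =ᵐ[volume] (fun x => deriv ψ (p.1.1 x) • p.1.2 x) ∧
      (fun n => testPair hσ ((hφ n).comp hψ h0)) ⇝ q := by
  have hd : Differentiable ℝ ψ := hψ.differentiable (by simp)
  have hc' : Continuous (deriv ψ) := hψ.continuous_deriv (by simp)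
  obtain ⟨h1, h2⟩ := (tendsto_testPair_iff hσ hφ p.1.1 p.1.2).1 (tendsto_subtype_rng.1 hlim)
  have hu := (memLp p.1.1).1
  refine exists_tendsto_testPair hσ _ ?_ ?_ ?_ ?_
  · refine (memLp p.1.1).of_le_mul (c := K) (hψ.continuous.comp_aestronglyMeasurable hu)
      (of_forall fun x => ?_)
    simpa [h0] using abs_le_of_abs_deriv_le hd hK (p.1.1 x) 0
  · refine (memLp p.1.2).of_le_mul (c := K)
      ((hc'.comp_aestronglyMeasurable hu).smul (memLp _).1)
      (of_forall fun x => ?_)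
    rw [norm_smul]
    exact mul_le_mul_of_nonneg_right (hK _) (norm_nonneg _)
  · have := const_mul (a := ofReal K) h1 (Or.inr ofReal_ne_top)
    rw [mul_zero] at this
    refine tendsto_of_tendsto_of_tendsto_of_le_of_le tendsto_const_nhds this (fun _ => zero_le)
      fun n => ?_
    refine eLpNorm_le_mul_eLpNorm_of_ae_le_mul (of_forall fun x => ?_) 2
    exact abs_le_of_abs_deriv_le hd hK _ _
  · refine (tendsto_eLpNorm_smul_of_ae (M := K) (fun n => aesm_DTest (hφ n))
      (memLp p.1.2) h2 (B := fun n x => deriv ψ (φ n x)) (b := fun x => deriv ψ (p.1.1 x))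
      (fun n => (hc'.comp (hφ n).1.continuous).aestronglyMeasurable)
      (fun n => of_forall fun x => hK _) ?_).congr fun n => ?_
    · filter_upwards [hae] with x hx using (hc'.tendsto _).comp hx
    · simp only [DTest_comp (hφ n) hd]

end

theorem exists_truncation (M : ℝ) : ∃ ψ : ℝ → ℝ, ContDiff ℝ ∞ ψ ∧ ψ 0 = 0 ∧
    (∃ K, ∀ x, |deriv ψ x| ≤ K) ∧ (∃ R, ∀ x, |ψ x| ≤ R) ∧
    ∀ x, |x| ≤ M → ψ x = x ∧ deriv ψ x = 1 := by
  let f : ContDiffBump (0 : ℝ) := ⟨|M| + 1, |M| + 2, by positivity, by linarith⟩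
  have hψ : ContDiff ℝ ∞ fun x => x * f x := contDiff_id.mul f.contDiff
  have hs : HasCompactSupport fun x => x * f x := f.hasCompactSupport.mul_left
  obtain ⟨K, hK⟩ := hs.deriv.exists_bound_of_continuous (hψ.continuous_deriv (by simp))
  obtain ⟨R, hR⟩ := hs.exists_bound_of_continuous hψ.continuous
  refine ⟨fun x => x * f x, hψ, by simp, ⟨K, hK⟩, ⟨R, hR⟩, fun x hx => ?_⟩
  have h1 : ∀ y ∈ Metric.ball (0 : ℝ) (|M| + 1), y * f y = y := fun y hy => by
    rw [f.one_of_mem_closedBall (Metric.ball_subset_closedBall hy), mul_one]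
  have hxb : x ∈ Metric.ball (0 : ℝ) (|M| + 1) := by
    rw [mem_ball_zero_iff, norm_eq_abs]
    linarith [le_abs_self M]
  refine ⟨h1 x hxb, ?_⟩
  have : (fun x => x * f x) =ᶠ[𝓝 x] id := by
    filter_upwards [Metric.isOpen_ball.mem_nhds hxb] with y hy using h1 y hy
  rw [this.deriv_eq, deriv_id]

/-- Bounded elements of the domain of `D_σ` have uniformly bounded approximations. -/
theorem exists_bounded_testPair_tendsto (hσ : Q.BddSigma) (p : Q.FGraph) {M : ℝ}
    (hM : ∀ᵐ x, |p.1.1 x| ≤ M) : ∃ (R : ℝ) (φ : ℕ → Rn d → ℝ) (hφ : ∀ n, IsTest (φ n)),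
      (fun n => testPair hσ (hφ n)) ⇝ p ∧ (∀ n x, |φ n x| ≤ R) ∧
      ∀ᵐ x, (fun n => φ n x) ⇝ (p.1.1 x) := by
  obtain ⟨φ, hφ, hlim, hae⟩ := exists_testPair_tendsto_ae hσ p
  obtain ⟨ψ, hψ, h0, ⟨K, hK⟩, ⟨R, hR⟩, h1⟩ := exists_truncation M
  obtain ⟨q, hq1, hq2, hq⟩ := exists_comp_tendsto hσ hψ h0 hK p hφ hlim hae
  have hqp : q = p := by
    refine Subtype.ext (Prod.ext (Lp.ext ?_) (Lp.ext ?_))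
    · filter_upwards [hq1, hM] with x hx hx' using hx.trans (h1 _ hx').1
    · filter_upwards [hq2, hM] with x hx hx'
      rw [hx, (h1 _ hx').2, one_smul]
  rw [hqp] at hq
  refine ⟨R, _, fun n => (hφ n).comp hψ h0, hq, fun n x => hR _, ?_⟩
  filter_upwards [hae, hM] with x hx hx'
  rw [show p.1.1 x = ψ (p.1.1 x) from ((h1 _ hx').1).symm]
  exact (hψ.continuous.tendsto _).comp hx

/-- The product rule for `D_σ`. -/
theorem exists_mul (hσ : Q.BddSigma) (p q : Q.FGraph) {M N : ℝ} (hM : ∀ᵐ x, |p.1.1 x| ≤ M)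
    (hN : ∀ᵐ x, |q.1.1 x| ≤ N) : ∃ r : Q.FGraph, r.1.1 =ᵐ[volume] (fun x => p.1.1 x * q.1.1 x) ∧
      r.1.2 =ᵐ[volume] (fun x => p.1.1 x • q.1.2 x + q.1.1 x • p.1.2 x) := by
  obtain ⟨R, φ, hφ, hp, hR, hae⟩ := exists_bounded_testPair_tendsto hσ p hM
  obtain ⟨R', φ', hφ', hq, hR', hae'⟩ := exists_bounded_testPair_tendsto hσ q hN
  obtain ⟨h1, h2⟩ := (tendsto_testPair_iff hσ hφ p.1.1 p.1.2).1 (tendsto_subtype_rng.1 hp)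
  obtain ⟨h1', h2'⟩ := (tendsto_testPair_iff hσ hφ' q.1.1 q.1.2).1 (tendsto_subtype_rng.1 hq)
  have e1 := tendsto_eLpNorm_smul_of_ae (fun n => (aesm_DTest (Q := Q) (hφ' n)))
    (memLp q.1.2) h2' (fun n => (hφ n).aesm)
    (fun n => of_forall (hR n)) hae
  have e2 := tendsto_eLpNorm_smul_of_ae (fun n => (aesm_DTest (Q := Q) (hφ n)))
    (memLp p.1.2) h2 (fun n => (hφ' n).aesm)
    (fun n => of_forall (hR' n)) hae'
  have e3 := tendsto_eLpNorm_smul_of_ae (fun n => (hφ' n).aesm)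
    (memLp q.1.1) h1' (fun n => (hφ n).aesm)
    (fun n => of_forall (hR n)) hae
  have hmem : ∀ {E : Type} [NormedAddCommGroup E] [NormedSpace ℝ E] (u : L2 d) (v : Lp E 2 (volume : Measure (Rn d)))
      (M : ℝ), (∀ᵐ x, |u x| ≤ M) → MemLp (fun x => u x • v x) 2 volume := by
    intro E _ _ u v M hM
    refine (memLp v).of_le_mul (c := M) ((memLp u).1.smul (memLp v).1) ?_
    filter_upwards [hM] with x hx
    rw [norm_smul]
    exact mul_le_mul_of_nonneg_right hx (norm_nonneg _)
  obtain ⟨r, hr1, hr2, -⟩ := exists_tendsto_testPair hσ (fun n => (hφ n).mul (hφ' n))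
    (u := fun x => p.1.1 x * q.1.1 x) (w := fun x => p.1.1 x • q.1.2 x + q.1.1 x • p.1.2 x)
    (hmem p.1.1 q.1.1 M hM) ((hmem p.1.1 q.1.2 M hM).add (hmem q.1.1 p.1.2 N hN)) e3 (by
      have := e1.add e2
      rw [add_zero] at this
      refine tendsto_of_tendsto_of_tendsto_of_le_of_le tendsto_const_nhds this (fun _ => zero_le)
        fun n => ?_
      refine le_trans (le_of_eq ?_) (eLpNorm_add_le
        (((hφ n).aesm.smul (aesm_DTest (hφ' n))).sub
          ((memLp p.1.1).1.smul (memLp q.1.2).1))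
        (((hφ' n).aesm.smul (aesm_DTest (hφ n))).sub
          ((memLp q.1.1).1.smul (memLp p.1.2).1)) (by norm_num))
      congr 1
      ext1 x
      simp only [DTest_mul (hφ n) (hφ' n), Pi.add_apply]
      abel)
  exact ⟨r, hr1, hr2⟩

theorem exists_smooth_posPart : ∃ (ψ : ℕ → ℝ → ℝ) (K : ℝ), (∀ n, ContDiff ℝ ∞ (ψ n)) ∧
    (∀ n, ψ n 0 = 0) ∧ (∀ n x, |deriv (ψ n) x| ≤ K) ∧
    (∀ x, (fun n => ψ n x) ⇝ max x 0) ∧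
    ∀ x, (fun n => deriv (ψ n) x) ⇝ (if 0 < x then 1 else 0) := by
  set g : ℝ → ℝ := fun x => x * Real.smoothTransition x with hg
  have hgs : ContDiff ℝ ∞ g := contDiff_id.mul Real.smoothTransition.contDiff
  have hgd : Differentiable ℝ g := hgs.differentiable (by simp)
  have hg0 : ∀ x ≤ 0, g x = 0 := fun x hx => by simp [hg, Real.smoothTransition.zero_of_nonpos hx]
  have hg1 : ∀ x, 1 ≤ x → g x = x := fun x hx => by simp [hg, Real.smoothTransition.one_of_one_le hx]
  have hcont : Continuous (deriv g) := hgs.continuous_deriv (by simp)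
  have hd0 : ∀ x ≤ 0, deriv g x = 0 := by
    have h : ∀ x < 0, deriv g x = 0 := fun x hx => by
      have : g =ᶠ[𝓝 x] fun _ => 0 := by
        filter_upwards [Iio_mem_nhds hx] with y hy using hg0 y (le_of_lt hy)
      rw [this.deriv_eq, deriv_const]
    intro x hx
    have hcl : IsClosed {x | deriv g x = 0} := isClosed_eq hcont continuous_const
    have : closure (Iio (0 : ℝ)) ⊆ {x | deriv g x = 0} := closure_minimal (fun y hy => h y hy) hcl
    rw [closure_Iio] at this
    exact this hx
  have hd1 : ∀ x, 1 < x → deriv g x = 1 := fun x hx => by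
    have : g =ᶠ[𝓝 x] id := by
      filter_upwards [Ioi_mem_nhds hx] with y hy using hg1 y (le_of_lt hy)
    rw [this.deriv_eq, deriv_id]
  obtain ⟨K, hK⟩ := (isCompact_Icc (a := (0 : ℝ)) (b := 1)).exists_bound_of_continuousOn hcont.continuousOn
  have hK' : ∀ x, |deriv g x| ≤ max K 1 := by
    intro x
    rcases le_or_gt x 0 with h | h
    · rw [hd0 x h]; simp
    rcases le_or_gt x 1 with h' | h'
    · exact (hK x ⟨h.le, h'⟩).trans (le_max_left _ _)
    · rw [hd1 x h']; simp
  have hderiv : ∀ (n : ℕ) x, deriv (fun x => g ((n + 1) * x) / (n + 1)) x = deriv g ((n + 1) * x) := by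
    intro n x
    have hn : (n + 1 : ℝ) ≠ 0 := by positivity
    have h1 : HasDerivAt (fun x : ℝ => (n + 1 : ℝ) * x) (n + 1) x := by
      simpa using (hasDerivAt_id x).const_mul (n + 1 : ℝ)
    have h2 := ((hgd ((n + 1) * x)).hasDerivAt.comp x h1).div_const (n + 1 : ℝ)
    rw [mul_div_cancel_right₀ _ hn] at h2
    exact h2.deriv
  have hbig : ∀ x : ℝ, 0 < x → ∀ᶠ n : ℕ in atTop, 1 < ((n : ℝ) + 1) * x := by
    intro x hx
    have : Tendsto (fun n : ℕ => ((n : ℝ) + 1) * x) atTop atTop :=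
      (tendsto_atTop_add_const_right _ _ tendsto_natCast_atTop_atTop).atTop_mul_const hx
    exact this.eventually_gt_atTop 1
  refine ⟨fun n x => g ((n + 1) * x) / (n + 1), max K 1, fun n => ?_, fun n => by simp [hg],
    fun n x => by rw [hderiv]; exact hK' _, fun x => ?_, fun x => ?_⟩
  · exact (hgs.comp (contDiff_const.mul contDiff_id)).div_const _
  · rcases le_or_gt x 0 with h | h
    · rw [max_eq_right h]
      refine tendsto_const_nhds.congr fun n => ?_
      change (0 : ℝ) = g ((n + 1) * x) / (n + 1)
      rw [hg0 _ (mul_nonpos_of_nonneg_of_nonpos (by positivity) h), zero_div]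
    · rw [max_eq_left h.le]
      refine tendsto_const_nhds.congr' ?_
      filter_upwards [hbig x h] with n hn
      have hn' : (n + 1 : ℝ) ≠ 0 := by positivity
      change x = g ((n + 1) * x) / (n + 1)
      rw [hg1 _ hn.le]
      field_simp
  · simp only [hderiv]
    rcases le_or_gt x 0 with h | h
    · rw [if_neg (not_lt.2 h)]
      refine tendsto_const_nhds.congr fun n => ?_
      rw [hd0 _ (mul_nonpos_of_nonneg_of_nonpos (by positivity) h)]
    · rw [if_pos h]
      refine tendsto_const_nhds.congr' ?_
      filter_upwards [hbig x h] with n hn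
      rw [hd1 _ hn]

/-- The positive part of an element of the domain of `D_σ`. -/
theorem exists_posPart (hσ : Q.BddSigma) (p : Q.FGraph) : ∃ r : Q.FGraph,
    r.1.1 =ᵐ[volume] (fun x => max (p.1.1 x) 0) ∧
      r.1.2 =ᵐ[volume] (fun x => (if 0 < p.1.1 x then (1 : ℝ) else 0) • p.1.2 x) := by
  obtain ⟨ψ, K, hψ, h0, hK, hl, hl'⟩ := exists_smooth_posPart
  obtain ⟨φ, hφ, hlim, hae⟩ := exists_testPair_tendsto_ae hσ p
  choose q hq1 hq2 _ using fun n => exists_comp_tendsto hσ (hψ n) (h0 n) (hK n) p hφ hlim hae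
  have hu := (memLp p.1.1).1
  have hK0 : 0 ≤ K := (abs_nonneg _).trans (hK 0 0)
  have hum : AEStronglyMeasurable (fun x => max (p.1.1 x) 0) volume :=
    (continuous_id.max continuous_const).comp_aestronglyMeasurable hu
  have hi : AEStronglyMeasurable (fun x => if 0 < p.1.1 x then (1 : ℝ) else 0) volume := by
    have : StronglyMeasurable fun y : ℝ => if 0 < y then (1 : ℝ) else 0 :=
      (Measurable.ite measurableSet_Ioi measurable_const measurable_const).stronglyMeasurable
    exact (this.measurable.comp_aemeasurable hu.aemeasurable).aestronglyMeasurable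
  have hum' := hi.smul (memLp p.1.2).1
  have hmax : ∀ y : ℝ, |max y 0| ≤ |y| := fun y => by
    rw [abs_of_nonneg (le_max_right _ _)]; exact max_le (le_abs_self _) (abs_nonneg _)
  have hite : ∀ y : ℝ, |if 0 < y then (1 : ℝ) else 0| ≤ 1 := fun y => by split_ifs <;> simp
  refine Exists.imp (fun r h => ⟨h.1, h.2.1⟩) (exists_tendsto_FGraph (q := q) (u := fun x => max (p.1.1 x) 0)
    (w := fun x => (if 0 < p.1.1 x then (1 : ℝ) else 0) • p.1.2 x) ?_ ?_ ?_ ?_)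
  · exact (memLp p.1.1).of_le hum (of_forall fun x => hmax _)
  · refine (memLp p.1.2).of_le hum' (of_forall fun x => ?_)
    rw [norm_smul]
    exact mul_le_of_le_one_left (norm_nonneg _) (hite _)
  · refine tendsto_eLpNorm_two_of_dominated (g := fun x => (K + 1) * ‖p.1.1 x‖)
      (fun n => (memLp _).1) hum ((memLp p.1.1).norm.const_mul _) (fun n => ?_) ?_
    · filter_upwards [hq1 n] with x hx
      rw [hx]
      have := abs_le_of_abs_deriv_le ((hψ n).differentiable (by simp)) (hK n) (p.1.1 x) 0
      rw [h0, sub_zero, sub_zero] at this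
      refine (norm_sub_le _ _).trans ?_
      rw [add_mul, one_mul]
      exact add_le_add this (hmax _)
    · filter_upwards [ae_all_iff.2 hq1] with x hx
      simp only [hx]
      exact hl _
  · refine tendsto_eLpNorm_two_of_dominated (g := fun x => (K + 1) * ‖p.1.2 x‖)
      (fun n => (memLp _).1) hum' ((memLp p.1.2).norm.const_mul _) (fun n => ?_) ?_
    · filter_upwards [hq2 n] with x hx
      rw [hx, ← sub_smul, norm_smul]
      refine mul_le_mul_of_nonneg_right ((abs_sub _ _).trans ?_) (norm_nonneg _)
      exact add_le_add (hK _ _) (hite _)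
    · filter_upwards [ae_all_iff.2 hq2] with x hx
      simp only [hx]
      exact (hl' _).smul_const _

end Coefficients

theorem isBdd_iff {u : L2 d} : IsBdd u ↔ ∃ M : ℝ, ∀ᵐ x, |u x| ≤ M := by
  constructor
  · intro h
    refine ⟨(eLpNorm u ⊤ volume).toReal, ?_⟩
    have h1 := ae_le_eLpNormEssSup (f := u) (μ := volume)
    have h2 : eLpNorm u ⊤ volume = eLpNormEssSup u volume := eLpNorm_exponent_top
    filter_upwards [h1] with x hx
    rw [← h2] at hx
    rw [← norm_eq_abs, ← toReal_enorm]
    exact toReal_mono h.2.ne hx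
  · rintro ⟨M, hM⟩
    exact memLp_top_of_bound (memLp u).1 M hM

namespace Coefficients

section

variable {E : Type*} [NormedAddCommGroup E]

theorem memLp_bounded_smul [NormedSpace ℝ E] {u : L2 d} {M : ℝ}
    (hM : ∀ᵐ x, |u x| ≤ M) {v : Rn d → E} (hv : MemLp v 2 volume) :
    MemLp (fun x => u x • v x) 2 volume := by
  refine hv.of_le_mul (c := M) ((memLp u).1.smul hv.1) ?_
  filter_upwards [hM] with x hx
  rw [norm_smul]
  exact mul_le_mul_of_nonneg_right hx (norm_nonneg _)

theorem integrable_inner_two [InnerProductSpace ℝ E]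
    {u v : Rn d → E} (hu : MemLp u 2 volume) (hv : MemLp v 2 volume) :
    Integrable fun x => (inner ℝ (u x) (v x) : ℝ) := by
  refine Integrable.mono' (hu.norm.integrable_mul hv.norm) (hu.1.inner hv.1) (of_forall fun x => ?_)
  exact abs_real_inner_le_norm _ _

end

theorem CondA2.le_energy (h2 : Q.CondA2 c₂) (h : Q.CondA2') (hA1 : Q.CondA1) :
    ∃ c₁ > 0, ∀ p : Q.FGraph, c₁ * ‖p.1.2‖ ^ 2 + ‖p.1.1‖ ^ 2 ≤ Q.energy c₂ p.1.1 := by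
  obtain ⟨c₁, hc₁, hl⟩ := h2.coercive h
  refine ⟨c₁, hc₁, fun p => ?_⟩
  rw [h.energy_eq hA1]
  linarith [hl p]

/-- The integrand of the form `𝓔`. -/
noncomputable def formDensity (p q : Q.FGraph) (x : Rn d) : ℝ :=
  inner ℝ (p.1.2 x) (q.1.2 x) + Q.c x * p.1.1 x * q.1.1 x
    + inner ℝ (Q.bHatσ x) (p.1.2 x) * q.1.1 x + inner ℝ (Q.bσ x) (p.1.2 x) * q.1.1 x

theorem integrable_bTerm (hb : MemLp Q.bσ 2 volume) (p : Q.FGraph) {q : L2 d} {M : ℝ}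
    (hM : ∀ᵐ x, |q x| ≤ M) : Integrable fun x => inner ℝ (Q.bσ x) (p.1.2 x) * q x := by
  refine (integrable_inner_two hb (memLp_bounded_smul hM (memLp p.1.2))).congr
    (of_forall fun x => ?_)
  simp only [inner_smul_right]
  ring

theorem CondA2'.integrable_terms (h : Q.CondA2') (p q : Q.FGraph) :
    (Integrable fun x => (inner ℝ (p.1.2 x) (q.1.2 x) : ℝ)) ∧
    (Integrable fun x => Q.c x * p.1.1 x * q.1.1 x) ∧
    Integrable fun x => inner ℝ (Q.bHatσ x) (p.1.2 x) * q.1.1 x := by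
  refine ⟨integrable_inner_two (memLp _) (memLp _), ?_, ?_⟩
  · refine (integrable_inner_two (memLp (h.sqrtC p)) (memLp (h.sqrtC q))).congr ?_
    filter_upwards [h.coeFn_sqrtC p, h.coeFn_sqrtC q] with x h1 h2
    rw [h1, h2]
    simp only [RCLike.inner_apply, conj_trivial]
    nth_rewrite 3 [← Real.mul_self_sqrt (Q.c_nonneg x)]
    ring
  · refine (integrable_inner_two (memLp (h.mulBHat q)) (memLp p.1.2)).congr ?_
    filter_upwards [h.coeFn_mulBHat q] with x h1
    rw [h1, real_inner_smul_left]
    ring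

section

variable (h : Q.CondA2') (hb : MemLp Q.bσ 2 volume) (p q : Q.FGraph) {M : ℝ}
  (hM : ∀ᵐ x, |q.1.1 x| ≤ M)

include h hb p q hM

theorem CondA2'.integrable_formDensity : Integrable (formDensity p q) := by
  obtain ⟨h1, h2, h3⟩ := h.integrable_terms p q
  exact ((h1.add h2).add h3).add (integrable_bTerm hb p hM)

theorem CondA2'.integral_formDensity : ∫ x, formDensity p q x
      = h.bil p q + ∫ x, inner ℝ (Q.bσ x) (p.1.2 x) * q.1.1 x := by
  obtain ⟨h1, h2, h3⟩ := h.integrable_terms p q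
  have e1 := integral_add h1 h2
  have e2 := integral_add (h1.add h2) h3
  have e3 := integral_add ((h1.add h2).add h3) (integrable_bTerm hb p hM)
  simp only [Pi.add_apply] at e2 e3
  rw [h.bil_eq, ← e1, ← e2, ← e3]
  rfl

end

theorem tendsto_integral_inner {u : ℕ → Rn d → Rn k} {v b : Rn d → Rn k} (hb : MemLp b 2 volume)
    (hu : ∀ n, MemLp (u n) 2 volume) (hv : MemLp v 2 volume)
    (h : (fun n => eLpNorm (fun x => u n x - v x) 2 volume) ⇝ 0) :
    (fun n => ∫ x, inner ℝ (b x) (u n x)) ⇝ (∫ x, inner ℝ (b x) (v x)) := by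
  have h1 : (fun n => (hu n).toLp (u n)) ⇝ (hv.toLp v) :=
    (Lp.tendsto_Lp_iff_tendsto_eLpNorm'' _ hu v hv).2 h
  have h2 := (Tendsto.inner (𝕜 := ℝ) (tendsto_const_nhds (x := hb.toLp b)) h1)
  simp only [inner_def] at h2
  have e : ∀ {w : Rn d → Rn k} (hw : MemLp w 2 volume),
      ∫ x, inner ℝ (hb.toLp b x) (hw.toLp w x) = ∫ x, (inner ℝ (b x) (w x) : ℝ) := fun hw => by
    refine integral_congr_ae ?_
    filter_upwards [hb.coeFn_toLp, hw.coeFn_toLp] with x h1 h2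
    rw [h1, h2]
  rw [e hv] at h2
  exact h2.congr fun n => e (hu n)

theorem CondA3.bTerm_self (h3 : Q.CondA3) (hσ : Q.BddSigma) : ∃ α : ℝ, 0 ≤ α ∧
    ∀ (p : Q.FGraph) (M : ℝ), (∀ᵐ x, |p.1.1 x| ≤ M) →
      -(α / 2) * ‖p.1.1‖ ^ 2 ≤ ∫ x, inner ℝ (Q.bσ x) (p.1.2 x) * p.1.1 x := by
  obtain ⟨α, hα, hl⟩ := h3.lower
  refine ⟨α, hα, fun p M hM => ?_⟩
  obtain ⟨R, φ, hφ, hp, hR, hae⟩ := exists_bounded_testPair_tendsto hσ p hM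
  obtain ⟨h1, h2⟩ := (tendsto_testPair_iff hσ hφ p.1.1 p.1.2).1 (tendsto_subtype_rng.1 hp)
  have e2 := tendsto_eLpNorm_smul_of_ae (fun n => (aesm_DTest (Q := Q) (hφ n)))
    (Lp.memLp p.1.2) h2 (fun n => (hφ n).aesm)
    (fun n => of_forall (hR n)) hae
  have hmem : ∀ n, MemLp (fun x => φ n x • Q.DTest (φ n) x) 2 volume := fun n => by
    refine (memLp_DTest hσ (hφ n) 2).of_le_mul (c := R)
      ((hφ n).aesm.smul (aesm_DTest (hφ n)))
      (of_forall fun x => ?_)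
    rw [norm_smul]
    exact mul_le_mul_of_nonneg_right (hR n x) (norm_nonneg _)
  have e3 := tendsto_integral_inner h3.memLp hmem (memLp_bounded_smul hM (Lp.memLp p.1.2)) e2
  have e4 : (fun n => -(α / 2) * ‖(testPair hσ (hφ n)).1.1‖ ^ 2) ⇝ (-(α / 2) * ‖p.1.1‖ ^ 2) := by
    have hc : Continuous fun p : Q.FGraph => -(α / 2) * ‖p.1.1‖ ^ 2 := by fun_prop
    exact (hc.tendsto p).comp hp
  have e5 : ∫ x, inner ℝ (Q.bσ x) (p.1.2 x) * p.1.1 x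
      = ∫ x, inner ℝ (Q.bσ x) (p.1.1 x • p.1.2 x) := by
    simp only [inner_smul_right, mul_comm]
  rw [e5]
  refine le_of_tendsto_of_tendsto' e4 e3 fun n => ?_
  have h4 := hl (φ n) (hφ n)
  have h5 : ∫ x, φ n x ^ 2 = ‖(testPair hσ (hφ n)).1.1‖ ^ 2 := by
    rw [← real_inner_self_eq_norm_sq, ← integral_mul_testPair hσ (hφ n) (hφ n)]
    simp only [sq]
  have h6 : ∀ x, inner ℝ (Q.bσ x) (Q.DTest (fun y => φ n y ^ 2) x)
      = 2 * inner ℝ (Q.bσ x) (φ n x • Q.DTest (φ n) x) := fun x => by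
    have : (fun y => φ n y ^ 2) = fun y => φ n y * φ n y := by ext y; ring
    rw [this, DTest_mul (hφ n) (hφ n), inner_add_right]
    ring
  simp only [h6] at h4
  rw [integral_const_mul, h5] at h4
  linarith

section

variable (h4 : Q.CondA4 c₂ T P) (hA1 : Q.CondA1)
  (h2' : Q.CondA2') (h3 : Q.CondA3) (h2 : Q.CondA2 c₂)

include h4 hA1 h2' h3 h2

/-- `𝓔(u, v) = -(Lu, v)` for bounded `u ∈ 𝒟(L)` and bounded `v ∈ F`. -/
theorem CondA4.assoc_graph
    {p q : Q.FGraph} {g : L2 d} (hg : IsGenerator P p.1.1 g) {M N : ℝ} (hM : ∀ᵐ x, |p.1.1 x| ≤ M)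
    (hN : ∀ᵐ x, |q.1.1 x| ≤ N) : ∫ x, formDensity p q x = -inner ℝ g q.1.1 := by
  obtain ⟨w, hw, ⟨R, hR⟩, hlim⟩ := h4.approx q.1.1 ((h2.memF_iff h2' _).2 ⟨q, rfl⟩) (isBdd_iff.2 ⟨N, hN⟩)
  have hwb : ∀ n, IsBdd (w n) := fun n => isBdd_iff.2 ⟨R, hR n⟩
  choose G hG using hw
  choose r hr using fun n => (h2.memF_iff h2' _).1 (h4.domain _ _ (hG n) (hwb n))
  obtain ⟨c₁, hc₁, hle⟩ := h2.le_energy h2' hA1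
  have hrq : r ⇝ q := by
    have hen : (fun n => Q.energy c₂ (r n - q).1.1) ⇝ 0 := by
      refine hlim.congr fun n => ?_
      rw [← hr n]; rfl
    have hn1 : (fun n => ‖(r n - q).1.1‖ ^ 2) ⇝ 0 :=
      squeeze_zero (fun _ => by positivity)
        (fun n => by nlinarith [hle (r n - q), mul_nonneg hc₁.le (sq_nonneg ‖(r n - q).1.2‖)]) hen
    have hn2 : (fun n => ‖(r n - q).1.2‖ ^ 2) ⇝ 0 := by
      have := hen.const_mul c₁⁻¹
      rw [mul_zero] at this
      refine squeeze_zero (fun _ => by positivity) (fun n => ?_) this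
      rw [← div_eq_inv_mul, le_div_iff₀' hc₁]
      nlinarith [hle (r n - q), sq_nonneg ‖(r n - q).1.1‖]
    have hn := hn1.add hn2
    rw [add_zero] at hn
    rw [tendsto_iff_norm_sub_tendsto_zero]
    have h5 : (fun n => ‖r n - q‖ ^ 2) ⇝ 0 :=
      squeeze_zero (fun _ => by positivity) (fun n => norm_sq_le_of_pair (r n - q).1) hn
    have h6 := h5.sqrt
    rw [sqrt_zero] at h6
    exact h6.congr fun n => sqrt_sq (norm_nonneg _)
  have hwq : (fun n => (r n).1.1) ⇝ q.1.1 :=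
    ((continuous_fst.comp continuous_subtype_val).tendsto q).comp hrq
  have hmeas : TendstoInMeasure volume (fun n => ((r n).1.1 : Rn d → ℝ)) atTop q.1.1 :=
    tendstoInMeasure_of_tendsto_Lp hwq
  have hRr : ∀ n, ∀ᵐ x, |(r n).1.1 x| ≤ R := fun n => by rw [hr n]; exact hR n
  have e1 := tendsto_eLpNorm_smul_of_bounded (A := fun _ => (p.1.2 : Rn d → Rn k)) (a := p.1.2)
    (fun n => (memLp _).1) (Lp.memLp p.1.2) (by simp)
    (fun n => (memLp _).1) hRr hmeas
  have e2 := tendsto_integral_inner h3.memLp (fun n => memLp_bounded_smul (hRr n) (Lp.memLp p.1.2))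
    (memLp_bounded_smul hN (Lp.memLp p.1.2)) e1
  have e3 : (fun n => h2'.bil p (r n)) ⇝ (h2'.bil p q) :=
    ((h2'.continuous_bil.comp (continuous_const.prodMk continuous_id)).tendsto q).comp hrq
  have e4 : (fun n => -inner ℝ g (r n).1.1) ⇝ (-inner ℝ g q.1.1) :=
    (tendsto_const_nhds.inner hwq).neg
  have e5 : ∀ (s : L2 d), ∫ x, inner ℝ (Q.bσ x) (p.1.2 x) * s x
      = ∫ x, inner ℝ (Q.bσ x) (s x • p.1.2 x) := fun s => by
    simp only [inner_smul_right, mul_comm]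
  rw [h2'.integral_formDensity h3.memLp p q hN, e5]
  refine tendsto_nhds_unique (e3.add e2) (e4.congr fun n => ?_)
  have h7 := h4.assoc p.1.1 g (w n) (G n) hg (hG n) (isBdd_iff.2 ⟨M, hM⟩) (hwb n)
  rw [← hr n, form, h2'.formHat_eq hA1, Dσ_eq h2'.bdd hA1, e5] at h7
  exact h7.symm

/-- The energy inequality for bounded elements of the domain of the generator. -/
theorem CondA4.bil_le : ∃ α : ℝ, 0 ≤ α ∧
    ∀ (p : Q.FGraph) (g : L2 d) (M : ℝ), IsGenerator P p.1.1 g → (∀ᵐ x, |p.1.1 x| ≤ M) →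
      h2'.bil p p ≤ -inner ℝ g p.1.1 + α / 2 * ‖p.1.1‖ ^ 2 := by
  obtain ⟨α, hα, hb⟩ := h3.bTerm_self h2'.bdd
  refine ⟨α, hα, fun p g M hg hM => ?_⟩
  have h5 := h4.assoc_graph hA1 h2' h3 h2 hg hM hM
  rw [h2'.integral_formDensity h3.memLp p p hM] at h5
  have := hb p M hM
  linarith

end

theorem coeFn_FGraph_sub (p q : Q.FGraph) :
    ((p - q).1.1 =ᵐ[volume] fun x => p.1.1 x - q.1.1 x) ∧
      (p - q).1.2 =ᵐ[volume] fun x => p.1.2 x - q.1.2 x :=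
  ⟨coeFn_sub p.1.1 q.1.1, coeFn_sub p.1.2 q.1.2⟩

theorem coeFn_FGraph_sum (p : Fin l → Q.FGraph) :
    ((∑ i, p i).1.1 =ᵐ[volume] fun x => ∑ i, (p i).1.1 x) ∧
      (∑ i, p i).1.2 =ᵐ[volume] fun x => ∑ i, (p i).1.2 x := by
  have e1 : (∑ i, p i).1.1 = ∑ i, (p i).1.1 := by
    rw [Submodule.coe_sum, Prod.fst_sum]
  have e2 : (∑ i, p i).1.2 = ∑ i, (p i).1.2 := by
    rw [Submodule.coe_sum, Prod.snd_sum]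
  rw [e1, e2]
  constructor
  · filter_upwards [Lp.coeFn_finsetSum Finset.univ fun i => (p i).1.1] with x hx
    rw [hx, Finset.sum_apply]
  · filter_upwards [Lp.coeFn_finsetSum Finset.univ fun i => (p i).1.2] with x hx
    rw [hx, Finset.sum_apply]

/-- The inequality behind the comparison of `∑ uᵢ²` with `v`, where `uᵢ` and `v` are bounded
elements of the domain of the generator and `η = (∑ uᵢ² - v)⁺`. -/
theorem CondA4.comparison (h4 : Q.CondA4 c₂ T P)
    (hA1 : Q.CondA1) (h2' : Q.CondA2') (h3 : Q.CondA3) (h2 : Q.CondA2 c₂) :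
    ∃ κ : ℝ, 0 ≤ κ ∧ ∀ (p : Fin l → Q.FGraph) (g : Fin l → L2 d) (q : Q.FGraph) (h η : L2 d)
      (M N : ℝ), (∀ i, IsGenerator P (p i).1.1 (g i)) → IsGenerator P q.1.1 h →
      (∀ i, ∀ᵐ x, |(p i).1.1 x| ≤ M) → (∀ᵐ x, |q.1.1 x| ≤ N) →
      (η =ᵐ[volume] fun x => max ((∑ i, (p i).1.1 x ^ 2) - q.1.1 x) 0) →
      ∫ x, (2 * ∑ i, ‖(p i).1.2 x‖ ^ 2 + 2 * ∑ i, g i x * (p i).1.1 x - h x) * η x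
        ≤ κ * ‖η‖ ^ 2 := by
  obtain ⟨α, hα, hb⟩ := h3.bTerm_self h2'.bdd
  obtain ⟨c₁, hc₁, hcoer⟩ := h2.coercive h2'
  refine ⟨c₂ + α / 2, by have := h2.c₂_nonneg; positivity,
    fun p g q h η M N hg hh hM hN hη => ?_⟩
  choose s hs1 hs2 using fun i => exists_mul h2'.bdd (p i) (p i) (hM i) (hM i)
  obtain ⟨e, he1, he2⟩ := exists_posPart h2'.bdd ((∑ i, s i) - q)
  have hX : ((∑ i, s i) - q).1.1 =ᵐ[volume] fun x => (∑ i, (p i).1.1 x ^ 2) - q.1.1 x := by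
    filter_upwards [(coeFn_FGraph_sub (∑ i, s i) q).1, (coeFn_FGraph_sum s).1, ae_all_iff.2 hs1]
      with x h1 h2 h3
    rw [h1, h2]
    simp only [h3, sq]
  have hDX : ((∑ i, s i) - q).1.2 =ᵐ[volume] fun x =>
      (∑ i, (2 * (p i).1.1 x) • (p i).1.2 x) - q.1.2 x := by
    filter_upwards [(coeFn_FGraph_sub (∑ i, s i) q).2, (coeFn_FGraph_sum s).2, ae_all_iff.2 hs2]
      with x h1 h2 h3
    rw [h1, h2]
    simp only [h3, two_mul, add_smul]
  have hηe : η = e.1.1 := Lp.ext (by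
    filter_upwards [hη, he1, hX] with x h1 h2 h3
    rw [h1, h2, h3])
  have hM0 : ∀ i, ∀ᵐ x, |(p i).1.1 x| ≤ |M| := fun i => (hM i).mono fun x hx => hx.trans (le_abs_self _)
  have heb : ∀ᵐ x, |e.1.1 x| ≤ l * |M| ^ 2 + N := by
    filter_upwards [he1, hX, ae_all_iff.2 hM0, hN] with x h1 h2 h3 h4
    rw [h1, h2, abs_of_nonneg (le_max_right _ _)]
    have h5 : ∑ i, (p i).1.1 x ^ 2 ≤ l * |M| ^ 2 := by
      have : ∀ i ∈ Finset.univ, (p i).1.1 x ^ 2 ≤ |M| ^ 2 := fun i _ => by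
        rw [← sq_abs]; exact pow_le_pow_left₀ (abs_nonneg _) (h3 i) 2
      simpa using sum_le_sum this
    have h6 := (abs_le.1 h4).1
    have h7 := (abs_nonneg _).trans h4
    refine max_le (by linarith) (by positivity)
  choose r hr1 hr2 using fun i => exists_mul h2'.bdd (p i) e (hM i) heb
  have hrb : ∀ i, ∀ᵐ x, |(r i).1.1 x| ≤ M * (l * |M| ^ 2 + N) := fun i => by
    filter_upwards [hr1 i, hM i, heb] with x h1 h2 h3
    rw [h1, abs_mul]
    exact mul_le_mul h2 h3 (abs_nonneg _) ((abs_nonneg _).trans h2)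
  have a1 : ∀ i, ∫ x, formDensity (p i) (r i) x = -inner ℝ (g i) (r i).1.1 := fun i =>
    h4.assoc_graph hA1 h2' h3 h2 (hg i) (hM i) (hrb i)
  have a2 : ∫ x, formDensity q e x = -inner ℝ h e.1.1 := h4.assoc_graph hA1 h2' h3 h2 hh hN heb
  have i1 : ∀ i, Integrable (formDensity (p i) (r i)) := fun i =>
    h2'.integrable_formDensity h3.memLp _ _ (hrb i)
  have i2 : Integrable (formDensity q e) := h2'.integrable_formDensity h3.memLp _ _ heb
  have i3 : Integrable (formDensity e e) := h2'.integrable_formDensity h3.memLp _ _ heb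
  have i4 : Integrable fun x => 2 * (∑ i, ‖(p i).1.2 x‖ ^ 2) * e.1.1 x := by
    have h5 : ∀ i, Integrable fun x => e.1.1 x * ‖(p i).1.2 x‖ ^ 2 := fun i => by
      refine Integrable.bdd_mul (c := l * |M| ^ 2 + N) ?_ (memLp _).1 heb
      exact (memLp (p i).1.2).integrable_norm_pow (by norm_num)
    refine ((integrable_finsetSum Finset.univ fun i _ => h5 i).const_mul 2).congr
      (of_forall fun x => ?_)
    simp only
    rw [← mul_sum]; ring
  have key : ∀ᵐ x, formDensity e e x + 2 * (∑ i, ‖(p i).1.2 x‖ ^ 2) * e.1.1 x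
      ≤ 2 * (∑ i, formDensity (p i) (r i) x) - formDensity q e x := by
    filter_upwards [he1, he2, hX, hDX, ae_all_iff.2 hr1, ae_all_iff.2 hr2] with x h1 h2 h3 h4 h5 h6
    rw [h3] at h1
    rw [h3, h4] at h2
    have e0 : 0 ≤ e.1.1 x := by rw [h1]; exact le_max_right _ _
    set X := ∑ i, (p i).1.1 x ^ 2 with hXdef
    set D := ∑ i, (2 * (p i).1.1 x) • (p i).1.2 x with hD
    have hX0 : 0 ≤ X := sum_nonneg fun i _ => sq_nonneg _
    have t1 : (X - q.1.1 x) * e.1.1 x = e.1.1 x * e.1.1 x := by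
      rcases le_or_gt (X - q.1.1 x) 0 with h7 | h7
      · rw [h1, max_eq_right h7]; simp
      · rw [h1, max_eq_left h7.le]
    have t2 : inner ℝ (D - q.1.2 x) (e.1.2 x) = (inner ℝ (e.1.2 x) (e.1.2 x) : ℝ) := by
      rw [h2]; split_ifs <;> simp
    have t3 : ∀ B : Rn k, inner ℝ B (D - q.1.2 x) * e.1.1 x = inner ℝ B (e.1.2 x) * e.1.1 x := by
      intro B
      rcases le_or_gt (X - q.1.1 x) 0 with h7 | h7
      · rw [h1, max_eq_right h7]; simp
      · rw [h2, if_pos h7, one_smul]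
    have t4 : ∀ B : Rn k, inner ℝ B D = ∑ i, 2 * ((p i).1.1 x * inner ℝ B ((p i).1.2 x)) := by
      intro B
      rw [hD, inner_sum]
      refine sum_congr rfl fun i _ => ?_
      rw [inner_smul_right]; ring
    have t5 : 2 * (∑ i, formDensity (p i) (r i) x) = inner ℝ D (e.1.2 x)
        + 2 * (∑ i, ‖(p i).1.2 x‖ ^ 2) * e.1.1 x + 2 * Q.c x * X * e.1.1 x
        + inner ℝ (Q.bHatσ x) D * e.1.1 x + inner ℝ (Q.bσ x) D * e.1.1 x := by
      rw [real_inner_comm, t4, t4, t4, hXdef]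
      simp only [mul_sum, sum_mul, ← sum_add_distrib]
      refine sum_congr rfl fun i _ => ?_
      simp only [formDensity, h5, h6]
      rw [inner_add_right, inner_smul_right, inner_smul_right, real_inner_self_eq_norm_sq,
        real_inner_comm (e.1.2 x)]
      ring
    rw [t5]
    simp only [formDensity]
    rw [inner_sub_left] at t2
    have t3a := t3 (Q.bHatσ x)
    have t3b := t3 (Q.bσ x)
    rw [inner_sub_right] at t3a t3b
    have t6 : Q.c x * e.1.1 x * e.1.1 x = Q.c x * X * e.1.1 x - Q.c x * q.1.1 x * e.1.1 x := by
      rw [mul_assoc, ← t1]; ring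
    have t7 : 0 ≤ Q.c x * X * e.1.1 x := by have := Q.c_nonneg x; positivity
    linarith
  have h5 := integral_mono_ae (i3.add i4)
    (((integrable_finsetSum Finset.univ fun i _ => i1 i).const_mul 2).sub i2) key
  have e1 : ∫ x, formDensity e e x + 2 * (∑ i, ‖(p i).1.2 x‖ ^ 2) * e.1.1 x
      = (∫ x, formDensity e e x) + ∫ x, 2 * (∑ i, ‖(p i).1.2 x‖ ^ 2) * e.1.1 x :=
    integral_add i3 i4
  have e2 : ∫ x, 2 * (∑ i, formDensity (p i) (r i) x) - formDensity q e x
      = 2 * (∑ i, ∫ x, formDensity (p i) (r i) x) - ∫ x, formDensity q e x := by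
    rw [integral_sub ((integrable_finsetSum Finset.univ fun i _ => i1 i).const_mul 2) i2,
      integral_const_mul, integral_finsetSum _ fun i _ => i1 i]
  have h6 : (∫ x, formDensity e e x) + (∫ x, 2 * (∑ i, ‖(p i).1.2 x‖ ^ 2) * e.1.1 x)
      ≤ 2 * (∑ i, ∫ x, formDensity (p i) (r i) x) - ∫ x, formDensity q e x :=
    e1 ▸ e2 ▸ h5
  have h7 : -(c₂ + α / 2) * ‖e.1.1‖ ^ 2 ≤ ∫ x, formDensity e e x := by
    rw [h2'.integral_formDensity h3.memLp e e heb]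
    have := hb e _ heb
    have := hcoer e
    nlinarith [mul_nonneg hc₁.le (sq_nonneg ‖e.1.2‖)]
  have j1 : ∀ i, ∫ x, g i x * (p i).1.1 x * e.1.1 x = inner ℝ (g i) (r i).1.1 := fun i => by
    rw [inner_def]
    refine integral_congr_ae ?_
    filter_upwards [hr1 i] with x hx
    rw [hx]
    simp only [RCLike.inner_apply, conj_trivial]; ring
  have j2 : ∫ x, h x * e.1.1 x = inner ℝ h e.1.1 := by
    rw [inner_def]
    refine integral_congr_ae (of_forall fun x => ?_)
    simp only [RCLike.inner_apply, conj_trivial]; ring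
  have k1 : ∀ i, Integrable fun x => g i x * (p i).1.1 x * e.1.1 x := fun i => by
    refine (integrable_inner_two (memLp (g i)) (memLp (r i).1.1)).congr ?_
    filter_upwards [hr1 i] with x hx
    rw [hx]
    simp only [RCLike.inner_apply, conj_trivial]; ring
  have k2 : Integrable fun x => h x * e.1.1 x := by
    refine (integrable_inner_two (memLp h) (memLp e.1.1)).congr
      (of_forall fun x => ?_)
    simp only [RCLike.inner_apply, conj_trivial]; ring
  have k3 : Integrable fun x => 2 * ∑ i, g i x * (p i).1.1 x * e.1.1 x :=
    (integrable_finsetSum Finset.univ fun i _ => k1 i).const_mul 2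
  have j3 : ∫ x, (2 * ∑ i, ‖(p i).1.2 x‖ ^ 2 + 2 * ∑ i, g i x * (p i).1.1 x - h x) * e.1.1 x
      = (∫ x, 2 * (∑ i, ‖(p i).1.2 x‖ ^ 2) * e.1.1 x)
        + (2 * ∑ i, inner ℝ (g i) (r i).1.1) - inner ℝ h e.1.1 := by
    have s1 : ∫ x, 2 * ∑ i, g i x * (p i).1.1 x * e.1.1 x = 2 * ∑ i, inner ℝ (g i) (r i).1.1 := by
      rw [integral_const_mul, integral_finsetSum _ fun i _ => k1 i]
      simp only [j1]
    rw [← s1, ← j2]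
    have s2 := integral_add i4 k3
    have s3 := integral_sub (i4.add k3) k2
    simp only [Pi.add_apply] at s3
    rw [← s2, ← s3]
    refine integral_congr_ae (of_forall fun x => ?_)
    simp only [← sum_mul]
    ring
  rw [hηe, j3]
  rw [a2] at h6
  simp only [a1, Finset.sum_neg_distrib] at h6
  linarith

end Coefficients

/-- `A` is bounded by `C` with respect to the sup norm. -/
abbrev SupBound {p : ℝ≥0∞} [Fact (1 ≤ p)] (C : ℝ)
    (A : Lp ℝ p (volume : Measure (Rn d)) →L[ℝ] Lp ℝ p (volume : Measure (Rn d))) : Prop :=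
  ∀ f M, (∀ᵐ x, |f x| ≤ M) → ∀ᵐ x, |A f x| ≤ C * M

/-- The functions in `L¹ ∩ L²`. -/
noncomputable def L12 (d : ℕ) : Submodule ℝ (L1 d × L2 d) where
  carrier := {p | p.1 =ᵐ[volume] p.2}
  add_mem' := fun {p q} hp hq =>
    (coeFn_add p.1 q.1).trans ((EventuallyEq.add (show p.1 =ᵐ[volume] p.2 from hp) (show q.1 =ᵐ[volume] q.2 from hq)).trans (coeFn_add p.2 q.2).symm)
  zero_mem' := (coeFn_zero _ _ _).trans (coeFn_zero _ _ _).symm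
  smul_mem' := fun c p hp =>
    (coeFn_smul c p.1).trans ((EventuallyEq.const_smul (show p.1 =ᵐ[volume] p.2 from hp) c).trans (coeFn_smul c p.2).symm)

theorem _root_.Subtype.ae_eq (p : L12 d) : p.1.1 =ᵐ[volume] p.1.2 := p.2

theorem exists_L12 {f : Rn d → ℝ} (h1 : MemLp f 1 volume) (h2 : MemLp f 2 volume) :
    ∃ p : L12 d, p.1.1 =ᵐ[volume] f ∧ p.1.2 =ᵐ[volume] f :=
  ⟨⟨(h1.toLp f, h2.toLp f), h1.coeFn_toLp.trans h2.coeFn_toLp.symm⟩, h1.coeFn_toLp, h2.coeFn_toLp⟩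

/-- Bounded functions in `L¹ ∩ L²` approximate `u ∈ L²` from below. -/
theorem exists_L12_tendsto (u : L2 d) : ∃ p : ℕ → L12 d,
    (fun n => (p n).1.2) ⇝ u ∧ (∀ n, ∀ᵐ x, |(p n).1.2 x| ≤ n) ∧
      ∀ n, ∀ᵐ x, |(p n).1.2 x| ≤ |u x| := by
  set A : ℕ → Set (Rn d) := fun n => {x | |u x| ≤ n} ∩ Metric.closedBall 0 n with hA
  have hm : ∀ n, MeasurableSet (A n) := fun n =>
    (measurableSet_le (Lp.stronglyMeasurable u).measurable.abs measurable_const).inter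
      Metric.isClosed_closedBall.measurableSet
  have h2 : ∀ n, MemLp ((A n).indicator u) 2 volume := fun n => (memLp u).indicator (hm n)
  have h1 : ∀ n, MemLp ((A n).indicator u) 1 volume := fun n => by
    have hc : MemLp ((Metric.closedBall (0 : Rn d) n).indicator fun _ => (n : ℝ)) 1 volume :=
      memLp_indicator_const 1 Metric.isClosed_closedBall.measurableSet (n : ℝ)
        (Or.inr measure_closedBall_lt_top.ne)
    refine hc.of_le (h2 n).1 (of_forall fun x => ?_)
    by_cases hx : x ∈ A n
    · rw [indicator_of_mem hx, indicator_of_mem hx.2]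
      simpa using hx.1
    · rw [indicator_of_notMem hx]; simp
  choose p hp1 hp2 using fun n => exists_L12 (h1 n) (h2 n)
  have hle : ∀ n x, |(A n).indicator u x| ≤ |u x| := fun n x => by
    by_cases hx : x ∈ A n
    · rw [indicator_of_mem hx]
    · rw [indicator_of_notMem hx]; simp
  refine ⟨p, ?_, fun n => ?_, fun n => ?_⟩
  · rw [Lp.tendsto_Lp_iff_tendsto_eLpNorm']
    refine tendsto_eLpNorm_two_of_dominated (g := fun x => 2 * ‖u x‖) (fun n => (memLp _).1)
      (memLp _).1 ((memLp u).norm.const_mul 2) (fun n => ?_) ?_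
    · filter_upwards [hp2 n] with x hx
      rw [hx, two_mul]
      exact (norm_sub_le _ _).trans (add_le_add (hle n x) le_rfl)
    · filter_upwards [ae_all_iff.2 hp2] with x hx
      refine tendsto_const_nhds.congr' ?_
      obtain ⟨N, hN⟩ := exists_nat_ge (max |u x| ‖x‖)
      filter_upwards [eventually_ge_atTop N] with n hn
      have hN' : max |u x| ‖x‖ ≤ n := hN.trans (Nat.cast_le.2 hn)
      rw [hx, indicator_of_mem]
      exact ⟨(le_max_left _ _).trans hN', mem_closedBall_zero_iff.2 ((le_max_right _ _).trans hN')⟩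
  · filter_upwards [hp2 n] with x hx
    rw [hx]
    by_cases hx : x ∈ A n
    · rw [indicator_of_mem hx]; exact hx.1
    · rw [indicator_of_notMem hx]; simp
  · filter_upwards [hp2 n] with x hx
    rw [hx]; exact hle n x

theorem denseRange_L12 : DenseRange ((LinearMap.snd ℝ (L1 d) (L2 d)).comp (L12 d).subtype) := by
  intro u
  obtain ⟨p, hp, -⟩ := exists_L12_tendsto u
  exact mem_closure_of_tendsto hp (of_forall fun n => ⟨p n, rfl⟩)

/-- `(P_t f)² ≤ 4 C P_t (f²)` if `P_t` is positivity preserving and bounded by `C` on `L^∞`. -/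
theorem sq_le_of_pos {Q : L1 d →L[ℝ] L1 d} (hQ : ∀ f, 0 ≤ f → 0 ≤ Q f) (hC : 0 ≤ C)
    (hb : SupBound C Q) {f g : L1 d}
    (hg : g =ᵐ[volume] fun x => f x ^ 2) : ∀ᵐ x, Q f x ^ 2 ≤ 4 * C * Q g x := by
  have mono : ∀ f g : L1 d, f ≤ g → Q f ≤ Q g := fun f g h => by
    have := hQ (g - f) (sub_nonneg.2 h)
    rwa [map_sub, sub_nonneg] at this
  have h1 : ∀ r : {r : ℚ // 0 < r}, ∀ᵐ x, |Q f x| ≤ ((r : ℚ) : ℝ)⁻¹ * Q g x + C * (r : ℚ) := by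
    rintro ⟨r, hr⟩
    have hr' : (0 : ℝ) < r := Rat.cast_pos.2 hr
    have hm : MemLp (fun x => min |f x| r) 1 volume := by
      refine (memLp f).of_le ((memLp f).1.norm.inf aestronglyMeasurable_const)
        (of_forall fun x => ?_)
      rw [norm_of_nonneg (le_min (abs_nonneg _) hr'.le)]
      exact min_le_left _ _
    have hle : |f| ≤ ((r : ℝ)⁻¹ • g + hm.toLp _ : L1 d) := by
      rw [← coeFn_le]
      filter_upwards [Lp.coeFn_abs f, ae_add ((r : ℝ)⁻¹ • g) (hm.toLp _),
        ae_smul (r : ℝ)⁻¹ g, hm.coeFn_toLp, hg] with x e1 e2 e3 e4 e5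
      rw [e1, e2, e3, e4, e5, smul_eq_mul, ← sq_abs]
      rcases le_total |f x| r with h | h
      · rw [min_eq_left h]
        have : 0 ≤ (r : ℝ)⁻¹ * |f x| ^ 2 := by positivity
        linarith
      · have : |f x| ≤ (r : ℝ)⁻¹ * |f x| ^ 2 := by
          rw [← div_eq_inv_mul, le_div_iff₀ hr', sq]
          exact mul_le_mul_of_nonneg_left h (abs_nonneg _)
        have : 0 ≤ min |f x| r := le_min (abs_nonneg _) hr'.le
        linarith
    have h2 : Q f ≤ Q ((r : ℝ)⁻¹ • g + hm.toLp _) := mono _ _ ((le_abs_self f).trans hle)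
    have h3 : -Q f ≤ Q ((r : ℝ)⁻¹ • g + hm.toLp _) := by
      rw [← map_neg]; exact mono _ _ ((neg_le_abs f).trans hle)
    rw [map_add, map_smul] at h2 h3
    have h4 := hb (hm.toLp _) r (by
      filter_upwards [hm.coeFn_toLp] with x hx
      rw [hx, abs_of_nonneg (le_min (abs_nonneg _) hr'.le)]
      exact min_le_right _ _)
    filter_upwards [(coeFn_le _ _).2 h2, (coeFn_le _ _).2 h3, h4, Lp.coeFn_neg (Q f),
      ae_add ((r : ℝ)⁻¹ • Q g) (Q (hm.toLp _)), ae_smul (r : ℝ)⁻¹ (Q g)]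
      with x e1 e2 e3 e4 e5 e6
    rw [e5, e6, smul_eq_mul] at e1 e2
    rw [e4, Pi.neg_apply] at e2
    have := (abs_le.1 e3).2
    exact abs_le.2 ⟨by linarith, by linarith⟩
  have h0 : 0 ≤ Q g := hQ g (by
    rw [← Lp.coeFn_nonneg]
    filter_upwards [hg] with x hx
    rw [hx]; exact sq_nonneg _)
  filter_upwards [ae_all_iff.2 h1, (Lp.coeFn_nonneg _).2 h0] with x hx hx0
  rw [Pi.zero_apply] at hx0
  have hreal : ∀ r : ℝ, 0 < r → |Q f x| * r ≤ Q g x + C * r ^ 2 := by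
    intro r hr
    have hcl : IsClosed {r : ℝ | |Q f x| * r ≤ Q g x + C * r ^ 2} := isClosed_le (by fun_prop) (by fun_prop)
    have hsub : (Ioi (0 : ℝ)) ∩ range ((↑) : ℚ → ℝ) ⊆ {r : ℝ | |Q f x| * r ≤ Q g x + C * r ^ 2} := by
      rintro _ ⟨hq, q, rfl⟩
      have := hx ⟨q, Rat.cast_pos.1 (show (0 : ℝ) < q from hq)⟩
      have hq' : (0 : ℝ) < q := hq
      have h5 := mul_le_mul_of_nonneg_right this hq'.le
      simp only at h5
      change |Q f x| * q ≤ Q g x + C * (q : ℝ) ^ 2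
      refine h5.trans (le_of_eq ?_)
      field_simp
    exact closure_minimal hsub hcl (Rat.denseRange_cast.open_subset_closure_inter isOpen_Ioi hr)
  rcases (abs_nonneg (Q f x)).eq_or_lt with h | h
  · rw [← sq_abs, ← h]
    have : 0 ≤ 4 * C * Q g x := by positivity
    simpa using this
  rcases hC.eq_or_lt with hC0 | hC0
  · have := hreal ((Q g x + 1) / |Q f x|) (by positivity)
    rw [mul_div_cancel₀ _ h.ne', ← hC0] at this
    linarith
  · have := hreal (|Q f x| / (2 * C)) (by positivity)
    have e1 : |Q f x| * (|Q f x| / (2 * C)) = |Q f x| ^ 2 / (4 * C) * 2 := by field_simp; ring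
    have e2 : C * (|Q f x| / (2 * C)) ^ 2 = |Q f x| ^ 2 / (4 * C) := by field_simp; ring
    rw [e1, e2] at this
    have h3 : |Q f x| ^ 2 / (4 * C) ≤ Q g x := by linarith
    rw [div_le_iff₀ (by positivity)] at h3
    rw [← sq_abs]; linarith

theorem integrable_sq (u : L2 d) : Integrable fun x => u x ^ 2 := (memLp u).integrable_sq

theorem integral_sq (u : L2 d) : ∫ x, u x ^ 2 = ‖u‖ ^ 2 := by
  rw [← real_inner_self_eq_norm_sq, inner_def]
  refine integral_congr_ae (of_forall fun x => ?_)
  simp only [RCLike.inner_apply, conj_trivial]; ring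

theorem integral_le_norm (f : L1 d) : ∫ x, f x ≤ ‖f‖ := by
  rw [L1.norm_eq_integral_norm]
  exact integral_mono (integrable_coeFn f) (integrable_coeFn f).norm fun x => le_abs_self _

theorem norm_mulL_self (u : L2 d) : ‖mulL u u‖ = ‖u‖ ^ 2 := by
  rw [L1.norm_eq_integral_norm, ← integral_sq]
  refine integral_congr_ae ?_
  filter_upwards [coeFn_mulL u u] with x hx
  rw [hx, ← sq, norm_of_nonneg (sq_nonneg _)]

section

variable {Q : L1 d →L[ℝ] L1 d} (hQ : ∀ f, 0 ≤ f → 0 ≤ Q f) (hC : 0 ≤ C)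
  (hb : SupBound C Q)

include hQ hC hb

theorem exists_L2_image (p : L12 d) :
    ∃ v : L2 d, v =ᵐ[volume] Q p.1.1 ∧ ‖v‖ ≤ √(4 * C * ‖Q‖) * ‖p.1.2‖ := by
  have hg : mulL p.1.2 p.1.2 =ᵐ[volume] fun x => p.1.1 x ^ 2 := by
    filter_upwards [coeFn_mulL p.1.2 p.1.2, (p.2 : p.1.1 =ᵐ[volume] p.1.2)] with x h1 h2
    rw [h1, h2, sq]
  have hsq := sq_le_of_pos hQ hC hb hg
  have hi : Integrable fun x => 4 * C * Q (mulL p.1.2 p.1.2) x := (integrable_coeFn _).const_mul _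
  have hm := (memLp (Q p.1.1)).1
  have hi2 : Integrable fun x => Q p.1.1 x ^ 2 := hi.mono' (hm.pow 2) (by
    filter_upwards [hsq] with x hx
    rwa [norm_of_nonneg (sq_nonneg _)])
  have hmem : MemLp (Q p.1.1) 2 volume := (memLp_two_iff_integrable_sq hm).2 hi2
  refine ⟨hmem.toLp _, hmem.coeFn_toLp, ?_⟩
  rw [← sqrt_sq (norm_nonneg (hmem.toLp _)), ← sqrt_sq (norm_nonneg p.1.2),
    ← Real.sqrt_mul (by positivity)]
  apply Real.sqrt_le_sqrt
  rw [← integral_sq]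
  calc ∫ x, hmem.toLp _ x ^ 2 = ∫ x, Q p.1.1 x ^ 2 := integral_congr_ae (by
        filter_upwards [hmem.coeFn_toLp] with x hx
        rw [hx])
    _ ≤ ∫ x, 4 * C * Q (mulL p.1.2 p.1.2) x := integral_mono_ae hi2 hi hsq
    _ = 4 * C * ∫ x, Q (mulL p.1.2 p.1.2) x := integral_const_mul _ _
    _ ≤ 4 * C * (‖Q‖ * ‖p.1.2‖ ^ 2) := by
        refine mul_le_mul_of_nonneg_left ?_ (by positivity)
        rw [← norm_mulL_self]
        exact (integral_le_norm _).trans (Q.le_opNorm _)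
    _ = _ := by ring

/-- The restriction of `Q` to `L¹ ∩ L²`, extended to `L²`. -/
theorem exists_L2_extension :
    ∃ S : L2 d →L[ℝ] L2 d, (∀ p : L12 d, S p.1.2 =ᵐ[volume] Q p.1.1) ∧
      ‖S‖ ≤ √(4 * C * ‖Q‖) := by
  choose v hv hn using exists_L2_image hQ hC hb
  let F : L12 d →ₗ[ℝ] L2 d :=
    { toFun := v
      map_add' := fun p q => Lp.ext (by
        have e : Q (p + q : L12 d).1.1 = Q p.1.1 + Q q.1.1 := map_add Q p.1.1 q.1.1
        have h1 := hv (p + q)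
        rw [e] at h1
        filter_upwards [h1, hv p, hv q, ae_add (v p) (v q), ae_add (Q p.1.1) (Q q.1.1)]
          with x h1 h2 h3 h4 h5
        rw [h1, h4, h5, h2, h3])
      map_smul' := fun c p => Lp.ext (by
        have e : Q (c • p : L12 d).1.1 = c • Q p.1.1 := map_smul Q c p.1.1
        have h1 := hv (c • p)
        rw [e] at h1
        filter_upwards [h1, hv p, ae_smul c (v p), ae_smul c (Q p.1.1)]
          with x h1 h2 h3 h4
        rw [h1, id_apply, h3, h4, h2]) }
  have hF : ∀ p, ‖F p‖ ≤ √(4 * C * ‖Q‖) * ‖(LinearMap.snd ℝ (L1 d) (L2 d)).comp (L12 d).subtype p‖ := hn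
  refine ⟨F.extendOfNorm ((LinearMap.snd ℝ (L1 d) (L2 d)).comp (L12 d).subtype), fun p => ?_,
    LinearMap.opNorm_extendOfNorm_le denseRange_L12 (sqrt_nonneg _) hF⟩
  have := LinearMap.extendOfNorm_eq denseRange_L12 ⟨_, hF⟩ p
  exact (Eq.subst (motive := fun w : L2 d => w =ᵐ[volume] Q p.1.1) this.symm (hv p))

end

theorem isClosed_ae_abs_le {q : ℝ≥0∞} [Fact (1 ≤ q)] (M : ℝ) :
    IsClosed {u : Lp ℝ q (volume : Measure (Rn d)) | ∀ᵐ x, |u x| ≤ M} := by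
  refine isClosed_of_closure_subset fun u hu => ?_
  obtain ⟨v, hv, hlim⟩ := mem_closure_iff_seq_limit.1 hu
  obtain ⟨ns, hns, hae⟩ := (tendstoInMeasure_of_tendsto_Lp hlim).exists_seq_tendsto_ae
  filter_upwards [hae, ae_all_iff.2 hv] with x hx hM
  exact le_of_tendsto hx.abs (of_forall fun n => hM _)

theorem tendsto_toNNReal_nhdsGT : Tendsto Real.toNNReal (𝓝[>] 0) (𝓝[>] 0) := by
  refine tendsto_nhdsWithin_iff.2 ⟨?_, ?_⟩
  · simpa using (continuous_real_toNNReal.tendsto 0).mono_left nhdsWithin_le_nhds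
  · filter_upwards [self_mem_nhdsWithin] with t ht using Real.toNNReal_pos.2 ht

theorem tendsto_iff_tendsto_eLpNorm {a : ℕ → L2 d} {b : ℕ → Rn d → ℝ} {u : L2 d}
    (h : ∀ n, a n =ᵐ[volume] b n) :
    a ⇝ u ↔ (fun n => eLpNorm (fun x => b n x - u x) 2 volume) ⇝ 0 := by
  rw [Lp.tendsto_Lp_iff_tendsto_eLpNorm']
  exact tendsto_congr fun n => eLpNorm_congr_ae ((h n).sub .rfl)

/-- `S` is the semigroup on `L²` that is induced by the semigroup `P` on `L¹`. -/
structure IsL2Semigroup (P : ℝ≥0 → L1 d →L[ℝ] L1 d) (T : ℝ) (S : ℝ → L2 d →L[ℝ] L2 d) : Prop where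
  semigroup : IsC0Semigroup S
  semigroup_one : IsC0Semigroup fun t : ℝ => P t.toNNReal
  pos : ∀ t f, 0 ≤ f → 0 ≤ P t f
  compat : ∀ (t : ℝ) (p : L12 d), S t p.1.2 =ᵐ[volume] P t.toNNReal p.1.1
  gen_iff : ∀ u g, IsGenerator P u g ↔ HasGen S u g
  bound_one : ∃ C : ℝ, 0 ≤ C ∧ ∀ t ≤ T, SupBound C (P t.toNNReal)
  bound : ∃ C : ℝ, 0 ≤ C ∧ ∀ t ≤ T, SupBound C (S t)

theorem ae_abs_le_mul_of_eLpNorm_le {Q : L1 d →L[ℝ] L1 d} (hC : 0 ≤ C)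
    (h : ∀ f : L1 d, MemLp f ⊤ volume →
      eLpNorm (Q f) ⊤ volume ≤ ofReal C * eLpNorm f ⊤ volume) : SupBound C Q := by
  intro f M hM
  rcases lt_or_ge M 0 with h0 | h0
  · filter_upwards [hM] with x hx
    exact absurd ((abs_nonneg _).trans hx) (not_le.2 h0)
  have h1 := h f (memLp_top_of_bound (memLp f).1 M hM)
  have h2 : eLpNorm f ⊤ volume ≤ ofReal M := by
    rw [eLpNorm_exponent_top]; exact eLpNormEssSup_le_of_ae_bound hM
  have h3 : eLpNormEssSup (Q f) volume ≤ ofReal (C * M) := by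
    rw [← eLpNorm_exponent_top, ofReal_mul hC]
    exact h1.trans (mul_le_mul_right h2 _)
  filter_upwards [ae_le_eLpNormEssSup (f := Q f) (μ := volume)] with x hx
  have := hx.trans h3
  rwa [← ofReal_norm, ENNReal.ofReal_le_ofReal_iff (by positivity)] at this

section

variable (hP : IsPosC0Semigroup P)

include hP

theorem IsPosC0Semigroup.exists_bound :
    IsC0Semigroup fun t : ℝ => P t.toNNReal := by
  have h0 : ∀ t ≤ (0 : ℝ), P t.toNNReal = ContinuousLinearMap.id ℝ (L1 d) := fun t ht => by
    rw [Real.toNNReal_of_nonpos ht, hP.zero]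
  have hadd : ∀ s t : ℝ, 0 ≤ s → 0 ≤ t →
      P (s + t).toNNReal = (P s.toNNReal).comp (P t.toNNReal) := fun s t hs ht => by
    rw [Real.toNNReal_add hs ht, hP.add]
  have hc : ∀ x, Tendsto (fun t : ℝ => P t.toNNReal x) (𝓝[>] 0) (𝓝 x) := fun x => (hP.cont x).comp tendsto_toNNReal_nhdsGT
  refine .of_bound h0 hadd ?_ hc
  have hnear : ∃ δ > (0 : ℝ), ∃ M, ∀ t ≤ δ, ‖P t.toNNReal‖ ≤ M := by
    by_contra! hcon
    choose t ht1 ht2 using fun n : ℕ => hcon (1 / (n + 1 : ℝ)) (by positivity) (max n ‖P 0‖)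
    have htpos : ∀ n, 0 < t n := fun n => by
      by_contra! hle
      have := ht2 n
      rw [Real.toNNReal_of_nonpos hle] at this
      exact absurd this (not_lt.2 (le_max_right _ _))
    have hlim : Tendsto t atTop (𝓝[>] 0) := by
      refine tendsto_nhdsWithin_iff.2 ⟨?_, of_forall htpos⟩
      exact squeeze_zero (fun n => (htpos n).le) ht1 tendsto_one_div_add_atTop_nhds_zero_nat
    obtain ⟨K, hK⟩ := banach_steinhaus (g := fun n => P (t n).toNNReal) fun x => by
      obtain ⟨C, hC⟩ := (Metric.isBounded_range_of_tendsto _ ((hc x).comp hlim)).exists_norm_le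
      exact ⟨C, fun n => hC _ ⟨n, rfl⟩⟩
    obtain ⟨n, hn⟩ := exists_nat_gt K
    exact absurd (hK n) (not_le.2 (hn.trans ((le_max_left _ _).trans_lt (ht2 n))))
  obtain ⟨δ, hδ, M, hM⟩ := hnear
  exact fun T => semigroup_bound_of_bound_near_zero hadd hδ hM T

theorem IsPosC0Semigroup.exists_sup_bound (hT : 0 < T) (hC : 0 ≤ C) (hb : ∀ t ≤ T, SupBound C (P t.toNNReal))
    (T' : ℝ) : ∃ C', 0 ≤ C' ∧ ∀ t ≤ T', SupBound C' (P t.toNNReal) := by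
  have key (n : ℕ) : ∃ C', 0 ≤ C' ∧ ∀ t ≤ (n + 1) * T, SupBound C' (P t.toNNReal) := by
    induction n with
    | zero => exact ⟨C, hC, fun t ht => hb t (by simpa using ht)⟩
    | succ n ih =>
      obtain ⟨K, hK0, hK⟩ := ih
      refine ⟨max K (C * K), le_max_of_le_left hK0, fun t ht f M hM => ?_⟩
      rcases lt_or_ge M 0 with h0 | h0
      · filter_upwards [hM] with x hx
        exact absurd ((abs_nonneg _).trans hx) (not_le.2 h0)
      by_cases h : t ≤ (n + 1) * T
      · filter_upwards [hK t h f M hM] with x hx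
        exact hx.trans (mul_le_mul_of_nonneg_right (le_max_left _ _) h0)
      · push Not at h
        have h1 : 0 ≤ t - T := by nlinarith [(Nat.cast_nonneg n : (0 : ℝ) ≤ n)]
        have e : P t.toNNReal f = P T.toNNReal (P (t - T).toNNReal f) := by
          rw [← comp_apply, ← hP.add, ← Real.toNNReal_add hT.le h1,
            add_sub_cancel]
        have h2 : t - T ≤ (n + 1) * T := by push_cast at ht; linarith
        filter_upwards [hb T le_rfl _ _ (hK _ h2 f M hM)] with x hx
        rw [e]
        refine hx.trans ?_
        rw [← mul_assoc]
        exact mul_le_mul_of_nonneg_right (le_max_right _ _) h0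
  obtain ⟨n, hn⟩ := exists_nat_gt (T' / T)
  obtain ⟨K, hK0, hK⟩ := key n
  refine ⟨K, hK0, fun t ht => hK t ?_⟩
  have : T' < n * T := by rwa [div_lt_iff₀ hT] at hn
  nlinarith

end

theorem norm_sq_le_of_L12 {u : L2 d} {f : L1 d} (h : u =ᵐ[volume] f) {M : ℝ}
    (hM : ∀ᵐ x, |u x| ≤ M) : ‖u‖ ^ 2 ≤ M * ‖f‖ := by
  rw [← integral_sq, L1.norm_eq_integral_norm, ← integral_const_mul]
  refine integral_mono_ae (integrable_sq u) ((integrable_coeFn f).norm.const_mul M) ?_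
  filter_upwards [h, hM] with x h1 h2
  rw [← h1, ← sq_abs, sq]
  exact mul_le_mul_of_nonneg_right h2 (abs_nonneg _)

theorem IsPosC0Semigroup.exists_l2Semigroup (hP : IsPosC0Semigroup P) (hT : 0 < T) (hbdd : ∃ C_T > 0, ∀ t : ℝ≥0, (t : ℝ) ≤ T → ∀ f : L1 d, MemLp f ⊤ volume →
      eLpNorm (P t f) ⊤ volume ≤ ofReal C_T * eLpNorm f ⊤ volume) :
    ∃ S, IsL2Semigroup P T S := by
  have hP1 := hP.exists_bound
  obtain ⟨C, hC, hCb⟩ := hbdd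
  have hb : ∀ t ≤ T, SupBound C (P t.toNNReal) := fun t ht =>
    ae_abs_le_mul_of_eLpNorm_le hC.le (hCb t.toNNReal (by
      rw [Real.coe_toNNReal']; exact max_le ht hT.le))
  choose K hK0 hK using hP.exists_sup_bound hT hC.le hb
  choose S hS hSn using fun t : ℝ => exists_L2_extension (hP.pos t.toNNReal) (hK0 t) (hK t t le_rfl)
  have hdet : ∀ {A B : L2 d →L[ℝ] L2 d}, (∀ p : L12 d, A p.1.2 =ᵐ[volume] B p.1.2) → A = B := by
    intro A B h
    ext1 u
    obtain ⟨p, hp, -⟩ := exists_L12_tendsto u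
    refine tendsto_nhds_unique ((A.continuous.tendsto u).comp hp) ?_
    have e : (fun n => A (p n).1.2) = fun n => B (p n).1.2 := funext fun n => Lp.ext (h _)
    change Tendsto (fun n => A (p n).1.2) _ _
    rw [e]
    exact (B.continuous.tendsto u).comp hp
  have h0 : ∀ t ≤ (0 : ℝ), S t = ContinuousLinearMap.id ℝ (L2 d) := fun t ht => hdet fun p => by
    have := hS t p
    rw [hP1.of_nonpos t ht] at this
    exact this.trans p.ae_eq
  have hadd : ∀ s t : ℝ, 0 ≤ s → 0 ≤ t → S (s + t) = (S s).comp (S t) := fun s t hs ht =>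
    hdet fun p => by
      have h1 := hS (s + t) p
      rw [Real.toNNReal_add hs ht, hP.add] at h1
      exact h1.trans (hS s ⟨(P t.toNNReal p.1.1, S t p.1.2), (hS t p).symm⟩).symm
  have hbd : ∀ T', ∃ M, ∀ t ≤ T', ‖S t‖ ≤ M := fun T' => by
    obtain ⟨M, hM1, hM⟩ := hP1.exists_bound T'
    refine ⟨√(4 * K T' * M), fun t ht => ?_⟩
    obtain ⟨S', hS', hSn'⟩ := exists_L2_extension (hP.pos t.toNNReal) (hK0 T') (hK T' t ht)
    rw [show S t = S' from hdet fun p => (hS t p).trans (hS' p).symm]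
    have := hK0 T'
    exact hSn'.trans (Real.sqrt_le_sqrt (by gcongr; exact hM t ht))
  have hcb : ∀ p : L12 d, (∃ M : ℝ, ∀ᵐ x, |p.1.2 x| ≤ M) →
      Tendsto (fun t => S t p.1.2) (𝓝[>] 0) (𝓝 p.1.2) := by
    rintro p ⟨M, hM⟩
    have hlim := (((hP1.continuous_apply p.1.1).tendsto 0).sub_const p.1.1).norm
    rw [hP1.zero_apply, sub_self, norm_zero] at hlim
    have hlim2 := ((hlim.const_mul (C * M + M)).mono_left
      (nhdsWithin_le_nhds (s := Ioi (0 : ℝ)))).sqrt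
    rw [mul_zero, sqrt_zero] at hlim2
    rw [tendsto_iff_norm_sub_tendsto_zero]
    refine squeeze_zero' (of_forall fun _ => norm_nonneg _) ?_ hlim2
    filter_upwards [Ioo_mem_nhdsGT hT] with t ht
    refine Real.le_sqrt_of_sq_le (norm_sq_le_of_L12 ?_ ?_)
    · filter_upwards [hS t p, ae_sub (S t p.1.2) p.1.2, p.ae_eq,
        ae_sub (P t.toNNReal p.1.1) p.1.1] with x h1 h2 h3 h4
      rw [h2, h4, h1, h3]
    · filter_upwards [hS t p, ae_sub (S t p.1.2) p.1.2, hM, hb t ht.2.le p.1.1 M (by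
        filter_upwards [p.ae_eq, hM] with x h1 h2
        rwa [h1])] with x h1 h2 h3 h4
      rw [h2, h1]
      exact (abs_sub _ _).trans (add_le_add h4 h3)
  have hcont : ∀ u, Tendsto (fun t => S t u) (𝓝[>] 0) (𝓝 u) := by
    intro u
    obtain ⟨M, hM⟩ := hbd T
    have hM0 : 0 ≤ M := (norm_nonneg _).trans (hM T le_rfl)
    obtain ⟨p, hp, hpb, -⟩ := exists_L12_tendsto u
    refine Metric.tendsto_nhds.2 fun ε hε => ?_
    have h1 : ∀ᶠ n in atTop, dist (p n).1.2 u < ε / (2 * (M + 1)) :=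
      Metric.tendsto_nhds.1 hp _ (by positivity)
    obtain ⟨n, hn⟩ := h1.exists
    have h2 := Metric.tendsto_nhds.1 (hcb (p n) ⟨n, hpb n⟩) (ε / 2) (by positivity)
    filter_upwards [h2, Ioo_mem_nhdsGT hT] with t ht htT
    have h3 : dist (S t u) (S t (p n).1.2) ≤ M * dist (p n).1.2 u := by
      rw [dist_eq_norm, ← map_sub, dist_comm, dist_eq_norm]
      exact (S t).le_of_opNorm_le (hM t htT.2.le) _
    have h4 : (M + 1) * dist (p n).1.2 u < ε / 2 := by
      rw [lt_div_iff₀ (by positivity)] at hn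
      linarith
    have h5 := dist_triangle4 (S t u) (S t (p n).1.2) (p n).1.2 u
    have h6 : dist (S t u) u ≤ (M + 1) * dist (p n).1.2 u + dist (S t (p n).1.2) (p n).1.2 := by
      rw [add_mul, one_mul]; linarith
    linarith
  have hsg : IsC0Semigroup S := .of_bound h0 hadd hbd hcont
  have hext : ∀ (t : ℝ≥0) u v, IsL2Ext P t u v ↔ v = S t u := by
    intro t u v
    constructor
    · rintro ⟨f, hf1, hf2⟩
      have hfin : ∀ᶠ n in atTop, MemLp (f n) 2 volume := by
        have h1 : ∀ᶠ n in atTop, eLpNorm (fun x => f n x - u x) 2 volume < 1 :=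
          hf1.eventually (gt_mem_nhds (by norm_num))
        filter_upwards [h1] with n hn
        have h2 : MemLp (fun x => f n x - u x) 2 volume :=
          ⟨(memLp _).1.sub (memLp _).1, hn.trans (by norm_num)⟩
        exact (h2.add (memLp u)).ae_eq (of_forall fun x => by simp)
      obtain ⟨N, hN⟩ := eventually_atTop.1 hfin
      choose p hp1 hp2 using fun n => exists_L12 (memLp (f (n + N))) (hN (n + N) (by omega))
      have hpf : ∀ n, (p n).1.1 = f (n + N) := fun n => Lp.ext (hp1 n)
      have hpu := (tendsto_iff_tendsto_eLpNorm fun n => (hp2 n).trans (.of_eq rfl)).2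
        (hf1.comp (tendsto_add_atTop_nat N))
      refine tendsto_nhds_unique ((tendsto_iff_tendsto_eLpNorm fun n => ?_).2
        (hf2.comp (tendsto_add_atTop_nat N))) (((S t).continuous.tendsto u).comp hpu)
      simpa [hpf] using hS t (p n)
    · rintro rfl
      obtain ⟨p, hp, -⟩ := exists_L12_tendsto u
      exact ⟨fun n => (p n).1.1, (tendsto_iff_tendsto_eLpNorm fun n => .symm <| (p n).ae_eq).1 hp,
        (tendsto_iff_tendsto_eLpNorm fun n => by simpa using hS t (p n)).1
          (((S t).continuous.tendsto u).comp hp)⟩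
  refine ⟨S, hsg, hP1, hP.pos, hS, fun u g => ?_, ⟨C, hC.le, hb⟩, ⟨C, hC.le, fun t ht u M hM => ?_⟩⟩
  · constructor
    · rintro ⟨v, hv, hlim⟩
      refine (hlim.comp tendsto_toNNReal_nhdsGT).congr' ?_
      filter_upwards [self_mem_nhdsWithin] with t ht
      rw [Function.comp_apply, (hext _ _ _).1 (hv _), Real.coe_toNNReal _ (le_of_lt ht)]
    · intro h
      refine ⟨fun t => S t u, fun t => (hext _ _ _).2 rfl, h.comp ?_⟩
      refine tendsto_nhdsWithin_iff.2 ⟨?_, ?_⟩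
      · exact (NNReal.continuous_coe.tendsto 0).mono_left nhdsWithin_le_nhds
      · filter_upwards [self_mem_nhdsWithin] with t ht
        exact NNReal.coe_pos.2 ht
  · obtain ⟨p, hp, -, hpb⟩ := exists_L12_tendsto u
    refine (isClosed_ae_abs_le (C * M)).mem_of_tendsto (((S t).continuous.tendsto u).comp hp)
      (of_forall fun n => ?_)
    have h1 := hb t ht (p n).1.1 M (by
      filter_upwards [(p n).ae_eq, hpb n, hM] with x h1 h2 h3
      rw [h1]; exact h2.trans h3)
    change ∀ᵐ x, |S t (p n).1.2 x| ≤ C * M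
    filter_upwards [hS t (p n), h1] with x h2 h3
    rwa [h2]

section

variable {q : ℝ≥0∞} [Fact (1 ≤ q)]

theorem convex_ae_abs_le (M : ℝ) :
    Convex ℝ {u : Lp ℝ q (volume : Measure (Rn d)) | ∀ᵐ x, |u x| ≤ M} := by
  intro u hu v hv a b ha hb hab
  change ∀ᵐ x, |(a • u + b • v : Lp ℝ q (volume : Measure (Rn d))) x| ≤ M
  filter_upwards [hu, hv, ae_add (a • u) (b • v), ae_smul a u, ae_smul b v]
    with x h1 h2 h3 h4 h5
  rw [h3, h4, h5]
  simp only [smul_eq_mul]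
  calc |a * u x + b * v x| ≤ a * |u x| + b * |v x| := by
        refine (abs_add_le _ _).trans ?_
        rw [abs_mul, abs_mul, abs_of_nonneg ha, abs_of_nonneg hb]
    _ ≤ a * M + b * M := by gcongr
    _ = M := by rw [← add_mul, hab, one_mul]

theorem ae_abs_integral_le {f : ℝ → Lp ℝ q (volume : Measure (Rn d))}
    {a b M : ℝ} (hab : a ≤ b) (hf : IntervalIntegrable f volume a b)
    (hM : ∀ᵐ s ∂(volume.restrict (Ioc a b)), ∀ᵐ x, |f s x| ≤ M) :
    ∀ᵐ x, |(∫ s in a..b, f s) x| ≤ (b - a) * M := by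
  rcases hab.eq_or_lt with rfl | hab'
  · rw [integral_same]
    filter_upwards [coeFn_zero ℝ q (volume : Measure (Rn d))] with x hx
    rw [hx]; simp
  rw [integral_of_le hab]
  have hfi := (intervalIntegrable_iff_integrableOn_Ioc_of_le hab).1 hf
  have h1 := (convex_ae_abs_le (d := d) (q := q) M).set_average_mem (isClosed_ae_abs_le M)
    (t := Ioc a b) (μ := volume) (by simpa using hab') (by simp) hM hfi
  have h2 : (∫ s in Ioc a b, f s) = (b - a) • ⨍ s in Ioc a b, f s := by
    rw [setAverage_eq, Real.volume_real_Ioc_of_le hab, smul_smul,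
      mul_inv_cancel₀ (by linarith), one_smul]
  rw [h2]
  have h3 : ∀ᵐ x, |(⨍ s in Ioc a b, f s) x| ≤ M := h1
  filter_upwards [h3, ae_smul (b - a) (⨍ s in Ioc a b, f s)] with x h4 h5
  rw [h5, smul_eq_mul, abs_mul, abs_of_nonneg (by linarith)]
  exact mul_le_mul_of_nonneg_left h4 (by linarith)

end

theorem exists_partition_approx {E : Type*} [NormedAddCommGroup E] [NormedSpace ℝ E]
    (hT : 0 < T) {g : ℝ → E} (hg : ContinuousOn g (Icc 0 T)) {ε : ℝ} (hε : 0 < ε) :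
    ∃ (n : ℕ) (θ : Fin n → ℝ → ℝ) (y : Fin n → E), (∀ j, Continuous (θ j)) ∧
      (∀ j t, 0 ≤ θ j t) ∧ (∀ t, ∑ j, θ j t = 1) ∧
      ∀ t ∈ Icc 0 T, ‖(∑ j, θ j t • y j) - g t‖ < ε := by
  let r : unitInterval → ℝ := fun x => T * x
  have hr : ∀ x : unitInterval, r x ∈ Icc 0 T := fun x =>
    ⟨mul_nonneg hT.le x.2.1, mul_le_of_le_one_right hT.le x.2.2⟩
  have hrc : Continuous r := continuous_const.mul continuous_subtype_val
  let f : C(unitInterval, E) := ⟨fun x => g (r x), hg.comp_continuous hrc hr⟩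
  have h1 := Metric.tendsto_nhds.1 (bernsteinApproximation_uniform f) ε hε
  obtain ⟨n, hn⟩ := h1.exists
  let pr : ℝ → unitInterval := fun t => projIcc 0 1 zero_le_one (t / T)
  have hpr : Continuous pr := continuous_projIcc.comp (continuous_id.div_const T)
  refine ⟨n + 1, fun j t => bernstein n j (pr t), fun j => f (bernstein.z j), fun j =>
    (bernstein n j).continuous.comp hpr, fun j t => bernstein_nonneg, fun t =>
    bernstein.probability n (pr t), fun t ht => ?_⟩
  have h2 : f (pr t) = g t := by
    change g (T * (projIcc 0 1 zero_le_one (t / T) : ℝ)) = g t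
    rw [projIcc_of_mem zero_le_one (x := t / T) ⟨div_nonneg ht.1 hT.le, div_le_one_of_le₀ ht.2 hT.le⟩]
    change g (T * (t / T)) = g t
    rw [mul_div_cancel₀ _ hT.ne']
  have h3 := (ContinuousMap.dist_lt_iff hε).1 hn (pr t)
  rw [bernsteinApproximation.apply, h2, dist_eq_norm] at h3
  exact h3

/-- Bounded classical solutions of `u' + L u + g = 0` on `[0, T]`. -/
structure IsBddClassical (S : ℝ → L2 d →L[ℝ] L2 d) (T : ℝ) (u Lu g : ℝ → L2 d) : Prop where
  gen : ∀ t ∈ Icc 0 T, HasGen S (u t) (Lu t)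
  contL : ContinuousOn Lu (Icc 0 T)
  contg : ContinuousOn g (Icc 0 T)
  deriv : ∀ t ∈ Icc 0 T, HasDerivWithinAt u (-(Lu t) - g t) (Icc 0 T) t
  bdd : ∃ M : ℝ, ∀ t ∈ Icc 0 T, ∀ᵐ x, |u t x| ≤ M

theorem HasGen.add {u v g h : L2 d} (hu : HasGen S u g) (hv : HasGen S v h) :
    HasGen S (u + v) (g + h) := by
  have := Tendsto.add hu hv
  refine this.congr fun t => ?_
  rw [map_add, ← smul_add]; congr 1; abel

theorem HasGen.const_smul {u g : L2 d} (c : ℝ) (hu : HasGen S u g) :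
    HasGen S (c • u) (c • g) := by
  have := Tendsto.const_smul hu c
  refine this.congr fun t => ?_
  rw [map_smul, ← smul_sub, smul_comm]

theorem HasGen.sub {u v g h : L2 d} (hu : HasGen S u g) (hv : HasGen S v h) :
    HasGen S (u - v) (g - h) := by
  have := hu.add (hv.const_smul (-1))
  simpa [sub_eq_add_neg] using this

namespace IsBddClassical

theorem cont {u Lu g : ℝ → L2 d} (h : IsBddClassical S T u Lu g) : ContinuousOn u (Icc 0 T) :=
  fun t ht => (h.deriv t ht).continuousWithinAt

theorem add {u Lu g v Lv h : ℝ → L2 d} (h1 : IsBddClassical S T u Lu g) (h2 : IsBddClassical S T v Lv h) :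
    IsBddClassical S T (fun t => u t + v t) (fun t => Lu t + Lv t) fun t => g t + h t := by
  obtain ⟨M, hM⟩ := h1.bdd
  obtain ⟨N, hN⟩ := h2.bdd
  refine ⟨fun t ht => (h1.gen t ht).add (h2.gen t ht), h1.contL.add h2.contL,
    h1.contg.add h2.contg, fun t ht => ?_, M + N, fun t ht => ?_⟩
  · exact ((h1.deriv t ht).add (h2.deriv t ht)).congr_deriv (by abel)
  · filter_upwards [hM t ht, hN t ht, ae_add (u t) (v t)] with x a b c
    rw [c]; exact (abs_add_le _ _).trans (add_le_add a b)

theorem const_smul {u Lu g : ℝ → L2 d} (h1 : IsBddClassical S T u Lu g) (c : ℝ) :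
    IsBddClassical S T (fun t => c • u t) (fun t => c • Lu t) fun t => c • g t := by
  obtain ⟨M, hM⟩ := h1.bdd
  refine ⟨fun t ht => (h1.gen t ht).const_smul c, h1.contL.const_smul c,
    h1.contg.const_smul c, fun t ht => ?_, |c| * M, fun t ht => ?_⟩
  · exact ((h1.deriv t ht).const_smul c).congr_deriv (by rw [smul_sub, smul_neg])
  · filter_upwards [hM t ht, ae_smul c (u t)] with x a b
    rw [b, smul_eq_mul, abs_mul]
    exact mul_le_mul_of_nonneg_left a (abs_nonneg c)

theorem sub {u Lu g v Lv h : ℝ → L2 d} (h1 : IsBddClassical S T u Lu g) (h2 : IsBddClassical S T v Lv h) :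
    IsBddClassical S T (fun t => u t - v t) (fun t => Lu t - Lv t) fun t => g t - h t := by
  have := h1.add (h2.const_smul (-1))
  simpa [sub_eq_add_neg] using this

theorem zero : IsBddClassical S T (fun _ => 0) (fun _ => 0) fun _ => 0 := by
  refine ⟨fun t _ => ?_, continuousOn_const, continuousOn_const, fun t _ => ?_, 0, fun t _ => ?_⟩
  · simp [HasGen]
  · simpa using hasDerivWithinAt_const t (Icc 0 T) (0 : L2 d)
  · filter_upwards [ae_zero (E := ℝ) (p := 2)] with x hx
    rw [hx]; simp

theorem sum {ι : Type*} (s : Finset ι) {u Lu g : ι → ℝ → L2 d}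
    (h : ∀ i, IsBddClassical S T (u i) (Lu i) (g i)) : IsBddClassical S T (fun t => ∑ i ∈ s, u i t)
      (fun t => ∑ i ∈ s, Lu i t) fun t => ∑ i ∈ s, g i t := by
  classical
  induction s using Finset.induction_on with
  | empty => simpa using zero
  | insert i s hi ih =>
    simp only [sum_insert hi]
    exact (h i).add ih

end IsBddClassical

theorem IsL2Semigroup.exists_bdd_domain (hS : IsL2Semigroup P T S) (hT : 0 < T) (u : L2 d) {ε : ℝ}
    (hε : 0 < ε) : ∃ (h Lh : L2 d) (M : ℝ), HasGen S h Lh ∧ (∀ᵐ x, |h x| ≤ M) ∧ ‖h - u‖ < ε := by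
  obtain ⟨C, hC, hb⟩ := hS.bound
  obtain ⟨p, hp, hpb, -⟩ := exists_L12_tendsto u
  obtain ⟨n, hn⟩ := (Metric.tendsto_nhds.1 hp (ε / 2) (by positivity)).exists
  have h1 := Metric.tendsto_nhds.1 (hS.semigroup.tendsto_avg (p n).1.2) (ε / 2) (by positivity)
  obtain ⟨δ, hδ, hδT⟩ := (h1.and (Ioo_mem_nhdsGT hT)).exists
  refine ⟨IsC0Semigroup.avg S δ (p n).1.2, _, C * n, hS.semigroup.hasGen_avg hδT.1 _, ?_, ?_⟩
  · have h2 := ae_abs_integral_le (M := C * n) hδT.1.le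
      ((hS.semigroup.continuous_apply (p n).1.2).intervalIntegrable 0 δ) (by
        filter_upwards [ae_restrict_mem measurableSet_Ioc] with s hs
        exact hb s (hs.2.trans hδT.2.le) _ _ (hpb n))
    filter_upwards [h2, ae_smul δ⁻¹ (∫ r in (0 : ℝ)..δ, S r (p n).1.2)] with x h3 h4
    rw [IsC0Semigroup.avg, h4, smul_eq_mul, abs_mul, abs_of_pos (inv_pos.2 hδT.1),
      inv_mul_le_iff₀ hδT.1]
    simpa using h3
  · rw [dist_eq_norm] at hn hδ
    have := norm_sub_le_norm_sub_add_norm_sub (IsC0Semigroup.avg S δ (p n).1.2) (p n).1.2 u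
    linarith

section

variable (hS : IsL2Semigroup P T S) {h Lh : L2 d} {M : ℝ} (hg : HasGen S h Lh)
  (hM : ∀ᵐ x, |h x| ≤ M)

include hS hg hM

theorem IsL2Semigroup.isBddClassical_apply :
    IsBddClassical S T (fun t => S (T - t) h) (fun t => S (T - t) Lh) fun _ => 0 := by
  obtain ⟨C, hC, hb⟩ := hS.bound
  have hc : ∀ x, Continuous fun t => S (T - t) x := fun x =>
    (hS.semigroup.continuous_apply x).comp (by fun_prop)
  refine ⟨fun t ht => ?_, (hc Lh).continuousOn, continuousOn_const, fun t ht => ?_, C * M,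
    fun t ht => hb _ (by linarith [ht.1]) _ _ hM⟩
  · have h1 := ((S (T - t)).continuous.tendsto Lh).comp hg
    refine h1.congr' ?_
    filter_upwards [self_mem_nhdsWithin] with r hr
    rw [Function.comp_apply, map_smul, map_sub, hS.semigroup.comm (le_of_lt hr) (by linarith [ht.2])]
  · have h1 : HasDerivAt (fun r => h + ∫ s in (0 : ℝ)..r, S s Lh) (S (T - t) Lh) (T - t) :=
      ((hS.semigroup.continuous_apply Lh).integral_hasStrictDerivAt 0 (T - t)).hasDerivAt.const_add h
    have h2 := h1.scomp t ((hasDerivAt_id t).const_sub T)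
    simp only [neg_smul, one_smul, Function.comp_def] at h2
    rw [sub_zero]
    refine h2.hasDerivWithinAt.congr (fun s hs => ?_) ?_
    · rw [hS.semigroup.hasGen_integral hg le_rfl (sub_nonneg.2 hs.2), hS.semigroup.zero_apply]; abel
    · rw [hS.semigroup.hasGen_integral hg le_rfl (sub_nonneg.2 ht.2), hS.semigroup.zero_apply]; abel

theorem IsL2Semigroup.isBddClassical_duhamel {θ : ℝ → ℝ} (hθ : Continuous θ)
    {B : ℝ} (hB : ∀ t, |θ t| ≤ B) :
    IsBddClassical S T (fun t => ∫ s in t..T, θ s • S (s - t) h)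
      (fun t => ∫ s in t..T, θ s • S (s - t) Lh) fun t => θ t • h := by
  obtain ⟨C, hC, hb⟩ := hS.bound
  refine ⟨fun t ht => hS.semigroup.hasGen_duhamel hθ hg ht.2,
    (hS.semigroup.continuous_duhamel T hθ Lh).continuousOn, (hθ.smul continuous_const).continuousOn,
    fun t ht => hS.semigroup.hasDerivWithinAt_duhamel hθ hg ht, T * (B * (C * M)), fun t ht => ?_⟩
  have hB0 : 0 ≤ B := (abs_nonneg _).trans (hB 0)
  have hc : Continuous fun s => θ s • S (s - t) h :=
    hθ.smul ((hS.semigroup.continuous_apply h).comp (by fun_prop))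
  have hae : ∀ s ≤ T, ∀ᵐ x, |(θ s • S (s - t) h : L2 d) x| ≤ B * (C * M) := fun s hs => by
    filter_upwards [hb (s - t) (by linarith [ht.1]) h M hM, ae_smul (θ s) (S (s - t) h)]
      with x h1 h2
    rw [h2, smul_eq_mul, abs_mul]
    exact mul_le_mul (hB s) h1 (abs_nonneg _) hB0
  have h2 := ae_abs_integral_le (M := B * (C * M)) ht.2 (hc.intervalIntegrable t T) (by
    filter_upwards [ae_restrict_mem measurableSet_Ioc] with s hs using hae s hs.2)
  filter_upwards [h2, hae T le_rfl] with x h3 h4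
  exact h3.trans (mul_le_mul_of_nonneg_right (by linarith [ht.1]) ((abs_nonneg _).trans h4))

end

section

variable (hS : IsL2Semigroup P T S) (hT : 0 < T) (φ : L2 d) {g : ℝ → L2 d} {ε : ℝ}

include hS hT φ

/-- Data of regular solutions are dense, uniformly in time if `g` is continuous. -/
theorem IsL2Semigroup.exists_isBddClassical_of_continuousOn (hg : ContinuousOn g (Icc 0 T)) (hε : 0 < ε) :
    ∃ u Lu g', IsBddClassical S T u Lu g' ∧ ‖u T - φ‖ < ε ∧ ∀ t ∈ Icc 0 T, ‖g' t - g t‖ < ε := by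
  obtain ⟨n, θ, y, hθ, hθ0, hθ1, happ⟩ := exists_partition_approx hT hg (half_pos hε)
  choose h Lh M hh hM hhy using fun j => hS.exists_bdd_domain hT (y j) (half_pos hε)
  obtain ⟨ψ, Lψ, N, hψ, hN, hψφ⟩ := hS.exists_bdd_domain hT φ hε
  have hθb : ∀ j t, |θ j t| ≤ 1 := fun j t => by
    rw [abs_of_nonneg (hθ0 j t), ← hθ1 t]
    exact single_le_sum (f := fun j => θ j t) (fun i _ => hθ0 i t) (Finset.mem_univ j)
  have hr := (hS.isBddClassical_apply hψ hN).add (IsBddClassical.sum Finset.univ fun j =>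
    hS.isBddClassical_duhamel (hh j) (hM j) (hθ j) (hθb j))
  refine ⟨_, _, _, hr, ?_, fun t ht => ?_⟩
  · simpa [hS.semigroup.zero_apply] using hψφ
  · have h1 : ‖(∑ j, θ j t • h j) - ∑ j, θ j t • y j‖ ≤ ε / 2 := by
      rw [← sum_sub_distrib]
      calc _ ≤ ∑ j, ‖θ j t • h j - θ j t • y j‖ := norm_sum_le _ _
        _ ≤ ∑ j, θ j t * (ε / 2) := by
            refine sum_le_sum fun j _ => ?_
            rw [← smul_sub, norm_smul, norm_of_nonneg (hθ0 j t)]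
            exact mul_le_mul_of_nonneg_left (hhy j).le (hθ0 j t)
        _ = ε / 2 := by rw [← sum_mul, hθ1, one_mul]
    have := norm_sub_le_norm_sub_add_norm_sub (∑ j, θ j t • h j) (∑ j, θ j t • y j) (g t)
    simp only [zero_add]
    linarith [happ t ht]

theorem IsL2Semigroup.exists_isBddClassical (hg : g ∈L¹ T) (hε : 0 < ε) :
    ∃ u Lu g', IsBddClassical S T u Lu g' ∧ ‖u T - φ‖ < ε ∧ ∫ t in Icc 0 T, ‖g' t - g t‖ < ε := by
  obtain ⟨g₁, -, hg₁, hc, hi⟩ := hg.exists_hasCompactSupport_integral_sub_le (half_pos (half_pos hε))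
  set δ := min (ε / 4 / T) ε with hδ
  have hδ0 : 0 < δ := by positivity
  obtain ⟨u, Lu, g', hr, h1, h2⟩ := hS.exists_isBddClassical_of_continuousOn hT φ hc.continuousOn hδ0
  have hi' : g' ∈L¹ T := hr.contg.integrableOn_Icc
  refine ⟨u, Lu, g', hr, h1.trans_le (min_le_right _ _), ?_⟩
  have e1 : ∫ t in Icc 0 T, ‖g' t - g₁ t‖ ≤ ε / 4 := by
    have h3 : ∫ t in Icc 0 T, ‖g' t - g₁ t‖ ≤ ∫ t in Icc 0 T, δ :=
      setIntegral_mono_on (hi'.sub hi).norm (by simp) measurableSet_Icc fun t ht => (h2 t ht).le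
    have h4 : ∫ t in Icc 0 T, δ = T * δ := by simp [hT.le]
    rw [h4] at h3
    refine h3.trans ?_
    calc T * δ ≤ T * (ε / 4 / T) := mul_le_mul_of_nonneg_left (min_le_left _ _) hT.le
      _ = ε / 4 := by field_simp
  have e2 : ∫ t in Icc 0 T, ‖g' t - g t‖ ≤ ∫ t in Icc 0 T, (‖g' t - g₁ t‖ + ‖g t - g₁ t‖) := by
    refine integral_mono (hi'.sub hg).norm ((hi'.sub hi).norm.add (hg.sub hi).norm) fun t => ?_
    have := norm_sub_le_norm_sub_add_norm_sub (g' t) (g₁ t) (g t)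
    rwa [norm_sub_rev (g₁ t)] at this
  have e3 := integral_add (hi'.sub hi).norm (hg.sub hi).norm
  simp only [Pi.sub_apply] at e3
  rw [e3] at e2
  linarith

end

theorem IsBddClassical.eq_mild {u Lu g : ℝ → L2 d} (hS : IsC0Semigroup S)
    (h : IsBddClassical S T u Lu g) {t : ℝ} (ht : t ∈ Icc 0 T) : u t = mild S T (u T) g t :=
  hS.eq_mild h.deriv (h.contL.neg.sub h.contg).integrableOn_Icc h.contg.integrableOn_Icc
    (by
      filter_upwards [ae_mem_Icc] with s hs
      exact ⟨h.gen s hs, by abel⟩) ht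

section Bilinear

variable {E F G : Type*} [NormedAddCommGroup E] [NormedSpace ℝ E] [NormedAddCommGroup F]
  [NormedSpace ℝ F] [NormedAddCommGroup G] [NormedSpace ℝ G]

section

variable (B : E →L[ℝ] F →L[ℝ] G) {ν : Measure ℝ} {g : ℝ → E} {u : ℝ → F} (hg : Integrable g ν)
  {M : ℝ}

include B hg

theorem integrable_bilin (hu : AEStronglyMeasurable u ν) (hM : ∀ᵐ t ∂ν, ‖u t‖ ≤ M) :
    Integrable (fun t => B (g t) (u t)) ν := by
  refine (hg.norm.const_mul (‖B‖ * M)).mono' (B.aestronglyMeasurable_comp₂ hg.1 hu) ?_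
  filter_upwards [hM] with t ht
  refine (B.le_opNorm₂ _ _).trans ?_
  rw [mul_assoc, mul_assoc, mul_comm M]
  gcongr

theorem tendsto_integral_bilin
    {gn : ℕ → ℝ → E} {un : ℕ → ℝ → F} (hgn : ∀ n, Integrable (gn n) ν)
    (hlim : (fun n => ∫ t, ‖gn n t - g t‖ ∂ν) ⇝ 0)
    (hu : AEStronglyMeasurable u ν) (hun : ∀ n, AEStronglyMeasurable (un n) ν) (hM : ∀ᵐ t ∂ν, ‖u t‖ ≤ M) {δ : ℕ → ℝ} (hδ : δ ⇝ 0)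
    (hδu : ∀ n, ∀ᵐ t ∂ν, ‖un n t - u t‖ ≤ δ n) :
    (fun n => ∫ t, ‖B (gn n t) (un n t) - B (g t) (u t)‖ ∂ν) ⇝ 0 := by
  have hlim2 : (fun n => ‖B‖ * ((∫ t, ‖gn n t - g t‖ ∂ν) * (M + δ n) +
      (∫ t, ‖g t‖ ∂ν) * δ n)) ⇝ 0 := by
    have := ((hlim.mul (hδ.const_add M)).add (hδ.const_mul (∫ t, ‖g t‖ ∂ν))).const_mul ‖B‖
    simpa using this
  refine squeeze_zero (fun n => integral_nonneg fun t => norm_nonneg _) (fun n => ?_) hlim2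
  rw [← integral_mul_const, ← integral_mul_const]
  have i1 : Integrable (fun t => ‖gn n t - g t‖ * (M + δ n)) ν := ((hgn n).sub hg).norm.mul_const _
  have i2 : Integrable (fun t => ‖g t‖ * δ n) ν := hg.norm.mul_const _
  rw [← integral_add i1 i2, ← integral_const_mul]
  have hun' : ∀ᵐ t ∂ν, ‖un n t‖ ≤ M + δ n := by
    filter_upwards [hM, hδu n] with t h1 h2
    have := norm_add_le (u t) (un n t - u t)
    rw [add_sub_cancel] at this
    linarith
  refine integral_mono_ae ((integrable_bilin B (hgn n) (hun n) hun').sub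
    (integrable_bilin B hg hu hM)).norm ((i1.add i2).const_mul _) ?_
  filter_upwards [hun', hδu n] with t h1 h2
  have e : B (gn n t) (un n t) - B (g t) (u t)
      = B (gn n t - g t) (un n t) + B (g t) (un n t - u t) := by
    rw [map_sub, sub_apply, map_sub]; abel
  rw [e]
  refine (norm_add_le _ _).trans ?_
  have b1 := B.le_opNorm₂ (gn n t - g t) (un n t)
  have b2 := B.le_opNorm₂ (g t) (un n t - u t)
  have b3 : ‖B‖ * ‖gn n t - g t‖ * ‖un n t‖ ≤ ‖B‖ * ‖gn n t - g t‖ * (M + δ n) := by gcongr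
  have b4 : ‖B‖ * ‖g t‖ * ‖un n t - u t‖ ≤ ‖B‖ * ‖g t‖ * δ n := by gcongr
  calc _ ≤ ‖B‖ * ‖gn n t - g t‖ * (M + δ n) + ‖B‖ * ‖g t‖ * δ n := by linarith
    _ = _ := by ring

end

end Bilinear

theorem integrable_of_tendsto_of_integral_le {α : Type*} [MeasurableSpace α] {ν : Measure α}
    {f : ℕ → α → ℝ} {F : α → ℝ} (hf : ∀ n, Integrable (f n) ν) (h0 : ∀ n, ∀ᵐ x ∂ν, 0 ≤ f n x)
    (hF : ∀ᵐ x ∂ν, (fun n => f n x) ⇝ F x) {c : ℕ → ℝ} {c' : ℝ}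
    (hc : ∀ n, ∫ x, f n x ∂ν ≤ c n) (hc' : c ⇝ c') :
    Integrable F ν ∧ ∫ x, F x ∂ν ≤ c' := by
  have hFm : AEStronglyMeasurable F ν := aestronglyMeasurable_of_tendsto_ae atTop (fun n => (hf n).1) hF
  have hF0 : 0 ≤ᵐ[ν] F := by
    filter_upwards [hF, ae_all_iff.2 h0] with x hx h
    exact ge_of_tendsto hx (of_forall h)
  have hc0 : 0 ≤ c' := ge_of_tendsto hc' (of_forall fun n =>
    (integral_nonneg_of_ae (h0 n)).trans (hc n))
  have key : ∫⁻ x, ofReal (F x) ∂ν ≤ ofReal c' := by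
    calc ∫⁻ x, ofReal (F x) ∂ν
        = ∫⁻ x, liminf (fun n => ofReal (f n x)) atTop ∂ν := by
          refine lintegral_congr_ae ?_
          filter_upwards [hF] with x hx
          exact ((ENNReal.continuous_ofReal.tendsto _).comp hx).liminf_eq.symm
      _ ≤ liminf (fun n => ∫⁻ x, ofReal (f n x) ∂ν) atTop :=
          lintegral_liminf_le' fun n => (hf n).1.aemeasurable.ennreal_ofReal
      _ ≤ liminf (fun n => ofReal (c n)) atTop := by
          refine liminf_le_liminf (of_forall fun n => ?_)
          rw [← ofReal_integral_eq_lintegral_ofReal (hf n) (h0 n)]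
          exact ofReal_le_ofReal (hc n)
      _ = ofReal c' := ((ENNReal.continuous_ofReal.tendsto _).comp hc').liminf_eq
  have hi : Integrable F ν := by
    refine ⟨hFm, ?_⟩
    rw [hasFiniteIntegral_iff_ofReal hF0]
    exact key.trans_lt ENNReal.ofReal_lt_top
  refine ⟨hi, ?_⟩
  rw [← ofReal_integral_eq_lintegral_ofReal hi hF0, ENNReal.ofReal_le_ofReal_iff hc0] at key
  exact key

namespace Coefficients

/-- The standing assumptions on the operator, with `S` the semigroup on `L²`. -/
structure Assumptions (Q : Coefficients d k) (c₂ T : ℝ) (P : ℝ≥0 → L1 d →L[ℝ] L1 d)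
    (S : ℝ → L2 d →L[ℝ] L2 d) : Prop where
  pos : 0 < T
  A1 : Q.CondA1
  A2' : Q.CondA2'
  A2 : Q.CondA2 c₂
  A3 : Q.CondA3
  A4 : Q.CondA4 c₂ T P
  sg : IsL2Semigroup P T S

end Coefficients

section

variable {α H : Type*} [MeasurableSpace α] {ν : Measure α} [NormedAddCommGroup H]
  [InnerProductSpace ℝ H]

theorem norm_sq_toLp_sub {v w : α → H} (hv : MemLp v 2 ν) (hw : MemLp w 2 ν) :
    ‖hv.toLp v - hw.toLp w‖ ^ 2 = ∫ x, ‖v x - w x‖ ^ 2 ∂ν := by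
  rw [← MemLp.toLp_sub, ← real_inner_self_eq_norm_sq, inner_def]
  refine integral_congr_ae ?_
  filter_upwards [(hv.sub hw).coeFn_toLp] with x hx
  rw [hx, real_inner_self_eq_norm_sq]
  rfl

theorem exists_limit_of_integral_norm_sq_le [CompleteSpace H] {w : ℕ → α → H}
    (hw : ∀ n, MemLp (w n) 2 ν) {b : ℕ → ℝ} (hb : b ⇝ 0)
    (h : ∀ n m N, N ≤ n → N ≤ m → ∫ x, ‖w n x - w m x‖ ^ 2 ∂ν ≤ b N ^ 2) (hb0 : ∀ n, 0 ≤ b n) :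
    ∃ W : α → H, MemLp W 2 ν ∧ (fun n => ∫ x, ‖w n x - W x‖ ^ 2 ∂ν) ⇝ 0 ∧
      ∃ ns : ℕ → ℕ, StrictMono ns ∧ ∀ᵐ x ∂ν, (fun n => w (ns n) x) ⇝ W x := by
  obtain ⟨W, hW⟩ := cauchySeq_tendsto_of_complete <| cauchySeq_of_le_tendsto_0
    (s := fun n => (hw n).toLp (w n)) b (fun n m N hN hM => by
      rw [dist_eq_norm]
      refine abs_le_of_sq_le_sq' ?_ (hb0 N) |>.2
      rw [norm_sq_toLp_sub]
      exact h n m N hN hM) hb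
  obtain ⟨ns, hns, hae⟩ := (tendstoInMeasure_of_tendsto_Lp hW).exists_seq_tendsto_ae
  have e := (tendsto_iff_norm_sub_tendsto_zero.1 hW).pow 2
  rw [zero_pow two_ne_zero] at e
  refine ⟨W, memLp W, e.congr fun n => ?_, ns, hns, ?_⟩
  · have e2 := norm_sq_toLp_sub (hw n) (memLp W)
    rwa [Lp.toLp_coeFn] at e2
  · filter_upwards [hae, ae_all_iff.2 fun n => (hw n).coeFn_toLp] with x h1 h2
    exact h1.congr fun n => h2 _

end

section

variable {H : Type*} [NormedAddCommGroup H] [InnerProductSpace ℝ H] {u g : ℝ → H}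

theorem integrableOn_inner_add (hu : ContinuousOn u (Icc 0 T)) (hg : g ∈L¹ T) (β : ℝ) :
    (fun s => 2 * inner ℝ (g s) (u s) + β * ‖u s‖ ^ 2) ∈L¹ T := by
  obtain ⟨B, hB⟩ := isCompact_Icc.exists_bound_of_continuousOn hu
  exact ((integrable_bilin (innerSL ℝ : H →L[ℝ] H →L[ℝ] ℝ) hg
    (hu.aestronglyMeasurable measurableSet_Icc)
    (ae_restrict_of_forall_mem measurableSet_Icc hB)).const_mul 2).add
    (continuousOn_const.mul (hu.norm.pow 2)).integrableOn_Icc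

theorem integral_inner_add_le {β δ : ℝ}
    (hT : 0 ≤ T) (hβ : 0 ≤ β) (hu : ContinuousOn u (Icc 0 T))
    (hg : g ∈L¹ T) (hδ : ∀ t ∈ Icc 0 T, ‖u t‖ ≤ δ)
    (hgδ : ∫ t in Icc 0 T, ‖g t‖ ≤ δ) :
    ∫ s in (0 : ℝ)..T, (2 * inner ℝ (g s) (u s) + β * ‖u s‖ ^ 2) ≤ (2 + β * T) * δ ^ 2 := by
  have hδ0 := (norm_nonneg _).trans (hδ 0 (left_mem_Icc.2 hT))
  rw [integral_of_le hT, ← integral_Icc_eq_integral_Ioc]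
  refine (setIntegral_mono_on (integrableOn_inner_add hu hg β) ((hg.norm.const_mul (2 * δ)).add
    (integrableOn_const_Icc (β * δ ^ 2))) measurableSet_Icc fun s hs => ?_).trans ?_
  · have e1 := real_inner_le_norm (g s) (u s)
    have e2 := mul_le_mul_of_nonneg_left (hδ s hs) (norm_nonneg (g s))
    have e3 : β * ‖u s‖ ^ 2 ≤ β * δ ^ 2 := by gcongr; exact hδ s hs
    simp only [Pi.add_apply]
    linarith
  · have e1 := integral_add (hg.norm.const_mul (2 * δ)) (integrableOn_const_Icc (β * δ ^ 2))
    have e2 : ∫ _ in Icc 0 T, β * δ ^ 2 = T * (β * δ ^ 2) := by simp [hT]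
    rw [integral_const_mul, e2] at e1
    refine e1.trans_le ?_
    linarith [mul_le_mul_of_nonneg_left hgδ (show 0 ≤ 2 * δ by positivity)]

end

section

variable
  (hS : IsL2Semigroup P T S) (hT : 0 < T) (φ : L2 d) {g : ℝ → L2 d} (hg : g ∈L¹ T)

include hS hT φ hg

theorem IsL2Semigroup.exists_classical_approx : ∃ (un Lun gn : ℕ → ℝ → L2 d) (δ : ℕ → ℝ),
      (∀ n, IsBddClassical S T (un n) (Lun n) (gn n)) ∧ Antitone δ ∧ (∀ n, 0 ≤ δ n) ∧
      δ ⇝ 0 ∧ (∀ n, ∀ t ∈ Icc 0 T, ‖un n t - mild S T φ g t‖ ≤ δ n) ∧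
      ∀ n, ∫ t in Icc 0 T, ‖gn n t - g t‖ ≤ δ n := by
  obtain ⟨M, hM1, hM⟩ := hS.semigroup.exists_bound T
  choose un Lun gn hun h1 h2 using fun n : ℕ =>
    hS.exists_isBddClassical hT φ hg (ε := 1 / ((n : ℝ) + 1)) (by positivity)
  have ha : Antitone fun n : ℕ => 1 / ((n : ℝ) + 1) := fun m n h => by
    have : (m : ℝ) ≤ n := Nat.cast_le.2 h
    simp only; gcongr
  refine ⟨un, Lun, gn, fun n => (2 * M) * (1 / ((n : ℝ) + 1)), hun, fun m n h =>
    mul_le_mul_of_nonneg_left (ha h) (by positivity), fun n => by positivity, ?_, fun n t ht => ?_,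
    fun n => ?_⟩
  · simpa using tendsto_one_div_add_atTop_nhds_zero_nat.const_mul (2 * M)
  · have hgi : gn n ∈L¹ T := (hun n).contg.integrableOn_Icc
    rw [(hun n).eq_mild hS.semigroup ht, ← hS.semigroup.mild_sub hgi hg ht]
    refine (IsC0Semigroup.norm_mild_le hM (hgi.sub hg) ht).trans ?_
    have h3 : ∫ s in t..T, ‖gn n s - g s‖ ≤ ∫ s in Icc 0 T, ‖gn n s - g s‖ := by
      rw [integral_of_le ht.2]
      exact setIntegral_mono_set (hgi.sub hg).norm (of_forall fun s => norm_nonneg _)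
        (Ioc_subset_Icc_self.trans (Icc_subset_Icc_left ht.1)).eventuallyLE
    calc _ ≤ M * (1 / ((n : ℝ) + 1) + 1 / ((n : ℝ) + 1)) := by
          gcongr
          · exact (h1 n).le
          · exact h3.trans (h2 n).le
      _ = _ := by ring
  · refine (h2 n).le.trans (le_mul_of_one_le_left (by positivity) (by linarith))

theorem IsL2Semigroup.continuousOn_mild : ContinuousOn (mild S T φ g) (Icc 0 T) := by
  obtain ⟨un, Lun, gn, δ, hun, -, -, hδ, hd, -⟩ := hS.exists_classical_approx hT φ hg
  have : TendstoUniformlyOn un (mild S T φ g) atTop (Icc 0 T) := by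
    refine Metric.tendstoUniformlyOn_iff.2 fun ε hε => ?_
    filter_upwards [hδ.eventually (gt_mem_nhds hε)] with n hn t ht
    rw [dist_comm, dist_eq_norm]
    exact (hd n t ht).trans_lt hn
  exact this.continuousOn (Frequently.of_forall fun n => (hun n).cont)

end

theorem AbsolutelyContinuousOnInterval.exp_comp {f : ℝ → ℝ} {a b : ℝ}
    (hf : AbsolutelyContinuousOnInterval f a b) :
    AbsolutelyContinuousOnInterval (fun x => exp (f x)) a b := by
  obtain ⟨B, hB⟩ := hf.exists_bound
  have hlip : ∀ x ∈ uIcc a b, ∀ y ∈ uIcc a b,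
      dist (exp (f x)) (exp (f y)) ≤ exp B * dist (f x) (f y) := by
    intro x hx y hy
    have h := Convex.norm_image_sub_le_of_norm_deriv_le (f := exp) (s := Iic B)
      (C := exp B) (x := f y) (y := f x) (fun z _ => Real.differentiableAt_exp)
      (fun z hz => by
        rw [Real.deriv_exp, norm_eq_abs, abs_of_pos (exp_pos z)]
        exact Real.exp_le_exp.2 hz) (convex_Iic B)
      ((le_abs_self _).trans (hB y hy)) ((le_abs_self _).trans (hB x hx))
    simpa [dist_eq, norm_eq_abs] using h
  rw [absolutelyContinuousOnInterval_iff] at hf ⊢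
  intro ε hε
  obtain ⟨δ, hδ, h⟩ := hf (ε / exp B) (by positivity)
  refine ⟨δ, hδ, fun E hE hlt => ?_⟩
  have hE' := hE
  obtain ⟨h1, -⟩ := hE'
  have h2 := h E hE hlt
  rw [lt_div_iff₀ (exp_pos B)] at h2
  refine lt_of_le_of_lt ?_ h2
  rw [sum_mul]
  exact sum_le_sum fun i hi => by
    rw [mul_comm]
    exact hlip _ (h1 i hi).1 _ (h1 i hi).2

/-- The weight `exp ∫₀ᵗ k`. -/
noncomputable def expInt (k : ℝ → ℝ) (t : ℝ) : ℝ := exp (∫ s in (0 : ℝ)..t, k s)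

section ExpInt

variable {k : ℝ → ℝ}

theorem expInt_pos (k : ℝ → ℝ) (t : ℝ) : 0 < expInt k t := exp_pos _

theorem expInt_mono (hk : k ∈L¹ T) (hk0 : ∀ t, 0 ≤ k t) {s t : ℝ} (hs : 0 ≤ s)
    (hst : s ≤ t) (ht : t ≤ T) : expInt k s ≤ expInt k t := by
  refine Real.exp_le_exp.2 (intervalIntegral.integral_mono_interval le_rfl hs hst
    (of_forall hk0) ?_)
  rw [intervalIntegrable_iff_integrableOn_Icc_of_le (hs.trans hst)]
  exact hk.mono_set (Icc_subset_Icc_right ht)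

theorem one_le_expInt (hk0 : ∀ t, 0 ≤ k t) {t : ℝ} (ht : 0 ≤ t) : 1 ≤ expInt k t :=
  Real.one_le_exp (intervalIntegral.integral_nonneg ht fun s _ => hk0 s)

section

variable (hT : 0 ≤ T) (hk : k ∈L¹ T)

include hT hk

theorem absolutelyContinuous_expInt :
    AbsolutelyContinuousOnInterval (expInt k) 0 T := by
  have hki :=
    (intervalIntegrable_iff_integrableOn_Icc_of_le hT).2 hk
  exact (hki.absolutelyContinuousOnInterval_intervalIntegral left_mem_uIcc).exp_comp

theorem continuousOn_expInt :
    ContinuousOn (expInt k) (Icc 0 T) := by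
  simpa [uIcc_of_le hT] using (absolutelyContinuous_expInt hT hk).continuousOn

theorem ae_hasDerivAt_expInt :
    ∀ᵐ t, t ∈ Icc 0 T → HasDerivAt (expInt k) (k t * expInt k t) t := by
  have hki :=
    (intervalIntegrable_iff_integrableOn_Icc_of_le hT).2 hk
  filter_upwards [hki.ae_hasDerivAt_integral] with t ht hmem
  have := (ht (by rwa [uIcc_of_le hT]) 0 left_mem_uIcc).exp
  rwa [mul_comm]

end

theorem integral_mul_expInt (hk : k ∈L¹ T) {t : ℝ}
    (ht : t ∈ Icc 0 T) : ∫ s in t..T, k s * expInt k s = expInt k T - expInt k t := by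
  have hT := ht.1.trans ht.2
  have hsub : uIcc t T ⊆ uIcc 0 T := by
    rw [uIcc_of_le hT, uIcc_of_le ht.2]; exact Icc_subset_Icc_left ht.1
  rw [← ((absolutelyContinuous_expInt hT hk).mono hsub).integral_deriv_eq_sub]
  refine intervalIntegral.integral_congr_ae ?_
  filter_upwards [ae_hasDerivAt_expInt hT hk] with s hs hmem
  rw [uIoc_of_le ht.2] at hmem
  exact (hs ⟨ht.1.trans hmem.1.le, hmem.2⟩).deriv.symm

theorem integral_mul_expInt_mul (hk : k ∈L¹ T) {h : ℝ → ℝ} {t : ℝ}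
    (hh : IntegrableOn h (Icc t T)) (ht : t ∈ Icc 0 T) :
    ∫ s in t..T, (k s * expInt k s * (∫ r in s..T, h r) - expInt k s * h s)
      = -(expInt k t * ∫ r in t..T, h r) := by
  have hT := ht.1.trans ht.2
  have hhi : IntervalIntegrable h volume t T :=
    (intervalIntegrable_iff_integrableOn_Icc_of_le ht.2).2 hh
  have hsub : uIcc t T ⊆ uIcc 0 T := by
    rw [uIcc_of_le hT, uIcc_of_le ht.2]; exact Icc_subset_Icc_left ht.1
  have hac : AbsolutelyContinuousOnInterval (fun s => ∫ r in s..T, h r) t T := by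
    have := (hhi.absolutelyContinuousOnInterval_intervalIntegral right_mem_uIcc).neg
    refine (congrArg (fun f => AbsolutelyContinuousOnInterval f t T) ?_).mp this
    funext s
    rw [Pi.neg_apply, ← integral_symm]
  have e := (((absolutelyContinuous_expInt hT hk).mono hsub).fun_mul hac).integral_deriv_eq_sub
  simp only [integral_same, mul_zero, zero_sub] at e
  rw [← e]
  refine intervalIntegral.integral_congr_ae ?_
  filter_upwards [ae_hasDerivAt_expInt hT hk, hhi.ae_hasDerivAt_integral] with s hs hs' hmem
  rw [uIoc_of_le ht.2] at hmem
  have hm : s ∈ Icc 0 T := ⟨ht.1.trans hmem.1.le, hmem.2⟩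
  have h1 : HasDerivAt (fun s => ∫ r in s..T, h r) (-h s) s := by
    have := (hs' (by rw [uIcc_of_le ht.2]; exact ⟨hmem.1.le, hmem.2⟩) T right_mem_uIcc).neg
    refine this.congr_of_eventuallyEq (of_forall fun x => ?_)
    simp only [Pi.neg_apply]
    rw [← integral_symm]
  rw [((hs hm).fun_mul h1).deriv]
  ring

/-- An integral inequality on all intervals `[s, T]` with `s ≥ t` implies its weighted form. -/
theorem expInt_mul_add_integral_le (hk : k ∈L¹ T) (hk0 : ∀ t, 0 ≤ k t)
    {Y h : ℝ → ℝ} {a t : ℝ} (ht : t ∈ Icc 0 T) (hY : ContinuousOn Y (Icc t T))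
    (hh : IntegrableOn h (Icc t T)) (hYh : ∀ s ∈ Icc t T, Y s ≤ a + ∫ r in s..T, h r) :
    expInt k t * Y t + ∫ s in t..T, k s * expInt k s * Y s
      ≤ expInt k T * a + ∫ s in t..T, expInt k s * h s := by
  have hT := ht.1.trans ht.2
  have hsub : Icc t T ⊆ Icc 0 T := Icc_subset_Icc_left ht.1
  have hi : ∀ {f : ℝ → ℝ}, IntegrableOn f (Icc t T) → IntervalIntegrable f volume t T := fun hf =>
    (intervalIntegrable_iff_integrableOn_Icc_of_le ht.2).2 hf
  have hΓ := (continuousOn_expInt hT hk).mono hsub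
  have hkΓ : IntegrableOn (fun s => k s * expInt k s) (Icc t T) :=
    (hk.mono_set hsub).mul_continuousOn hΓ isCompact_Icc
  have hΓh : IntegrableOn (fun s => expInt k s * h s) (Icc t T) :=
    hh.continuousOn_mul hΓ isCompact_Icc
  have hH : ContinuousOn (fun s => ∫ r in s..T, h r) (Icc t T) := by
    have := ((hi hh).absolutelyContinuousOnInterval_intervalIntegral right_mem_uIcc).continuousOn.neg
    rw [uIcc_of_le ht.2] at this
    refine this.congr fun s _ => ?_
    simp only [Pi.neg_apply]
    rw [← integral_symm]
  have hkH := hkΓ.mul_continuousOn hH isCompact_Icc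
  have hkY := hkΓ.mul_continuousOn hY isCompact_Icc
  have e1 := integral_mul_expInt hk ht
  have e2 := integral_mul_expInt_mul hk hh ht
  rw [intervalIntegral.integral_sub (hi hkH) (hi hΓh)] at e2
  have e3 : ∫ s in t..T, k s * expInt k s * Y s
      ≤ ∫ s in t..T, (a * (k s * expInt k s) + k s * expInt k s * ∫ r in s..T, h r) := by
    refine integral_mono_on ht.2 (hi hkY) ((hi (hkΓ.const_mul a)).add (hi hkH))
      fun s hs => ?_
    have := mul_le_mul_of_nonneg_left (hYh s hs) (mul_nonneg (hk0 s) (expInt_pos k s).le)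
    linarith
  rw [intervalIntegral.integral_add (hi (hkΓ.const_mul a)) (hi hkH),
    intervalIntegral.integral_const_mul, e1] at e3
  have e4 := mul_le_mul_of_nonneg_left (hYh t (left_mem_Icc.2 ht.2)) (expInt_pos k t).le
  linarith

end ExpInt

theorem real_inner_eq_mul (a b : ℝ) : inner ℝ a b = a * b := by simp [mul_comm]

theorem exists_mul_path {s : Set ℝ} {a b : ℝ → L2 d} (ha : ContinuousOn a s)
    (hb : ContinuousOn b s) {M : ℝ} (hM : ∀ t ∈ s, ∀ᵐ x, |b t x| ≤ M) :
    ∃ c : ℝ → L2 d, ContinuousOn c s ∧ ∀ t ∈ s, c t =ᵐ[volume] fun x => b t x * a t x := by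
  have hm : ∀ t ∈ s, MemLp (fun x => b t x * a t x) 2 volume := fun t ht =>
    Coefficients.memLp_bounded_smul (hM t ht) (memLp (a t))
  have h0 : ∀ t, ∃ c : L2 d, t ∈ s → c =ᵐ[volume] fun x => b t x * a t x := fun t => by
    by_cases ht : t ∈ s
    · exact ⟨(hm t ht).toLp _, fun _ => (hm t ht).coeFn_toLp⟩
    · exact ⟨0, fun h => (ht h).elim⟩
  choose c hc using h0
  refine ⟨c, fun t ht => ?_, fun t ht => hc t ht⟩
  rw [ContinuousWithinAt, tendsto_iff_seq_tendsto]
  intro x hx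
  rw [tendsto_nhdsWithin_iff] at hx
  obtain ⟨N, hN⟩ := eventually_atTop.1 hx.2
  have hxs : ∀ n, x (n + N) ∈ s := fun n => hN _ (Nat.le_add_left _ _)
  have hx' : Tendsto (fun n => x (n + N)) atTop (𝓝[s] t) := tendsto_nhdsWithin_iff.2
    ⟨(tendsto_add_atTop_iff_nat N).2 hx.1, of_forall hxs⟩
  refine (tendsto_add_atTop_iff_nat (f := c ∘ x) N).1 ?_
  rw [Lp.tendsto_Lp_iff_tendsto_eLpNorm']
  have hlim := tendsto_eLpNorm_smul_of_bounded (M := M)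
    (fun n => (memLp (a (x (n + N)))).1) (memLp (a t))
    (by
      have := (Lp.tendsto_Lp_iff_tendsto_eLpNorm' _ _).1 ((ha t ht).tendsto.comp hx')
      exact this)
    (fun n => (memLp (b (x (n + N)))).1) (fun n => hM _ (hxs n))
    (tendstoInMeasure_of_tendsto_Lp ((hb t ht).tendsto.comp hx'))
  refine hlim.congr fun n => eLpNorm_congr_ae ?_
  filter_upwards [hc _ (hxs n), hc t ht] with y h1 h2
  simp only [Pi.sub_apply, Function.comp_apply, h1, h2, smul_eq_mul]

/-- `w ↦ min(|w|², N²)` on `ℝ^k`. -/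
noncomputable def truncSq (N : ℝ) (w : Rn k) : ℝ := min ‖w‖ N ^ 2

section

variable (N : ℝ≥0)

include N

theorem lipschitzWith_truncSq : LipschitzWith (2 * N) (truncSq (k := k) N) := by
  refine LipschitzWith.of_dist_le_mul fun v w => ?_
  have h1 : |min ‖v‖ (N : ℝ) - min ‖w‖ N| ≤ ‖v - w‖ := by
    refine (abs_min_sub_min_le_max _ _ _ _).trans ?_
    rw [sub_self, abs_zero, max_eq_left (abs_nonneg _)]
    exact abs_norm_sub_norm_le v w
  have h2 : |min ‖v‖ (N : ℝ) + min ‖w‖ N| ≤ 2 * N := by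
    have e1 : 0 ≤ min ‖v‖ (N : ℝ) := le_min (norm_nonneg _) N.2
    have e2 : 0 ≤ min ‖w‖ (N : ℝ) := le_min (norm_nonneg _) N.2
    rw [abs_of_nonneg (add_nonneg e1 e2)]
    linarith [min_le_right ‖v‖ (N : ℝ), min_le_right ‖w‖ (N : ℝ)]
  rw [dist_eq, dist_eq_norm, truncSq, truncSq, sq_sub_sq, abs_mul]
  push_cast
  gcongr

theorem truncSq_zero : truncSq (k := k) N 0 = 0 := by simp [truncSq]

theorem truncSq_le (w : Rn k) : truncSq N w ≤ ‖w‖ ^ 2 := by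
  have : 0 ≤ min ‖w‖ (N : ℝ) := le_min (norm_nonneg _) N.2
  exact pow_le_pow_left₀ this (min_le_left _ _) 2

/-- `w ↦ min(|w|², N²)` from `L²(ℝ^d; ℝ^k)` to `L²`. -/
noncomputable def truncSqL (N : ℝ≥0) (w : L2v d k) : L2 d :=
  (lipschitzWith_truncSq N).compLp (truncSq_zero N) w

theorem continuous_truncSqL : Continuous (truncSqL (d := d) (k := k) N) :=
  (lipschitzWith_truncSq N).continuous_compLp (truncSq_zero N)

theorem coeFn_truncSqL (w : L2v d k) :
    truncSqL N w =ᵐ[volume] fun x => truncSq N (w x) :=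
  (lipschitzWith_truncSq N).coeFn_compLp (truncSq_zero N) w

end

theorem norm_sq_posPart_sub_le (a b : L2 d) : ‖Lp.posPart a‖ ^ 2 - ‖Lp.posPart b‖ ^ 2
    ≤ 2 * inner ℝ (Lp.posPart a) (a - b) := by
  rw [← integral_sq, ← integral_sq, ← integral_sub (integrable_sq _) (integrable_sq _),
    inner_def, ← integral_const_mul]
  refine integral_mono_ae ((integrable_sq _).sub (integrable_sq _))
    ((integrable_inner _ _).const_mul 2) ?_
  filter_upwards [Lp.coeFn_posPart a, Lp.coeFn_posPart b, ae_sub a b] with x h1 h2 h3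
  simp only [h1, h2, h3, real_inner_eq_mul]
  rcases le_total (a x) 0 with h | h <;> rcases le_total (b x) 0 with h' | h'
  · simp [h, h']
  · simp [h, h']
  · rw [max_eq_left h, max_eq_right h']; nlinarith
  · rw [max_eq_left h, max_eq_left h']; nlinarith [sq_nonneg (a x - b x)]

theorem tendsto_slope_reflect {E : Type*} [NormedAddCommGroup E] [NormedSpace ℝ E] {τ : ℝ}
    {u : ℝ → E} {u' : E} (hτ : τ ∈ Ico 0 T) (h : HasDerivWithinAt u u' (Icc 0 T) (T - τ)) :
    Tendsto (fun z => (z - τ)⁻¹ • (u (T - z) - u (T - τ))) (𝓝[>] τ) (𝓝 (-u')) := by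
  have h1 : HasDerivWithinAt (fun z => T - z) (-1) (Ioc τ T) τ := by
    simpa using ((hasDerivAt_id τ).const_sub T).hasDerivWithinAt
  have h2 : HasDerivWithinAt (fun z => u (T - z)) ((-1 : ℝ) • u') (Ioc τ T) τ :=
    scomp τ h h1 fun z hz => ⟨by linarith [hz.2], by linarith [hz.1, hτ.1]⟩
  rw [neg_one_smul, hasDerivWithinAt_iff_tendsto_slope' (by simp), nhdsWithin_Ioc_eq_nhdsGT hτ.2]
    at h2
  exact h2

theorem coeFn_sum_Lp {E ι : Type*} [NormedAddCommGroup E] {p : ℝ≥0∞} (s : Finset ι)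
    (f : ι → Lp E p (volume : Measure (Rn d))) :
    (∑ i ∈ s, f i : Lp E p (volume : Measure (Rn d))) =ᵐ[volume] fun x => ∑ i ∈ s, f i x := by
  classical
  induction s using Finset.induction_on with
  | empty =>
    simp only [Finset.sum_empty]
    exact coeFn_zero E p (volume : Measure (Rn d))
  | insert a s ha ih =>
    rw [sum_insert ha]
    filter_upwards [ae_add (f a) (∑ i ∈ s, f i), ih] with x h1 h2
    rw [h1, h2, sum_insert ha]

theorem integral_mul_le_sqrt {α : Type*} [MeasurableSpace α] {ν : Measure α} {f g : α → ℝ}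
    (hf : MemLp f 2 ν) (hg : MemLp g 2 ν) (hf0 : ∀ x, 0 ≤ f x) (hg0 : ∀ x, 0 ≤ g x) :
    ∫ x, f x * g x ∂ν ≤ √(∫ x, f x ^ 2 ∂ν) * √(∫ x, g x ^ 2 ∂ν) := by
  have h := integral_mul_le_Lp_mul_Lq_of_nonneg (p := 2) (q := 2) two_two
    (of_forall hf0) (of_forall hg0) (by simpa using hf) (by simpa using hg)
  simpa [Real.sqrt_eq_rpow] using h

theorem isClosed_L12 : IsClosed (L12 d : Set (L1 d × L2 d)) := by
  refine isClosed_of_closure_subset fun p hp => ?_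
  obtain ⟨x, hx, hlim⟩ := mem_closure_iff_seq_limit.1 hp
  have h1 : (fun n => (x n).1) ⇝ p.1 := (continuous_fst.tendsto p).comp hlim
  have h2 : (fun n => (x n).2) ⇝ p.2 := (continuous_snd.tendsto p).comp hlim
  obtain ⟨ns, hns, hae⟩ := (tendstoInMeasure_of_tendsto_Lp h1).exists_seq_tendsto_ae
  obtain ⟨ms, hms, hae'⟩ :=
    (tendstoInMeasure_of_tendsto_Lp (h2.comp hns.tendsto_atTop)).exists_seq_tendsto_ae
  change p.1 =ᵐ[volume] p.2
  have heq : ∀ᵐ y, ∀ n, (x n).1 y = (x n).2 y := ae_all_iff.2 fun n => hx n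
  filter_upwards [hae, hae', heq] with y h3 h4 h5
  refine tendsto_nhds_unique (h3.comp hms.tendsto_atTop) (h4.congr fun n => ?_)
  simp only [Function.comp_apply, h5]

theorem integral_ae_eq_of_ae_eq {a b : ℝ} (hab : a ≤ b) {f : ℝ → L1 d} {g : ℝ → L2 d}
    (hf : IntervalIntegrable f volume a b) (hg : IntervalIntegrable g volume a b)
    (h : ∀ s ∈ Ioc a b, f s =ᵐ[volume] g s) :
    ((∫ s in a..b, f s : L1 d) : Rn d → ℝ) =ᵐ[volume] (∫ s in a..b, g s : L2 d) := by
  rcases hab.eq_or_lt with rfl | hab'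
  · rw [integral_same, integral_same]
    exact (coeFn_zero _ _ _).trans (coeFn_zero _ _ _).symm
  have hf' := (intervalIntegrable_iff_integrableOn_Ioc_of_le hab).1 hf
  have hg' := (intervalIntegrable_iff_integrableOn_Ioc_of_le hab).1 hg
  have hp : IntegrableOn (fun s => (f s, g s)) (Ioc a b) := Integrable.prodMk hf' hg'
  have h1 := (L12 d).convex.set_average_mem isClosed_L12
    (t := Ioc a b) (μ := volume) (by simpa using hab') (by simp)
    (ae_restrict_of_forall_mem measurableSet_Ioc h) hp
  have h2 : (∫ s in Ioc a b, (f s, g s)) = (b - a) • ⨍ s in Ioc a b, (f s, g s) := by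
    rw [setAverage_eq, Real.volume_real_Ioc_of_le hab, smul_smul,
      mul_inv_cancel₀ (by linarith), one_smul]
  have h3 : (∫ s in Ioc a b, (f s, g s)) ∈ L12 d := h2 ▸ (L12 d).smul_mem _ h1
  have h4 : (∫ s in Ioc a b, (f s, g s)).1 =ᵐ[volume] (∫ s in Ioc a b, (f s, g s)).2 := h3
  rwa [fst_integral hp, snd_integral hp, ← integral_of_le hab,
    ← integral_of_le hab] at h4

theorem IsL2Semigroup.mild_ae_eq (hS : IsL2Semigroup P T S) {φ₁ : L1 d} {φ₂ : L2 d}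
    (hφ : φ₁ =ᵐ[volume] φ₂) {g₁ : ℝ → L1 d} {g₂ : ℝ → L2 d} (h1 : g₁ ∈L¹ T)
    (h2 : g₂ ∈L¹ T) (h : ∀ s ∈ Icc 0 T, g₁ s =ᵐ[volume] g₂ s) {t : ℝ}
    (ht : t ∈ Icc 0 T) :
    (mild S T φ₂ g₂ t : L2 d) =ᵐ[volume]
      (mild (fun t : ℝ => P t.toNNReal) T φ₁ g₁ t : L1 d) := by
  have hi1 : IntervalIntegrable g₁ volume t T :=
    (intervalIntegrable_iff_integrableOn_Icc_of_le ht.2).2 (h1.mono_set (Icc_subset_Icc_left ht.1))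
  have hi2 : IntervalIntegrable g₂ volume t T :=
    (intervalIntegrable_iff_integrableOn_Icc_of_le ht.2).2 (h2.mono_set (Icc_subset_Icc_left ht.1))
  refine (coeFn_add _ _).trans (EventuallyEq.trans ?_ (coeFn_add _ _).symm)
  refine EventuallyEq.add (hS.compat (T - t) ⟨(φ₁, φ₂), hφ⟩) ?_
  refine (integral_ae_eq_of_ae_eq ht.2 (hS.semigroup_one.intervalIntegrable hi1)
    (hS.semigroup.intervalIntegrable hi2) fun s hs => ?_).symm
  exact (hS.compat (s - t) ⟨(g₁ s, g₂ s), h s ⟨ht.1.trans hs.1.le, hs.2⟩⟩).symm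

theorem truncSq_eq (N : ℝ≥0) (w : Rn k) : truncSq N w = min (‖w‖ ^ 2) ((N : ℝ) ^ 2) := by
  rw [truncSq]
  rcases le_total ‖w‖ (N : ℝ) with h | h
  · rw [min_eq_left h, min_eq_left (pow_le_pow_left₀ (norm_nonneg _) h 2)]
  · have h2 : (N : ℝ) ^ 2 ≤ ‖w‖ ^ 2 := pow_le_pow_left₀ N.2 h 2
    rw [min_eq_right h, min_eq_right h2]

theorem lipschitzWith_min_const (c : ℝ) : LipschitzWith 1 fun y : ℝ => min y c :=
  LipschitzWith.id.min_const c

/-- `f ↦ min(f, N²)` on `L¹`. -/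
noncomputable def minL (N : ℝ≥0) (f : L1 d) : L1 d :=
  (lipschitzWith_min_const ((N : ℝ) ^ 2)).compLp (by simp) f

theorem coeFn_minL (N : ℝ≥0) (f : L1 d) :
    minL N f =ᵐ[volume] fun x => min (f x) ((N : ℝ) ^ 2) :=
  (lipschitzWith_min_const ((N : ℝ) ^ 2)).coeFn_compLp (by simp) f

theorem continuous_minL (N : ℝ≥0) : Continuous (minL (d := d) N) :=
  (lipschitzWith_min_const ((N : ℝ) ^ 2)).continuous_compLp (by simp)

theorem norm_minL_sub_le (N : ℝ≥0) (f : L1 d) : ‖minL N f - f‖ ≤ ‖f‖ := by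
  refine Lp.norm_le_norm_of_ae_le ?_
  filter_upwards [coeFn_minL N f, ae_sub (minL N f) f] with x h1 h2
  rw [h2, h1, norm_eq_abs, norm_eq_abs]
  rcases le_total (f x) ((N : ℝ) ^ 2) with h | h
  · rw [min_eq_left h, sub_self, abs_zero]; exact abs_nonneg _
  · have hN : 0 ≤ (N : ℝ) ^ 2 := sq_nonneg _
    rw [min_eq_right h, abs_of_nonpos (by linarith), abs_of_nonneg (hN.trans h)]
    linarith

theorem tendsto_minL (f : L1 d) : (fun n : ℕ => minL (n : ℝ≥0) f) ⇝ f := by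
  rw [tendsto_iff_norm_sub_tendsto_zero]
  have e : ∀ n : ℕ, ‖minL (n : ℝ≥0) f - f‖ = ∫ x, |min (f x) ((n : ℝ) ^ 2) - f x| := fun n => by
    rw [L1.norm_eq_integral_norm]
    refine integral_congr_ae ?_
    filter_upwards [coeFn_minL (n : ℝ≥0) f, ae_sub (minL (n : ℝ≥0) f) f] with x h1 h2
    rw [h2, h1, norm_eq_abs]
    simp
  simp only [e]
  rw [show (0 : ℝ) = ∫ _ : Rn d, (0 : ℝ) by simp]
  refine tendsto_integral_of_dominated_convergence (fun x => |f x|) (fun n => ?_)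
    (integrable_coeFn f).abs (fun n => of_forall fun x => ?_)
    (of_forall fun x => ?_)
  · have := (memLp f).1
    exact ((this.inf aestronglyMeasurable_const).sub this).norm
  · rw [norm_eq_abs, abs_abs]
    rcases le_total (f x) ((n : ℝ) ^ 2) with h | h
    · rw [min_eq_left h, sub_self, abs_zero]; exact abs_nonneg _
    · have hN : 0 ≤ (n : ℝ) ^ 2 := sq_nonneg _
      rw [min_eq_right h, abs_of_nonpos (by linarith), abs_of_nonneg (hN.trans h)]
      linarith
  · refine tendsto_const_nhds.congr' ?_
    filter_upwards [eventually_ge_atTop (max ⌈|f x|⌉₊ 1)] with n hn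
    have h1 : |f x| ≤ n := (Nat.le_ceil _).trans (Nat.cast_le.2 ((le_max_left _ _).trans hn))
    have h2 : (1 : ℝ) ≤ n := by exact_mod_cast (le_max_right _ _).trans hn
    rw [min_eq_left (by nlinarith [le_abs_self (f x)]), sub_self, abs_zero]

theorem tendsto_integral_minL {s : Set ℝ} {q : ℝ → L1 d}
    (hq : IntegrableOn q s) :
    (fun n : ℕ => ∫ t in s, ‖minL (n : ℝ≥0) (q t) - q t‖) ⇝ 0 := by
  rw [show (0 : ℝ) = ∫ _ in s, (0 : ℝ) by simp]
  refine tendsto_integral_of_dominated_convergence (fun t => ‖q t‖) (fun n => ?_) hq.norm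
    (fun n => of_forall fun t => ?_) (of_forall fun t => ?_)
  · exact (((continuous_minL (n : ℝ≥0)).comp_aestronglyMeasurable hq.1).sub hq.1).norm
  · rw [norm_norm]; exact norm_minL_sub_le _ _
  · exact tendsto_iff_norm_sub_tendsto_zero.1 (tendsto_minL (q t))

section

variable {s : Set ℝ}

theorem continuousOn_dotL {v w : ℝ → L2v d k} (hv : ContinuousOn v s)
    (hw : ContinuousOn w s) : ContinuousOn (fun t => dotL (v t) (w t)) s :=
  (dotL.continuous.comp_continuousOn hv).clm_apply hw

theorem continuousOn_mulL {v w : ℝ → L2 d} (hv : ContinuousOn v s)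
    (hw : ContinuousOn w s) : ContinuousOn (fun t => mulL (v t) (w t)) s :=
  (mulL.continuous.comp_continuousOn hv).clm_apply hw

theorem continuousOn_sum_two_smul_sub {E ι : Type*} [NormedAddCommGroup E] [NormedSpace ℝ E]
    [Fintype ι] {a b : ι → ℝ → E} (ha : ∀ i, ContinuousOn (a i) s)
    (hb : ∀ i, ContinuousOn (b i) s) :
    ContinuousOn (fun t => ∑ i, ((2 : ℝ) • a i t - (2 : ℝ) • b i t)) s :=
  continuousOn_finsetSum _ fun i _ => ((ha i).const_smul 2).sub ((hb i).const_smul 2)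

end

namespace Coefficients

/-- `2⟨g, u⟩ - 2|D_σ u|²` as an element of `L¹`. -/
noncomputable def sqSource (Q : Coefficients d k) (u g : Fin l → ℝ → L2 d) (t : ℝ) : L1 d :=
  ∑ i, ((2 : ℝ) • mulL (g i t) (u i t) - (2 : ℝ) • dotL (Q.Dσ (u i t)) (Q.Dσ (u i t)))

end Coefficients

section BilinSq

variable {E G : Type*} [NormedAddCommGroup E] [NormedSpace ℝ E] [NormedAddCommGroup G]
  [NormedSpace ℝ G] {α : Type*} [MeasurableSpace α] {ν : Measure α}

section

variable (B : E →L[ℝ] E →L[ℝ] G) {a : α → E} (ha : MemLp a 2 ν)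

include B ha

theorem integrable_bilin_sq :
    Integrable (fun t => B (a t) (a t)) ν := by
  refine (ha.integrable_norm_pow (by norm_num)).const_mul ‖B‖ |>.mono'
    (B.continuous₂.comp_aestronglyMeasurable (ha.1.prodMk ha.1)) (of_forall fun t => ?_)
  refine (B.le_opNorm₂ _ _).trans_eq ?_
  ring

theorem tendsto_integral_bilin_sq {an : ℕ → α → E} (han : ∀ n, MemLp (an n) 2 ν)
    (h : (fun n => ∫ t, ‖an n t - a t‖ ^ 2 ∂ν) ⇝ 0) :
    (fun n => ∫ t, ‖B (an n t) (an n t) - B (a t) (a t)‖ ∂ν) ⇝ 0 := by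
  have hlim : (fun n => ‖B‖ * (2 * (√(∫ t, ‖a t‖ ^ 2 ∂ν) * √(∫ t, ‖an n t - a t‖ ^ 2 ∂ν))
      + ∫ t, ‖an n t - a t‖ ^ 2 ∂ν)) ⇝ 0 := by
    have h1 : (fun n => √(∫ t, ‖an n t - a t‖ ^ 2 ∂ν)) ⇝ 0 := by
      simpa using h.sqrt
    simpa using (((h1.const_mul (√(∫ t, ‖a t‖ ^ 2 ∂ν))).const_mul 2).add h).const_mul ‖B‖
  refine squeeze_zero (fun n => integral_nonneg fun _ => norm_nonneg _) (fun n => ?_) hlim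
  have hd := (han n).sub ha
  have hsq : Integrable (fun t => ‖an n t - a t‖ ^ 2) ν := hd.integrable_norm_pow (by norm_num)
  have hm : Integrable (fun t => ‖a t‖ * ‖an n t - a t‖) ν := ha.norm.integrable_mul hd.norm
  have hcs := integral_mul_le_sqrt ha.norm hd.norm (fun _ => norm_nonneg _) fun _ => norm_nonneg _
  simp only [Pi.sub_apply] at hcs
  refine (integral_mono_ae ((integrable_bilin_sq B (han n)).sub (integrable_bilin_sq B ha)).norm
    (((hm.const_mul 2).add hsq).const_mul ‖B‖) (of_forall fun t => ?_)).trans ?_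
  · simp only [Pi.sub_apply, Pi.add_apply]
    have e : B (an n t) (an n t) - B (a t) (a t) = B (a t) (an n t - a t) + B (an n t - a t) (a t)
        + B (an n t - a t) (an n t - a t) := by
      simp only [map_sub, sub_apply]; abel
    rw [e]
    refine (norm_add₃_le).trans ?_
    have e1 := B.le_opNorm₂ (a t) (an n t - a t)
    have e2 := B.le_opNorm₂ (an n t - a t) (a t)
    have e3 := B.le_opNorm₂ (an n t - a t) (an n t - a t)
    linarith
  · have e := integral_add (hm.const_mul 2) hsq
    rw [integral_const_mul]
    simp only [Pi.add_apply]
    rw [e, integral_const_mul]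
    refine mul_le_mul_of_nonneg_left ?_ (norm_nonneg B)
    linarith

end

end BilinSq

theorem tendsto_bilin {E F G : Type*} [NormedAddCommGroup E] [NormedSpace ℝ E]
    [NormedAddCommGroup F] [NormedSpace ℝ F] [NormedAddCommGroup G] [NormedSpace ℝ G]
    (B : E →L[ℝ] F →L[ℝ] G) {u : ℕ → E} {v : ℕ → F} {a : E} {b : F} (hu : u ⇝ a)
    (hv : v ⇝ b) : (fun n => B (u n) (v n)) ⇝ B a b :=
  (B.continuous₂.tendsto (a, b)).comp (hu.prodMk_nhds hv)

theorem ae_le_const_of_forall_setIntegral_le {w : L1 d} {c : ℝ}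
    (h : ∀ s, MeasurableSet s → volume s < ⊤ → ∫ x in s, w x ≤ (volume s).toReal * c) :
    ∀ᵐ x, w x ≤ c := by
  have hc : ∀ s : Set (Rn d), volume s < ⊤ → IntegrableOn (fun _ : Rn d => c) s volume :=
    fun s hs => integrableOn_const hs.ne
  have h1 := ae_nonneg_of_forall_setIntegral_nonneg_of_sigmaFinite
    (μ := (volume : Measure (Rn d))) (f := fun x => c - w x)
    (fun s _ hs => (hc s hs).sub (integrable_coeFn w).integrableOn)
    (fun s hs hsf => by
      have e := integral_sub (hc s hsf) (integrable_coeFn w).integrableOn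
      rw [e, setIntegral_const, smul_eq_mul]
      exact sub_nonneg.2 (h s hs hsf))
  filter_upwards [h1] with x hx
  simpa using hx

/-- `f ↦ ∫_s f`. -/
noncomputable def setIntegralL (s : Set (Rn d)) : L1 d →L[ℝ] ℝ :=
  LinearMap.mkContinuous
    { toFun := fun f => ∫ x in s, f x
      map_add' := fun f g => by
        rw [← integral_add (integrable_coeFn f).integrableOn (integrable_coeFn g).integrableOn]
        exact integral_congr_ae (ae_restrict_of_ae (coeFn_add f g))
      map_smul' := fun c f => by
        rw [id_apply, smul_eq_mul, ← integral_const_mul]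
        exact integral_congr_ae (ae_restrict_of_ae (coeFn_smul c f)) } 1
    fun f => by
      rw [one_mul, L1.norm_eq_integral_norm]
      exact (norm_integral_le_integral_norm _).trans
        (setIntegral_le_integral (integrable_coeFn f).norm (of_forall fun _ => norm_nonneg _))

theorem setIntegralL_apply (s : Set (Rn d)) (f : L1 d) :
    setIntegralL s f = ∫ x in s, f x := rfl

theorem setIntegralL_mono (s : Set (Rn d)) {f g : L1 d} (h : f ≤ g) :
    setIntegralL s f ≤ setIntegralL s g := by
  rw [setIntegralL_apply, setIntegralL_apply]
  exact setIntegral_mono_ae (integrable_coeFn f).integrableOn (integrable_coeFn g).integrableOn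
    ((coeFn_le f g).2 h)

theorem setIntegralL_le_of_ae_le {s : Set (Rn d)} (hs : volume s < ⊤) {f : L1 d} {c : ℝ}
    (h : ∀ᵐ x, |f x| ≤ c) : setIntegralL s f ≤ (volume s).toReal * c := by
  rw [setIntegralL_apply]
  refine (setIntegral_mono_ae (integrable_coeFn f).integrableOn
    (integrableOn_const (C := c) hs.ne) (h.mono fun x hx => (le_abs_self _).trans hx)).trans_eq ?_
  rw [setIntegral_const, smul_eq_mul]
  rfl

namespace IsL2Semigroup

theorem mono (hS : IsL2Semigroup P T S) (t : ℝ≥0) {f g : L1 d} (h : f ≤ g) : P t f ≤ P t g := by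
  have := hS.pos t (g - f) (sub_nonneg.2 h)
  rwa [map_sub, sub_nonneg] at this

/-- A linear integral inequality in `L¹` implies a pointwise bound. -/
theorem exists_sup_bound (hS : IsL2Semigroup P T S) : ∃ C : ℝ, 0 ≤ C ∧
    ∀ {w b : ℝ → L1 d} {κ : ℝ → ℝ} {R : ℝ → L1 d} {a c : ℝ}, 0 ≤ a → 0 ≤ c →
      ContinuousOn w (Icc 0 T) → R ∈L¹ T → b ∈L¹ T →
      κ ∈L¹ T → (∀ t, 0 ≤ κ t) →
      (∀ t ∈ Icc 0 T, w t ≤ mild (fun t : ℝ => P t.toNNReal) T (w T) R t) →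
      (∀ᵐ t ∂(dt T), R t ≤ b t + κ t • w t) →
      (∀ᵐ x, |w T x| ≤ a) → (∀ᵐ t ∂(dt T), ∀ᵐ x, |b t x| ≤ c) →
      ∀ t ∈ Icc 0 T, ∀ᵐ x, w t x ≤ expInt κ T * C * (a + T * c) := by
  obtain ⟨C, hC0, hC⟩ := hS.bound_one
  refine ⟨C, hC0, ?_⟩
  intro w b κ R a c ha0 hc0 hw hR hb hκ hκ0 hle hRle ha hc t ht
  have hQ := hS.semigroup_one
  set Q : ℝ → L1 d →L[ℝ] L1 d := fun t => P t.toNNReal with hQdef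
  refine ae_le_const_of_forall_setIntegral_le fun O _ hsf => ?_
  have hsub : Icc t T ⊆ Icc 0 T := Icc_subset_Icc_left ht.1
  set ℓ := setIntegralL O with hℓ
  have hint : ∀ {g : ℝ → L1 d} {r : ℝ}, g ∈L¹ T → r ∈ Icc t T →
      IntervalIntegrable (fun s => Q (s - t) (g s)) volume r T := fun hg hr =>
    hQ.intervalIntegrable ((intervalIntegrable_iff_integrableOn_Icc_of_le hr.2).2
      (hg.mono_set (Icc_subset_Icc_left (ht.1.trans hr.1))))
  have hintℓ : ∀ {g : ℝ → L1 d}, g ∈L¹ T →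
      IntegrableOn (fun s => ℓ (Q (s - t) (g s))) (Icc t T) := fun hg =>
    ℓ.integrable_comp ((intervalIntegrable_iff_integrableOn_Icc_of_le ht.2).1
      (hint hg (left_mem_Icc.2 ht.2)))
  set Y : ℝ → ℝ := fun s => ℓ (Q (s - t) (w s)) with hY
  have hYc : ContinuousOn Y (Icc t T) := by
    refine ℓ.continuous.comp_continuousOn ?_
    have := hQ.cont
    exact (this.comp_continuousOn (s := Icc t T) (f := fun s => (s - t, w s))
      ((continuous_id.sub continuous_const).continuousOn.prodMk (hw.mono hsub)))
  have hstep : ∀ r ∈ Icc t T, Y r ≤ ℓ (Q (T - t) (w T)) + ∫ s in r..T, ℓ (Q (s - t) (R s)) := by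
    intro r hr
    have hr0 : r ∈ Icc 0 T := hsub hr
    have h1 := hS.mono (r - t).toNNReal (hle r hr0)
    have h2 : Q (r - t) (mild Q T (w T) R r) = Q (T - t) (w T) + ∫ s in r..T, Q (s - t) (R s) := by
      have hadd : ∀ s, r ≤ s → ∀ x, Q (r - t) (Q (s - r) x) = Q (s - t) x := fun s hs x => by
        have := hQ.add (r - t) (s - r) (by linarith [hr.1]) (by linarith)
        rw [show s - t = (r - t) + (s - r) by ring, this]; rfl
      rw [mild, map_add, hadd T hr.2]
      congr 1
      have hRi : IntervalIntegrable R volume r T :=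
        (intervalIntegrable_iff_integrableOn_Icc_of_le hr.2).2
          (hR.mono_set (Icc_subset_Icc_left hr0.1))
      rw [← intervalIntegral_comp_comm _ (hQ.intervalIntegrable hRi)]
      refine integral_congr fun s hs => ?_
      rw [uIcc_of_le hr.2] at hs
      exact hadd s hs.1 _
    have h3 := setIntegralL_mono O h1
    change Y r ≤ ℓ (Q (r - t) (mild Q T (w T) R r)) at h3
    rw [h2, map_add, ← intervalIntegral_comp_comm _ (hint hR hr)] at h3
    exact h3
  have hκY : IntegrableOn (fun s => κ s * Y s) (Icc t T) :=
    (hκ.mono_set hsub).mul_continuousOn hYc isCompact_Icc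
  have hstep' : ∀ r ∈ Icc t T, Y r ≤ ℓ (Q (T - t) (w T))
      + ∫ s in r..T, (ℓ (Q (s - t) (b s)) + κ s * Y s) := by
    intro r hr
    refine (hstep r hr).trans (add_le_add_right ?_ _)
    have hsr : Icc r T ⊆ Icc t T := Icc_subset_Icc_left hr.1
    refine integral_mono_ae_restrict hr.2
      ((intervalIntegrable_iff_integrableOn_Icc_of_le hr.2).2 ((hintℓ hR).mono_set hsr))
      ((intervalIntegrable_iff_integrableOn_Icc_of_le hr.2).2
        (((hintℓ hb).add hκY).mono_set hsr)) ?_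
    filter_upwards [ae_restrict_of_ae_restrict_of_subset (hsr.trans hsub) hRle] with s hs
    have h1 := setIntegralL_mono O (hS.mono (s - t).toNNReal hs)
    rw [map_add, map_add, map_smul, map_smul, smul_eq_mul] at h1
    exact h1
  have key := expInt_mul_add_integral_le hκ hκ0 ht hYc ((hintℓ hb).add hκY) hstep'
  have hΓ := (continuousOn_expInt (ht.1.trans ht.2) hκ).mono hsub
  have hi : ∀ {f : ℝ → ℝ}, IntegrableOn f (Icc t T) → IntervalIntegrable f volume t T := fun hf =>
    (intervalIntegrable_iff_integrableOn_Icc_of_le ht.2).2 hf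
  have e1 : ∫ s in t..T, expInt κ s * (ℓ (Q (s - t) (b s)) + κ s * Y s)
      = (∫ s in t..T, expInt κ s * ℓ (Q (s - t) (b s))) + ∫ s in t..T, κ s * expInt κ s * Y s := by
    rw [← intervalIntegral.integral_add (hi ((hintℓ hb).continuousOn_mul hΓ isCompact_Icc))
      (hi (((hκ.mono_set hsub).mul_continuousOn hΓ isCompact_Icc).mul_continuousOn hYc
        isCompact_Icc))]
    exact integral_congr fun s _ => by ring
  simp only [Pi.add_apply] at key
  rw [e1] at key
  set V := (volume O).toReal with hV
  have hV0 : 0 ≤ V := toReal_nonneg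
  have hla : ℓ (Q (T - t) (w T)) ≤ V * (C * a) :=
    setIntegralL_le_of_ae_le hsf (hC _ (by linarith [ht.1]) _ _ ha)
  have hb0 : ∫ s in t..T, expInt κ s * ℓ (Q (s - t) (b s)) ≤ (T - t) * (expInt κ T * (V * (C * c))) := by
    rw [← smul_eq_mul (T - t), ← intervalIntegral.integral_const]
    refine integral_mono_ae_restrict ht.2
      (hi ((hintℓ hb).continuousOn_mul hΓ isCompact_Icc)) intervalIntegrable_const ?_
    filter_upwards [ae_restrict_of_ae_restrict_of_subset hsub hc, ae_mem_Icc]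
      with s hs hmem
    have h1 : ℓ (Q (s - t) (b s)) ≤ V * (C * c) := setIntegralL_le_of_ae_le hsf
      (hC _ (by linarith [hmem.2, ht.1]) _ _ hs)
    have hm := expInt_mono hκ hκ0 (ht.1.trans hmem.1) hmem.2 le_rfl
    exact (mul_le_mul_of_nonneg_left h1 (expInt_pos _ _).le).trans
      (mul_le_mul_of_nonneg_right hm (by positivity))
  have hYt : Y t = ∫ x in O, w t x := by
    simp only [hY, sub_self]
    rw [hQ.zero_apply]; rfl
  rw [← hYt]
  have hT0 : 0 ≤ T := ht.1.trans ht.2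
  have hG0 := expInt_pos κ T
  rcases le_or_gt (Y t) 0 with hneg | hpos
  · exact hneg.trans (by positivity)
  have f1 : Y t ≤ expInt κ t * Y t := le_mul_of_one_le_left hpos.le (one_le_expInt hκ0 ht.1)
  have f2 := mul_le_mul_of_nonneg_left hla hG0.le
  have f3 : (T - t) * (expInt κ T * (V * (C * c))) ≤ T * (expInt κ T * (V * (C * c))) :=
    mul_le_mul_of_nonneg_right (by linarith [ht.1]) (by positivity)
  calc Y t ≤ expInt κ T * (V * (C * a)) + T * (expInt κ T * (V * (C * c))) := by linarith
    _ = _ := by ring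

end IsL2Semigroup

theorem norm_vec_sq (w : Fin l → L2 d) (x : Rn d) : ‖vec w x‖ ^ 2 = ∑ i, w i x ^ 2 := by
  rw [norm_sq_eq]
  simp [vec]

/-- The matrix-valued function with rows `wⁱ`. -/
noncomputable def matOf (w : Fin l → L2v d k) (x : Rn d) : Mat l k :=
  toLp 2 fun p => w p.1 x p.2

theorem norm_matOf_sq (w : Fin l → L2v d k) (x : Rn d) :
    ‖matOf w x‖ ^ 2 = ∑ i, ‖w i x‖ ^ 2 := by
  simp only [norm_sq_eq]
  simp only [matOf, Fintype.sum_prod_type]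

theorem inner_vec (v w : Fin l → L2 d) (x : Rn d) :
    inner ℝ (vec v x) (vec w x) = ∑ i, v i x * w i x := by
  simp [vec, PiLp.inner_apply, mul_comm]

theorem vec_sub_ae (v w : Fin l → L2 d) :
    ∀ᵐ x, vec (fun i => v i - w i) x = vec v x - vec w x := by
  filter_upwards [ae_all_iff.2 fun i => ae_sub (v i) (w i)] with x hx
  ext i
  change (v i - w i : L2 d) x = v i x - w i x
  rw [hx i]

theorem matOf_sub_ae (v w : Fin l → L2v d k) :
    ∀ᵐ x, matOf (fun i => v i - w i) x = matOf v x - matOf w x := by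
  filter_upwards [ae_all_iff.2 fun i => ae_sub (v i) (w i)] with x hx
  ext i
  change (v i.1 - w i.1 : L2v d k) x i.2 = v i.1 x i.2 - w i.1 x i.2
  rw [hx i.1, PiLp.sub_apply]

namespace Coefficients

section

variable (Q) (u : Fin l → L2 d)

include Q u

theorem DσMat_eq :
    Q.DσMat u = matOf fun i => Q.Dσ (u i) := rfl

theorem norm_DσMat_sq (x : Rn d) :
    ‖Q.DσMat u x‖ ^ 2 = ∑ i, ‖Q.Dσ (u i) x‖ ^ 2 := by
  rw [DσMat_eq, norm_matOf_sq]

end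

end Coefficients

theorem exists_path {F : ℝ × Rn d → ℝ} (hF : Measurable F) : ∃ g : ℝ → L2 d, StronglyMeasurable g ∧
    ∀ t, MemLp (fun x => F (t, x)) 2 volume → g t =ᵐ[volume] fun x => F (t, x) := by
  classical
  set s : Set ℝ := {t | ∫⁻ x, ‖F (t, x)‖ₑ ^ (2 : ℝ) < ⊤} with hs
  have hsm : MeasurableSet s :=
    measurableSet_lt (Measurable.lintegral_prod_right' (f := fun p => ‖F p‖ₑ ^ (2 : ℝ))
      (by fun_prop)) measurable_const
  have hmem : ∀ t, t ∈ s ↔ MemLp (fun x => F (t, x)) 2 volume := fun t => by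
    have hm : AEStronglyMeasurable (fun x => F (t, x)) volume :=
      (hF.comp measurable_prodMk_left).aestronglyMeasurable
    simp only [MemLp, hm, true_and]
    rw [eLpNorm_lt_top_iff_lintegral_rpow_enorm_lt_top two_ne_zero ENNReal.ofNat_ne_top]
    simp [hs]
  let g : ℝ → L2 d := fun t => if h : t ∈ s then ((hmem t).1 h).toLp _ else 0
  refine ⟨g, stronglyMeasurable_slice
    (h := fun p : ℝ × Rn d => (s ×ˢ (univ : Set (Rn d))).indicator F p)
    (hF.indicator (hsm.prod MeasurableSet.univ)) fun t => ?_, fun t ht => ?_⟩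
  · by_cases h : t ∈ s
    · simp only [g, h, dif_pos]
      filter_upwards [((hmem t).1 h).coeFn_toLp] with x hx
      simp [hx, indicator, h]
    · simp only [g, h, dif_neg, not_false_eq_true]
      filter_upwards [ae_zero (E := ℝ) (p := 2)] with x hx
      simp [hx, indicator, h]
  · simp only [g, (hmem t).2 ht, dif_pos]
    exact ht.coeFn_toLp

theorem exists_rep {ν : Measure ℝ} {v : ℝ → L2 d} (hv : AEStronglyMeasurable v ν) :
    ∃ V : ℝ × Rn d → ℝ, Measurable V ∧ ∀ᵐ t ∂ν, v t =ᵐ[volume] fun x => V (t, x) := by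
  refine ⟨fun p => evalL2 (hv.mk v p.1) p.2, measurable_evalL2 hv.stronglyMeasurable_mk, ?_⟩
  filter_upwards [hv.ae_eq_mk] with t ht
  rw [ht]
  exact evalL2_ae _

theorem exists_rep_vector {ν : Measure ℝ} {v : ℝ → L2v d k} (hv : AEStronglyMeasurable v ν) :
    ∃ V : Fin k → ℝ × Rn d → ℝ, (∀ j, Measurable (V j)) ∧
      ∀ᵐ t ∂ν, ∀ᵐ x, ∀ j, v t x j = V j (t, x) := by
  let q : Fin k → L2v d k →L[ℝ] L2 d := fun j =>
    (proj (𝕜 := ℝ) j : Rn k →L[ℝ] ℝ).compLpL 2 volume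
  choose V hV hVe using fun j => exists_rep ((q j).continuous.comp_aestronglyMeasurable hv)
  refine ⟨V, hV, ?_⟩
  filter_upwards [ae_all_iff.2 hVe] with t ht
  filter_upwards [ae_all_iff.2 ht, ae_all_iff.2 fun j =>
    (proj (𝕜 := ℝ) j : Rn k →L[ℝ] ℝ).coeFn_compLpL (v t)] with x h1 h2 j
  rw [← h1 j, h2 j]
  rfl

/-- `f(t, ·, u, W)` belongs to `L¹([0,T]; L²)`, with components `gⁱ`. -/
def IsSubstAt (T : ℝ) (f : Nonlin d k l) (u : Fin l → ℝ → L2 d) (W : Fin l → ℝ → L2v d k)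
    (g : Fin l → ℝ → L2 d) : Prop :=
  (∀ i, g i ∈L¹ T) ∧
  ∀ᵐ t ∂(dt T), ∀ᵐ x, vec (fun i => g i t) x
    = f t x (vec (fun j => u j t) x) (matOf (fun j => W j t) x)

theorem Coefficients.isSubst_iff
    {u g : Fin l → ℝ → L2 d} :
    Q.IsSubst T f u g ↔ IsSubstAt T f u (fun j t => Q.Dσ (u j t)) g := by
  refine and_congr_right fun _ => eventually_congr (of_forall fun t => ?_)
  rw [← ae_all_iff]
  refine eventually_congr (of_forall fun x => ?_)
  rw [PiLp.ext_iff]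
  rfl

theorem norm_path_le {v h : L2 d} (hle : ∀ᵐ x, ‖v x‖ ≤ h x) : ‖v‖ ≤ ‖h‖ :=
  Lp.norm_le_norm_of_ae_le (hle.mono fun _ hx => hx.trans (le_abs_self _))

/-- Measurable nonlinearities may be evaluated along measurable paths. -/
theorem exists_isSubstAt (hf : f.IsMeasurable) {u : Fin l → ℝ → L2 d}
    {W : Fin l → ℝ → L2v d k}
    (hu : ∀ i, AEStronglyMeasurable (u i) (dt T))
    (hW : ∀ i, AEStronglyMeasurable (W i) (dt T))
    {h : ℝ → L2 d} (hh : h ∈L¹ T)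
    (hle : ∀ᵐ t ∂(dt T), ∀ᵐ x,
      ‖f t x (vec (fun j => u j t) x) (matOf (fun j => W j t) x)‖ ≤ h t x) :
    ∃ g, IsSubstAt T f u W g := by
  choose U hU hUe using fun i => exists_rep (hu i)
  choose V hV hVe using fun i => exists_rep_vector (hW i)
  let F : ℝ × Rn d → Rn l := fun p => f p.1 p.2 (toLp 2 fun i => U i p)
    (toLp 2 fun q => V q.1 q.2 p)
  have hF : Measurable F := by
    refine Measurable.comp (g := fun p : ℝ × Rn d × Rn l × Mat l k => f p.1 p.2.1 p.2.2.1 p.2.2.2) hf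
      (measurable_fst.prodMk (measurable_snd.prodMk (Measurable.prodMk ?_ ?_)))
    · exact (continuous_toLp 2 _).measurable.comp (measurable_pi_lambda _ hU)
    · exact (continuous_toLp 2 _).measurable.comp (measurable_pi_lambda _ fun q => hV q.1 q.2)
  have hFe : ∀ᵐ t ∂(dt T), ∀ᵐ x,
      F (t, x) = f t x (vec (fun j => u j t) x) (matOf (fun j => W j t) x) := by
    filter_upwards [ae_all_iff.2 hUe, ae_all_iff.2 hVe] with t h1 h2
    filter_upwards [ae_all_iff.2 h1, ae_all_iff.2 h2] with x h3 h4
    have e1 : vec (fun j => u j t) x = toLp 2 fun i => U i (t, x) := by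
      simp only [vec, h3]
    have e2 : matOf (fun j => W j t) x = toLp 2 fun q => V q.1 q.2 (t, x) := by
      simp only [matOf, h4]
    rw [e1, e2]
  have hFi : ∀ i, Measurable fun p => F p i := fun i =>
    (proj (𝕜 := ℝ) i : Rn l →L[ℝ] ℝ).measurable.comp hF
  choose g hg hge using fun i => exists_path (hFi i)
  have key : ∀ᵐ t ∂(dt T), ∀ i, (g i t =ᵐ[volume] fun x => F (t, x) i) ∧
      ‖g i t‖ ≤ ‖h t‖ := by
    filter_upwards [hFe, hle] with t h1 h2 i
    have hb : ∀ᵐ x, ‖F (t, x) i‖ ≤ h t x := by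
      filter_upwards [h1, h2] with x h3 h4
      exact (PiLp.norm_apply_le _ i).trans (by rwa [h3])
    have e := hge i t ((memLp (h t)).mono'
      ((hFi i).comp measurable_prodMk_left).aestronglyMeasurable hb)
    refine ⟨e, norm_path_le ?_⟩
    filter_upwards [e, hb] with x h3 h4
    rwa [h3]
  refine ⟨g, fun i => hh.norm.mono' (hg i).aestronglyMeasurable ?_, ?_⟩
  · filter_upwards [key] with t ht using (ht i).2
  · filter_upwards [key, hFe] with t h1 h2
    filter_upwards [ae_all_iff.2 fun i => (h1 i).1, h2] with x h3 h4
    rw [← h4]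
    ext i
    exact h3 i

theorem sum_inner_eq_integral (g u : Fin l → L2 d) :
    Integrable (fun x => inner ℝ (vec g x) (vec u x)) ∧
      ∑ i, inner ℝ (g i) (u i) = ∫ x, inner ℝ (vec g x) (vec u x) := by
  have h : ∀ i, Integrable fun x => inner ℝ (g i x) (u i x) := fun i => integrable_inner _ _
  simp only [inner_vec, ← real_inner_eq_mul, inner_def]
  exact ⟨integrable_finsetSum _ fun i _ => h i, (integral_finsetSum _ fun i _ => h i).symm⟩

theorem sum_norm_sq_vec (u : Fin l → L2 d) :
    Integrable (fun x => ‖vec u x‖ ^ 2) ∧ ∑ i, ‖u i‖ ^ 2 = ∫ x, ‖vec u x‖ ^ 2 := by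
  simpa [real_inner_self_eq_norm_sq] using sum_inner_eq_integral u u

theorem sum_norm_sq_matOf (W : Fin l → L2v d k) :
    Integrable (fun x => ‖matOf W x‖ ^ 2) ∧ ∑ i, ‖W i‖ ^ 2 = ∫ x, ‖matOf W x‖ ^ 2 := by
  have h : ∀ i, Integrable fun x => inner ℝ (W i x) (W i x) := fun i => integrable_inner _ _
  simp only [norm_matOf_sq]
  simp only [← real_inner_self_eq_norm_sq, inner_def]
  exact ⟨integrable_finsetSum _ fun i _ => h i, (integral_finsetSum _ fun i _ => h i).symm⟩

theorem two_sum_inner_le {g u : Fin l → L2 d} {W : Fin l → L2v d k} {κ c : ℝ} {r : Rn d → ℝ}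
    (hr : Integrable r) (h : ∀ᵐ x, 2 * inner ℝ (vec g x) (vec u x)
      ≤ κ * ‖vec u x‖ ^ 2 + c * ‖matOf W x‖ ^ 2 + r x) :
    2 * ∑ i, inner ℝ (g i) (u i) ≤ κ * ∑ i, ‖u i‖ ^ 2 + c * ∑ i, ‖W i‖ ^ 2 + ∫ x, r x := by
  obtain ⟨i1, e1⟩ := sum_inner_eq_integral g u
  obtain ⟨i2, e2⟩ := sum_norm_sq_vec u
  obtain ⟨i3, e3⟩ := sum_norm_sq_matOf W
  have e := integral_mono_ae (i1.const_mul 2) (((i2.const_mul κ).add (i3.const_mul c)).add hr) h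
  have e4 := integral_add ((i2.const_mul κ).add (i3.const_mul c)) hr
  have e5 := integral_add (i2.const_mul κ) (i3.const_mul c)
  simp only [Pi.add_apply] at e e4 e5
  rw [e4, e5, integral_const_mul, integral_const_mul, integral_const_mul] at e
  rwa [e1, e2, e3]

/-- The contraction principle in `L²([0,T]; B)^l` with the weight `Γ`, for a map that is given by its
graph. -/
theorem exists_fixed_of_contraction {B : Type*} [NormedAddCommGroup B] [InnerProductSpace ℝ B]
    [CompleteSpace B] {Γ : ℝ → ℝ} (hΓ : ContinuousOn Γ (Icc 0 T))
    (hΓ1 : ∀ t ∈ Icc 0 T, 1 ≤ Γ t) (R : (Fin l → ℝ → B) → (Fin l → ℝ → B) → Prop)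
    (hex : ∀ v, (∀ i, MemLp (v i) 2 (dt T)) →
      ∃ w, (∀ i, MemLp (w i) 2 (dt T)) ∧ R v w)
    (hc : ∀ v v' w w', (∀ i, MemLp (v i) 2 (dt T)) →
      (∀ i, MemLp (v' i) 2 (dt T)) → R v w → R v' w' →
      ∫ t in Icc 0 T, Γ t * ∑ i, ‖w i t - w' i t‖ ^ 2
        ≤ 1 / 4 * ∫ t in Icc 0 T, Γ t * ∑ i, ‖v i t - v' i t‖ ^ 2) :
    ∃ v w, (∀ i, MemLp (v i) 2 (dt T)) ∧ R v w ∧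
      ∀ᵐ t ∂(dt T), ∀ i, w i t = v i t := by
  set m : Measure ℝ := (dt T) with hm
  set D : ℝ → ℝ≥0∞ := fun t => ofReal (Γ t) with hD
  have hΓm : AEMeasurable Γ m := hΓ.aemeasurable measurableSet_Icc
  have hDm : AEMeasurable D m := hΓm.ennreal_ofReal
  set ν : Measure ℝ := m.withDensity D with hν
  obtain ⟨M, hM⟩ := (isCompact_Icc.image_of_continuousOn hΓ).bddAbove
  have h1 : m ≤ ν := by
    have : m.withDensity 1 ≤ ν := withDensity_mono (by
      filter_upwards [ae_mem_Icc] with t ht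
      simpa [hD] using ofReal_le_ofReal (hΓ1 t ht))
    rwa [withDensity_one] at this
  have h2 : ν ≤ ofReal M • m := by
    rw [← withDensity_const]
    refine withDensity_mono ?_
    filter_upwards [ae_mem_Icc] with t ht
    exact ofReal_le_ofReal (hM (mem_image_of_mem _ ht))
  have to1 : ∀ {v : ℝ → B}, MemLp v 2 ν → MemLp v 2 m := fun h => h.mono_measure h1
  have to2 : ∀ {v : ℝ → B}, MemLp v 2 m → MemLp v 2 ν := fun h =>
    (h.smul_measure ofReal_ne_top).mono_measure h2
  have hint : ∀ f : ℝ → ℝ, ∫ t, f t ∂ν = ∫ t, Γ t * f t ∂m := fun f => by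
    rw [hν, integral_withDensity_eq_integral_toReal_smul₀ hDm (by simp [hD])]
    refine integral_congr_ae ?_
    filter_upwards [ae_mem_Icc] with t ht
    simp only [hD, smul_eq_mul]
    rw [ENNReal.toReal_ofReal (by linarith [hΓ1 t ht])]
  have hX : ∀ v w : Fin l → ℝ → B, (hv : ∀ i, MemLp (v i) 2 ν) → (hw : ∀ i, MemLp (w i) 2 ν) →
      ∑ i, ‖(hv i).toLp (v i) - (hw i).toLp (w i)‖ ^ 2
        = ∫ t, Γ t * ∑ i, ‖v i t - w i t‖ ^ 2 ∂m := fun v w hv hw => by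
    rw [← hint, integral_finsetSum _ fun i _ => ?_]
    · simp only [norm_sq_toLp_sub]
    · exact ((hv i).sub (hw i)).integrable_norm_pow two_ne_zero
  choose Φ hΦm hΦ using hex
  let X := PiLp 2 fun _ : Fin l => Lp B 2 ν
  have hx : ∀ x : X, ∀ i, MemLp (x i : ℝ → B) 2 m := fun x i => to1 (memLp (x i))
  let Ψ : X → X := fun x => toLp 2 fun i => (to2 (hΦm _ (hx x) i)).toLp _
  have hΨ : ContractingWith (1 / 2) Ψ := by
    refine ⟨by norm_num [← NNReal.coe_lt_coe], LipschitzWith.of_dist_le_mul fun x y => ?_⟩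
    refine abs_le_of_sq_le_sq' ?_ (by positivity) |>.2
    rw [dist_eq_norm, dist_eq_norm, mul_pow, PiLp.norm_sq_eq_of_L2, PiLp.norm_sq_eq_of_L2]
    have e1 := hX _ _ (fun i => to2 (hΦm _ (hx x) i)) (fun i => to2 (hΦm _ (hx y) i))
    have e2 := hX (fun i => x i) (fun i => y i) (fun i => memLp (x i)) (fun i => memLp (y i))
    simp only [Lp.toLp_coeFn] at e2
    calc ∑ i, ‖(Ψ x - Ψ y) i‖ ^ 2 = _ := e1
      _ ≤ _ := hc _ _ _ _ (hx x) (hx y) (hΦ _ (hx x)) (hΦ _ (hx y))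
      _ = _ := by rw [← e2]; norm_num; rfl
  obtain ⟨x, hfix, -⟩ := hΨ.exists_fixedPoint 0 (edist_ne_top _ _)
  refine ⟨fun i => x i, Φ _ (hx x), hx x, hΦ _ (hx x), ae_all_iff.2 fun i => ?_⟩
  have e : Ψ x i = x i := congrArg (fun y : X => y i) hfix
  have e' := (to2 (hΦm _ (hx x) i)).coeFn_toLp
  have e'' : ((to2 (hΦm _ (hx x) i)).toLp _ : Lp B 2 ν) = x i := e
  rw [e''] at e'
  exact (h1.absolutelyContinuous.ae_le e'.symm)

notation:max u:max "@@" t:max => fun i => u i t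

section NormPath

variable {E : Type*} [NormedAddCommGroup E]

/-- The function `|w|`. -/
noncomputable def normL (w : Lp E 2 (volume : Measure (Rn d))) : L2 d :=
  lipschitzWith_one_norm.compLp norm_zero w

section

variable (w : Lp E 2 (volume : Measure (Rn d)))

include w

theorem coeFn_normL : normL w =ᵐ[volume] fun x => ‖w x‖ :=
  lipschitzWith_one_norm.coeFn_compLp norm_zero w

theorem norm_normL : ‖normL w‖ = ‖w‖ := by
  have h : ∀ᵐ x, ‖normL w x‖ = ‖w x‖ := by
    filter_upwards [coeFn_normL w] with x hx
    rw [hx, norm_norm]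
  exact le_antisymm (Lp.norm_le_norm_of_ae_le (h.mono fun _ hx => hx.le))
    (Lp.norm_le_norm_of_ae_le (h.mono fun _ hx => hx.ge))

end

theorem integrableOn_sum_normL {w : Fin l → ℝ → Lp E 2 (volume : Measure (Rn d))}
    (hw : ∀ i, w i ∈L¹ T) :
    (fun t => ∑ i, normL (w i t)) ∈L¹ T :=
  integrable_finsetSum _ fun i _ => (hw i).norm.mono'
    ((lipschitzWith_one_norm.continuous_compLp norm_zero).comp_aestronglyMeasurable
      (hw i).aestronglyMeasurable) (of_forall fun t => (norm_normL (w i t)).le)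

theorem le_sum_normL {w : Fin l → Lp E 2 (volume : Measure (Rn d))} {N : Rn d → ℝ}
    (hN : ∀ x, N x ^ 2 = ∑ i, ‖w i x‖ ^ 2) : ∀ᵐ x, N x ≤ (∑ i, normL (w i) : L2 d) x := by
  filter_upwards [coeFn_sum_Lp Finset.univ fun i => normL (w i),
    ae_all_iff.2 fun i => coeFn_normL (w i)] with x h1 h2
  rw [h1]
  refine abs_le_of_sq_le_sq' ?_ (sum_nonneg fun i _ => by rw [h2]; positivity) |>.2
  simp only [hN, h2]
  exact Finset.sum_sq_le_sq_sum_of_nonneg fun i _ => norm_nonneg _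

theorem norm_vec_le_sum (u : Fin l → L2 d) : ∀ᵐ x, ‖vec u x‖ ≤ (∑ i, normL (u i) : L2 d) x :=
  le_sum_normL fun x => by simp only [norm_vec_sq, norm_eq_abs, sq_abs]

theorem norm_matOf_le_sum (W : Fin l → L2v d k) :
    ∀ᵐ x, ‖matOf W x‖ ≤ (∑ i, normL (W i) : L2 d) x := le_sum_normL fun _ => norm_matOf_sq _ _

theorem add_smul_le_coeFn (hC : 0 ≤ C) (h : L2 d) {w : L2 d} {N : Rn d → ℝ}
    (hN : ∀ᵐ x, N x ≤ w x) : ∀ᵐ x, h x + C * N x ≤ (h + C • w : L2 d) x := by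
  filter_upwards [hN, ae_add h (C • w), ae_smul C w] with x h1 h2 h3
  rw [h2, h3]
  exact add_le_add_right (mul_le_mul_of_nonneg_left h1 hC) _

theorem integrableOn_of_memLp_two {E : Type*} [NormedAddCommGroup E] {v : ℝ → E}
    (hv : MemLp v 2 (dt T)) : v ∈L¹ T :=
  hv.integrable one_le_two

end NormPath

namespace Coefficients

/-- `u` solves the mild form of the system with nonlinearity `f`, and `g = f(·, ·, u, D_σ u)`. -/
def IsMildSol (Q : Coefficients d k) (T : ℝ) (S : ℝ → L2 d →L[ℝ] L2 d) (φ : Fin l → L2 d)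
    (f : Nonlin d k l) (u g : Fin l → ℝ → L2 d) : Prop :=
  Q.IsSubst T f u g ∧ ∀ i, u i = mild S T (φ i) (g i)

end Coefficients

section RadialProj

variable {E : Type*} [NormedAddCommGroup E] [InnerProductSpace ℝ E]

/-- The projection to the closed ball of radius `R`. -/
noncomputable def radialProj (R : ℝ) (z : E) : E := (max 1 (‖z‖ / R))⁻¹ • z

theorem smul_radialProj (R : ℝ) (z : E) : (max 1 (‖z‖ / R)) • radialProj R z = z := by
  rw [radialProj, smul_smul, mul_inv_cancel₀ (by positivity), one_smul]

theorem norm_radialProj (R : ℝ) (z : E) :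
    ‖radialProj R z‖ = (max 1 (‖z‖ / R))⁻¹ * ‖z‖ := by
  rw [radialProj, norm_smul, norm_of_nonneg (by positivity)]

theorem radialProj_of_norm_le {R : ℝ} {z : E} (h : ‖z‖ ≤ R) : radialProj R z = z := by
  have : ‖z‖ / R ≤ 1 := div_le_one_of_le₀ h ((norm_nonneg z).trans h)
  simp [radialProj, max_eq_left this]

theorem norm_radialProj_of_le {R : ℝ} (hR : 0 < R) {z : E} (h : R ≤ ‖z‖) : ‖radialProj R z‖ = R := by
  have h1 : 1 ≤ ‖z‖ / R := (one_le_div hR).2 h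
  have h2 : 0 < ‖z‖ := hR.trans_le h
  rw [norm_radialProj, max_eq_right h1]
  field_simp

theorem norm_radialProj_le {R : ℝ} (hR : 0 < R) (z : E) : ‖radialProj R z‖ ≤ R := by
  rcases le_total ‖z‖ R with h | h
  · rwa [radialProj_of_norm_le h]
  · exact (norm_radialProj_of_le hR h).le

theorem norm_radialProj_le_norm (R : ℝ) (z : E) : ‖radialProj R z‖ ≤ ‖z‖ := by
  rw [norm_radialProj]
  exact mul_le_of_le_one_left (norm_nonneg z) (inv_le_one_of_one_le₀ (le_max_left _ _))

section

variable {R : ℝ} (hR : 0 < R)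

include hR

theorem norm_radialProj_sub_le (z : E) : ‖radialProj R z - z‖ ≤ ‖z‖ ^ 2 / R := by
  rcases le_total ‖z‖ R with h | h
  · rw [radialProj_of_norm_le h, sub_self, norm_zero]; positivity
  · have h1 : 1 ≤ ‖z‖ / R := (one_le_div hR).2 h
    have h2 : 0 < ‖z‖ := hR.trans_le h
    have e : radialProj R z - z = (R / ‖z‖ - 1) • z := by
      rw [radialProj, max_eq_right h1, sub_smul, one_smul, inv_div]
    rw [e, norm_smul, norm_eq_abs, abs_of_nonpos (by
      rw [sub_nonpos, div_le_one h2]; exact h), le_div_iff₀ hR]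
    have : -(R / ‖z‖ - 1) ≤ 1 := by have : 0 ≤ R / ‖z‖ := by positivity
                                    linarith
    nlinarith [mul_le_mul_of_nonneg_right this h2.le]

theorem norm_radialProj_sub_radialProj_le (a b : E) :
    ‖radialProj R a - radialProj R b‖ ≤ ‖a - b‖ := by
  have main : ∀ a b : E, ‖b‖ ≤ ‖a‖ → ‖radialProj R a - radialProj R b‖ ≤ ‖a - b‖ := by
    intro a b hab
    rcases le_total ‖a‖ R with ha | ha
    · rw [radialProj_of_norm_le ha, radialProj_of_norm_le (hab.trans ha)]
    set s := max 1 (‖a‖ / R) with hs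
    set r := max 1 (‖b‖ / R) with hr
    have hs1 : 1 ≤ s := le_max_left _ _
    have hr1 : 1 ≤ r := le_max_left _ _
    set p := radialProj R a with hp
    set q := radialProj R b with hq
    have hpR : ‖p‖ = R := norm_radialProj_of_le hR ha
    have hqR : ‖q‖ ≤ R := norm_radialProj_le hR b
    have hpq := real_inner_le_norm p q
    have ha' : a = s • p := (smul_radialProj R a).symm
    have hb' : b = r • q := (smul_radialProj R b).symm
    have e1 : ‖a - b‖ ^ 2 = s ^ 2 * ‖p‖ ^ 2 - 2 * (s * r) * inner ℝ p q + r ^ 2 * ‖q‖ ^ 2 := by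
      rw [ha', hb', norm_sub_sq_real, norm_smul, norm_smul, real_inner_smul_left,
        real_inner_smul_right, norm_of_nonneg (by linarith), norm_of_nonneg (by linarith)]
      ring
    refine abs_le_of_sq_le_sq' ?_ (norm_nonneg _) |>.2
    rw [e1, norm_sub_sq_real, hpR]
    rw [hpR] at hpq
    rcases le_total ‖b‖ R with hb | hb
    · have hr' : r = 1 := max_eq_left (div_le_one_of_le₀ hb hR.le)
      rw [hr']
      have h1 : inner ℝ p q ≤ R ^ 2 := by nlinarith
      nlinarith [mul_le_mul_of_nonneg_left h1 (by linarith : (0 : ℝ) ≤ s - 1),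
        mul_nonneg (mul_self_nonneg (s - 1)) (sq_nonneg R)]
    · have hq' : ‖q‖ = R := norm_radialProj_of_le hR hb
      rw [hq'] at hpq ⊢
      nlinarith [mul_le_mul_of_nonneg_left hpq (by nlinarith : (0 : ℝ) ≤ s * r - 1),
        mul_nonneg (sq_nonneg (s - r)) (sq_nonneg R)]
  rcases le_total ‖b‖ ‖a‖ with h | h
  · exact main a b h
  · rw [norm_sub_rev, norm_sub_rev a]; exact main b a h

theorem continuous_radialProj : Continuous (radialProj R : E → E) :=
  (LipschitzWith.of_dist_le_mul (K := 1) fun a b => by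
    simpa [dist_eq_norm] using norm_radialProj_sub_radialProj_le hR a b).continuous

end

end RadialProj

/-- The structure conditions on a nonlinearity: measurability, Lipschitz continuity in `z`,
monotonicity and continuity in `y`, and local boundedness in `y` by functions in `L¹([0,T]; L²)`. -/
structure Nonlin.IsMonotone (f : Nonlin d k l) (T C : ℝ) (μ : ℝ → ℝ) : Prop where
  meas : f.IsMeasurable
  lip : ∀ t ∈ Icc 0 T, ∀ x y z z', ‖f t x y z - f t x y z'‖ ≤ C * ‖z - z'‖
  mono : ∀ t ∈ Icc 0 T, ∀ x y y' z,
    inner ℝ (y - y') (f t x y z - f t x y' z) ≤ μ t * ‖y - y'‖ ^ 2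
  cont : ∀ t ∈ Icc 0 T, ∀ x z, Continuous fun y => f t x y z
  dom : ∀ R > 0, ∃ h : ℝ → L2 d, h ∈L¹ T ∧
    ∀ᵐ t ∂(dt T), ∀ᵐ x, ∀ y, ‖y‖ ≤ R → ‖f t x y 0‖ ≤ h t x

theorem norm_sub_eq_eLpNorm (v w : L2 d) :
    ‖v - w‖ = (eLpNorm (fun x => v x - w x) 2 volume).toReal := by
  rw [Lp.norm_def, eLpNorm_congr_ae (coeFn_sub v w)]
  rfl

/-- Convergence in `L¹([0,T]; L²)` by dominated convergence in both variables. -/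
theorem tendsto_integral_of_dominated_slices {gn : ℕ → ℝ → L2 d} {g h : ℝ → L2 d}
    (hgn : ∀ n, gn n ∈L¹ T) (hg : g ∈L¹ T)
    (hh : h ∈L¹ T)
    (hle : ∀ n, ∀ᵐ t ∂(dt T), ∀ᵐ x, ‖gn n t x - g t x‖ ≤ h t x)
    (hlim : ∀ᵐ t ∂(dt T), ∀ ns : ℕ → ℕ, Tendsto ns atTop atTop →
      ∃ ms : ℕ → ℕ, ∀ᵐ x, (fun n => gn (ns (ms n)) t x) ⇝ g t x) :
    (fun n => ∫ t in Icc 0 T, ‖gn n t - g t‖) ⇝ 0 := by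
  suffices h0 : (fun n => ∫ t in Icc 0 T, ‖gn n t - g t‖) ⇝ (∫ _ in Icc 0 T, (0 : ℝ)) by simpa using h0
  refine tendsto_integral_of_dominated_convergence (fun t => ‖h t‖)
    (fun n => ((hgn n).sub hg).norm.aestronglyMeasurable) hh.norm (fun n => ?_) ?_
  · filter_upwards [hle n] with t ht
    rw [norm_norm]
    refine norm_path_le ?_
    filter_upwards [ht, ae_sub (gn n t) (g t)] with x h1 h2
    rwa [h2]
  · filter_upwards [ae_all_iff.2 hle, hlim] with t h1 h2
    refine tendsto_of_subseq_tendsto fun ns hns => ?_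
    obtain ⟨ms, hms⟩ := h2 ns hns
    refine ⟨ms, ?_⟩
    simp only [norm_sub_eq_eLpNorm]
    exact (ENNReal.tendsto_toReal ENNReal.zero_ne_top).comp (tendsto_eLpNorm_two_of_dominated
      (fun n => (memLp _).1) (memLp _).1 (memLp (h t))
      (fun n => h1 _) hms)

theorem Nonlin.IsMonotone.norm_le
    (hf : f.IsMonotone T C μ) {t : ℝ} (ht : t ∈ Icc 0 T) (x : Rn d) (y : Rn l) (z : Mat l k) :
    ‖f t x y z‖ ≤ ‖f t x y 0‖ + C * ‖z‖ := by
  have h1 := hf.lip t ht x y z 0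
  rw [sub_zero] at h1
  linarith [norm_le_norm_add_norm_sub' (f t x y z) (f t x y 0)]

theorem Nonlin.IsMeasurable.comp (hf : f.IsMeasurable)
    {ζ : ℝ × Rn d × Rn l × Mat l k → Mat l k} (hζ : Measurable ζ) :
    Nonlin.IsMeasurable fun t x y z => f t x y (ζ (t, x, y, z)) := by
  have h : Measurable fun p : ℝ × Rn d × Rn l × Mat l k => (p.1, p.2.1, p.2.2.1, ζ p) := by fun_prop
  exact Measurable.comp (g := fun p : ℝ × Rn d × Rn l × Mat l k => f p.1 p.2.1 p.2.2.1 p.2.2.2) hf h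

theorem two_inner_le_of_monotone {Y : Type*} [NormedAddCommGroup Y] [InnerProductSpace ℝ Y]
    {G G' F₁ F₂ F₃ p p' : Y} {m c ζ α e e' s R : ℝ} (hC : 0 ≤ C) (hc : 0 < c) (hα : 0 ≤ α)
    (h12 : inner ℝ (p - p') (F₁ - F₂) ≤ m * ‖p - p'‖ ^ 2) (h23 : ‖F₂ - F₃‖ ≤ C * (ζ + α))
    (hG : ‖G - F₁‖ ≤ e) (hG' : ‖G' - F₃‖ ≤ e') (hs : ‖p - p'‖ ≤ s) (hR : ‖p - p'‖ ≤ 2 * R) :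
    2 * inner ℝ (G - G') (p - p') ≤ (2 * |m| + C ^ 2 / c) * ‖p - p'‖ ^ 2 + c * ζ ^ 2
      + (4 * R * C * α + 2 * (e + e') * s) := by
  have e1 : G - G' = (G - F₁) + (F₁ - F₂) + (F₂ - F₃) - (G' - F₃) := by abel
  set δ := p - p' with hδ
  rw [e1, inner_sub_left, inner_add_left, inner_add_left, real_inner_comm]
  have i1 := (real_inner_le_norm δ (G - F₁)).trans (mul_le_mul_of_nonneg_left hG (norm_nonneg δ))
  have i2 := (real_inner_le_norm (F₂ - F₃) δ).trans (mul_le_mul_of_nonneg_right h23 (norm_nonneg δ))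
  have i3 := (abs_le.1 (abs_real_inner_le_norm (G' - F₃) δ)).1
  have i4 := mul_le_mul_of_nonneg_right hG' (norm_nonneg δ)
  rw [real_inner_comm] at h12
  have i5 : (e + e') * ‖δ‖ ≤ (e + e') * s := mul_le_mul_of_nonneg_left hs
    (add_nonneg ((norm_nonneg _).trans hG) ((norm_nonneg _).trans hG'))
  have i6 : C * α * ‖δ‖ ≤ C * α * (2 * R) := mul_le_mul_of_nonneg_left hR (by positivity)
  have i7 : 2 * C * ζ * ‖δ‖ ≤ C ^ 2 / c * ‖δ‖ ^ 2 + c * ζ ^ 2 := by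
    have : 0 ≤ (C * ‖δ‖ - c * ζ) ^ 2 / c := by positivity
    have e2 : (C * ‖δ‖ - c * ζ) ^ 2 / c = C ^ 2 / c * ‖δ‖ ^ 2 + c * ζ ^ 2 - 2 * C * ζ * ‖δ‖ := by
      field_simp
      ring
    linarith
  have i8 : m * ‖δ‖ ^ 2 ≤ |m| * ‖δ‖ ^ 2 := mul_le_mul_of_nonneg_right (le_abs_self m) (sq_nonneg _)
  nlinarith

theorem MeasureTheory.IntegrableOn.two_abs_add (hμ : μ ∈L¹ T)
    (c : ℝ) : (fun t => 2 * |μ t| + c) ∈L¹ T :=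
  (hμ.norm.const_mul 2).add (integrableOn_const_Icc c)

/-- The monotonicity condition for nonlinearities that are Lipschitz in `z`. -/
theorem Nonlin.IsMonotone.two_inner_sub_le
    (hf : f.IsMonotone T C μ) (hC : 0 ≤ C) {c : ℝ} (hc : 0 < c) {t : ℝ} (ht : t ∈ Icc 0 T) (x : Rn d)
    (y y' : Rn l) (z z' : Mat l k) : 2 * inner ℝ (f t x y z - f t x y' z') (y - y')
      ≤ (2 * |μ t| + C ^ 2 / c) * ‖y - y'‖ ^ 2 + c * ‖z - z'‖ ^ 2 := by
  simpa using two_inner_le_of_monotone (e := 0) (e' := 0) (α := 0) (R := ‖y - y'‖) hC hc le_rfl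
    (hf.mono t ht x y y' z) (by simpa using hf.lip t ht x y' z z') (by simp) (by simp) le_rfl
    (by linarith [norm_nonneg (y - y')])

theorem exists_subseq_vec {w : ℕ → Fin l → L2 d} {v : Fin l → L2 d}
    (h : ∀ i, (fun n => w n i) ⇝ v i) : ∃ ms : ℕ → ℕ, StrictMono ms ∧
      ∀ᵐ x, (fun n => vec (w (ms n)) x) ⇝ vec v x := by
  have h0 : (fun n => (∑ i, normL (w n i - v i) : L2 d)) ⇝ 0 := by
    rw [tendsto_zero_iff_norm_tendsto_zero]
    refine squeeze_zero (fun n => norm_nonneg _) (fun n => norm_sum_le _ _) ?_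
    simp only [norm_normL]
    have h1 := tendsto_finsetSum Finset.univ fun i _ => tendsto_iff_norm_sub_tendsto_zero.1 (h i)
    rwa [Finset.sum_const_zero] at h1
  obtain ⟨ms, hms, hae⟩ := (tendstoInMeasure_of_tendsto_Lp h0).exists_seq_tendsto_ae
  refine ⟨ms, hms, ?_⟩
  filter_upwards [hae, ae_zero (E := ℝ) (p := 2),
    ae_all_iff.2 fun n => norm_vec_le_sum fun i => w n i - v i,
    ae_all_iff.2 fun n => vec_sub_ae (w n) v] with x h1 h2 h3 h4
  rw [h2] at h1
  rw [tendsto_iff_norm_sub_tendsto_zero]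
  refine squeeze_zero (fun n => norm_nonneg _) (fun n => ?_) h1
  rw [← h4]
  exact h3 _

theorem tendsto_integral_norm_of_sq {E : Type*} [NormedAddCommGroup E] {a : ℕ → ℝ → E}
    (ha : ∀ n, MemLp (a n) 2 (dt T))
    (h : (fun n => ∫ t in Icc 0 T, ‖a n t‖ ^ 2) ⇝ 0) :
    (fun n => ∫ t in Icc 0 T, ‖a n t‖) ⇝ 0 := by
  have e : (fun n => √(∫ _ in Icc 0 T, (1 : ℝ) ^ 2) * √(∫ t in Icc 0 T, ‖a n t‖ ^ 2)) ⇝ 0 := by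
    simpa only [sqrt_zero, mul_zero] using (h.sqrt).const_mul (√(∫ _ in Icc 0 T, (1 : ℝ) ^ 2))
  refine squeeze_zero (fun n => by positivity) (fun n => ?_) e
  have := integral_mul_le_sqrt (f := fun _ => (1 : ℝ)) (g := fun t => ‖a n t‖)
    (memLp_const (μ := (dt T)) 1) (ha n).norm
  simpa using this

theorem ae_eq_of_tendsto_integral_norm_sq {α H : Type*} [MeasurableSpace α] {ν : Measure α}
    [NormedAddCommGroup H] [InnerProductSpace ℝ H] {w : ℕ → α → H} {V W : α → H}
    (hw : ∀ n, MemLp (w n) 2 ν) (hV : MemLp V 2 ν) (hW : MemLp W 2 ν)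
    (h : (fun n => ∫ x, ‖w n x - V x‖ ^ 2 ∂ν) ⇝ 0)
    (h' : (fun n => ∫ x, ‖w n x - W x‖ ^ 2 ∂ν) ⇝ 0) : V =ᵐ[ν] W := by
  have key : ∀ {V : α → H} (hV : MemLp V 2 ν),
      (fun n => ∫ x, ‖w n x - V x‖ ^ 2 ∂ν) ⇝ 0 →
      (fun n => (hw n).toLp (w n)) ⇝ (hV.toLp V) := fun hV h => by
    rw [tendsto_iff_norm_sub_tendsto_zero]
    have e := h.sqrt
    rw [sqrt_zero] at e
    refine e.congr fun n => ?_
    rw [← norm_sq_toLp_sub (hw n) hV, sqrt_sq (norm_nonneg _)]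
  exact (MemLp.toLp_eq_toLp_iff hV hW).1 (tendsto_nhds_unique (key hV h) (key hW h'))

theorem Nonlin.IsMonotone.two_inner_le
    (hf : f.IsMonotone T C μ) (hC : 0 ≤ C) {c : ℝ} (hc : 0 < c) {t : ℝ} (ht : t ∈ Icc 0 T) (x : Rn d)
    (y : Rn l) (z : Mat l k) : 2 * inner ℝ (f t x y z) y
      ≤ ‖f t x 0 0‖ ^ 2 + (1 + 2 * |μ t| + C ^ 2 / c) * ‖y‖ ^ 2 + c * ‖z‖ ^ 2 := by
  have h := hf.two_inner_sub_le hC hc ht x y 0 z 0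
  rw [sub_zero, sub_zero, inner_sub_left] at h
  nlinarith [sq_nonneg (‖f t x 0 0‖ - ‖y‖), real_inner_le_norm (f t x 0 0) y]

section InfConv

variable {Y : Type*} [NormedAddCommGroup Y] [TopologicalSpace.SeparableSpace Y]

/-- The largest `n`-Lipschitz minorant of `q`, computed on a dense sequence. -/
noncomputable def infConv (n : ℝ) (q : Y → ℝ) (y : Y) : ℝ :=
  ⨅ j, (q (denseSeq Y j) + n * ‖y - denseSeq Y j‖)

variable {n B : ℝ} {q : Y → ℝ}

theorem bddBelow_infConv (hn : 0 ≤ n) (hB : ∀ y, |q y| ≤ B) (y : Y) : BddBelow (range fun j =>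
    q (denseSeq Y j) + n * ‖y - denseSeq Y j‖) :=
  ⟨-B, by
    rintro _ ⟨j, rfl⟩
    have : 0 ≤ n * ‖y - denseSeq Y j‖ := by positivity
    linarith [(abs_le.1 (hB (denseSeq Y j))).1]⟩

theorem abs_infConv_sub_le (hn : 0 ≤ n) (hB : ∀ y, |q y| ≤ B) (y y' : Y) :
    |infConv n q y - infConv n q y'| ≤ n * ‖y - y'‖ := by
  have main : ∀ y y' : Y, infConv n q y ≤ infConv n q y' + n * ‖y - y'‖ := fun y y' => by
    rw [← sub_le_iff_le_add]
    refine le_ciInf fun j => ?_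
    have h1 : infConv n q y ≤ _ := ciInf_le (bddBelow_infConv hn hB y) j
    have h2 := mul_le_mul_of_nonneg_left (norm_sub_le_norm_sub_add_norm_sub y y'
      (denseSeq Y j)) hn
    linarith
  have h1 := main y y'
  have h2 := main y' y
  rw [norm_sub_rev] at h2
  exact abs_le.2 ⟨by linarith, by linarith⟩

theorem exists_infConv_approx (hB : ∀ y, |q y| ≤ B) (hq : UniformContinuous q) {ε : ℝ} (hε : 0 < ε) :
    ∃ N : ℝ, ∀ n, N ≤ n → ∀ y, |q y - infConv n q y| ≤ ε := by
  obtain ⟨δ, hδ, hqδ⟩ := Metric.uniformContinuous_iff.1 hq ε hε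
  have hB0 : 0 ≤ B := (abs_nonneg _).trans (hB 0)
  refine ⟨2 * B / δ, fun n hn y => ?_⟩
  have hn0 : 0 ≤ n := (by positivity : 0 ≤ 2 * B / δ).trans hn
  have h1 : q y - ε ≤ infConv n q y := by
    refine le_ciInf fun j => ?_
    set w := denseSeq Y j with hw
    rcases lt_or_ge (dist y w) δ with h | h
    · have := hqδ h
      rw [dist_eq] at this
      have h3 : 0 ≤ n * ‖y - w‖ := by positivity
      linarith [(abs_lt.1 this).2]
    · rw [dist_eq_norm] at h
      have h3 : 2 * B ≤ n * ‖y - w‖ := by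
        rw [div_le_iff₀ hδ] at hn
        exact hn.trans (mul_le_mul_of_nonneg_left h hn0)
      linarith [(abs_le.1 (hB w)).1, (abs_le.1 (hB y)).2]
  have h2 : infConv n q y ≤ q y := by
    refine le_of_forall_pos_le_add fun η hη => ?_
    obtain ⟨δ', hδ', hq'⟩ := Metric.uniformContinuous_iff.1 hq (η / 2) (by positivity)
    obtain ⟨j, hj⟩ := (denseRange_denseSeq Y).exists_dist_lt y
      (lt_min hδ' (by positivity : 0 < η / (2 * (n + 1))))
    have h3 : infConv n q y ≤ _ := ciInf_le (bddBelow_infConv hn0 hB y) j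
    have h4 := hq' (hj.trans_le (min_le_left _ _))
    rw [dist_eq] at h4
    have h5 := (hj.trans_le (min_le_right _ _)).le
    rw [dist_eq_norm, le_div_iff₀ (by positivity)] at h5
    have h6 : 0 ≤ ‖y - denseSeq Y j‖ := norm_nonneg _
    nlinarith [(abs_lt.1 h4).1]
  exact abs_le.2 ⟨by linarith, by linarith⟩

end InfConv

theorem uniformContinuous_comp_radialProj {Y Z : Type*} [NormedAddCommGroup Y] [InnerProductSpace ℝ Y]
    [ProperSpace Y] [NormedAddCommGroup Z] {R : ℝ} (hR : 0 < R) {G : Y → Z} (hG : Continuous G) :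
    UniformContinuous fun y => G (radialProj R y) := by
  have h := (isCompact_closedBall (0 : Y) R).uniformContinuousOn_of_continuous hG.continuousOn
  rw [Metric.uniformContinuous_iff]
  intro ε hε
  obtain ⟨δ, hδ, h1⟩ := Metric.uniformContinuousOn_iff.1 h ε hε
  refine ⟨δ, hδ, fun {a b} hab => h1 _ (by simpa using norm_radialProj_le hR a) _
    (by simpa using norm_radialProj_le hR b) (lt_of_le_of_lt ?_ hab)⟩
  rw [dist_eq_norm, dist_eq_norm]
  exact norm_radialProj_sub_radialProj_le hR a b

theorem inner_radialProj_le {Y : Type*} [NormedAddCommGroup Y] [InnerProductSpace ℝ Y] {R m : ℝ}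
    {F : Y → Y} {y : Y} (h : inner ℝ (radialProj R y) (F (radialProj R y) - F 0)
      ≤ m * ‖radialProj R y‖ ^ 2) :
    inner ℝ (F (radialProj R y) - F 0) y ≤ |m| * ‖y‖ ^ 2 := by
  have hy := smul_radialProj R y
  have h2 := norm_radialProj_le_norm R y
  have h1 : (0 : ℝ) ≤ max 1 (‖y‖ / R) := by positivity
  set p := radialProj R y
  set s := max 1 (‖y‖ / R)
  have e1 : inner ℝ (F p - F 0) y = s * inner ℝ p (F p - F 0) := by
    rw [← hy, real_inner_smul_right, real_inner_comm]
  have e2 : ‖y‖ = s * ‖p‖ := by rw [← hy, norm_smul, norm_of_nonneg h1]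
  rw [e1]
  calc _ ≤ s * (|m| * ‖p‖ ^ 2) := mul_le_mul_of_nonneg_left
        (h.trans (mul_le_mul_of_nonneg_right (le_abs_self m) (sq_nonneg _))) h1
    _ = |m| * (‖y‖ * ‖p‖) := by rw [e2]; ring
    _ ≤ |m| * ‖y‖ ^ 2 := mul_le_mul_of_nonneg_left (by nlinarith [norm_nonneg y]) (abs_nonneg m)

theorem exists_weight (d : ℕ) : ∃ w : Rn d → ℝ, Measurable w ∧ (∀ x, 0 < w x) ∧ (∀ x, w x ≤ 1) ∧
    MemLp w 2 volume := by
  have hpos : ∀ x : Rn d, 0 < (1 + ‖x‖) ^ (-((d : ℝ) + 1)) := fun x => by positivity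
  have hle : ∀ x : Rn d, (1 + ‖x‖) ^ (-((d : ℝ) + 1)) ≤ 1 := fun x =>
    Real.rpow_le_one_of_one_le_of_nonpos (by linarith [norm_nonneg x]) (by linarith [d.cast_nonneg (α := ℝ)])
  have hm : Measurable fun x : Rn d => (1 + ‖x‖) ^ (-((d : ℝ) + 1)) := by fun_prop
  refine ⟨_, hm, hpos, hle, (memLp_two_iff_integrable_sq hm.aestronglyMeasurable).2 ?_⟩
  have hi : Integrable fun x : Rn d => (1 + ‖x‖) ^ (-((d : ℝ) + 1)) :=
    integrable_one_add_norm (by simp)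
  refine hi.mono' (hm.pow_const 2).aestronglyMeasurable (of_forall fun x => ?_)
  rw [norm_of_nonneg (sq_nonneg _), sq]
  exact mul_le_of_le_one_left (hpos x).le (hle x)

theorem norm_le_sum_abs (v : Rn l) : ‖v‖ ≤ ∑ i, |v i| := by
  refine abs_le_of_sq_le_sq' ?_ (by positivity) |>.2
  rw [norm_sq_eq]
  exact Finset.sum_sq_le_sq_sum_of_nonneg fun i _ => abs_nonneg (v i)

/-- Approximation of a monotone nonlinearity by Lipschitz ones with the same growth. -/
theorem exists_lipschitz_approx {G : ℝ → Rn d → Rn l → Rn l}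
    (hG : Nonlin.IsMonotone (k := k) (fun t x y _ => G t x y) T C μ) {R : ℝ} (hR : 0 < R)
    {w : Rn d → ℝ} (hwm : Measurable w) (hw0 : ∀ x, 0 < w x) (hw2 : MemLp w 2 volume) {ε : ℝ}
    (hε : 0 < ε) : ∃ (L : ℝ) (G' : ℝ → Rn d → Rn l → Rn l) (e : ℝ → L2 d), 0 ≤ L ∧
      Nonlin.IsMeasurable (k := k) (fun t x y _ => G' t x y) ∧
      (∀ t ∈ Icc 0 T, ∀ x y y', ‖G' t x y - G' t x y'‖ ≤ L * ‖y - y'‖) ∧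
      e ∈L¹ T ∧ ∫ t in Icc 0 T, ‖e t‖ ≤ ε ∧
      (∀ᵐ t ∂(dt T), ∀ᵐ x, ∀ y,
        ‖G' t x y - G t x (radialProj R y)‖ ≤ e t x) ∧
      ∀ t ∈ Icc 0 T, ∀ x y,
        2 * inner ℝ (G' t x y) y ≤ (‖G t x 0‖ + w x) ^ 2 + (1 + 2 * |μ t|) * ‖y‖ ^ 2 := by
  classical
  set D : ℕ → Rn l := denseSeq (Rn l) with hDdef
  set wL : L2 d := hw2.toLp w with hwL
  set V : ℝ := (volume : Measure ℝ).real (Icc 0 T) with hV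
  have hV0 : 0 ≤ V := measureReal_nonneg
  obtain ⟨η, hη0, hη1, hηε⟩ : ∃ η > 0, η ≤ 1 ∧ V * (η * ‖wL‖) ≤ ε / 2 := by
    refine ⟨min 1 (ε / (2 * (V * ‖wL‖ + 1))), by positivity, min_le_left _ _, ?_⟩
    have h1 := min_le_right 1 (ε / (2 * (V * ‖wL‖ + 1)))
    rw [le_div_iff₀ (by positivity)] at h1
    have h2 : 0 < min 1 (ε / (2 * (V * ‖wL‖ + 1))) := by positivity
    nlinarith
  obtain ⟨h, hh, hdom⟩ := hG.dom R hR
  let q : ℝ × Rn d → Rn l → Rn l := fun p y => G p.1 p.2 (radialProj R y) - G p.1 p.2 0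
  let Ψ : ℕ → ℝ × Rn d → Rn l → Rn l := fun n p y => toLp 2 fun i => infConv n (fun y => q p y i) y
  have hGc : ∀ t ∈ Icc 0 T, ∀ x, Continuous fun y => G t x y := fun t ht x => hG.cont t ht x 0
  have hqu : ∀ t ∈ Icc 0 T, ∀ x, UniformContinuous (q (t, x)) := fun t ht x =>
    (uniformContinuous_comp_radialProj hR (hGc t ht x)).sub uniformContinuous_const
  have hqB : ∀ t ∈ Icc 0 T, ∀ x, ∃ B, ∀ y, ‖q (t, x) y‖ ≤ B := fun t ht x => by
    obtain ⟨B, hB⟩ := (isCompact_closedBall (0 : Rn l) R).exists_bound_of_continuousOn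
      ((hGc t ht x).sub (continuous_const (y := G t x 0))).continuousOn
    exact ⟨B, fun y => hB (radialProj R y) (by simpa using norm_radialProj_le hR y)⟩
  have hqi : ∀ t ∈ Icc 0 T, ∀ x, ∃ B, ∀ i y, |q (t, x) y i| ≤ B := fun t ht x => by
    obtain ⟨B, hB⟩ := hqB t ht x
    exact ⟨B, fun i y => (PiLp.norm_apply_le (q (t, x) y) i).trans (hB y)⟩
  have hQL : ∀ t ∈ Icc 0 T, ∀ x (n : ℕ) y y', ‖Ψ n (t, x) y - Ψ n (t, x) y'‖ ≤ l * n * ‖y - y'‖ :=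
    fun t ht x n y y' => by
    obtain ⟨B, hB⟩ := hqi t ht x
    refine (norm_le_sum_abs _).trans ((sum_le_sum fun i _ =>
      abs_infConv_sub_le n.cast_nonneg (hB i) y y').trans (le_of_eq ?_))
    simp [mul_assoc]
  let s : ℕ → Set (ℝ × Rn d) := fun n => {p | ∀ j, ‖q p (D j) - Ψ n p (D j)‖ ≤ η * w p.2}
  have hs : ∀ t ∈ Icc 0 T, ∀ x n, (t, x) ∈ s n → ∀ y, ‖q (t, x) y - Ψ n (t, x) y‖ ≤ η * w x :=
    fun t ht x n hp y => by
    have hQc : Continuous (Ψ n (t, x)) := by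
      refine LipschitzWith.continuous (K := ⟨l * n, by positivity⟩)
        (LipschitzWith.of_dist_le_mul fun a b => ?_)
      rw [dist_eq_norm, dist_eq_norm]
      exact hQL t ht x n a b
    exact isClosed_property (denseRange_denseSeq (Rn l))
      (isClosed_le ((hqu t ht x).continuous.sub hQc).norm continuous_const) hp y
  have hsN : ∀ t ∈ Icc 0 T, ∀ x, ∀ᶠ n in atTop, (t, x) ∈ s n := fun t ht x => by
    obtain ⟨B, hB⟩ := hqi t ht x
    have hpos : 0 < η * w x / (l + 1) := div_pos (mul_pos hη0 (hw0 x)) (by positivity)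
    choose N hN using fun i => exists_infConv_approx (hB i)
      ((PiLp.uniformContinuous_ofLp 2 _ |> fun hc => (uniformContinuous_pi.1 hc i)).comp (hqu t ht x)) hpos
    filter_upwards [eventually_all.2 fun i => tendsto_natCast_atTop_atTop.eventually_ge_atTop (N i)]
      with n hn j
    refine (norm_le_sum_abs _).trans ((sum_le_sum fun i _ => hN i n (hn i) (D j)).trans ?_)
    rw [Finset.sum_const, Finset.card_univ, card_fin, nsmul_eq_mul, mul_div_assoc',
      div_le_iff₀ (by positivity)]
    have := mul_pos hη0 (hw0 x)
    nlinarith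
  have hGm : Measurable fun p : (ℝ × Rn d) × Rn l => G p.1.1 p.1.2 p.2 :=
    Measurable.comp (g := fun p : ℝ × Rn d × Rn l × Mat l k => G p.1 p.2.1 p.2.2.1) hG.meas
      ((measurable_fst.comp measurable_fst).prodMk ((measurable_snd.comp measurable_fst).prodMk
        (measurable_snd.prodMk (measurable_const (a := (0 : Mat l k))))))
  have hqm : ∀ y, Measurable fun p => q p y := fun y =>
    (hGm.comp (measurable_id.prodMk measurable_const)).sub
      (hGm.comp (measurable_id.prodMk measurable_const))
  have hQm : ∀ n, Measurable fun p : (ℝ × Rn d) × Rn l => Ψ n p.1 p.2 := fun n => by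
    refine (continuous_toLp 2 _).measurable.comp (measurable_pi_lambda _ fun i => ?_)
    refine Measurable.iInf fun j => ?_
    refine Measurable.add ?_ (by fun_prop)
    exact (proj (𝕜 := ℝ) i : Rn l →L[ℝ] ℝ).measurable.comp ((hqm _).comp measurable_fst)
  have hsm : ∀ n, MeasurableSet (s n) := fun n => by
    simp only [s, setOf_forall]
    exact MeasurableSet.iInter fun j => measurableSet_le ((hqm _).sub ((hQm n).comp
      (measurable_id.prodMk measurable_const))).norm (by fun_prop)
  obtain ⟨H, hHm, hH⟩ := exists_rep hh.aestronglyMeasurable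
  choose p hpm hp using fun n => exists_path (F := ((s n)ᶜ).indicator fun p => 2 * H p)
    ((hHm.const_mul 2).indicator (hsm n).compl)
  have hp' : ∀ᵐ t ∂(dt T), ∀ n, ∀ᵐ x, 0 ≤ h t x ∧
      p n t x = ((s n)ᶜ).indicator (fun _ => 2 * h t x) (t, x) := by
    filter_upwards [hH, hdom] with t h1 h2 n
    have h3 : MemLp (fun x => ((s n)ᶜ).indicator (fun p => 2 * H p) (t, x)) 2 volume := by
      refine ((memLp (h t)).const_mul 2).mono
        (((hHm.const_mul 2).indicator (hsm n).compl).comp measurable_prodMk_left).aestronglyMeasurable ?_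
      filter_upwards [h1] with x h4
      rw [h4]
      exact norm_indicator_le_norm_self (fun p => 2 * H p) (t, x)
    filter_upwards [hp n t h3, h1, h2] with x h4 h5 h6
    refine ⟨(norm_nonneg _).trans (h6 0 (by simpa using hR.le)), ?_⟩
    rw [h4, h5]
    rfl
  have hple : ∀ᵐ t ∂(dt T), ∀ n, ∀ᵐ x, ‖p n t x‖ ≤ ((2 : ℝ) • h t) x := by
    filter_upwards [hp'] with t h1 n
    filter_upwards [h1 n, ae_smul (2 : ℝ) (h t)] with x ⟨h2, h3⟩ h4
    rw [h3, h4, smul_eq_mul]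
    refine (norm_indicator_le_norm_self _ _).trans (le_of_eq ?_)
    rw [norm_of_nonneg (by positivity)]
  have hpi : ∀ n, p n ∈L¹ T := fun n => by
    refine (hh.smul (2 : ℝ)).norm.mono' (hpm n).aestronglyMeasurable ?_
    filter_upwards [hple] with t ht
    exact norm_path_le (ht n)
  have hlim := tendsto_integral_of_dominated_slices (g := fun _ => (0 : L2 d)) hpi
    (integrable_zero _ _ _) (hh.smul (2 : ℝ)) (fun n => by
      filter_upwards [hple] with t ht
      filter_upwards [ht n, ae_zero (E := ℝ) (p := 2)] with x h1 h2
      rw [h2, sub_zero]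
      exact h1) (by
      filter_upwards [hp', ae_mem_Icc] with t h1 ht ns hns
      refine ⟨id, ?_⟩
      filter_upwards [ae_all_iff.2 h1, ae_zero (E := ℝ) (p := 2)] with x h2 h3
      rw [h3]
      refine tendsto_const_nhds.congr' ?_
      filter_upwards [hns.eventually (hsN t ht x)] with n hn
      rw [id, (h2 (ns n)).2, indicator_of_notMem (by simpa using hn)])
  simp only [sub_zero] at hlim
  obtain ⟨n, hn⟩ := (hlim.eventually_le_const (half_pos hε)).exists
  let G' : ℝ → Rn d → Rn l → Rn l := fun t x y => G t x 0 + (s n).indicator (fun p => Ψ n p y) (t, x)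
  have hηw : (fun _ : ℝ => η • wL) ∈L¹ T := continuousOn_const.integrableOn_Icc
  refine ⟨l * n, G', fun t => η • wL + p n t, by positivity, ?_, ?_, hηw.add (hpi n), ?_, ?_, ?_⟩
  · refine Measurable.comp (g := fun p : (ℝ × Rn d) × Rn l => G' p.1.1 p.1.2 p.2)
      (f := fun p : ℝ × Rn d × Rn l × Mat l k => ((p.1, p.2.1), p.2.2.1)) ?_ (by fun_prop)
    refine Measurable.add (hGm.comp (measurable_fst.prodMk measurable_const)) ?_
    exact (hQm n).indicator (s := Prod.fst ⁻¹' s n) (measurable_fst (hsm n))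
  · intro t ht x y y'
    simp only [G', add_sub_add_left_eq_sub]
    by_cases h1 : (t, x) ∈ s n
    · rw [indicator_of_mem h1, indicator_of_mem h1]
      exact hQL t ht x n y y'
    · rw [indicator_of_notMem h1, indicator_of_notMem h1, sub_zero, norm_zero]
      positivity
  · have h1 : ∫ t in Icc 0 T, ‖η • wL + p n t‖ ≤ ∫ t in Icc 0 T, (‖η • wL‖ + ‖p n t‖) :=
      integral_mono (hηw.add (hpi n)).norm (hηw.norm.add (hpi n).norm) fun t => norm_add_le _ _
    rw [integral_add hηw.norm (hpi n).norm, setIntegral_const, smul_eq_mul, norm_smul,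
      norm_of_nonneg hη0.le] at h1
    linarith
  · filter_upwards [hp', hdom, ae_mem_Icc] with t h1 h2 ht
    filter_upwards [h1 n, h2, ae_add (η • wL) (p n t), ae_smul η wL, hw2.coeFn_toLp]
      with x ⟨h3, h4⟩ h5 h6 h7 h8 y
    rw [h6, h7, h8, h4, smul_eq_mul]
    have e1 : G' t x y - G t x (radialProj R y) = (s n).indicator (fun p => Ψ n p y) (t, x) - q (t, x) y := by
      simp only [G', q]; abel
    rw [e1]
    have hw := mul_pos hη0 (hw0 x)
    by_cases h9 : (t, x) ∈ s n
    · rw [indicator_of_mem h9, indicator_of_notMem (by simpa using h9), norm_sub_rev, add_zero]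
      exact hs t ht x n h9 y
    · rw [indicator_of_notMem h9, indicator_of_mem (by simpa using h9), zero_sub, norm_neg]
      have := norm_sub_le (G t x (radialProj R y)) (G t x 0)
      have a1 := h5 _ (norm_radialProj_le hR y)
      have a2 := h5 0 (by simpa using hR.le)
      simp only [q]
      linarith
  · intro t ht x y
    have a1 : inner ℝ (G' t x y) y ≤ (‖G t x 0‖ + w x) * ‖y‖ + |μ t| * ‖y‖ ^ 2 := by
      have b1 := real_inner_le_norm (G t x 0) y
      have b2 : 0 ≤ |μ t| * ‖y‖ ^ 2 := by positivity
      have b3 : 0 ≤ w x * ‖y‖ := mul_nonneg (hw0 x).le (norm_nonneg y)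
      simp only [G', inner_add_left]
      by_cases h1 : (t, x) ∈ s n
      · rw [indicator_of_mem h1]
        have b4 : Ψ n (t, x) y = q (t, x) y - (q (t, x) y - Ψ n (t, x) y) := by abel
        have b5 := (abs_le.1 (abs_real_inner_le_norm (q (t, x) y - Ψ n (t, x) y) y)).1
        have b6 := mul_le_mul_of_nonneg_right (hs t ht x n h1 y) (norm_nonneg y)
        have b7 := inner_radialProj_le (F := fun y => G t x y) (by
          simpa using hG.mono t ht x (radialProj R y) 0 0)
        have b8 : η * (w x * ‖y‖) ≤ 1 * (w x * ‖y‖) := mul_le_mul_of_nonneg_right hη1 b3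
        rw [b4, inner_sub_left]
        simp only [q] at b5 b6 ⊢
        linarith
      · rw [indicator_of_notMem h1, inner_zero_left]
        linarith
    nlinarith [sq_nonneg (‖G t x 0‖ + w x - ‖y‖)]

theorem exists_path_of_norm_le {F : ℝ × Rn d → ℝ} (hF : Measurable F) {h : ℝ → L2 d}
    (hh : MemLp h 2 (dt T))
    (hle : ∀ᵐ t ∂(dt T), ∀ᵐ x, ‖F (t, x)‖ ≤ h t x) :
    ∃ ρ : ℝ → L2 d, MemLp ρ 2 (dt T) ∧
      ∀ᵐ t ∂(dt T), ∀ᵐ x, ρ t x = F (t, x) := by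
  obtain ⟨ρ, hρm, hρ⟩ := exists_path hF
  have h1 : ∀ᵐ t ∂(dt T), ∀ᵐ x, ρ t x = F (t, x) := by
    filter_upwards [hle] with t ht
    exact hρ t ((memLp (h t)).mono' (hF.comp measurable_prodMk_left).aestronglyMeasurable ht)
  refine ⟨ρ, hh.mono hρm.aestronglyMeasurable ?_, h1⟩
  filter_upwards [h1, hle] with t h2 h3
  refine norm_path_le ?_
  filter_upwards [h2, h3] with x h4 h5
  rwa [h4]

theorem exists_rep_matOf {ν : Measure ℝ} {V : Fin l → ℝ → L2v d k}
    (hV : ∀ i, AEStronglyMeasurable (V i) ν) : ∃ Z : ℝ × Rn d → Mat l k, Measurable Z ∧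
      ∀ᵐ t ∂ν, ∀ᵐ x, matOf V@@t x = Z (t, x) := by
  choose Z hZ hZe using fun i => exists_rep_vector (hV i)
  refine ⟨fun p => toLp 2 fun q => Z q.1 q.2 p,
    (continuous_toLp 2 _).measurable.comp (measurable_pi_lambda _ fun q => hZ q.1 q.2), ?_⟩
  filter_upwards [ae_all_iff.2 hZe] with t h2
  filter_upwards [ae_all_iff.2 h2] with x h4
  simp only [matOf, h4]

section

variable {E : Type*} [NormedAddCommGroup E]

theorem memLp_sum_normL
    {w : Fin l → ℝ → Lp E 2 (volume : Measure (Rn d))}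
    (hw : ∀ i, MemLp (w i) 2 (dt T)) :
    MemLp (fun t => ∑ i, normL (w i t)) 2 (dt T) :=
  memLp_finsetSum _ fun i _ => (hw i).norm.mono'
    ((lipschitzWith_one_norm.continuous_compLp norm_zero).comp_aestronglyMeasurable
      (hw i).1) (of_forall fun t => (norm_normL (w i t)).le)

theorem radialProj_zero [InnerProductSpace ℝ E] (R : ℝ) :
    radialProj R (0 : E) = 0 := smul_zero _

end

section

variable {F : ℝ × Rn d → ℝ} (hF : Measurable F)

include hF

theorem measurable_eLpNorm_slice :
    Measurable fun t => eLpNorm (fun x => F (t, x)) 2 volume := by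
  simp only [eLpNorm_eq_lintegral_rpow_enorm_toReal two_ne_zero ENNReal.ofNat_ne_top]
  exact (Measurable.lintegral_prod_right' (f := fun p => ‖F p‖ₑ ^ (2 : ℝ≥0∞).toReal)
    (by fun_prop)).pow_const _

theorem exists_integrable_path
    (h : ∫⁻ t in Icc 0 T, eLpNorm (fun x => F (t, x)) 2 volume < ⊤) :
    ∃ g : ℝ → L2 d, g ∈L¹ T ∧
      ∀ᵐ t ∂(dt T), ∀ᵐ x, g t x = F (t, x) := by
  obtain ⟨g, hgm, hg⟩ := exists_path hF
  have h1 : ∀ᵐ t ∂(dt T), g t =ᵐ[volume] fun x => F (t, x) := by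
    filter_upwards [ae_lt_top (measurable_eLpNorm_slice hF) h.ne] with t ht
    exact hg t ⟨(hF.comp measurable_prodMk_left).aestronglyMeasurable, ht⟩
  refine ⟨g, ⟨hgm.aestronglyMeasurable, ?_⟩, h1⟩
  refine lt_of_eq_of_lt (lintegral_congr_ae ?_) h
  filter_upwards [h1] with t ht
  rw [Lp.enorm_def, eLpNorm_congr_ae ht]

end

namespace Nonlin

variable {φ : Fin l → L2 d}

theorem IsMeasurable.f0 (hf : f.IsMeasurable) : Measurable f.f0 :=
  Measurable.comp (g := fun p : ℝ × Rn d × Rn l × Mat l k => f p.1 p.2.1 p.2.2.1 p.2.2.2) hf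
    (f := fun p : ℝ × Rn d => (p.1, p.2, (0 : Rn l), (0 : Mat l k))) (by fun_prop)

section

variable (hm : f.IsMeasurable) (hf : f.CondH T C μ φ)

include hm hf

/-- The path `t ↦ |f(t, ·, 0, 0)|` in `L²`. -/
theorem CondH.exists_norm_f0_path :
    ∃ ρ : ℝ → L2 d, MemLp ρ 2 (dt T) ∧
      (∀ᵐ t ∂(dt T), ∀ᵐ x, ρ t x = ‖f t x 0 0‖) ∧
      (∀ᵐ t ∂(dt T), ∀ᵐ x,
        |ρ t x| ≤ (eLpNorm f.f0 ⊤ (slab d T)).toReal) ∧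
      ∫ t in Icc 0 T, ‖ρ t‖ ^ 2 = ∫ t in Icc 0 T, ∫ x, ‖f t x 0 0‖ ^ 2 := by
  have h0 := hm.f0
  obtain ⟨ρ, hρm, hρ⟩ := exists_path h0.norm
  have hsq : Integrable (fun p : ℝ × Rn d => ‖f.f0 p‖ ^ 2) (slab d T) :=
    (memLp_two_iff_integrable_sq_norm h0.aestronglyMeasurable).1 hf.H5_f0_sq
  have h1 : ∀ᵐ t ∂(dt T), ∀ᵐ x, ρ t x = ‖f t x 0 0‖ := by
    filter_upwards [hsq.prod_right_ae] with t ht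
    exact hρ t ((memLp_two_iff_integrable_sq_norm
      (h0.comp measurable_prodMk_left).aestronglyMeasurable).2 ht).norm
  have h2 : ∀ᵐ t ∂(dt T), ‖ρ t‖ ^ 2 = ∫ x, ‖f t x 0 0‖ ^ 2 := by
    filter_upwards [h1] with t ht
    rw [← real_inner_self_eq_norm_sq, inner_def]
    refine integral_congr_ae (ht.mono fun x hx => ?_)
    simp only [hx, real_inner_self_eq_norm_sq, norm_norm]
  refine ⟨ρ, (memLp_two_iff_integrable_sq_norm hρm.aestronglyMeasurable).2
    (hsq.integral_prod_left.congr (h2.mono fun t ht => ht.symm)), h1, ?_, integral_congr_ae h2⟩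
  have h3 : ∀ᵐ p ∂(slab d T), ‖f.f0 p‖ ≤ (eLpNorm f.f0 ⊤ (slab d T)).toReal := by
    filter_upwards [ae_le_eLpNormEssSup (f := f.f0) (μ := slab d T)] with p hp
    rw [← toReal_enorm]
    exact toReal_mono hf.H5_f0.2.ne (by rwa [eLpNorm_exponent_top])
  filter_upwards [h1, Measure.ae_ae_of_ae_prod h3] with t h4 h5
  filter_upwards [h4, h5] with x h6 h7
  rwa [h6, abs_of_nonneg (norm_nonneg _)]

/-- A locally bounded path that dominates `f(t, ·, y, 0) - f(t, ·, 0, 0)` for `|y| ≤ R`. -/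
theorem CondH.exists_dominating {R : ℝ} (hR : 0 < R) :
    ∃ h : ℝ → L2 d, h ∈L¹ T ∧
      ∀ᵐ t ∂(dt T), ∀ᵐ x, ∀ y, ‖y‖ ≤ R → ‖f t x y 0 - f t x 0 0‖ ≤ h t x := by
  set F : ℝ × Rn d → ℝ := fun p => ⨆ n : ℕ,
    ‖f p.1 p.2 (radialProj R (denseSeq (Rn l) n)) 0 - f p.1 p.2 0 0‖ with hF
  have hFm : Measurable F := by
    refine Measurable.iSup fun n => Measurable.norm (Measurable.sub ?_ hm.f0)
    exact Measurable.comp (g := fun p : ℝ × Rn d × Rn l × Mat l k => f p.1 p.2.1 p.2.2.1 p.2.2.2) hm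
      (f := fun p : ℝ × Rn d => (p.1, p.2,
        radialProj R (denseSeq (Rn l) n), (0 : Mat l k))) (by fun_prop)
  have hbdd : ∀ t ∈ Icc 0 T, ∀ x, BddAbove
      ((fun y : Rn l => ‖f t x y 0 - f t x 0 0‖) '' Metric.closedBall 0 R) := fun t ht x =>
    (isCompact_closedBall 0 R).bddAbove_image
      ((hf.H3 t ht x 0).sub continuous_const).norm.continuousOn
  have hmem : ∀ t x (y : Rn l), ‖f t x (radialProj R y) 0 - f t x 0 0‖ ∈
      ((fun y : Rn l => ‖f t x y 0 - f t x 0 0‖) '' Metric.closedBall 0 R) := fun t x y =>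
    ⟨_, by simpa using norm_radialProj_le hR y, rfl⟩
  have hle : ∀ t ∈ Icc 0 T, ∀ x, F (t, x) ≤ f.fsup R t x := fun t ht x =>
    ciSup_le fun n => le_csSup (hbdd t ht x) (hmem t x _)
  obtain ⟨h, hh, hhe⟩ := exists_integrable_path (T := T) hFm (by
    refine lt_of_le_of_lt (setLIntegral_mono' measurableSet_Icc fun t ht => ?_) (hf.H4 R hR)
    refine eLpNorm_mono_real fun x => ?_
    rw [norm_of_nonneg (Real.iSup_nonneg fun n => norm_nonneg _)]
    exact hle t ht x)
  refine ⟨h, hh, ?_⟩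
  filter_upwards [hhe, ae_mem_Icc] with t h1 ht
  filter_upwards [h1] with x h2 y hy
  rw [h2, ← radialProj_of_norm_le hy]
  refine (denseRange_denseSeq (Rn l)).induction_on
    (p := fun y => ‖f t x (radialProj R y) 0 - f t x 0 0‖ ≤ F (t, x)) y
    (isClosed_le (((hf.H3 t ht x 0).comp (continuous_radialProj hR)).sub
      continuous_const).norm continuous_const) fun n => ?_
  exact le_ciSup (f := fun n : ℕ =>
    ‖f t x (radialProj R (denseSeq (Rn l) n)) 0 - f t x 0 0‖)
    ((hbdd t ht x).mono (range_subset_iff.2 fun n => hmem t x _)) n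

theorem CondH.isMonotone : f.IsMonotone T C μ := by
  refine ⟨hm, hf.H1, hf.H2, hf.H3, fun R hR => ?_⟩
  obtain ⟨h, hh, hle⟩ := hf.exists_dominating hm hR
  obtain ⟨ρ, hρ, hρe, -, -⟩ := hf.exists_norm_f0_path hm
  refine ⟨fun t => h t + ρ t, hh.add (hρ.integrable one_le_two), ?_⟩
  filter_upwards [hle, hρe] with t h1 h2
  filter_upwards [h1, h2, ae_add (h t) (ρ t)] with x h3 h4 h5 y hy
  rw [h5, h4]
  have := norm_le_norm_sub_add (f t x y 0) (f t x 0 0)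
  linarith [h3 y hy]

end

end Nonlin

namespace Coefficients

theorem MemFhat.congr {u v : ℝ → L2 d} (hu : Q.MemFhat c₂ T u)
    (h : ∀ t ∈ Icc 0 T, v t = u t) : Q.MemFhat c₂ T v := by
  have h' : ∀ᵐ t ∂(dt T), u t = v t := by
    filter_upwards [ae_mem_Icc] with t ht using (h t ht).symm
  refine ⟨hu.cont.congr h, ?_, hu.meas.congr ?_, hu.int.congr ?_⟩
  · filter_upwards [hu.mem, h'] with t h1 h2
    rwa [← h2]
  · filter_upwards [h'] with t h2
    rw [h2]
  · filter_upwards [h'] with t h2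
    rw [h2]

theorem normTSq_le {a b : ℝ} (hT : 0 ≤ T) {u : Fin l → ℝ → L2 d}
    (ha : ∀ t ∈ Icc 0 T, ∑ i, ‖u i t‖ ^ 2 ≤ a)
    (hb : ∫ t in Icc 0 T, ∑ i, Q.energy c₂ (u i t) ≤ b) : Q.normTSq c₂ T u ≤ a + b := by
  have : Nonempty (Icc 0 T) := ⟨⟨0, le_rfl, hT⟩⟩
  exact add_le_add (ciSup_le fun t => ha t t.2) hb

theorem IsSubst.congr {u v g : Fin l → ℝ → L2 d}
    (hu : Q.IsSubst T f u g) (h : ∀ i, ∀ t ∈ Icc 0 T, u i t = v i t) : Q.IsSubst T f v g := by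
  refine ⟨hu.1, ?_⟩
  filter_upwards [hu.2, ae_mem_Icc] with t h1 ht
  simpa only [h _ t ht] using h1

end Coefficients

namespace Coefficients.Assumptions

variable (A : Assumptions Q c₂ T P S)

include A

theorem memF (p : Q.FGraph) : Q.MemF c₂ p.1.1 :=
  (A.A2.memF_iff A.A2' _).2 ⟨p, rfl⟩

theorem Dσ_graph (p : Q.FGraph) : Q.Dσ p.1.1 = p.1.2 :=
  Dσ_eq A.A2'.bdd A.A1 p

theorem exists_graph {u : L2 d} (hu : Q.MemF c₂ u) :
    ∃ p : Q.FGraph, p.1.1 = u ∧ p.1.2 = Q.Dσ u := by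
  obtain ⟨p, rfl⟩ := (A.A2.memF_iff A.A2' _).1 hu
  exact ⟨p, rfl, (A.Dσ_graph p).symm⟩

theorem sub_mem {u v : L2 d} (hu : Q.MemF c₂ u) (hv : Q.MemF c₂ v) :
    Q.MemF c₂ (u - v) ∧ Q.Dσ (u - v) = Q.Dσ u - Q.Dσ v := by
  obtain ⟨p, rfl, hp⟩ := A.exists_graph hu
  obtain ⟨q, rfl, hq⟩ := A.exists_graph hv
  refine ⟨A.memF (p - q), ?_⟩
  rw [← hp, ← hq]
  exact A.Dσ_graph (p - q)

theorem exists_energy_lower : ∃ c₁ > 0, ∀ u, Q.MemF c₂ u →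
    c₁ * ‖Q.Dσ u‖ ^ 2 + ‖u‖ ^ 2 ≤ Q.energy c₂ u := by
  obtain ⟨c₁, hc, h⟩ := A.A2.le_energy A.A2' A.A1
  refine ⟨c₁, hc, fun u hu => ?_⟩
  obtain ⟨p, rfl, hp⟩ := A.exists_graph hu
  rw [← hp]; exact h p

theorem energy_nonneg {u : L2 d} (hu : Q.MemF c₂ u) :
    0 ≤ Q.energy c₂ u := by
  obtain ⟨c₁, hc, h⟩ := A.exists_energy_lower
  exact le_trans (by positivity) (h u hu)

theorem continuous_energy :
    Continuous fun p : Q.FGraph => Q.energy c₂ p.1.1 := by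
  simp only [A.A2'.energy_eq A.A1]
  have : Continuous fun p : Q.FGraph => A.A2'.bil p p :=
    A.A2'.continuous_bil.comp (continuous_id.prodMk continuous_id)
  fun_prop

theorem memF_of_hasGen {u g : L2 d} (h : HasGen S u g) {M : ℝ}
    (hM : ∀ᵐ x, |u x| ≤ M) : Q.MemF c₂ u :=
  A.A4.domain u g ((A.sg.gen_iff u g).2 h) (isBdd_iff.2 ⟨M, hM⟩)

theorem exists_energy_gen : ∃ β : ℝ, 0 ≤ β ∧ ∀ (u g : L2 d) (M : ℝ),
    HasGen S u g → (∀ᵐ x, |u x| ≤ M) →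
    2 * Q.energy c₂ u ≤ -2 * inner ℝ g u + β * ‖u‖ ^ 2 := by
  obtain ⟨α, hα, h⟩ := A.A4.bil_le A.A1 A.A2' A.A3 A.A2
  refine ⟨α + 2 * (c₂ + 1), by have := A.A2.c₂_nonneg; positivity, fun u g M hg hM => ?_⟩
  obtain ⟨p, rfl, hp⟩ := A.exists_graph (A.memF_of_hasGen hg hM)
  have := h p g M ((A.sg.gen_iff _ _).2 hg) hM
  rw [A.A2'.energy_eq A.A1]
  linarith

theorem exists_graph_path {u Lu g : ℝ → L2 d}
    (h : IsBddClassical S T u Lu g) : ∃ p : ℝ → Q.FGraph, (∀ t ∈ Icc 0 T, (p t).1.1 = u t) ∧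
      ContinuousOn p (Icc 0 T) := by
  classical
  obtain ⟨M, hM⟩ := h.bdd
  choose p hp _ using fun t (ht : t ∈ Icc 0 T) => A.exists_graph (A.memF_of_hasGen (h.gen t ht) (hM t ht))
  refine ⟨fun t => if ht : t ∈ Icc 0 T then p t ht else 0, fun t ht => by
    simp only [dif_pos ht, hp], ?_⟩
  obtain ⟨c₁, hc, hl⟩ := A.exists_energy_lower
  obtain ⟨β, hβ, hen⟩ := A.exists_energy_gen
  intro t ht
  rw [ContinuousWithinAt, tendsto_iff_norm_sub_tendsto_zero]
  set R : ℝ → ℝ := fun s => -2 * inner ℝ (Lu s - Lu t) (u s - u t) + β * ‖u s - u t‖ ^ 2 with hR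
  have hRlim : Tendsto R (𝓝[Icc 0 T] t) (𝓝 0) := by
    have h1 : Tendsto (fun s => u s - u t) (𝓝[Icc 0 T] t) (𝓝 0) := by
      simpa using Tendsto.sub_const (h.cont t ht) (u t)
    have h2 : Tendsto (fun s => Lu s - Lu t) (𝓝[Icc 0 T] t) (𝓝 0) := by
      simpa using Tendsto.sub_const (h.contL t ht) (Lu t)
    have := ((Tendsto.inner (𝕜 := ℝ) h2 h1).const_mul (-2)).add ((h1.norm.pow 2).const_mul β)
    simpa [hR] using this
  have hlim2 : Tendsto (fun s => √((1 + c₁⁻¹) * R s)) (𝓝[Icc 0 T] t) (𝓝 0) := by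
    have := (hRlim.const_mul (1 + c₁⁻¹)).sqrt
    simpa using this
  refine squeeze_zero' (of_forall fun _ => norm_nonneg _) ?_ hlim2
  filter_upwards [self_mem_nhdsWithin] with s hs
  simp only [dif_pos hs, dif_pos ht]
  refine Real.le_sqrt_of_sq_le ?_
  have e1 : (p s hs - p t ht).1.1 = u s - u t := by rw [← hp s hs, ← hp t ht]; rfl
  have h3 := hl _ (A.memF (p s hs - p t ht))
  have h4 : ∀ᵐ x, |(u s - u t) x| ≤ M + M := by
    filter_upwards [hM s hs, hM t ht, ae_sub (u s) (u t)] with x a b c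
    rw [c]; exact (abs_sub _ _).trans (add_le_add a b)
  have h5 := hen (u s - u t) (Lu s - Lu t) (M + M) ((h.gen s hs).sub (h.gen t ht)) h4
  rw [A.Dσ_graph, e1] at h3
  have h6 : ‖p s hs - p t ht‖ ^ 2 ≤ _ := norm_sq_le_of_pair (p s hs - p t ht).1
  rw [e1] at h6
  have h7 : c₁ * ‖(p s hs - p t ht).1.2‖ ^ 2 + ‖u s - u t‖ ^ 2 ≤ R s := by
    have : 0 ≤ c₁ * ‖(p s hs - p t ht).1.2‖ ^ 2 + ‖u s - u t‖ ^ 2 := by positivity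
    simp only [hR]; linarith
  calc _ ≤ ‖u s - u t‖ ^ 2 + ‖(p s hs - p t ht).1.2‖ ^ 2 := h6
    _ ≤ R s + c₁⁻¹ * R s := by
        refine add_le_add ?_ ?_
        · have := mul_nonneg hc.le (sq_nonneg ‖(p s hs - p t ht).1.2‖); linarith
        · rw [← div_eq_inv_mul, le_div_iff₀' hc]
          have := sq_nonneg ‖u s - u t‖; linarith
    _ = _ := by ring

/-- The energy inequality for bounded classical solutions. -/
theorem exists_energy_classical : ∃ β : ℝ, 0 ≤ β ∧
    ∀ (u Lu g : ℝ → L2 d), IsBddClassical S T u Lu g → ∀ t ∈ Icc 0 T,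
      ‖u t‖ ^ 2 + 2 * ∫ s in t..T, Q.energy c₂ (u s)
        ≤ ‖u T‖ ^ 2 + ∫ s in t..T, (2 * inner ℝ (g s) (u s) + β * ‖u s‖ ^ 2) := by
  obtain ⟨β, hβ, hen⟩ := A.exists_energy_gen
  refine ⟨β, hβ, fun u Lu g h t ht => ?_⟩
  obtain ⟨p, hp, hpc⟩ := A.exists_graph_path h
  obtain ⟨M, hM⟩ := h.bdd
  have hsub : Icc t T ⊆ Icc 0 T := Icc_subset_Icc_left ht.1
  have hce : ContinuousOn (fun s => Q.energy c₂ (u s)) (Icc t T) :=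
    ((A.continuous_energy.comp_continuousOn hpc).congr fun s hs => by
      rw [Function.comp_apply, hp s hs]).mono hsub
  have hcu := h.cont.mono hsub
  have hcL := h.contL.mono hsub
  have hcg := h.contg.mono hsub
  have hderiv : ∀ s ∈ Ioo t T, HasDerivAt (fun s => ‖u s‖ ^ 2) (2 * inner ℝ (u s) (-(Lu s) - g s)) s := by
    intro s hs
    have hs' : Icc 0 T ∈ 𝓝 s := Icc_mem_nhds (ht.1.trans_lt hs.1) hs.2
    exact ((h.deriv s ⟨ht.1.trans hs.1.le, hs.2.le⟩).hasDerivAt hs').norm_sq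
  have hcd : ContinuousOn (fun s => 2 * inner ℝ (u s) (-(Lu s) - g s)) (Icc t T) :=
    continuousOn_const.mul (hcu.inner (hcL.neg.sub hcg))
  have hint : ∀ {f : ℝ → ℝ}, ContinuousOn f (Icc t T) → IntervalIntegrable f volume t T :=
    fun hf => hf.intervalIntegrable_of_Icc ht.2
  have hce2 : ContinuousOn (fun s => 2 * Q.energy c₂ (u s)) (Icc t T) := continuousOn_const.mul hce
  have h1 : ∫ s in t..T, 2 * inner ℝ (u s) (-(Lu s) - g s) = ‖u T‖ ^ 2 - ‖u t‖ ^ 2 :=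
    intervalIntegral.integral_eq_sub_of_hasDerivAt_of_le ht.2 (hcu.norm.pow 2) hderiv (hint hcd)
  have hcr : ContinuousOn (fun s => 2 * inner ℝ (g s) (u s) + β * ‖u s‖ ^ 2) (Icc t T) :=
    (continuousOn_const.mul (hcg.inner hcu)).add (continuousOn_const.mul (hcu.norm.pow 2))
  have h2 : ∫ s in t..T, (2 * Q.energy c₂ (u s) - (2 * inner ℝ (g s) (u s) + β * ‖u s‖ ^ 2))
      ≤ ∫ s in t..T, 2 * inner ℝ (u s) (-(Lu s) - g s) := by
    refine integral_mono_on ht.2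
      (hint (hce2.sub hcr)) (hint hcd) fun s hs => ?_
    have := hen (u s) (Lu s) M (h.gen s (hsub hs)) (hM s (hsub hs))
    rw [inner_sub_right, inner_neg_right, real_inner_comm (Lu s), real_inner_comm (g s)]
    linarith
  rw [intervalIntegral.integral_sub (hint hce2) (hint hcr),
    intervalIntegral.integral_const_mul, h1] at h2
  linarith

/-- Mild solutions belong to `F̂`, and satisfy the energy inequality. -/
theorem exists_energy_mild : ∃ β : ℝ, 0 ≤ β ∧
    ∀ (φ : L2 d) (g : ℝ → L2 d), g ∈L¹ T →
      Q.MemFhat c₂ T (mild S T φ g) ∧ ∀ t ∈ Icc 0 T,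
        ‖mild S T φ g t‖ ^ 2 + 2 * ∫ s in t..T, Q.energy c₂ (mild S T φ g s)
          ≤ ‖φ‖ ^ 2 + ∫ s in t..T,
            (2 * inner ℝ (g s) (mild S T φ g s) + β * ‖mild S T φ g s‖ ^ 2) := by
  obtain ⟨β, hβ, hE⟩ := A.exists_energy_classical
  obtain ⟨c₁, hc₁, hlow⟩ := A.exists_energy_lower
  refine ⟨β, hβ, fun φ g hg => ?_⟩
  have hT := A.pos
  have hcu := A.sg.continuousOn_mild hT φ hg
  obtain ⟨un, Lun, gn, δ, hun, hanti, hδ0, hδ, hd, hdg⟩ := A.sg.exists_classical_approx hT φ hg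
  set u := mild S T φ g with hu
  have huT : u T = φ := by simp [hu, mild, A.sg.semigroup.zero_apply]
  have hgn : ∀ n, gn n ∈L¹ T := fun n => (hun n).contg.integrableOn_Icc
  choose p hp hpc using fun n => A.exists_graph_path (hun n)
  have hwc : ∀ n, ContinuousOn (fun t => (p n t).1.2) (Icc 0 T) := fun n =>
    (continuous_snd.comp continuous_subtype_val).comp_continuousOn (hpc n)
  have hwm : ∀ n, MemLp (fun t => (p n t).1.2) 2 (dt T) := fun n =>
    (memLp_two_iff_integrable_sq_norm ((hwc n).aestronglyMeasurable measurableSet_Icc)).2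
      ((hwc n).norm.pow 2).integrableOn_Icc
  have hK : 0 ≤ (6 + 2 * β * T) / c₁ := by positivity
  have hcau : ∀ n m N, N ≤ n → N ≤ m → ∫ t in Icc 0 T, ‖(p n t).1.2 - (p m t).1.2‖ ^ 2
      ≤ (√((6 + 2 * β * T) / c₁) * δ N) ^ 2 := fun n m N hn hm => by
    have hdiff := (hun n).sub (hun m)
    have hnm : ∀ t ∈ Icc 0 T, ‖un n t - un m t‖ ≤ 2 * δ N := fun t ht => by
      have e3 := norm_sub_le_norm_sub_add_norm_sub (un n t) (u t) (un m t)
      rw [norm_sub_rev (u t)] at e3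
      linarith [hd n t ht, hd m t ht, hanti hn, hanti hm]
    have hgnm : ∫ t in Icc 0 T, ‖gn n t - gn m t‖ ≤ 2 * δ N := by
      have e1 := integral_mono ((hgn n).sub (hgn m)).norm
        (((hgn n).sub hg).norm.add ((hgn m).sub hg).norm) fun t => by
          have := norm_sub_le_norm_sub_add_norm_sub (gn n t) (g t) (gn m t)
          rwa [norm_sub_rev (g t)] at this
      have e2 := integral_add ((hgn n).sub hg).norm ((hgn m).sub hg).norm
      exact (e1.trans_eq e2).trans ((add_le_add ((hdg n).trans (hanti hn))
        ((hdg m).trans (hanti hm))).trans_eq (two_mul _).symm)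
    have h1 := hE _ _ _ hdiff 0 (left_mem_Icc.2 hT.le)
    have h2 := integral_inner_add_le hT.le hβ hdiff.cont hdiff.contg.integrableOn_Icc hnm hgnm
    have h3 : c₁ * ∫ t in Icc 0 T, ‖(p n t).1.2 - (p m t).1.2‖ ^ 2
        ≤ ∫ s in (0 : ℝ)..T, Q.energy c₂ (un n s - un m s) := by
      rw [integral_of_le hT.le, ← integral_Icc_eq_integral_Ioc,
        ← integral_const_mul]
      have e1 : ∀ t ∈ Icc 0 T, (p n t - p m t).1.1 = un n t - un m t := fun t ht => by
        rw [← hp n t ht, ← hp m t ht]; rfl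
      refine setIntegral_mono_on
        (continuousOn_const.mul (((hwc n).sub (hwc m)).norm.pow 2)).integrableOn_Icc
        (((A.continuous_energy.comp_continuousOn ((hpc n).sub (hpc m))).congr fun t ht => by
          rw [← e1 t ht]; rfl).integrableOn_Icc) measurableSet_Icc fun t ht => ?_
      have := hlow _ (A.memF (p n t - p m t))
      rw [A.Dσ_graph, e1 t ht] at this
      exact (le_add_of_nonneg_right (sq_nonneg _)).trans this
    have h4 := pow_le_pow_left₀ (norm_nonneg _) (hnm T (right_mem_Icc.2 hT.le)) 2
    rw [mul_pow, sq_sqrt hK, div_mul_eq_mul_div, le_div_iff₀' hc₁]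
    linarith [sq_nonneg ‖un n 0 - un m 0‖]
  obtain ⟨W, hW, -, ns, hns, hae⟩ := exists_limit_of_integral_norm_sq_le hwm
    (by simpa using hδ.const_mul √((6 + 2 * β * T) / c₁)) hcau
    fun n => mul_nonneg (sqrt_nonneg _) (hδ0 n)
  have hnsδ : (fun n => δ (ns n)) ⇝ 0 := hδ.comp hns.tendsto_atTop
  have hunlim : ∀ t ∈ Icc 0 T, (fun n => un (ns n) t) ⇝ u t := fun t ht => by
    rw [tendsto_iff_norm_sub_tendsto_zero]
    exact squeeze_zero (fun _ => norm_nonneg _) (fun n => hd (ns n) t ht) hnsδ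
  have hgraph : ∀ᵐ t ∂(dt T), ∃ q : Q.FGraph, q.1.1 = u t ∧ q.1.2 = W t ∧
      (fun n => p (ns n) t) ⇝ q := by
    filter_upwards [hae, ae_mem_Icc] with t h1 h2
    have h3 : (fun n => (p (ns n) t).1) ⇝ (u t, W t) :=
      Prod.tendsto_iff _ _ |>.2 ⟨(hunlim t h2).congr fun n => (hp (ns n) t h2).symm, h1⟩
    exact ⟨⟨(u t, W t), (Submodule.isClosed_topologicalClosure _).mem_of_tendsto h3
      (.of_forall fun n => (p (ns n) t).2)⟩, rfl, rfl, tendsto_subtype_rng.2 h3⟩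
  have hen : ∀ᵐ t ∂(dt T),
      (fun n => Q.energy c₂ (un (ns n) t)) ⇝ (Q.energy c₂ (u t)) := by
    filter_upwards [hgraph, ae_mem_Icc] with t ⟨q, h1, _, h3⟩ h2
    rw [← h1]
    refine ((A.continuous_energy.tendsto q).comp h3).congr fun n => ?_
    rw [Function.comp_apply, hp _ t h2]
  obtain ⟨B, hB⟩ := isCompact_Icc.exists_bound_of_continuousOn hcu
  have hi := integrableOn_inner_add hcu hg β
  have hin := fun n => integrableOn_inner_add (hun n).cont (hgn n) β
  have hmain : ∀ t ∈ Icc 0 T, IntegrableOn (fun s => Q.energy c₂ (u s)) (Ioc t T) ∧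
      ∫ s in Ioc t T, Q.energy c₂ (u s) ≤ (‖u T‖ ^ 2 + (∫ s in Ioc t T,
        (2 * inner ℝ (g s) (u s) + β * ‖u s‖ ^ 2)) - ‖u t‖ ^ 2) / 2 := by
    intro t ht
    have hsub : Ioc t T ⊆ Icc 0 T := Ioc_subset_Icc_self.trans (Icc_subset_Icc_left ht.1)
    have hlim : (fun n => ∫ s in Ioc t T, (2 * inner ℝ (gn (ns n) s) (un (ns n) s)
        + β * ‖un (ns n) s‖ ^ 2)) ⇝ (∫ s in Ioc t T, (2 * inner ℝ (g s) (u s) + β * ‖u s‖ ^ 2)) := by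
      rw [tendsto_iff_norm_sub_tendsto_zero]
      have h0 : (fun n => 2 * (B + δ 0) * δ (ns n) + 2 * δ (ns n) * (∫ s in Icc 0 T, ‖g s‖)
          + T * (β * (δ (ns n) * (2 * B + δ 0)))) ⇝ 0 := by
        simpa using ((hnsδ.const_mul (2 * (B + δ 0))).add ((hnsδ.const_mul 2).mul_const _)).add
          (((hnsδ.mul_const (2 * B + δ 0)).const_mul β).const_mul T)
      refine squeeze_zero (fun n => norm_nonneg _) (fun n => ?_) h0
      rw [← integral_sub ((hin _).mono_set hsub) (hi.mono_set hsub)]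
      have i1 := ((hgn (ns n)).sub hg).norm.const_mul (2 * (B + δ 0))
      have i2 := hg.norm.const_mul (2 * δ (ns n))
      have i3 := integrableOn_const_Icc (a := 0) (b := T) (β * (δ (ns n) * (2 * B + δ 0)))
      refine (norm_integral_le_integral_norm _).trans ((setIntegral_mono_set
        ((hin _).sub hi).norm (.of_forall fun s => norm_nonneg _) hsub.eventuallyLE).trans
        ((setIntegral_mono_on ((hin _).sub hi).norm ((i1.add i2).add i3) measurableSet_Icc
          fun s hs => ?_).trans ?_))
      · have b1 := hB s hs
        have b2 := hd (ns n) s hs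
        have b3 := hanti (Nat.zero_le (ns n))
        have b4 := norm_le_norm_add_norm_sub' (un (ns n) s) (u s)
        have e1 := norm_inner_le_norm (𝕜 := ℝ) (gn (ns n) s - g s) (un (ns n) s)
        have e2 := norm_inner_le_norm (𝕜 := ℝ) (g s) (un (ns n) s - u s)
        have e3 := norm_inner_le_norm (𝕜 := ℝ) (un (ns n) s - u s) (un (ns n) s + u s)
        have e4 := norm_add_le (un (ns n) s) (u s)
        have e5 : 2 * inner ℝ (gn (ns n) s) (un (ns n) s) + β * ‖un (ns n) s‖ ^ 2
            - (2 * inner ℝ (g s) (u s) + β * ‖u s‖ ^ 2)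
            = 2 * inner ℝ (gn (ns n) s - g s) (un (ns n) s)
              + 2 * inner ℝ (g s) (un (ns n) s - u s)
              + β * inner ℝ (un (ns n) s - u s) (un (ns n) s + u s) := by
          simp only [inner_sub_left, inner_sub_right, inner_add_right, real_inner_self_eq_norm_sq,
            real_inner_comm (u s) (un (ns n) s)]
          ring
        simp only [Pi.add_apply, Pi.sub_apply]
        rw [e5]
        refine (norm_add₃_le).trans (add_le_add (add_le_add ?_ ?_) ?_)
        · rw [norm_mul, Real.norm_ofNat, mul_assoc, mul_comm (B + δ 0)]
          gcongr
          exact e1.trans (by gcongr; linarith)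
        · rw [norm_mul, Real.norm_ofNat, mul_assoc, mul_comm (δ _)]
          gcongr
          exact e2.trans (by gcongr)
        · rw [norm_mul, norm_of_nonneg hβ]
          gcongr
          exact e3.trans (mul_le_mul b2 (by linarith) (norm_nonneg _) (hδ0 _))
      · have e1 := integral_add (i1.add i2) i3
        have e2 := integral_add i1 i2
        have e3 : ∫ _ in Icc 0 T, β * (δ (ns n) * (2 * B + δ 0))
          = T * (β * (δ (ns n) * (2 * B + δ 0))) := by simp [hT.le]
        simp only [Pi.add_apply, Pi.sub_apply, integral_const_mul] at e1 e2 e3 ⊢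
        have hB0 := (norm_nonneg _).trans (hB 0 (left_mem_Icc.2 hT.le))
        have := mul_le_mul_of_nonneg_left (hdg (ns n))
          (show 0 ≤ 2 * (B + δ 0) by linarith [hδ0 0])
        linarith
    refine integrable_of_tendsto_of_integral_le (f := fun n s => Q.energy c₂ (un (ns n) s))
      (fun n => (((A.continuous_energy.comp_continuousOn (hpc (ns n))).congr fun s hs => by
        rw [Function.comp_apply, hp _ s hs]).integrableOn_Icc).mono_set hsub) (fun n => ?_)
      (ae_restrict_of_ae_restrict_of_subset hsub hen) (fun n => ?_)
      (((((hunlim T (right_mem_Icc.2 hT.le)).norm.pow 2).add hlim).sub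
        ((hunlim t ht).norm.pow 2)).div_const 2)
    · refine ae_restrict_of_forall_mem measurableSet_Ioc fun s hs => ?_
      rw [← hp _ s (hsub hs)]
      exact A.energy_nonneg (A.memF _)
    · have := hE _ _ _ (hun (ns n)) t ht
      rw [integral_of_le ht.2, integral_of_le ht.2] at this
      linarith
  refine ⟨⟨hcu, ?_, ?_, ?_⟩, fun t ht => ?_⟩
  · filter_upwards [hgraph] with t ⟨q, h1, _⟩
    rw [← h1]; exact A.memF q
  · refine hW.1.congr ?_
    filter_upwards [hgraph] with t ⟨q, h1, h2, _⟩
    rw [← h2, ← h1, A.Dσ_graph]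
  · rw [integrableOn_Icc_iff_integrableOn_Ioc]
    exact (hmain 0 (left_mem_Icc.2 hT.le)).1
  · have := (hmain t ht).2
    rw [integral_of_le ht.2, integral_of_le ht.2]
    rw [huT] at this
    linarith

/-- The weighted energy estimate for systems. -/
theorem exists_weighted_energy : ∃ c₁ > 0, ∃ β : ℝ, 0 ≤ β ∧
    (∀ u, Q.MemF c₂ u → c₁ * ‖Q.Dσ u‖ ^ 2 + ‖u‖ ^ 2 ≤ Q.energy c₂ u) ∧
    ∀ {l : ℕ} {φ : Fin l → L2 d} {u g : Fin l → ℝ → L2 d} {κ r : ℝ → ℝ},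
      (∀ i, g i ∈L¹ T) → (∀ i, u i = mild S T (φ i) (g i)) →
      κ ∈L¹ T → (∀ t, 0 ≤ κ t) → r ∈L¹ T →
      (∀ᵐ t ∂(dt T), 2 * ∑ i, inner ℝ (g i t) (u i t)
        ≤ κ t * ∑ i, ‖u i t‖ ^ 2 + c₁ * ∑ i, ‖Q.Dσ (u i t)‖ ^ 2 + r t) →
      ∀ t ∈ Icc 0 T, expInt (fun s => κ s + β) t * ∑ i, ‖u i t‖ ^ 2
          + ∫ s in t..T, expInt (fun s => κ s + β) s * ∑ i, Q.energy c₂ (u i s)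
        ≤ expInt (fun s => κ s + β) T * ∑ i, ‖φ i‖ ^ 2
          + ∫ s in t..T, expInt (fun s => κ s + β) s * r s := by
  obtain ⟨c₁, hc₁, hlow⟩ := A.exists_energy_lower
  obtain ⟨β, hβ, hE⟩ := A.exists_energy_mild
  refine ⟨c₁, hc₁, β, hβ, hlow, ?_⟩
  intro l φ u g κ r hg hu hκ hκ0 hr hle t ht
  have hT := ht.1.trans ht.2
  have hF : ∀ i, Q.MemFhat c₂ T (u i) := fun i => by rw [hu]; exact (hE _ _ (hg i)).1
  have hYc : ContinuousOn (fun s => ∑ i, ‖u i s‖ ^ 2) (Icc 0 T) :=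
    continuousOn_finsetSum _ fun i _ => (hF i).cont.norm.pow 2
  have hκβ : (fun s => κ s + β) ∈L¹ T :=
    hκ.add (integrableOn_const_Icc β)
  have hEi : (fun s => ∑ i, Q.energy c₂ (u i s)) ∈L¹ T :=
    integrable_finsetSum _ fun i _ => (hF i).int
  have hκY : (fun s => (κ s + β) * ∑ i, ‖u i s‖ ^ 2) ∈L¹ T :=
    hκβ.mul_continuousOn hYc isCompact_Icc
  have hh : (fun s => (κ s + β) * (∑ i, ‖u i s‖ ^ 2) + (r s
      - ∑ i, Q.energy c₂ (u i s))) ∈L¹ T := hκY.add (hr.sub hEi)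
  have key : ∀ t ∈ Icc 0 T, ∑ i, ‖u i t‖ ^ 2 ≤ (∑ i, ‖φ i‖ ^ 2)
      + ∫ s in t..T, ((κ s + β) * (∑ i, ‖u i s‖ ^ 2) + (r s - ∑ i, Q.energy c₂ (u i s))) := by
    intro t ht
    have hi : ∀ {f : ℝ → ℝ}, f ∈L¹ T → IntervalIntegrable f volume t T := fun hf =>
      (intervalIntegrable_iff_integrableOn_Icc_of_le ht.2).2
        (hf.mono_set (Icc_subset_Icc_left ht.1))
    have hgu := fun i => integrableOn_inner_add (hF i).cont (hg i) β
    have h1 : ∑ i, (‖u i t‖ ^ 2 + 2 * ∫ s in t..T, Q.energy c₂ (u i s))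
        ≤ ∑ i, (‖φ i‖ ^ 2 + ∫ s in t..T, (2 * inner ℝ (g i s) (u i s) + β * ‖u i s‖ ^ 2)) :=
      sum_le_sum fun i _ => by
        have := (hE (φ i) (g i) (hg i)).2 t ht
        rwa [← hu] at this
    rw [sum_add_distrib, sum_add_distrib, ← mul_sum,
      ← intervalIntegral.integral_finsetSum fun i _ => hi (hF i).int,
      ← intervalIntegral.integral_finsetSum fun i _ => hi (hgu i)] at h1
    have h2 : ∫ s in t..T, ∑ i, (2 * inner ℝ (g i s) (u i s) + β * ‖u i s‖ ^ 2)
        ≤ ∫ s in t..T, (((κ s + β) * (∑ i, ‖u i s‖ ^ 2) + (r s - ∑ i, Q.energy c₂ (u i s)))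
          + 2 * ∑ i, Q.energy c₂ (u i s)) := by
      refine integral_mono_ae_restrict ht.2
        (hi (integrable_finsetSum _ fun i _ => hgu i)) ((hi hh).add ((hi hEi).const_mul 2)) ?_
      have hle' := ae_restrict_of_ae_restrict_of_subset
        (Icc_subset_Icc_left ht.1 : Icc t T ⊆ Icc 0 T) hle
      have hmem := ae_restrict_of_ae_restrict_of_subset
        (Icc_subset_Icc_left ht.1 : Icc t T ⊆ Icc 0 T) (ae_all_iff.2 fun i => (hF i).mem)
      filter_upwards [hle', hmem] with s hs hm
      have h3 : c₁ * ∑ i, ‖Q.Dσ (u i s)‖ ^ 2 ≤ ∑ i, Q.energy c₂ (u i s) := by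
        rw [mul_sum]
        exact sum_le_sum fun i _ => by nlinarith [hlow _ (hm i), sq_nonneg ‖u i s‖]
      simp only [sum_add_distrib, ← mul_sum]
      linarith
    rw [intervalIntegral.integral_add (hi hh) ((hi hEi).const_mul 2),
      intervalIntegral.integral_const_mul] at h2
    linarith
  have h := expInt_mul_add_integral_le hκβ (fun s => add_nonneg (hκ0 s) hβ) ht
    (hYc.mono (Icc_subset_Icc_left ht.1)) (hh.mono_set (Icc_subset_Icc_left ht.1))
    fun s hs => key s ⟨ht.1.trans hs.1, hs.2⟩
  have hi : ∀ {f : ℝ → ℝ}, f ∈L¹ T → IntervalIntegrable f volume t T := fun hf =>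
    (intervalIntegrable_iff_integrableOn_Icc_of_le ht.2).2
      (hf.mono_set (Icc_subset_Icc_left ht.1))
  have hΓ := continuousOn_expInt hT hκβ
  have e : ∫ s in t..T, expInt (fun s => κ s + β) s * ((κ s + β) * (∑ i, ‖u i s‖ ^ 2)
      + (r s - ∑ i, Q.energy c₂ (u i s)))
      = (∫ s in t..T, (κ s + β) * expInt (fun s => κ s + β) s * ∑ i, ‖u i s‖ ^ 2)
        + ((∫ s in t..T, expInt (fun s => κ s + β) s * r s)
          - ∫ s in t..T, expInt (fun s => κ s + β) s * ∑ i, Q.energy c₂ (u i s)) := by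
    rw [← intervalIntegral.integral_sub (hi (hr.continuousOn_mul hΓ isCompact_Icc))
      (hi (hEi.continuousOn_mul hΓ isCompact_Icc)), ← intervalIntegral.integral_add
      (hi ((hκβ.mul_continuousOn hΓ isCompact_Icc).mul_continuousOn hYc isCompact_Icc))
      ((hi (hr.continuousOn_mul hΓ isCompact_Icc)).sub (hi (hEi.continuousOn_mul hΓ isCompact_Icc)))]
    exact integral_congr fun s _ => by ring
  rw [e] at h
  linarith

/-- Mild solutions depend continuously on the data. -/
theorem exists_mild_bound : ∃ K : ℝ, 0 ≤ K ∧
    ∀ (φ : L2 d) (g : ℝ → L2 d), g ∈L¹ T →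
      (∀ t ∈ Icc 0 T, ‖mild S T φ g t‖ ≤ K * (‖φ‖ + ∫ s in Icc 0 T, ‖g s‖)) ∧
      (∫ t in Icc 0 T, Q.energy c₂ (mild S T φ g t)) ≤ K * (‖φ‖ + ∫ s in Icc 0 T, ‖g s‖) ^ 2 ∧
      (fun t => ‖Q.Dσ (mild S T φ g t)‖ ^ 2) ∈L¹ T ∧
      ∫ t in Icc 0 T, ‖Q.Dσ (mild S T φ g t)‖ ^ 2 ≤ K * (‖φ‖ + ∫ s in Icc 0 T, ‖g s‖) ^ 2 := by
  obtain ⟨c₁, hc₁, hlow⟩ := A.exists_energy_lower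
  obtain ⟨β, hβ, hE⟩ := A.exists_energy_mild
  obtain ⟨M, hM1, hM⟩ := A.sg.semigroup.exists_bound T
  have hT : 0 < T := A.pos
  have hM0 : 0 ≤ M := by linarith
  refine ⟨M + (3 + β * T) * M ^ 2 + (3 + β * T) * M ^ 2 / c₁, by positivity, fun φ g hg => ?_⟩
  obtain ⟨hF, hen⟩ := hE φ g hg
  set u := mild S T φ g
  set X := ‖φ‖ + ∫ s in Icc 0 T, ‖g s‖ with hX
  have hG0 : 0 ≤ ∫ s in Icc 0 T, ‖g s‖ := by positivity
  have hX0 : 0 ≤ X := by positivity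
  have hXM : X ≤ M * X := le_mul_of_one_le_left hX0 hM1
  have hb : ∀ t ∈ Icc 0 T, ‖u t‖ ≤ M * X := fun t ht => by
    refine (IsC0Semigroup.norm_mild_le hM hg ht).trans ?_
    refine mul_le_mul_of_nonneg_left (add_le_add_right ?_ _) hM0
    rw [integral_of_le ht.2]
    exact setIntegral_mono_set hg.norm (.of_forall fun s => norm_nonneg _)
      (Ioc_subset_Icc_self.trans (Icc_subset_Icc_left ht.1)).eventuallyLE
  have hEL : ∫ t in Icc 0 T, Q.energy c₂ (u t) ≤ (3 + β * T) * M ^ 2 * X ^ 2 := by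
    have h0 := hen 0 (left_mem_Icc.2 hT.le)
    have h1 := integral_inner_add_le hT.le hβ hF.cont hg hb
      ((le_add_of_nonneg_left (norm_nonneg φ)).trans hXM)
    have h2 := pow_le_pow_left₀ (norm_nonneg _)
      ((le_add_of_nonneg_right (a := ‖φ‖) hG0).trans hXM) 2
    have hE0 : 0 ≤ ∫ t in Icc 0 T, Q.energy c₂ (u t) := integral_nonneg_of_ae <| by
      filter_upwards [hF.mem] with t ht using A.energy_nonneg ht
    rw [integral_Icc_eq_integral_Ioc, ← integral_of_le hT.le] at hE0 ⊢
    rw [mul_pow] at h1 h2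
    linarith [sq_nonneg ‖u 0‖]
  have hlow' : ∀ᵐ t ∂(dt T), c₁ * ‖Q.Dσ (u t)‖ ^ 2 ≤ Q.energy c₂ (u t) := by
    filter_upwards [hF.mem] with t ht using
      (le_add_of_nonneg_right (sq_nonneg _)).trans (hlow _ ht)
  have hDi : (fun t => ‖Q.Dσ (u t)‖ ^ 2) ∈L¹ T := by
    refine (hF.int.const_mul c₁⁻¹).mono' (hF.meas.norm.pow 2) ?_
    filter_upwards [hlow'] with t ht
    rwa [norm_of_nonneg (by positivity), inv_mul_eq_div, le_div_iff₀' hc₁]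
  have hc : 0 ≤ (3 + β * T) * M ^ 2 / c₁ := by positivity
  refine ⟨fun t ht => (hb t ht).trans ?_, hEL.trans ?_, hDi, ?_⟩
  · gcongr
    linarith [show 0 ≤ (3 + β * T) * M ^ 2 by positivity]
  · gcongr
    linarith
  · have e1 := (integral_mono_ae (hDi.const_mul c₁) hF.int hlow').trans hEL
    rw [integral_const_mul, ← le_div_iff₀' hc₁, mul_div_right_comm] at e1
    refine e1.trans ?_
    gcongr
    linarith [show 0 ≤ (3 + β * T) * M ^ 2 by positivity]

/-- Comparison of `∑ uᵢ²` with a bounded classical solution. -/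
theorem exists_sq_comparison : ∃ κ : ℝ, 0 ≤ κ ∧
    ∀ {u Lu g : Fin l → ℝ → L2 d} {v Lv h a b r : ℝ → L2 d} {ε : ℝ},
      (∀ i, IsBddClassical S T (u i) (Lu i) (g i)) → IsBddClassical S T v Lv h →
      ContinuousOn a (Icc 0 T) →
      (∀ t ∈ Icc 0 T, a t =ᵐ[volume] fun x => (∑ i, u i t x ^ 2) - v t x) →
      (∀ t ∈ Icc 0 T, b t =ᵐ[volume] fun x =>
        (2 * ∑ i, (Lu i t x + g i t x) * u i t x) - (Lv t x + h t x)) →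
      (∀ t ∈ Icc 0 T, ∀ᵐ x, 2 * ∑ i, g i t x * u i t x - 2 * ∑ i, ‖Q.Dσ (u i t) x‖ ^ 2 ≤ r t x) →
      (∀ t ∈ Icc 0 T, ‖r t - h t‖ ≤ ε) →
      ∀ t ∈ Icc 0 T, ‖Lp.posPart (a t)‖ ^ 2
        ≤ gronwallBound (‖Lp.posPart (a T)‖ ^ 2) (2 * κ + 1) (ε ^ 2) (T - t) := by
  obtain ⟨κ, hκ, hcomp⟩ := A.A4.comparison (l := l) A.A1 A.A2' A.A3 A.A2
  refine ⟨κ, hκ, ?_⟩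
  intro u Lu g v Lv h a b r ε hu hv hac ha hb hr hε t ht
  have hT : 0 < T := A.pos
  choose M hM using fun i => (hu i).bdd
  obtain ⟨N, hN⟩ := hv.bdd
  set η : ℝ → L2 d := fun t => Lp.posPart (a t) with hη
  have hηc : ContinuousOn η (Icc 0 T) := Lp.continuous_posPart.comp_continuousOn hac
  have hη' : ∀ t ∈ Icc 0 T, η t =ᵐ[volume] fun x => max ((∑ i, u i t x ^ 2) - v t x) 0 := by
    intro t ht
    filter_upwards [Lp.coeFn_posPart (a t), ha t ht] with x h1 h2
    rw [h1, h2]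
  have hrefl : ∀ τ ∈ Icc 0 T, T - τ ∈ Icc 0 T := fun τ h => ⟨by linarith [h.2], by linarith [h.1]⟩
  have hF : ContinuousOn (fun τ => ‖η (T - τ)‖ ^ 2) (Icc 0 T) :=
    ((hηc.comp (continuous_const.sub continuous_id).continuousOn hrefl).norm).pow 2
  have key := le_gronwallBound_of_liminf_deriv_right_le (f := fun τ => ‖η (T - τ)‖ ^ 2)
    (f' := fun τ => 2 * inner ℝ (η (T - τ)) (b (T - τ))) (δ := ‖η T‖ ^ 2) (K := 2 * κ + 1)
    (ε := ε ^ 2) hF ?_ (by simp) ?_ (T - t) (hrefl t ht)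
  · simpa using key
  · intro τ hτ ρ hρ
    have hτ' : τ ∈ Icc 0 T := Ico_subset_Icc_self hτ
    set t := T - τ with htdef
    have ht' : t ∈ Icc 0 T := hrefl τ hτ'
    choose p hpc hp using fun i => exists_mul_path hηc (hu i).cont (hM i)
    choose q hqc hq using fun i => exists_mul_path hηc
      (continuousOn_const (c := u i t)) (fun _ _ => hM i t ht')
    have hev : ∀ᶠ z in 𝓝[>] τ, z ∈ Ioc τ T := Ioc_mem_nhdsGT hτ.2
    have hmap : Tendsto (fun z => T - z) (𝓝[>] τ) (𝓝[Icc 0 T] t) := by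
      refine tendsto_nhdsWithin_iff.2 ⟨?_, ?_⟩
      · exact ((continuous_const.sub continuous_id).tendsto τ).mono_left nhdsWithin_le_nhds
      · filter_upwards [hev] with z hz
        exact hrefl z ⟨hτ.1.trans hz.1.le, hz.2⟩
    have hp' : ∀ i, Tendsto (fun z => p i (T - z)) (𝓝[>] τ) (𝓝 (p i t)) := fun i =>
      (hpc i t ht').tendsto.comp hmap
    have hq' : ∀ i, Tendsto (fun z => q i (T - z)) (𝓝[>] τ) (𝓝 (q i t)) := fun i =>
      (hqc i t ht').tendsto.comp hmap
    have hη'' : Tendsto (fun z => η (T - z)) (𝓝[>] τ) (𝓝 (η t)) := (hηc t ht').tendsto.comp hmap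
    have hdu := fun i => tendsto_slope_reflect hτ ((hu i).deriv t ht')
    have hdv := tendsto_slope_reflect hτ (hv.deriv t ht')
    simp only [← htdef] at hdu hdv
    have hlim := (((tendsto_finsetSum Finset.univ fun i _ =>
      ((hp' i).add (hq' i)).inner (𝕜 := ℝ) (hdu i))).sub (hη''.inner (𝕜 := ℝ) hdv)).const_mul 2
    have hval : 2 * ((∑ i, inner ℝ (p i t + q i t) (-(-(Lu i t) - g i t)))
        - inner ℝ (η t) (-(-(Lv t) - h t))) = 2 * inner ℝ (η t) (b t) := by
      congr 1
      simp only [inner_def]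
      rw [← integral_finsetSum _ fun i _ => integrable_inner _ _,
        ← integral_sub (integrable_finsetSum _ fun i _ => integrable_inner _ _)
          (integrable_inner _ _)]
      refine integral_congr_ae ?_
      have e1 : ∀ᵐ x, ∀ i, (p i t + q i t : L2 d) x = p i t x + q i t x :=
        ae_all_iff.2 fun i => coeFn_add _ _
      have e2 : ∀ᵐ x, ∀ i, (-(-(Lu i t) - g i t) : L2 d) x = Lu i t x + g i t x :=
        ae_all_iff.2 fun i => by
          rw [show -(-(Lu i t) - g i t) = Lu i t + g i t by abel]
          exact coeFn_add _ _
      have e3 : ∀ᵐ x, (-(-(Lv t) - h t) : L2 d) x = Lv t x + h t x := by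
        rw [show -(-(Lv t) - h t) = Lv t + h t by abel]
        exact coeFn_add _ _
      filter_upwards [e1, e2, e3, hb t ht', ae_all_iff.2 fun i => hp i t ht',
        ae_all_iff.2 fun i => hq i t ht'] with x h1 h2 h3 h4 h5 h6
      simp only [real_inner_eq_mul, h1, h2, h3, h4, h5, h6, mul_sub, mul_sum]
      congr 1
      exact sum_congr rfl fun i _ => by ring
    rw [hval] at hlim
    refine ((hlim.eventually_lt_const hρ).and hev).frequently.mono fun z hz => ?_
    refine lt_of_le_of_lt ?_ hz.1
    have hz0 : 0 < z - τ := sub_pos.2 hz.2.1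
    have hs : T - z ∈ Icc 0 T := hrefl z ⟨hτ.1.trans hz.2.1.le, hz.2.2⟩
    simp only [inner_smul_right, ← mul_sum, ← mul_sub]
    rw [mul_left_comm]
    refine mul_le_mul_of_nonneg_left ((norm_sq_posPart_sub_le (a (T - z)) (a t)).trans_eq ?_)
      (inv_nonneg.2 hz0.le)
    congr 1
    simp only [inner_def]
    rw [← integral_finsetSum _ fun i _ => integrable_inner _ _,
      ← integral_sub (integrable_finsetSum _ fun i _ => integrable_inner _ _)
        (integrable_inner _ _)]
    refine integral_congr_ae ?_
    have e1 : ∀ᵐ x, ∀ i, (p i (T - z) + q i (T - z) : L2 d) x = p i (T - z) x + q i (T - z) x :=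
      ae_all_iff.2 fun i => coeFn_add _ _
    have e2 : ∀ᵐ x, ∀ i, (u i (T - z) - u i t : L2 d) x = u i (T - z) x - u i t x :=
      ae_all_iff.2 fun i => coeFn_sub _ _
    filter_upwards [e1, e2, ae_sub (v (T - z)) (v t), ae_sub (a (T - z)) (a t),
      ha t ht', ha _ hs, ae_all_iff.2 fun i => hp i _ hs, ae_all_iff.2 fun i => hq i _ hs]
      with x h1 h2 h3 h4 h5 h6 h7 h8
    simp only [real_inner_eq_mul, h1, h2, h3, h4, h5, h6, h7, h8]
    have e3 : ∀ i, (u i (T - z) x * η (T - z) x + u i t x * η (T - z) x)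
        * (u i (T - z) x - u i t x) = η (T - z) x * (u i (T - z) x ^ 2 - u i t x ^ 2) := fun i => by
      ring
    simp only [e3, ← mul_sum, sum_sub_distrib]
    simp only [hη]
    ring
  · intro τ hτ
    have ht' : T - τ ∈ Icc 0 T := hrefl τ (Ico_subset_Icc_self hτ)
    generalize T - τ = t at ht' ⊢
    choose p hp1 hp2 using fun i => A.exists_graph (A.memF_of_hasGen ((hu i).gen t ht') (hM i t ht'))
    obtain ⟨q, hq1, -⟩ := A.exists_graph (A.memF_of_hasGen (hv.gen t ht') (hN t ht'))
    have hMi : ∀ i, ∀ᵐ x, |(p i).1.1 x| ≤ ∑ j, |M j| := fun i => by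
      rw [hp1]
      filter_upwards [hM i t ht'] with x hx
      exact hx.trans ((le_abs_self _).trans
        (single_le_sum (f := fun j => |M j|) (fun j _ => abs_nonneg _) (Finset.mem_univ i)))
    have hc := hcomp p (fun i => Lu i t) q (Lv t) (η t) _ N
      (fun i => by rw [hp1]; exact (A.sg.gen_iff _ _).2 ((hu i).gen t ht'))
      (by rw [hq1]; exact (A.sg.gen_iff _ _).2 (hv.gen t ht')) hMi
      (by rw [hq1]; exact hN t ht') (by simp only [hp1, hq1]; exact hη' t ht')
    simp only [hp1, hp2] at hc
    have hηb : ∀ᵐ x, |η t x| ≤ (∑ i, M i ^ 2) + N := by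
      filter_upwards [hη' t ht', ae_all_iff.2 fun i => hM i t ht', hN t ht'] with x h1 h2 h3
      rw [h1, abs_of_nonneg (le_max_right _ _)]
      have e1 : ∑ i, u i t x ^ 2 ≤ ∑ i, M i ^ 2 :=
        sum_le_sum fun i _ => sq_le_sq' (by linarith [abs_le.1 (h2 i)]) (abs_le.1 (h2 i)).2
      refine max_le (by linarith [(abs_le.1 h3).1]) ?_
      have : 0 ≤ ∑ i, M i ^ 2 := sum_nonneg fun i _ => sq_nonneg _
      linarith [abs_nonneg (v t x)]
    have hη0 : ∀ᵐ x, 0 ≤ η t x := by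
      filter_upwards [hη' t ht'] with x h1
      rw [h1]; exact le_max_right _ _
    have i1 : Integrable fun x => (2 * ∑ i, ‖Q.Dσ (u i t) x‖ ^ 2 + 2 * ∑ i, Lu i t x * u i t x
        - Lv t x) * η t x := by
      have j1 : Integrable fun x => 2 * ∑ i, ‖Q.Dσ (u i t) x‖ ^ 2 + 2 * ∑ i, Lu i t x * u i t x :=
        ((integrable_finsetSum _ fun i _ => (memLp (Q.Dσ (u i t))).integrable_norm_pow
          (by norm_num)).const_mul 2).add ((integrable_finsetSum _ fun i _ =>
            (memLp (Lu i t)).integrable_mul (memLp (u i t))).const_mul 2)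
      have j2 := j1.mul_bdd (c := (∑ i, M i ^ 2) + N) (memLp (η t)).1
        (by simpa [norm_eq_abs] using hηb)
      have j3 : Integrable fun x => Lv t x * η t x :=
        (memLp (Lv t)).integrable_mul (memLp (η t))
      exact (j2.sub j3).congr (of_forall fun x => by
        simp only [Pi.sub_apply]; ring)
    have h1 : (inner ℝ (η t) (b t) : ℝ) ≤ κ * ‖η t‖ ^ 2 + ‖η t‖ * ε := by
      have e1 : (inner ℝ (η t) (b t) : ℝ) ≤ (∫ x, (2 * ∑ i, ‖Q.Dσ (u i t) x‖ ^ 2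
          + 2 * ∑ i, Lu i t x * u i t x - Lv t x) * η t x) + inner ℝ (η t) (r t - h t) := by
        rw [inner_def, inner_def, ← integral_add i1 (integrable_inner _ _)]
        refine integral_mono_ae (integrable_inner _ _) (i1.add (integrable_inner _ _)) ?_
        filter_upwards [hb t ht', hr t ht', ae_sub (r t) (h t), hη0] with x h1 h2 h3 h4
        simp only [real_inner_eq_mul, h1, h3]
        have e : ∑ i, (Lu i t x + g i t x) * u i t x
            = ∑ i, Lu i t x * u i t x + ∑ i, g i t x * u i t x := by
          rw [← sum_add_distrib]
          exact sum_congr rfl fun i _ => by ring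
        rw [e]
        have := mul_le_mul_of_nonneg_left h2 h4
        linarith
      have e2 := real_inner_le_norm (η t) (r t - h t)
      have e3 : ‖η t‖ * ‖r t - h t‖ ≤ ‖η t‖ * ε := by
        gcongr
        exact hε t ht'
      linarith
    nlinarith [sq_nonneg (‖η t‖ - ε)]

theorem continuousOn_Dσ {u Lu g : ℝ → L2 d}
    (h : IsBddClassical S T u Lu g) : ContinuousOn (fun t => Q.Dσ (u t)) (Icc 0 T) := by
  obtain ⟨p, hp, hpc⟩ := A.exists_graph_path h
  refine ((continuous_snd.comp continuous_subtype_val).comp_continuousOn hpc).congr fun t ht => ?_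
  rw [← hp t ht, A.Dσ_graph]
  rfl

theorem le_mild_of_classical {u Lu g : Fin l → ℝ → L2 d}
    (hu : ∀ i, IsBddClassical S T (u i) (Lu i) (g i)) {a r : ℝ → L2 d}
    (hac : ContinuousOn a (Icc 0 T)) (hrc : ContinuousOn r (Icc 0 T))
    (ha : ∀ t ∈ Icc 0 T, a t =ᵐ[volume] fun x => ∑ i, u i t x ^ 2)
    (hr : ∀ t ∈ Icc 0 T, ∀ᵐ x,
      2 * ∑ i, g i t x * u i t x - 2 * ∑ i, ‖Q.Dσ (u i t) x‖ ^ 2 ≤ r t x)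
    {t : ℝ} (ht : t ∈ Icc 0 T) : ∀ᵐ x, a t x ≤ mild S T (a T) r t x := by
  have hT : 0 < T := A.pos
  obtain ⟨κ, hκ, hcomp⟩ := A.exists_sq_comparison (l := l)
  obtain ⟨M, hM1, hM⟩ := A.sg.semigroup.exists_bound T
  choose B hB using fun i => (hu i).bdd
  choose e hec he using fun i => exists_mul_path ((hu i).contL.add (hu i).contg) (hu i).cont (hB i)
  choose v Lv h hv h1 h2 using fun n : ℕ => A.sg.exists_isBddClassical_of_continuousOn hT (a T) hrc
    (ε := 1 / ((n : ℝ) + 1)) (by positivity)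
  have hri : r ∈L¹ T := hrc.integrableOn_Icc
  have hlim : (fun n => v n t) ⇝ (mild S T (a T) r t) := by
    rw [tendsto_iff_norm_sub_tendsto_zero]
    have h0 : (fun n : ℕ => M * (1 + T) * (1 / ((n : ℝ) + 1))) ⇝ 0 := by
      simpa using tendsto_one_div_add_atTop_nhds_zero_nat.const_mul (M * (1 + T))
    refine squeeze_zero (fun _ => norm_nonneg _) (fun n => ?_) h0
    have hgi : h n ∈L¹ T := (hv n).contg.integrableOn_Icc
    rw [(hv n).eq_mild A.sg.semigroup ht, ← A.sg.semigroup.mild_sub hgi hri ht]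
    refine (IsC0Semigroup.norm_mild_le hM (hgi.sub hri) ht).trans ?_
    rw [mul_assoc]
    refine mul_le_mul_of_nonneg_left ?_ (by linarith)
    change ‖v n T - a T‖ + ∫ s in t..T, ‖h n s - r s‖ ≤ _
    have h3 : ∫ s in t..T, ‖h n s - r s‖ ≤ ∫ s in t..T, 1 / ((n : ℝ) + 1) := by
      refine integral_mono_on ht.2 ?_ intervalIntegrable_const fun s hs =>
        (h2 n s ⟨ht.1.trans hs.1, hs.2⟩).le
      exact (intervalIntegrable_iff_integrableOn_Icc_of_le ht.2).2
        (Integrable.norm ((hgi.sub hri).mono_set (Icc_subset_Icc_left ht.1)))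
    rw [intervalIntegral.integral_const, smul_eq_mul] at h3
    have h4 : (T - t) * (1 / ((n : ℝ) + 1)) ≤ T * (1 / ((n : ℝ) + 1)) := by
      gcongr; linarith [ht.1]
    linarith [(h1 n).le]
  have hn : ∀ n : ℕ, ‖Lp.posPart (a t - v n t)‖ ^ 2
      ≤ gronwallBound 1 (2 * κ + 1) 1 (T - t) * (1 / ((n : ℝ) + 1)) ^ 2 := by
    intro n
    have hc := hcomp (a := fun s => a s - v n s)
      (b := fun s => (2 : ℝ) • (∑ i, e i s) - (Lv n s + h n s)) (r := r) hu (hv n)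
      (hac.sub (hv n).cont)
      (fun s hs => by
        filter_upwards [ae_sub (a s) (v n s), ha s hs] with x e1 e2
        rw [e1, e2])
      (fun s hs => by
        filter_upwards [ae_sub ((2 : ℝ) • ∑ i, e i s) (Lv n s + h n s),
          ae_add (Lv n s) (h n s), ae_smul (2 : ℝ) (∑ i, e i s),
          coeFn_sum_Lp Finset.univ fun i => e i s, ae_all_iff.2 fun i => he i s hs,
          ae_all_iff.2 fun i => ae_add (Lu i s) (g i s)] with x e1 e2 e3 e4 e5 e6
        rw [e1, e2, e3, e4, smul_eq_mul]
        congr 2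
        refine sum_congr rfl fun i _ => ?_
        rw [e5 i]
        have := e6 i
        simp only [Pi.add_apply] at this ⊢
        rw [this]; ring) hr (fun s hs => by rw [norm_sub_rev]; exact (h2 n s hs).le) t ht
    refine hc.trans ?_
    have hK : 2 * κ + 1 ≠ 0 := by positivity
    simp only [gronwallBound_of_K_ne_0 hK]
    have h3 : ‖Lp.posPart (a T - v n T)‖ ^ 2 ≤ (1 / ((n : ℝ) + 1)) ^ 2 := by
      refine pow_le_pow_left₀ (norm_nonneg _) ?_ 2
      refine le_trans (Lp.norm_le_norm_of_ae_le ?_) ((norm_sub_rev _ _).trans_le (h1 n).le)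
      filter_upwards [Lp.coeFn_posPart (a T - v n T)] with x hx
      rw [hx, norm_eq_abs, norm_eq_abs, abs_of_nonneg (le_max_right _ _)]
      exact max_le (le_abs_self _) (abs_nonneg _)
    have h4 := mul_le_mul_of_nonneg_right h3 (exp_pos ((2 * κ + 1) * (T - t))).le
    refine (add_le_add_left h4 _).trans_eq ?_
    ring
  have hpos : Lp.posPart (a t - mild S T (a T) r t) = 0 := by
    have l1 : (fun n => ‖Lp.posPart (a t - v n t)‖ ^ 2) ⇝ (‖Lp.posPart (a t - mild S T (a T) r t)‖ ^ 2) :=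
      ((Lp.continuous_posPart.tendsto _).comp (tendsto_const_nhds.sub hlim)).norm.pow 2
    have l2 : (fun n : ℕ => gronwallBound 1 (2 * κ + 1) 1 (T - t) * (1 / ((n : ℝ) + 1)) ^ 2) ⇝ 0 := by
      simpa using (tendsto_one_div_add_atTop_nhds_zero_nat.pow 2).const_mul
        (gronwallBound 1 (2 * κ + 1) 1 (T - t))
    have l3 := le_of_tendsto_of_tendsto' l1 l2 hn
    exact norm_eq_zero.1 (pow_eq_zero_iff two_ne_zero |>.1 (le_antisymm l3 (sq_nonneg _)))
  filter_upwards [Lp.coeFn_posPart (a t - mild S T (a T) r t),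
    ae_sub (a t) (mild S T (a T) r t),
    (by rw [hpos]; exact coeFn_zero _ _ _ :
      Lp.posPart (a t - mild S T (a T) r t) =ᵐ[volume] 0)] with x e1 e2 e3
  rw [e3, e2, Pi.zero_apply] at e1
  have := le_max_left (a t x - mild S T (a T) r t x) 0
  rw [← e1] at this
  linarith

theorem sq_le_mild_classical {u Lu g : Fin l → ℝ → L2 d}
    (hu : ∀ i, IsBddClassical S T (u i) (Lu i) (g i)) {t : ℝ} (ht : t ∈ Icc 0 T) :
    ∑ i, mulL (u i t) (u i t) ≤ mild (fun t : ℝ => P t.toNNReal) T (∑ i, mulL (u i T) (u i T))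
      (Q.sqSource u g) t := by
  have hT : 0 < T := A.pos
  choose B hB using fun i => (hu i).bdd
  choose c hcc hc using fun i => exists_mul_path (hu i).contg (hu i).cont (hB i)
  choose w hwc hw using fun i => exists_mul_path (hu i).cont (hu i).cont (hB i)
  obtain ⟨M, hM1, hM⟩ := A.sg.semigroup_one.exists_bound T
  have hD := fun i => A.continuousOn_Dσ (hu i)
  have hq : ∀ i, ContinuousOn (fun s => dotL (Q.Dσ (u i s)) (Q.Dσ (u i s))) (Icc 0 T) := fun i =>
    continuousOn_dotL (hD i) (hD i)
  have hgu : ∀ i, ContinuousOn (fun s => mulL (g i s) (u i s)) (Icc 0 T) := fun i =>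
    continuousOn_mulL (hu i).contg (hu i).cont
  set R : ℕ → ℝ → L1 d := fun N s => ∑ i, ((2 : ℝ) • mulL (g i s) (u i s)
    - (2 : ℝ) • minL (N : ℝ≥0) (dotL (Q.Dσ (u i s)) (Q.Dσ (u i s)))) with hR
  have hRc : ∀ N, ContinuousOn (R N) (Icc 0 T) := fun N =>
    continuousOn_sum_two_smul_sub hgu fun i => (continuous_minL (N : ℝ≥0)).comp_continuousOn (hq i)
  have hsc : ContinuousOn (Q.sqSource u g) (Icc 0 T) := continuousOn_sum_two_smul_sub hgu hq
  have hN : ∀ N : ℕ, ∑ i, mulL (u i t) (u i t) ≤ mild (fun t : ℝ => P t.toNNReal) T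
      (∑ i, mulL (u i T) (u i T)) (R N) t := by
    intro N
    set r : ℝ → L2 d := fun s => ∑ i, ((2 : ℝ) • c i s
      - (2 : ℝ) • truncSqL (N : ℝ≥0) (Q.Dσ (u i s))) with hr
    have hrc : ContinuousOn r (Icc 0 T) := 
      continuousOn_sum_two_smul_sub hcc fun i =>
        (continuous_truncSqL (N : ℝ≥0)).comp_continuousOn (hD i)
    have hac : ContinuousOn (fun s => ∑ i, w i s) (Icc 0 T) := continuousOn_finsetSum _ fun i _ =>
      hwc i
    have ha : ∀ s ∈ Icc 0 T, (∑ i, w i s : L2 d) =ᵐ[volume] fun x => ∑ i, u i s x ^ 2 := by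
      intro s hs
      filter_upwards [coeFn_sum_Lp Finset.univ fun i => w i s, ae_all_iff.2 fun i => hw i s hs]
        with x h1 h2
      rw [h1]
      exact sum_congr rfl fun i _ => by rw [h2 i, sq]
    have hra : ∀ s ∈ Icc 0 T, r s =ᵐ[volume] fun x => ∑ i, (2 * (u i s x * g i s x)
        - 2 * truncSq (N : ℝ≥0) (Q.Dσ (u i s) x)) := by
      intro s hs
      filter_upwards [coeFn_sum_Lp Finset.univ fun i => ((2 : ℝ) • c i s
          - (2 : ℝ) • truncSqL (N : ℝ≥0) (Q.Dσ (u i s))), ae_all_iff.2 fun i => hc i s hs,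
        ae_all_iff.2 fun i => coeFn_truncSqL (N : ℝ≥0) (Q.Dσ (u i s)),
        ae_all_iff.2 fun i => ae_smul (2 : ℝ) (c i s),
        ae_all_iff.2 fun i => ae_smul (2 : ℝ) (truncSqL (N : ℝ≥0) (Q.Dσ (u i s))),
        ae_all_iff.2 fun i => ae_sub ((2 : ℝ) • c i s)
          ((2 : ℝ) • truncSqL (N : ℝ≥0) (Q.Dσ (u i s)))] with x h1 h2 h3 h4 h5 h6
      rw [h1]
      refine sum_congr rfl fun i _ => ?_
      rw [h6 i, h4 i, h5 i, h2 i, h3 i, smul_eq_mul,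
        smul_eq_mul]
    have hRa : ∀ s, R N s =ᵐ[volume] fun x => ∑ i, (2 * (u i s x * g i s x)
        - 2 * truncSq (N : ℝ≥0) (Q.Dσ (u i s) x)) := by
      intro s
      filter_upwards [coeFn_sum_Lp Finset.univ fun i => ((2 : ℝ) • mulL (g i s) (u i s)
          - (2 : ℝ) • minL (N : ℝ≥0) (dotL (Q.Dσ (u i s)) (Q.Dσ (u i s)))),
        ae_all_iff.2 fun i => coeFn_mulL (g i s) (u i s),
        ae_all_iff.2 fun i => coeFn_minL (N : ℝ≥0) (dotL (Q.Dσ (u i s)) (Q.Dσ (u i s))),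
        ae_all_iff.2 fun i => ae_smul (2 : ℝ) (mulL (g i s) (u i s)),
        ae_all_iff.2 fun i => ae_smul (2 : ℝ)
          (minL (N : ℝ≥0) (dotL (Q.Dσ (u i s)) (Q.Dσ (u i s)))),
        ae_all_iff.2 fun i => ae_sub ((2 : ℝ) • mulL (g i s) (u i s))
          ((2 : ℝ) • minL (N : ℝ≥0) (dotL (Q.Dσ (u i s)) (Q.Dσ (u i s)))),
        ae_all_iff.2 fun i => coeFn_dotL (Q.Dσ (u i s)) (Q.Dσ (u i s))]
        with x h1 h2 h3 h4 h5 h6 h7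
      rw [h1]
      refine sum_congr rfl fun i _ => ?_
      rw [h6 i, h4 i, h5 i, h2 i, h3 i, h7 i,
        smul_eq_mul, smul_eq_mul, truncSq_eq, real_inner_self_eq_norm_sq, mul_comm (g i s x)]
    have hle := A.le_mild_of_classical hu hac hrc ha (fun s hs => by
      filter_upwards [hra s hs] with x h1
      rw [h1, sum_sub_distrib, ← mul_sum, ← mul_sum]
      have e1 : ∑ i, g i s x * u i s x = ∑ i, u i s x * g i s x :=
        sum_congr rfl fun i _ => mul_comm _ _
      have e2 : ∑ i, truncSq (N : ℝ≥0) (Q.Dσ (u i s) x) ≤ ∑ i, ‖Q.Dσ (u i s) x‖ ^ 2 :=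
        sum_le_sum fun i _ => truncSq_le _ _
      rw [e1]
      linarith) ht
    have hsq : ∀ s ∈ Icc 0 T, (∑ i, mulL (u i s) (u i s) : L1 d) =ᵐ[volume] (∑ i, w i s : L2 d) := by
      intro s hs
      filter_upwards [ha s hs, coeFn_sum_Lp Finset.univ fun i => mulL (u i s) (u i s),
        ae_all_iff.2 fun i => coeFn_mulL (u i s) (u i s)] with x h1 h2 h3
      rw [h1, h2]
      exact sum_congr rfl fun i _ => by rw [h3 i, sq]
    have hmild := A.sg.mild_ae_eq (hsq T (right_mem_Icc.2 hT.le)) (hRc N).integrableOn_Icc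
      hrc.integrableOn_Icc (fun s hs => (hRa s).trans (hra s hs).symm) ht
    refine coeFn_le _ _ |>.1 ?_
    filter_upwards [hle, hmild, hsq t ht] with x h1 h2 h3
    rw [← h2, h3]
    exact h1
  refine ge_of_tendsto' (show (fun N : ℕ => mild (fun t : ℝ => P t.toNNReal) T
    (∑ i, mulL (u i T) (u i T)) (R N) t) ⇝ _ from ?_) hN
  rw [tendsto_iff_norm_sub_tendsto_zero]
  have hlim : (fun N : ℕ => M * (2 * ∑ i, ∫ s in Icc 0 T,
      ‖minL (N : ℝ≥0) (dotL (Q.Dσ (u i s)) (Q.Dσ (u i s)))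
        - dotL (Q.Dσ (u i s)) (Q.Dσ (u i s))‖)) ⇝ 0 := by
    have := ((tendsto_finsetSum Finset.univ fun i _ =>
      tendsto_integral_minL (hq i).integrableOn_Icc).const_mul 2).const_mul M
    simpa using this
  refine squeeze_zero (fun _ => norm_nonneg _) (fun N => ?_) hlim
  have hRi : R N ∈L¹ T := (hRc N).integrableOn_Icc
  have hsi : (Q.sqSource u g) ∈L¹ T := hsc.integrableOn_Icc
  rw [← A.sg.semigroup_one.mild_sub hRi hsi ht]
  refine (IsC0Semigroup.norm_mild_le hM (hRi.sub hsi) ht).trans ?_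
  refine mul_le_mul_of_nonneg_left ?_ (by linarith)
  rw [sub_self, norm_zero, zero_add]
  change ∫ s in t..T, ‖R N s - Q.sqSource u g s‖ ≤ _
  have hqi : ∀ i, (fun s => ‖minL (N : ℝ≥0) (dotL (Q.Dσ (u i s)) (Q.Dσ (u i s)))
        - dotL (Q.Dσ (u i s)) (Q.Dσ (u i s))‖) ∈L¹ T := fun i =>
    (((continuous_minL _).comp_continuousOn (hq i)).sub (hq i)).norm.integrableOn_Icc
  rw [← integral_finsetSum _ fun i _ => hqi i, ← integral_const_mul,
    integral_of_le ht.2]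
  refine (setIntegral_mono_set (hRi.sub hsi).norm (of_forall fun s => norm_nonneg _)
      (Ioc_subset_Icc_self.trans (Icc_subset_Icc_left ht.1)).eventuallyLE).trans ?_
  refine integral_mono (hRi.sub hsi).norm ((integrable_finsetSum _ fun i _ => hqi i).const_mul 2)
    fun s => ?_
  simp only [Pi.sub_apply, hR, sqSource]
  rw [← sum_sub_distrib, mul_sum]
  refine (norm_sum_le _ _).trans (sum_le_sum fun i _ => ?_)
  rw [sub_sub_sub_cancel_left, ← smul_sub, norm_smul, norm_sub_rev]
  simp

section

variable (φ : L2 d) {g : ℝ → L2 d} (hg : g ∈L¹ T)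

include φ hg

theorem memFhat_mild : Q.MemFhat c₂ T (mild S T φ g) := by
  obtain ⟨_, _, hE⟩ := A.exists_energy_mild
  exact (hE φ g hg).1

theorem memLp_Dσ_mild :
    MemLp (fun t => Q.Dσ (mild S T φ g t)) 2 (dt T) := by
  obtain ⟨_, _, hK⟩ := A.exists_mild_bound
  exact (memLp_two_iff_integrable_sq_norm (A.memFhat_mild φ hg).meas).2 (hK φ g hg).2.2.1

end

theorem integrableOn_mulL_mild (φ : L2 d) {g h : ℝ → L2 d}
    (hg : g ∈L¹ T) (hh : h ∈L¹ T) :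
    (fun t => mulL (h t) (mild S T φ g t)) ∈L¹ T := by
  have hF := A.memFhat_mild φ hg
  obtain ⟨B, hB⟩ := isCompact_Icc.exists_bound_of_continuousOn hF.cont
  exact integrable_bilin mulL hh (hF.cont.aestronglyMeasurable measurableSet_Icc)
    (ae_restrict_of_forall_mem measurableSet_Icc hB)

theorem integrableOn_sqSource {φ : Fin l → L2 d}
    {u g : Fin l → ℝ → L2 d} (hg : ∀ i, g i ∈L¹ T)
    (hu : ∀ i, u i = mild S T (φ i) (g i)) : (Q.sqSource u g) ∈L¹ T := by
  refine integrable_finsetSum _ fun i _ => ?_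
  simp only [hu]
  exact ((A.integrableOn_mulL_mild (φ i) (hg i) (hg i)).smul (2 : ℝ)).sub
    ((integrable_bilin_sq dotL (A.memLp_Dσ_mild (φ i) (hg i))).smul (2 : ℝ))

/-- Convergence of the squared gradients for approximating classical solutions. -/
theorem tendsto_dotL_classical (φ : L2 d) {g : ℝ → L2 d}
    (hg : g ∈L¹ T) {un Lun gn : ℕ → ℝ → L2 d} {δ : ℕ → ℝ}
    (hun : ∀ n, IsBddClassical S T (un n) (Lun n) (gn n)) (hδ : δ ⇝ 0)
    (h1 : ∀ n, ∀ t ∈ Icc 0 T, ‖un n t - mild S T φ g t‖ ≤ δ n)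
    (h2 : ∀ n, ∫ t in Icc 0 T, ‖gn n t - g t‖ ≤ δ n) :
    (fun n => ∫ t in Icc 0 T, ‖dotL (Q.Dσ (un n t)) (Q.Dσ (un n t))
      - dotL (Q.Dσ (mild S T φ g t)) (Q.Dσ (mild S T φ g t))‖) ⇝ 0 := by
  obtain ⟨K, hK0, hK⟩ := A.exists_mild_bound
  have hT : 0 < T := A.pos
  have hgn : ∀ n, gn n ∈L¹ T := fun n => (hun n).contg.integrableOn_Icc
  have heq : ∀ n, ∀ t ∈ Icc 0 T, un n t = mild S T (un n T) (gn n) t := fun n t ht =>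
    (hun n).eq_mild A.sg.semigroup ht
  have hunm : ∀ n, MemLp (fun t => Q.Dσ (un n t)) 2 (dt T) := fun n =>
    (A.memLp_Dσ_mild (un n T) (hgn n)).congr_norm
      ((A.continuousOn_Dσ (hun n)).aestronglyMeasurable measurableSet_Icc)
      (ae_restrict_of_forall_mem measurableSet_Icc fun t ht => by rw [← heq n t ht])
  refine tendsto_integral_bilin_sq dotL (A.memLp_Dσ_mild φ hg) hunm ?_
  have hlim : (fun n => K * (2 * δ n) ^ 2) ⇝ 0 := by
    simpa using ((hδ.const_mul 2).pow 2).const_mul K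
  refine squeeze_zero (fun n => integral_nonneg fun _ => sq_nonneg _) (fun n => ?_) hlim
  have hb := (hK (un n T - φ) (fun t => gn n t - g t) ((hgn n).sub hg)).2.2.2
  have hφ : ‖un n T - φ‖ ≤ δ n := by
    have := h1 n T (right_mem_Icc.2 hT.le)
    rwa [show mild S T φ g T = φ by simp [mild, A.sg.semigroup.zero_apply]] at this
  refine le_trans (le_of_eq ?_) (hb.trans ?_)
  · refine integral_congr_ae ?_
    filter_upwards [(A.memFhat_mild φ hg).mem, ae_mem_Icc] with t ht hmem
    have hmemn : Q.MemF c₂ (un n t) := by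
      obtain ⟨M, hM⟩ := (hun n).bdd
      exact A.memF_of_hasGen ((hun n).gen t hmem) (hM t hmem)
    rw [A.sg.semigroup.mild_sub (hgn n) hg hmem, ← heq n t hmem, (A.sub_mem hmemn ht).2]
  · have h3 : 0 ≤ ∫ s in Icc 0 T, ‖gn n s - g s‖ := integral_nonneg fun _ => norm_nonneg _
    have h4 := h2 n
    gcongr
    linarith

/-- The pointwise square of a mild solution. -/
theorem sq_le_mild {φ : Fin l → L2 d}
    {u g : Fin l → ℝ → L2 d} (hg : ∀ i, g i ∈L¹ T)
    (hu : ∀ i, u i = mild S T (φ i) (g i)) {t : ℝ} (ht : t ∈ Icc 0 T) :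
    ∑ i, mulL (u i t) (u i t) ≤ mild (fun t : ℝ => P t.toNNReal) T (∑ i, mulL (φ i) (φ i))
      (Q.sqSource u g) t := by
  have hT : 0 < T := A.pos
  obtain ⟨M, hM1, hM⟩ := A.sg.semigroup_one.exists_bound T
  choose un Lun gn δ hun hanti hδ0 hδ h1 h2 using fun i =>
    A.sg.exists_classical_approx hT (φ i) (hg i)
  have huT : ∀ i, u i T = φ i := fun i => by rw [hu i]; simp [mild, A.sg.semigroup.zero_apply]
  have hlimu : ∀ i, ∀ s ∈ Icc 0 T, (fun n => un i n s) ⇝ u i s := by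
    intro i s hs
    rw [tendsto_iff_norm_sub_tendsto_zero]
    refine squeeze_zero (fun n => norm_nonneg _) (fun n => ?_) (hδ i)
    rw [hu i]; exact h1 i n s hs
  have hlims : ∀ s ∈ Icc 0 T, (fun n => ∑ i, mulL (un i n s) (un i n s)) ⇝ (∑ i, mulL (u i s) (u i s)) := fun s hs =>
    tendsto_finsetSum _ fun i _ => tendsto_bilin mulL (hlimu i s hs) (hlimu i s hs)
  have hn := fun n => A.sq_le_mild_classical (u := fun i => un i n) (fun i => hun i n) ht
  refine le_of_tendsto_of_tendsto' (hlims t ht) (show (fun n : ℕ =>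
    mild (fun t : ℝ => P t.toNNReal) T (∑ i, mulL (un i n T) (un i n T))
      (Q.sqSource (fun i => un i n) fun i => gn i n) t) ⇝ _ from ?_) hn
  have hgn : ∀ i n, gn i n ∈L¹ T := fun i n => (hun i n).contg.integrableOn_Icc
  have hsi := A.integrableOn_sqSource hg hu
  have hsn : ∀ n, (Q.sqSource (fun i => un i n) fun i => gn i n) ∈L¹ T := fun n =>
    (continuousOn_sum_two_smul_sub (fun i => continuousOn_mulL (hun i n).contg (hun i n).cont)
      fun i => continuousOn_dotL (A.continuousOn_Dσ (hun i n))
        (A.continuousOn_Dσ (hun i n))).integrableOn_Icc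
  have hF := fun i => A.memFhat_mild (φ i) (hg i)
  have ha : ∀ i, (fun n => ∫ s in Icc 0 T, ‖mulL (gn i n s) (un i n s)
      - mulL (g i s) (u i s)‖) ⇝ 0 := by
    intro i
    rw [hu i]
    obtain ⟨B, hB⟩ := isCompact_Icc.exists_bound_of_continuousOn (hF i).cont
    exact tendsto_integral_bilin mulL (hg i) (hgn i)
      (squeeze_zero (fun n => integral_nonneg fun _ => norm_nonneg _) (h2 i) (hδ i))
      ((hF i).cont.aestronglyMeasurable measurableSet_Icc)
      (fun n => (hun i n).cont.aestronglyMeasurable measurableSet_Icc)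
      (ae_restrict_of_forall_mem measurableSet_Icc hB) (hδ i)
      fun n => ae_restrict_of_forall_mem measurableSet_Icc fun s hs => h1 i n s hs
  have hb := fun i => A.tendsto_dotL_classical (φ i) (hg i) (hun i) (hδ i) (h1 i) (h2 i)
  simp only [← hu] at hb
  have hlim0 : (fun n => ∑ i, (2 * (∫ s in Icc 0 T, ‖mulL (gn i n s) (un i n s)
      - mulL (g i s) (u i s)‖) + 2 * ∫ s in Icc 0 T, ‖dotL (Q.Dσ (un i n s)) (Q.Dσ (un i n s))
      - dotL (Q.Dσ (u i s)) (Q.Dσ (u i s))‖)) ⇝ 0 := by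
    have := tendsto_finsetSum Finset.univ fun i _ => ((ha i).const_mul 2).add ((hb i).const_mul 2)
    simpa using this
  have hT' := tendsto_iff_norm_sub_tendsto_zero.1 (hlims T (right_mem_Icc.2 hT.le))
  rw [tendsto_iff_norm_sub_tendsto_zero]
  refine squeeze_zero (fun n => norm_nonneg _) (fun n => ?_)
    (by simpa using (hT'.add hlim0).const_mul M)
  rw [← A.sg.semigroup_one.mild_sub (hsn n) hsi ht]
  refine (IsC0Semigroup.norm_mild_le hM ((hsn n).sub hsi) ht).trans ?_
  refine mul_le_mul_of_nonneg_left (add_le_add ?_ ?_) (by linarith)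
  · simp only [huT]; exact le_rfl
  have ia : ∀ i, (fun s => ‖mulL (gn i n s) (un i n s) - mulL (g i s) (u i s)‖) ∈L¹ T := fun i => Integrable.norm (Integrable.sub
    (continuousOn_mulL (hun i n).contg (hun i n).cont).integrableOn_Icc
    (by rw [hu i]; exact A.integrableOn_mulL_mild (φ i) (hg i) (hg i)))
  have ib : ∀ i, (fun s => ‖dotL (Q.Dσ (un i n s)) (Q.Dσ (un i n s))
      - dotL (Q.Dσ (u i s)) (Q.Dσ (u i s))‖) ∈L¹ T := fun i =>
    Integrable.norm (Integrable.sub (continuousOn_dotL (A.continuousOn_Dσ (hun i n))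
        (A.continuousOn_Dσ (hun i n))).integrableOn_Icc
      (by rw [hu i]; exact integrable_bilin_sq dotL (A.memLp_Dσ_mild (φ i) (hg i))))
  rw [integral_of_le ht.2]
  refine (setIntegral_mono_set ((hsn n).sub hsi).norm (of_forall fun s => norm_nonneg _)
      (Ioc_subset_Icc_self.trans (Icc_subset_Icc_left ht.1)).eventuallyLE).trans ?_
  have e : ∀ i, 2 * (∫ s in Icc 0 T, ‖mulL (gn i n s) (un i n s)
      - mulL (g i s) (u i s)‖) + 2 * (∫ s in Icc 0 T, ‖dotL (Q.Dσ (un i n s)) (Q.Dσ (un i n s))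
      - dotL (Q.Dσ (u i s)) (Q.Dσ (u i s))‖) = ∫ s in Icc 0 T, (2 * ‖mulL (gn i n s) (un i n s)
      - mulL (g i s) (u i s)‖ + 2 * ‖dotL (Q.Dσ (un i n s)) (Q.Dσ (un i n s))
      - dotL (Q.Dσ (u i s)) (Q.Dσ (u i s))‖) := fun i => by
    rw [integral_add ((ia i).const_mul 2) ((ib i).const_mul 2), integral_const_mul,
      integral_const_mul]
  have ic : ∀ i ∈ Finset.univ, (fun s => 2 * ‖mulL (gn i n s) (un i n s)
      - mulL (g i s) (u i s)‖ + 2 * ‖dotL (Q.Dσ (un i n s)) (Q.Dσ (un i n s))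
      - dotL (Q.Dσ (u i s)) (Q.Dσ (u i s))‖) ∈L¹ T := fun i _ =>
    ((ia i).const_mul 2).add ((ib i).const_mul 2)
  simp only [e]
  rw [← integral_finsetSum _ ic]
  refine integral_mono ((hsn n).sub hsi).norm (integrable_finsetSum _ ic) fun s => ?_
  simp only [Pi.sub_apply, sqSource]
  rw [← sum_sub_distrib]
  refine (norm_sum_le _ _).trans (sum_le_sum fun i _ => ?_)
  rw [sub_sub_sub_comm, ← smul_sub, ← smul_sub]
  refine (norm_sub_le _ _).trans_eq ?_
  rw [norm_smul, norm_smul]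
  simp

/-- The sup-norm estimate for mild solutions of systems. -/
theorem exists_sup_bound : ∃ C : ℝ, 0 ≤ C ∧
    ∀ {φ : Fin l → L2 d} {u g : Fin l → ℝ → L2 d} {κ : ℝ → ℝ} {ρ : ℝ → L2 d} {a c : ℝ},
      (∀ i, g i ∈L¹ T) → (∀ i, u i = mild S T (φ i) (g i)) →
      κ ∈L¹ T → (∀ t, 0 ≤ κ t) → MemLp ρ 2 (dt T) →
      (∀ᵐ t ∂(dt T), ∀ᵐ x,
        2 * inner ℝ (vec (fun i => g i t) x) (vec (fun i => u i t) x)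
          - 2 * ‖Q.DσMat (fun i => u i t) x‖ ^ 2
          ≤ ρ t x ^ 2 + κ t * ‖vec (fun i => u i t) x‖ ^ 2) →
      (∀ᵐ x, ‖vec φ x‖ ≤ a) → (∀ᵐ t ∂(dt T), ∀ᵐ x, |ρ t x| ≤ c) →
      ∀ t ∈ Icc 0 T, ∀ᵐ x, ‖vec (fun i => u i t) x‖ ^ 2 ≤ expInt κ T * C * (a ^ 2 + T * c ^ 2) := by
  obtain ⟨C, hC0, hC⟩ := A.sg.exists_sup_bound
  refine ⟨C, hC0, ?_⟩
  intro φ u g κ ρ a c hg hu hκ hκ0 hρ hle hφ hρc t ht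
  have hT : 0 < T := A.pos
  have huT : ∀ i, u i T = φ i := fun i => by rw [hu i]; simp [mild, A.sg.semigroup.zero_apply]
  have hF : ∀ i, Q.MemFhat c₂ T (u i) := fun i => by rw [hu i]; exact A.memFhat_mild (φ i) (hg i)
  have hsq : ∀ s, (∑ i, mulL (u i s) (u i s) : L1 d) =ᵐ[volume]
      fun x => ‖vec (fun i => u i s) x‖ ^ 2 := fun s => by
    filter_upwards [coeFn_sum_Lp Finset.univ fun i => mulL (u i s) (u i s),
      ae_all_iff.2 fun i => coeFn_mulL (u i s) (u i s)] with x h1 h2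
    rw [h1, norm_vec_sq]
    exact sum_congr rfl fun i _ => by rw [h2 i, sq]
  have key := hC (w := fun s => ∑ i, mulL (u i s) (u i s)) (b := fun s => mulL (ρ s) (ρ s)) (κ := κ)
    (R := Q.sqSource u g) (a := a ^ 2) (c := c ^ 2) (sq_nonneg a) (sq_nonneg c)
    (continuousOn_finsetSum _ fun i _ => continuousOn_mulL (hF i).cont (hF i).cont)
    (A.integrableOn_sqSource hg hu) (integrable_bilin_sq mulL hρ) hκ hκ0
    (fun s hs => by simp only [huT]; exact A.sq_le_mild hg hu hs) ?_ ?_ ?_ t ht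
  · filter_upwards [key, hsq t] with x h1 h2
    rwa [h2] at h1
  · filter_upwards [hle] with s hs
    refine (coeFn_le _ _).1 ?_
    filter_upwards [hs, hsq s, ae_add (mulL (ρ s) (ρ s)) (κ s • ∑ i, mulL (u i s) (u i s)),
      ae_smul (κ s) (∑ i, mulL (u i s) (u i s)), coeFn_mulL (ρ s) (ρ s),
      coeFn_sum_Lp Finset.univ fun i => ((2 : ℝ) • mulL (g i s) (u i s)
        - (2 : ℝ) • dotL (Q.Dσ (u i s)) (Q.Dσ (u i s))),
      ae_all_iff.2 fun i => coeFn_mulL (g i s) (u i s),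
      ae_all_iff.2 fun i => coeFn_dotL (Q.Dσ (u i s)) (Q.Dσ (u i s)),
      ae_all_iff.2 fun i => ae_smul (2 : ℝ) (mulL (g i s) (u i s)),
      ae_all_iff.2 fun i => ae_smul (2 : ℝ) (dotL (Q.Dσ (u i s)) (Q.Dσ (u i s))),
      ae_all_iff.2 fun i => ae_sub ((2 : ℝ) • mulL (g i s) (u i s))
        ((2 : ℝ) • dotL (Q.Dσ (u i s)) (Q.Dσ (u i s)))]
      with x h1 h2 h3 h4 h5 h6 h7 h8 h9 h10 h11
    rw [h3, h4, h2, h5, smul_eq_mul, ← sq, sqSource, h6]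
    refine le_trans (le_of_eq ?_) h1
    rw [inner_vec, norm_DσMat_sq, mul_sum, mul_sum, ← sum_sub_distrib]
    refine sum_congr rfl fun i _ => ?_
    rw [h11 i, h9 i, h10 i, h7 i, h8 i, smul_eq_mul,
      smul_eq_mul, real_inner_self_eq_norm_sq]
  · simp only [huT]
    have hsqT := hsq T
    simp only [huT] at hsqT
    filter_upwards [hφ, hsqT] with x h1 h2
    rw [h2, abs_of_nonneg (sq_nonneg _)]
    exact pow_le_pow_left₀ (norm_nonneg _) h1 2
  · filter_upwards [hρc] with s hs
    filter_upwards [hs, coeFn_mulL (ρ s) (ρ s)] with x h1 h2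
    rw [h2, ← sq, abs_of_nonneg (sq_nonneg _), ← sq_abs]
    exact pow_le_pow_left₀ (abs_nonneg _) h1 2

theorem memLp_mild (φ : L2 d) {g : ℝ → L2 d}
    (hg : g ∈L¹ T) : MemLp (mild S T φ g) 2 (dt T) := by
  have hc := (A.memFhat_mild φ hg).cont
  obtain ⟨B, hB⟩ := isCompact_Icc.exists_bound_of_continuousOn hc
  exact MemLp.of_bound (hc.aestronglyMeasurable measurableSet_Icc) B
    (ae_restrict_of_forall_mem measurableSet_Icc hB)

/-- The energy estimates for a mild solution of a system. -/
theorem exists_estimate : ∃ c₁ > 0, ∀ κ : ℝ → ℝ,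
    κ ∈L¹ T → (∀ t, 0 ≤ κ t) → ∃ Γ : ℝ → ℝ, ∃ M ≥ 0,
    ContinuousOn Γ (Icc 0 T) ∧ (∀ t ∈ Icc 0 T, 1 ≤ Γ t) ∧
    ∀ {l : ℕ} {φ : Fin l → L2 d} {u g : Fin l → ℝ → L2 d} {ρ : ℝ → ℝ},
      (∀ i, g i ∈L¹ T) → (∀ i, u i = mild S T (φ i) (g i)) →
      ρ ∈L¹ T → (∀ t, 0 ≤ ρ t) →
      (∀ᵐ t ∂(dt T), ∃ r : Rn d → ℝ, Integrable r ∧ ∫ x, r x ≤ ρ t ∧ ∀ᵐ x,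
        2 * inner ℝ (vec g@@t x) (vec u@@t x)
          ≤ κ t * ‖vec u@@t x‖ ^ 2 + c₁ * ‖matOf (fun i => Q.Dσ (u i t)) x‖ ^ 2 + r x) →
      (∀ t ∈ Icc 0 T, ∑ i, ‖u i t‖ ^ 2 ≤ M * (∑ i, ‖φ i‖ ^ 2 + ∫ s in Icc 0 T, ρ s)) ∧
      ∫ t in Icc 0 T, ∑ i, Q.energy c₂ (u i t) ≤ M * (∑ i, ‖φ i‖ ^ 2 + ∫ s in Icc 0 T, ρ s) ∧
      ∫ t in Icc 0 T, ∑ i, ‖Q.Dσ (u i t)‖ ^ 2 ≤ M * (∑ i, ‖φ i‖ ^ 2 + ∫ s in Icc 0 T, ρ s) ∧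
      ∀ q : ℝ → ℝ, (∀ᵐ t ∂(dt T), 0 ≤ q t ∧
        q t ≤ ∑ i, (c₁ * ‖Q.Dσ (u i t)‖ ^ 2 + ‖u i t‖ ^ 2)) →
        ∫ t in Icc 0 T, Γ t * q t ≤ M * ∑ i, ‖φ i‖ ^ 2 + ∫ s in Icc 0 T, Γ s * ρ s := by
  obtain ⟨c₁, hc₁, β, hβ, hlow, hen⟩ := A.exists_weighted_energy
  refine ⟨c₁, hc₁, fun κ hκ hκ0 => ?_⟩
  have hT : 0 ≤ T := A.pos.le
  have hκβ : (fun s => κ s + β) ∈L¹ T := hκ.add (integrableOn_const_Icc β)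
  have hκβ0 := fun s => add_nonneg (hκ0 s) hβ
  set Γ := expInt fun s => κ s + β
  have hΓ : ContinuousOn Γ (Icc 0 T) := continuousOn_expInt hT hκβ
  have hΓ0 : ∀ t, 0 ≤ Γ t := fun t => (expInt_pos _ t).le
  have hΓ1 : ∀ t ∈ Icc 0 T, 1 ≤ Γ t := fun t ht => one_le_expInt hκβ0 ht.1
  have hM := div_nonneg (hΓ0 T) hc₁.le
  refine ⟨Γ, Γ T + Γ T / c₁, add_nonneg (hΓ0 T) hM, hΓ, hΓ1, ?_⟩
  intro l φ u g ρ hg hu hρ hρ0 h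
  have hF : ∀ i, Q.MemFhat c₂ T (u i) := fun i => by rw [hu i]; exact A.memFhat_mild _ (hg i)
  have hmem := ae_all_iff.2 fun i => (hF i).mem
  have key := hen hg hu hκ hκ0 hρ (by
    filter_upwards [h] with t ⟨r, hr, hrρ, hx⟩
    linarith [two_sum_inner_le hr hx])
  have hEi : (fun s => ∑ i, Q.energy c₂ (u i s)) ∈L¹ T :=
    integrable_finsetSum _ fun i _ => (hF i).int
  have hE0 : ∀ᵐ t ∂(dt T), 0 ≤ ∑ i, Q.energy c₂ (u i t) := by
    filter_upwards [hmem] with t ht using sum_nonneg fun i _ => A.energy_nonneg (ht i)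
  have hΓE0 : ∀ᵐ t ∂(dt T), 0 ≤ Γ t * ∑ i, Q.energy c₂ (u i t) :=
    hE0.mono fun t ht => mul_nonneg (hΓ0 t) ht
  have hΓE := hEi.continuousOn_mul hΓ isCompact_Icc
  have hΓρ := hρ.continuousOn_mul hΓ isCompact_Icc
  have hcv : ∀ {f : ℝ → ℝ} {t}, t ≤ T → ∫ s in t..T, f s = ∫ s in Icc t T, f s := fun ht => by
    rw [integral_of_le ht, integral_Icc_eq_integral_Ioc]
  have hΓρT : ∫ s in Icc 0 T, Γ s * ρ s ≤ Γ T * ∫ s in Icc 0 T, ρ s := by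
    rw [← integral_const_mul]
    exact setIntegral_mono_on hΓρ (hρ.const_mul _) measurableSet_Icc fun s hs =>
      mul_le_mul_of_nonneg_right (expInt_mono hκβ hκβ0 hs.1 hs.2 le_rfl) (hρ0 s)
  have hΓEl : ∫ s in Icc 0 T, Γ s * ∑ i, Q.energy c₂ (u i s)
      ≤ Γ T * ∑ i, ‖φ i‖ ^ 2 + ∫ s in Icc 0 T, Γ s * ρ s := by
    have e1 := key 0 ⟨le_rfl, hT⟩
    rw [hcv hT, hcv hT] at e1
    have e2 : 0 ≤ Γ 0 * ∑ i, ‖u i 0‖ ^ 2 := mul_nonneg (hΓ0 0) (by positivity)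
    linarith
  have hB0 : 0 ≤ ∑ i, ‖φ i‖ ^ 2 + ∫ s in Icc 0 T, ρ s :=
    add_nonneg (by positivity) (integral_nonneg hρ0)
  have hup : ∀ {x : ℝ}, x ≤ Γ T * (∑ i, ‖φ i‖ ^ 2 + ∫ s in Icc 0 T, ρ s) →
      x ≤ (Γ T + Γ T / c₁) * (∑ i, ‖φ i‖ ^ 2 + ∫ s in Icc 0 T, ρ s) := fun hx =>
    hx.trans (mul_le_mul_of_nonneg_right (le_add_of_nonneg_right hM) hB0)
  have hle : ∀ᵐ t ∂(dt T), ∑ i, (c₁ * ‖Q.Dσ (u i t)‖ ^ 2 + ‖u i t‖ ^ 2)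
      ≤ ∑ i, Q.energy c₂ (u i t) := by
    filter_upwards [hmem] with t ht using sum_le_sum fun i _ => hlow _ (ht i)
  have hE : ∫ t in Icc 0 T, ∑ i, Q.energy c₂ (u i t)
      ≤ Γ T * (∑ i, ‖φ i‖ ^ 2 + ∫ s in Icc 0 T, ρ s) := by
    refine (integral_mono_ae hEi hΓE ?_).trans (by linarith)
    filter_upwards [hE0, ae_mem_Icc] with t h3 h4 using le_mul_of_one_le_left h3 (hΓ1 t h4)
  refine ⟨fun t ht => hup ?_, hup hE, ?_, fun q hq => ?_⟩
  · have e1 := key t ht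
    rw [hcv ht.2, hcv ht.2] at e1
    have e2 := integral_nonneg_of_ae
      (ae_restrict_of_ae_restrict_of_subset (Icc_subset_Icc_left ht.1) hΓE0)
    have e3 := setIntegral_mono_set hΓρ (.of_forall fun s => mul_nonneg (hΓ0 s) (hρ0 s))
      (Icc_subset_Icc_left ht.1).eventuallyLE
    have e4 : ∑ i, ‖u i t‖ ^ 2 ≤ _ := le_mul_of_one_le_left (by positivity) (hΓ1 t ht)
    linarith
  · rw [add_mul, div_mul_eq_mul_div]
    refine le_add_of_nonneg_of_le (mul_nonneg (hΓ0 T) hB0) ((le_div_iff₀' hc₁).2 ?_)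
    rw [← integral_const_mul]
    refine (integral_mono_of_nonneg (.of_forall fun t => by positivity) hEi ?_).trans hE
    filter_upwards [hle] with t ht
    refine le_trans ?_ ht
    rw [sum_add_distrib, mul_sum]
    exact le_add_of_nonneg_right (by positivity)
  · refine (integral_mono_of_nonneg (hq.mono fun t ht => mul_nonneg (hΓ0 t) ht.1) hΓE ?_).trans
      (hΓEl.trans (add_le_add_left (mul_le_mul_of_nonneg_right (le_add_of_nonneg_right hM)
        (by positivity)) _))
    filter_upwards [hq, hle] with t h1 h2 using mul_le_mul_of_nonneg_left (h1.2.trans h2) (hΓ0 t)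

/-- The energy estimates for the difference of two mild solutions of systems with the same final
value. -/
theorem exists_pair_estimate : ∃ c₁ > 0, ∀ κ : ℝ → ℝ,
    κ ∈L¹ T → (∀ t, 0 ≤ κ t) → ∃ Γ : ℝ → ℝ, ∃ M ≥ 0,
    ContinuousOn Γ (Icc 0 T) ∧ (∀ t ∈ Icc 0 T, 1 ≤ Γ t) ∧
    ∀ {l : ℕ} {φ : Fin l → L2 d} {u u' g g' : Fin l → ℝ → L2 d} {ρ : ℝ → ℝ},
      (∀ i, g i ∈L¹ T) → (∀ i, (g' i) ∈L¹ T) →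
      (∀ i, u i = mild S T (φ i) (g i)) → (∀ i, u' i = mild S T (φ i) (g' i)) →
      ρ ∈L¹ T → (∀ t, 0 ≤ ρ t) →
      (∀ᵐ t ∂(dt T), ∃ r : Rn d → ℝ, Integrable r ∧ ∫ x, r x ≤ ρ t ∧ ∀ᵐ x,
        2 * inner ℝ (vec g@@t x - vec g'@@t x) (vec u@@t x - vec u'@@t x)
        ≤ κ t * ‖vec u@@t x - vec u'@@t x‖ ^ 2
          + c₁ * ‖Q.DσMat u@@t x - Q.DσMat u'@@t x‖ ^ 2 + r x) →
      (∀ t ∈ Icc 0 T, ∑ i, ‖u i t - u' i t‖ ^ 2 ≤ M * ∫ s in Icc 0 T, ρ s) ∧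
      ∫ t in Icc 0 T, ∑ i, ‖Q.Dσ (u i t) - Q.Dσ (u' i t)‖ ^ 2 ≤ M * ∫ s in Icc 0 T, ρ s ∧
      ∀ q : ℝ → ℝ, (∀ t, 0 ≤ q t ∧
        q t ≤ ∑ i, (c₁ * ‖Q.Dσ (u i t) - Q.Dσ (u' i t)‖ ^ 2 + ‖u i t - u' i t‖ ^ 2)) →
        ∫ t in Icc 0 T, Γ t * q t ≤ ∫ s in Icc 0 T, Γ s * ρ s := by
  obtain ⟨c₁, hc₁, H⟩ := A.exists_estimate
  refine ⟨c₁, hc₁, fun κ hκ hκ0 => ?_⟩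
  obtain ⟨Γ, M, hM, hΓ, hΓ1, H⟩ := H κ hκ hκ0
  refine ⟨Γ, M, hM, hΓ, hΓ1, ?_⟩
  intro l φ u u' g g' ρ hg hg' hu hu' hρ hρ0 h
  let w : Fin l → ℝ → L2 d := fun i => mild S T (φ i - φ i) (fun s => g i s - g' i s)
  have hw : ∀ i, ∀ t ∈ Icc 0 T, w i t = u i t - u' i t := fun i t ht => by
    rw [hu i, hu' i]; exact A.sg.semigroup.mild_sub (hg i) (hg' i) ht
  have hD : ∀ᵐ t ∂(dt T), ∀ i, w i t = u i t - u' i t ∧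
      Q.Dσ (w i t) = Q.Dσ (u i t) - Q.Dσ (u' i t) := by
    filter_upwards [ae_mem_Icc, ae_all_iff.2 fun i => (A.memFhat_mild (φ i) (hg i)).mem,
      ae_all_iff.2 fun i => (A.memFhat_mild (φ i) (hg' i)).mem] with t ht h1 h2 i
    rw [hw i t ht, hu i, hu' i]
    exact ⟨rfl, (A.sub_mem (h1 i) (h2 i)).2⟩
  have key := H (u := w) (g := fun i s => g i s - g' i s) (fun i => (hg i).sub (hg' i)) (fun i => rfl) hρ hρ0 (by
    filter_upwards [hD, h] with t ht ⟨r, hr, hrρ, hx⟩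
    refine ⟨r, hr, hrρ, ?_⟩
    filter_upwards [hx, vec_sub_ae g@@t g'@@t, vec_sub_ae u@@t u'@@t,
      matOf_sub_ae (fun i => Q.Dσ (u i t)) (fun i => Q.Dσ (u' i t))] with x h1 h2 h3 h4
    simp only [(ht _).2]
    simp only [(ht _).1]
    rw [h2, h3, h4]
    exact h1)
  simp only [sub_self, norm_zero, ne_eq, OfNat.ofNat_ne_zero, not_false_eq_true, zero_pow,
    Finset.sum_const_zero, mul_zero, zero_add] at key
  refine ⟨fun t ht => ?_, ?_, fun q hq => key.2.2.2 q ?_⟩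
  · simpa only [hw _ t ht] using key.1 t ht
  · refine le_trans (le_of_eq (integral_congr_ae ?_)) key.2.2.1
    filter_upwards [hD] with t ht
    simp only [(ht _).2]
  · filter_upwards [hD] with t ht
    simp only [(ht _).2]
    simpa only [(ht _).1] using hq t

/-- Existence for nonlinearities that are Lipschitz in `y` and do not depend on `z`. -/
theorem exists_isMildSol_of_lipschitz {G : ℝ → Rn d → Rn l → Rn l}
    (hG : Nonlin.IsMeasurable (k := k) fun t x y _ => G t x y) {L : ℝ} (hL0 : 0 ≤ L)
    (hL : ∀ t ∈ Icc 0 T, ∀ x y y', ‖G t x y - G t x y'‖ ≤ L * ‖y - y'‖) {h : ℝ → L2 d}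
    (hh : h ∈L¹ T)
    (h0 : ∀ᵐ t ∂(dt T), ∀ᵐ x, ‖G t x 0‖ ≤ h t x) (φ : Fin l → L2 d) :
    ∃ u g, Q.IsMildSol T S φ (fun t x y _ => G t x y) u g := by
  obtain ⟨c₁, hc₁, hpair⟩ := A.exists_pair_estimate
  obtain ⟨Γ, M, -, hΓ, hΓ1, hpair⟩ :=
    hpair _ (integrableOn_const_Icc (4 * L ^ 2)) fun t => by positivity
  let W : Fin l → ℝ → L2v d k := fun _ _ => 0
  let R : (Fin l → ℝ → L2 d) → (Fin l → ℝ → L2 d) → Prop := fun v w =>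
    ∃ g, IsSubstAt T (fun t x y (_ : Mat l k) => G t x y) v W g ∧ ∀ i, w i = mild S T (φ i) (g i)
  obtain ⟨v, w, -, ⟨g, hg, hw⟩, hvw⟩ := exists_fixed_of_contraction hΓ hΓ1 R
    (fun v hv => by
      have hvi := fun i => integrableOn_of_memLp_two (hv i)
      obtain ⟨g, hg⟩ := exists_isSubstAt (k := k) hG (fun i => (hv i).1)
        (W := W) (fun i => aestronglyMeasurable_const)
        (h := fun t => h t + L • ∑ i, normL (v i t)) (hh.add ((integrableOn_sum_normL hvi).smul L)) (by
          filter_upwards [h0, ae_mem_Icc] with t ht htT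
          filter_upwards [ht, add_smul_le_coeFn hL0 (h t) (norm_vec_le_sum v@@t)] with x h1 h2
          have h5 := hL t htT x (vec v@@t x) 0
          rw [sub_zero] at h5
          linarith [norm_le_norm_add_norm_sub' (G t x (vec v@@t x)) (G t x 0)])
      exact ⟨fun i => mild S T (φ i) (g i), fun i => A.memLp_mild _ (hg.1 i), g, hg, fun i => rfl⟩)
    (fun v v' w w' hv hv' ⟨g, hg, hw⟩ ⟨g', hg', hw'⟩ => by
      have hsq : (fun t => ∑ i, ‖v i t - v' i t‖ ^ 2) ∈L¹ T :=
        integrable_finsetSum _ fun i _ => ((hv i).sub (hv' i)).integrable_norm_pow two_ne_zero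
      refine ((hpair hg.1 hg'.1 hw hw' (hsq.const_mul (1 / 4)) (fun t => by positivity) (by
          filter_upwards [hg.2, hg'.2, ae_mem_Icc] with t h1 h2 htT
          obtain ⟨i1, e1⟩ := sum_norm_sq_vec fun i => v i t - v' i t
          refine ⟨_, i1.const_mul (1 / 4), by rw [integral_const_mul, ← e1], ?_⟩
          filter_upwards [h1, h2, vec_sub_ae v@@t v'@@t] with x h3 h4 h5
          rw [h3, h4, h5]
          set δ := vec w@@t x - vec w'@@t x
          have h6 := real_inner_le_norm (G t x (vec v@@t x) - G t x (vec v'@@t x)) δ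
          have h7 := mul_le_mul_of_nonneg_right (hL t htT x (vec v@@t x) (vec v'@@t x))
            (norm_nonneg δ)
          have h8 : 0 ≤ c₁ * ‖Q.DσMat w@@t x - Q.DσMat w'@@t x‖ ^ 2 := by positivity
          nlinarith [sq_nonneg (2 * L * ‖δ‖ - 1 / 2 * ‖vec v@@t x - vec v'@@t x‖)])).2.2
        _ fun t => ⟨by positivity, sum_le_sum fun i _ =>
          le_add_of_nonneg_left (by positivity)⟩).trans_eq ?_
      rw [← integral_const_mul]
      exact integral_congr_ae (.of_forall fun t => by simp only; ring))
  refine ⟨w, g, isSubst_iff.2 ⟨hg.1, ?_⟩, hw⟩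
  filter_upwards [hg.2, hvw] with t h1 h2
  simpa only [h2] using h1

/-- Bounded approximate solutions form a Cauchy sequence. -/
theorem exists_cauchy_bound
    (hC : 0 ≤ C) (hf : f.IsMonotone T C μ) (hμ : μ ∈L¹ T) {φ : Fin l → L2 d}
    {u g : ℕ → Fin l → ℝ → L2 d} (hg : ∀ n i, g n i ∈L¹ T)
    (hu : ∀ n i, u n i = mild S T (φ i) (g n i)) {R K : ℝ} (hR0 : 0 ≤ R) (hK0 : 0 ≤ K)
    (hR : ∀ n, ∀ t ∈ Icc 0 T, ∀ᵐ x, ‖vec (u n)@@t x‖ ≤ R)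
    (hK : ∀ n, ∀ t ∈ Icc 0 T, ∑ i, ‖u n i t‖ ≤ K)
    (hKD : ∀ n, ∫ t in Icc 0 T, ∑ i, ‖Q.Dσ (u n i t)‖ ^ 2 ≤ K) {e : ℕ → ℝ → L2 d}
    (he : ∀ n, e n ∈L¹ T) (he1 : ∀ n : ℕ, ∫ t in Icc 0 T, ‖e n t‖ ≤ 1 / ((n : ℝ) + 1))
    (hge : ∀ n : ℕ, ∀ᵐ t ∂(dt T), ∀ᵐ x, ‖vec (g n)@@t x
      - f t x (vec (u n)@@t x)
        (radialProj ((n : ℝ) + 1) (Q.DσMat (u n)@@t x))‖ ≤ e n t x) :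
    ∃ M : ℝ, 0 ≤ M ∧ ∀ n m N : ℕ, N ≤ n → N ≤ m →
      (∀ t ∈ Icc 0 T, ∑ i, ‖u n i t - u m i t‖ ^ 2 ≤ M * (1 / ((N : ℝ) + 1))) ∧
      ∫ t in Icc 0 T, ∑ i, ‖Q.Dσ (u n i t) - Q.Dσ (u m i t)‖ ^ 2 ≤ M * (1 / ((N : ℝ) + 1)) := by
  obtain ⟨c₁, hc₁, hpair⟩ := A.exists_pair_estimate
  obtain ⟨Γ, M, hM, -, -, hpair⟩ := hpair (fun t => 2 * |μ t| + C ^ 2 / c₁) (hμ.two_abs_add _) fun t => by positivity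
  have hDi : ∀ n, (fun t => ∑ i, ‖Q.Dσ (u n i t)‖ ^ 2) ∈L¹ T := fun n =>
    integrable_finsetSum _ fun i _ => by
      rw [hu n i]; exact (A.memLp_Dσ_mild _ (hg n i)).integrable_norm_pow two_ne_zero
  let ρ : ℕ → ℝ → ℝ := fun n t => 4 * R * C * (1 / ((n : ℝ) + 1)) * (∑ i, ‖Q.Dσ (u n i t)‖ ^ 2)
    + 4 * K * ‖e n t‖
  have hρ0 : ∀ n t, 0 ≤ ρ n t := fun n t => by positivity
  have hρi : ∀ n, ρ n ∈L¹ T := fun n =>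
    ((hDi n).const_mul _).add ((he n).norm.const_mul _)
  have hρ : ∀ n N : ℕ, N ≤ n →
      ∫ t in Icc 0 T, ρ n t ≤ (4 * R * C * K + 4 * K) * (1 / ((N : ℝ) + 1)) := fun n N hNn => by
    have e1 : 1 / ((n : ℝ) + 1) ≤ 1 / ((N : ℝ) + 1) := by gcongr
    refine (integral_add ((hDi n).const_mul _) ((he n).norm.const_mul _)).trans_le ?_
    rw [integral_const_mul, integral_const_mul]
    have e2 : 0 ≤ ∫ t in Icc 0 T, ∑ i, ‖Q.Dσ (u n i t)‖ ^ 2 := integral_nonneg fun t => by positivity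
    calc _ ≤ 4 * R * C * (1 / ((N : ℝ) + 1)) * K + 4 * K * (1 / ((N : ℝ) + 1)) := by
          gcongr
          exacts [hKD n, (he1 n).trans e1]
      _ = _ := by ring
  refine ⟨M * (2 * (4 * R * C * K + 4 * K)), by positivity, fun n m N hn hm => ?_⟩
  have hint : M * ∫ s in Icc 0 T, (ρ n s + ρ m s)
      ≤ M * (2 * (4 * R * C * K + 4 * K)) * (1 / ((N : ℝ) + 1)) := by
    rw [integral_add (hρi n) (hρi m), mul_assoc]
    exact mul_le_mul_of_nonneg_left (by linarith [hρ n N hn, hρ m N hm]) hM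
  have hp := hpair (hg n) (hg m) (hu n) (hu m) ((hρi n).add (hρi m))
    (fun t => add_nonneg (hρ0 n t) (hρ0 m t)) (by
      filter_upwards [hge n, hge m, ae_mem_Icc] with t h1 h2 ht
      set s : L2 d := ∑ i, normL (u n i t - u m i t)
      have hsn : ‖s‖ ≤ 2 * K := by
        refine (norm_sum_le _ _).trans ?_
        simp only [norm_normL]
        refine (sum_le_sum fun i _ => norm_sub_le _ _).trans ?_
        rw [sum_add_distrib]
        linarith [hK n t ht, hK m t ht]
      let F : ℕ → Rn d → ℝ := fun n x => 4 * R * C * (1 / ((n : ℝ) + 1)) *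
        ‖matOf (fun i => Q.Dσ (u n i t)) x‖ ^ 2 + 2 * inner ℝ (e n t x) (s x)
      have hF : ∀ n, Integrable (F n) ∧ ∫ x, F n x ≤ ρ n t := fun n => by
        obtain ⟨j, k⟩ := sum_norm_sq_matOf fun i => Q.Dσ (u n i t)
        have j3 : Integrable fun x => inner ℝ (e n t x) (s x) := integrable_inner _ _
        refine ⟨(j.const_mul _).add (j3.const_mul 2),
          (integral_add (j.const_mul _) (j3.const_mul 2)).trans_le ?_⟩
        rw [integral_const_mul, integral_const_mul, ← k, ← inner_def]
        linarith [(real_inner_le_norm (e n t) s).trans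
          (mul_le_mul_of_nonneg_left hsn (norm_nonneg _))]
      refine ⟨fun x => F n x + F m x, (hF n).1.add (hF m).1,
        (integral_add (hF n).1 (hF m).1).trans_le (add_le_add (hF n).2 (hF m).2), ?_⟩
      filter_upwards [h1, h2, hR n t ht, hR m t ht, norm_vec_le_sum fun i => u n i t - u m i t,
        vec_sub_ae (u n)@@t (u m)@@t] with x b1 b2 b3 b4 b5 b6
      rw [b6] at b5
      set z := Q.DσMat (u n)@@t x with hz
      set z' := Q.DσMat (u m)@@t x with hz'
      have q1 := norm_radialProj_sub_le (by positivity : (0 : ℝ) < n + 1) z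
      have q2 := norm_radialProj_sub_le (by positivity : (0 : ℝ) < m + 1) z'
      refine (two_inner_le_of_monotone (Y := Rn l) (R := R) (ζ := ‖z - z'‖)
        (α := ‖z‖ ^ 2 / ((n : ℝ) + 1) + ‖z'‖ ^ 2 / ((m : ℝ) + 1)) hC hc₁ (by positivity)
        (hf.mono t ht x _ _ _) ((hf.lip t ht x _ _ (radialProj ((m : ℝ) + 1) z')).trans
          (mul_le_mul_of_nonneg_left ?_ hC)) b1 b2 b5
        ((norm_sub_le _ _).trans (by linarith))).trans (le_of_eq ?_)
      · rw [norm_sub_rev] at q2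
        have := norm_add₃_le (a := radialProj ((n : ℝ) + 1) z - z) (b := z - z')
          (c := z' - radialProj ((m : ℝ) + 1) z')
        rw [sub_add_sub_cancel, sub_add_sub_cancel] at this
        linarith
      · simp only [F]
        rw [real_inner_eq_mul, real_inner_eq_mul, ← Q.DσMat_eq, ← Q.DσMat_eq]
        ring)
  exact ⟨fun t ht => (hp.1 t ht).trans hint, hp.2.1.trans hint⟩

/-- Mild solutions depend continuously on the data. -/
theorem exists_mild_sub_bound : ∃ K : ℝ, 0 ≤ K ∧
    ∀ {φ φ' : L2 d} {g g' : ℝ → L2 d}, g ∈L¹ T → g' ∈L¹ T →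
      (∀ t ∈ Icc 0 T, ‖mild S T φ g t - mild S T φ' g' t‖
        ≤ K * (‖φ - φ'‖ + ∫ s in Icc 0 T, ‖g s - g' s‖)) ∧
      (∫ t in Icc 0 T, Q.energy c₂ (mild S T φ g t - mild S T φ' g' t))
        ≤ K * (‖φ - φ'‖ + ∫ s in Icc 0 T, ‖g s - g' s‖) ^ 2 ∧
      ∫ t in Icc 0 T, ‖Q.Dσ (mild S T φ g t) - Q.Dσ (mild S T φ' g' t)‖ ^ 2
        ≤ K * (‖φ - φ'‖ + ∫ s in Icc 0 T, ‖g s - g' s‖) ^ 2 := by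
  obtain ⟨K, hK0, hK⟩ := A.exists_mild_bound
  refine ⟨K, hK0, fun {φ φ' g g'} hg hg' => ?_⟩
  obtain ⟨h1, h2, -, h3⟩ := hK (φ - φ') (fun s => g s - g' s) (hg.sub hg')
  have e : ∀ t ∈ Icc 0 T, mild S T (φ - φ') (fun s => g s - g' s) t
      = mild S T φ g t - mild S T φ' g' t := fun t ht => A.sg.semigroup.mild_sub hg hg' ht
  refine ⟨fun t ht => by rw [← e t ht]; exact h1 t ht, ?_, ?_⟩
  · rw [setIntegral_congr_fun measurableSet_Icc fun t ht => congrArg _ (e t ht)] at h2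
    exact h2
  · refine le_trans (le_of_eq (integral_congr_ae ?_)) h3
    filter_upwards [(A.memFhat_mild φ hg).mem, (A.memFhat_mild φ' hg').mem,
      ae_mem_Icc] with t m1 m2 ht
    rw [e t ht, (A.sub_mem m1 m2).2]

/-- Limits of bounded approximate solutions are mild solutions. -/
theorem exists_isMildSol_of_tendsto (hC : 0 ≤ C) (hf : f.IsMonotone T C μ) {φ : Fin l → L2 d}
    {u g : ℕ → Fin l → ℝ → L2 d} (hg : ∀ n i, g n i ∈L¹ T)
    (hu : ∀ n i, u n i = mild S T (φ i) (g n i)) {R : ℝ} (hR0 : 0 < R)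
    (hR : ∀ n, ∀ t ∈ Icc 0 T, ∀ᵐ x, ‖vec (u n)@@t x‖ ≤ R) {e : ℕ → ℝ → L2 d}
    (he : ∀ n, e n ∈L¹ T)
    (he0 : (fun n => ∫ t in Icc 0 T, ‖e n t‖) ⇝ 0)
    (hge : ∀ n : ℕ, ∀ᵐ t ∂(dt T), ∀ᵐ x, ‖vec (g n)@@t x
      - f t x (vec (u n)@@t x)
        (radialProj ((n : ℝ) + 1) (Q.DσMat (u n)@@t x))‖ ≤ e n t x)
    {v : Fin l → ℝ → L2 d} (hv : ∀ i, ∀ t ∈ Icc 0 T, (fun n => u n i t) ⇝ v i t)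
    {W : Fin l → ℝ → L2v d k} (hW : ∀ i, MemLp (W i) 2 (dt T))
    (hDW : ∀ i, (fun n => ∫ t in Icc 0 T, ‖Q.Dσ (u n i t) - W i t‖ ^ 2) ⇝ 0) :
    ∃ w g, Q.IsMildSol T S φ f w g := by
  have hpos : ∀ n : ℕ, (0 : ℝ) < (n : ℝ) + 1 := fun n => by positivity
  have hvR : ∀ t ∈ Icc 0 T, ∀ᵐ x, ‖vec v@@t x‖ ≤ R := fun t ht => by
    obtain ⟨ms, -, hms⟩ := exists_subseq_vec (w := fun n i => u n i t) (v := v@@t)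
      fun i => hv i t ht
    filter_upwards [hms, ae_all_iff.2 fun n => hR n t ht] with x h1 h2
    exact le_of_tendsto h1.norm (of_forall fun n => h2 _)
  have hum : ∀ n i, AEStronglyMeasurable (u n i) (dt T) := fun n i => by
    rw [hu n i]; exact (A.memLp_mild _ (hg n i)).1
  have hvm : ∀ i, AEStronglyMeasurable (v i) (dt T) := fun i =>
    aestronglyMeasurable_of_tendsto_ae atTop (fun n => hum n i)
      (ae_restrict_of_forall_mem measurableSet_Icc fun t ht => hv i t ht)
  have hD : ∀ n i, MemLp (fun t => Q.Dσ (u n i t)) 2 (dt T) := fun n i => by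
    rw [hu n i]; exact A.memLp_Dσ_mild _ (hg n i)
  obtain ⟨h, hh, hdom⟩ := hf.dom R hR0
  let H : ℝ → L2 d := fun t => h t + C • ∑ i, normL (W i t)
  have hH : H ∈L¹ T :=
    hh.add ((integrableOn_sum_normL fun i => integrableOn_of_memLp_two (hW i)).smul C)
  have hfH : ∀ᵐ t ∂(dt T), ∀ᵐ x, ∀ y z, ‖y‖ ≤ R →
      ‖z‖ ≤ ‖matOf W@@t x‖ → ‖f t x y z‖ ≤ H t x := by
    filter_upwards [hdom, ae_mem_Icc] with t h1 ht
    filter_upwards [h1, add_smul_le_coeFn hC (h t) (norm_matOf_le_sum W@@t)] with x h2 h3 y z hy hz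
    exact (hf.norm_le ht x y z).trans
      ((add_le_add (h2 y hy) (mul_le_mul_of_nonneg_left hz hC)).trans h3)
  let fn : ℕ → Nonlin d k l := fun n t x y z => f t x y (radialProj ((n : ℝ) + 1) z)
  have hfn : ∀ n, (fn n).IsMeasurable := fun n => hf.meas.comp (ζ := fun p => radialProj _ p.2.2.2)
    ((continuous_radialProj (hpos n)).measurable.comp (by fun_prop))
  have hmemR : ∀ n, ∀ᵐ t ∂(dt T), ∀ᵐ x, ‖vec (u n)@@t x‖ ≤ R := fun n =>
    ae_restrict_of_forall_mem measurableSet_Icc (hR n)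
  have hex : ∀ n, ∃ γ, IsSubstAt T (fn n) (u n) W γ := fun n =>
    exists_isSubstAt (hfn n) (hum n) (fun i => (hW i).1) hH (by
      filter_upwards [hfH, hmemR n] with t h1 h2
      filter_upwards [h1, h2] with x h3 h4
      exact h3 _ _ h4 (norm_radialProj_le_norm _ _))
  choose γ hγ using hex
  obtain ⟨g', hg'⟩ := exists_isSubstAt hf.meas hvm (fun i => (hW i).1) hH (by
      filter_upwards [hfH, ae_mem_Icc] with t h1 ht
      filter_upwards [h1, hvR t ht] with x h3 h4
      exact h3 _ _ h4 le_rfl)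
  have lim1 : ∀ i, (fun n => ∫ t in Icc 0 T, ‖γ n i t - g' i t‖) ⇝ 0 := fun i => by
    refine tendsto_integral_of_dominated_slices (fun n => (hγ n).1 i) (hg'.1 i) (hH.smul (2 : ℝ))
      (fun n => ?_) ?_
    · filter_upwards [hfH, hmemR n, (hγ n).2, hg'.2, ae_mem_Icc]
        with t h1 h2 h3 h4 ht
      filter_upwards [h1, h2, h3, h4, hvR t ht, ae_smul (2 : ℝ) (H t)] with x h5 h6 h7 h8 h9 h10
      refine (PiLp.norm_apply_le (vec (γ n)@@t x - vec g'@@t x) i).trans ((norm_sub_le _ _).trans ?_)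
      simp only [Pi.smul_apply] at h10 ⊢
      rw [h7, h8, h10, smul_eq_mul, two_mul]
      exact add_le_add (h5 _ _ h6 (norm_radialProj_le_norm _ _)) (h5 _ _ h9 le_rfl)
    · filter_upwards [ae_all_iff.2 fun n => (hγ n).2, hg'.2, ae_mem_Icc]
        with t h1 h2 ht ns hns
      obtain ⟨ms, hms, hae⟩ := exists_subseq_vec (w := fun n i => u (ns n) i t) (v := v@@t)
        fun i => (hv i t ht).comp hns
      refine ⟨ms, ?_⟩
      filter_upwards [hae, ae_all_iff.2 h1, h2] with x h3 h4 h5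
      have a1 : (fun n => vec (fun i => γ (ns (ms n)) i t) x) ⇝ (vec g'@@t x) := by
        rw [h5]
        have a2 := ((hf.cont t ht x (matOf W@@t x)).tendsto _).comp h3
        refine a2.congr' ?_
        have a3 := (tendsto_natCast_atTop_atTop (R := ℝ)).comp (hns.comp hms.tendsto_atTop)
        filter_upwards [a3.eventually_ge_atTop ‖matOf W@@t x‖] with n hn
        rw [h4 (ns (ms n))]
        simp only [fn, Function.comp_apply]
        rw [radialProj_of_norm_le]
        simp only [Function.comp_apply] at hn
        linarith
      exact ((PiLp.continuous_apply 2 (fun _ : Fin l => ℝ) i).tendsto _).comp a1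
  have hDWi : ∀ n i, MemLp (fun t => Q.Dσ (u n i t) - W i t) 2 (dt T) :=
    fun n i => (hD n i).sub (hW i)
  have lim2 : ∀ i, (fun n => ∫ t in Icc 0 T, ‖Q.Dσ (u n i t) - W i t‖) ⇝ 0 := fun i =>
    tendsto_integral_norm_of_sq (fun n => hDWi n i) (hDW i)
  have lim3 : ∀ i, (fun n => ∫ t in Icc 0 T, ‖g n i t - g' i t‖) ⇝ 0 := fun i => by
    have a0 : (fun n => (∫ t in Icc 0 T, ‖e n t‖) + C * (∑ j, ∫ t in Icc 0 T,
        ‖Q.Dσ (u n j t) - W j t‖) + ∫ t in Icc 0 T, ‖γ n i t - g' i t‖) ⇝ 0 := by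
      simpa using (he0.add ((tendsto_finsetSum Finset.univ fun j _ => lim2 j).const_mul C)).add (lim1 i)
    refine squeeze_zero (fun n => by positivity) (fun n => ?_) a0
    have b1 : (fun t => ∑ j, ‖Q.Dσ (u n j t) - W j t‖) ∈L¹ T :=
      integrable_finsetSum _ fun j _ => (integrableOn_of_memLp_two (hDWi n j)).norm
    have b2 : (fun t => ‖γ n i t - g' i t‖) ∈L¹ T := ((hγ n).1 i |>.sub (hg'.1 i)).norm
    rw [← integral_finsetSum _ fun j _ => (integrableOn_of_memLp_two (hDWi n j)).norm,
      ← integral_const_mul]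
    have b3 := integral_add (he n).norm (b1.const_mul C)
    have b4 := integral_add ((he n).norm.add (b1.const_mul C)) b2
    simp only [Pi.add_apply] at b3 b4
    rw [← b3, ← b4]
    refine integral_mono_ae ((hg n i).sub (hg'.1 i)).norm
      (((he n).norm.add (b1.const_mul C)).add b2) ?_
    filter_upwards [hge n, (hγ n).2, ae_mem_Icc] with t h1 h2 ht
    have b5 : ‖g n i t - γ n i t‖ ≤ ‖e n t + C • ∑ j, normL (Q.Dσ (u n j t) - W j t)‖ := by
      refine norm_path_le ?_
      filter_upwards [h1, h2, add_smul_le_coeFn hC (e n t) (norm_matOf_le_sum fun j =>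
        Q.Dσ (u n j t) - W j t), matOf_sub_ae (fun j => Q.Dσ (u n j t)) W@@t,
        ae_sub (g n i t) (γ n i t)] with x h3 h4 h5 h6 h7
      rw [h7]
      refine le_trans ((PiLp.norm_apply_le (vec (g n)@@t x - vec (γ n)@@t x) i).trans ?_) h5
      rw [h4, h6, ← Q.DσMat_eq]
      exact (norm_sub_le_norm_sub_add_norm_sub _ _ _).trans (add_le_add h3
        ((hf.lip t ht x _ _ _).trans (mul_le_mul_of_nonneg_left
          (norm_radialProj_sub_radialProj_le (hpos n) _ _) hC)))
    refine (norm_sub_le_norm_sub_add_norm_sub (g n i t) (γ n i t) (g' i t)).trans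
      (add_le_add (b5.trans ((norm_add_le _ _).trans (add_le_add le_rfl ?_))) le_rfl)
    rw [norm_smul, norm_of_nonneg hC]
    simpa only [norm_normL] using mul_le_mul_of_nonneg_left (norm_sum_le Finset.univ
      fun j => normL (Q.Dσ (u n j t) - W j t)) hC
  obtain ⟨K, hK0, hK⟩ := A.exists_mild_sub_bound
  have hvw : ∀ i, ∀ t ∈ Icc 0 T, mild S T (φ i) (g' i) t = v i t := fun i t ht => by
    refine tendsto_nhds_unique ?_ (hv i t ht)
    rw [tendsto_iff_norm_sub_tendsto_zero]
    have a0 := (lim3 i).const_mul K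
    rw [mul_zero] at a0
    refine squeeze_zero (fun n => norm_nonneg _) (fun n => ?_) a0
    rw [hu n i]
    simpa using (hK (φ := φ i) (φ' := φ i) (hg n i) (hg'.1 i)).1 t ht
  have hDv : ∀ i, ∀ᵐ t ∂(dt T), Q.Dσ (mild S T (φ i) (g' i) t) = W i t := fun i => by
    refine ae_eq_of_tendsto_integral_norm_sq (fun n => hD n i) (A.memLp_Dσ_mild (φ i) (hg'.1 i)) (hW i)
      ?_ (hDW i)
    have a1 := ((lim3 i).pow 2).const_mul K
    rw [zero_pow two_ne_zero, mul_zero] at a1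
    refine squeeze_zero (fun n => by positivity) (fun n => ?_) a1
    rw [hu n i]
    simpa using (hK (φ := φ i) (φ' := φ i) (hg n i) (hg'.1 i)).2.2
  refine ⟨fun i => mild S T (φ i) (g' i), g', isSubst_iff.2 ⟨hg'.1, ?_⟩, fun i => rfl⟩
  filter_upwards [hg'.2, ae_all_iff.2 hDv, ae_mem_Icc] with t h1 h2 ht
  simp only [h2]
  simp only [hvw _ t ht]
  exact h1

/-- Bounded approximate solutions converge to a mild solution. -/
theorem exists_isMildSol_of_approx
    (hC : 0 ≤ C) (hf : f.IsMonotone T C μ) (hμ : μ ∈L¹ T) {φ : Fin l → L2 d}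
    {u g : ℕ → Fin l → ℝ → L2 d} (hg : ∀ n i, g n i ∈L¹ T)
    (hu : ∀ n i, u n i = mild S T (φ i) (g n i)) {R K : ℝ} (hR0 : 0 < R) (hK0 : 0 ≤ K)
    (hR : ∀ n, ∀ t ∈ Icc 0 T, ∀ᵐ x, ‖vec (u n)@@t x‖ ≤ R)
    (hK : ∀ n, ∀ t ∈ Icc 0 T, ∑ i, ‖u n i t‖ ^ 2 ≤ K)
    (hKD : ∀ n, ∫ t in Icc 0 T, ∑ i, ‖Q.Dσ (u n i t)‖ ^ 2 ≤ K) {e : ℕ → ℝ → L2 d}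
    (he : ∀ n, e n ∈L¹ T) (he1 : ∀ n : ℕ, ∫ t in Icc 0 T, ‖e n t‖ ≤ 1 / ((n : ℝ) + 1))
    (hge : ∀ n : ℕ, ∀ᵐ t ∂(dt T), ∀ᵐ x, ‖vec (g n)@@t x
      - f t x (vec (u n)@@t x)
        (radialProj ((n : ℝ) + 1) (Q.DσMat (u n)@@t x))‖ ≤ e n t x) :
    ∃ w g, Q.IsMildSol T S φ f w g := by
  obtain ⟨M, hM0, hM⟩ := A.exists_cauchy_bound hC hf hμ hg hu (K := l + K) hR0.le (by positivity) hR
    (fun n t ht => by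
      have h1 : ∑ i, ‖u n i t‖ ≤ ∑ i, (1 + ‖u n i t‖ ^ 2) :=
        sum_le_sum fun i _ => by nlinarith [sq_nonneg (‖u n i t‖ - 1)]
      simp only [sum_add_distrib, Finset.sum_const, Finset.card_univ, card_fin,
        nsmul_eq_mul, mul_one] at h1
      linarith [hK n t ht]) (fun n => (hKD n).trans (by simp)) he he1 hge
  have hD : ∀ n i, MemLp (fun t => Q.Dσ (u n i t)) 2 (dt T) := fun n i => by
    rw [hu n i]; exact A.memLp_Dσ_mild _ (hg n i)
  set b : ℕ → ℝ := fun N => √(M * (1 / ((N : ℝ) + 1))) with hb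
  have hb2 : ∀ N, b N ^ 2 = M * (1 / ((N : ℝ) + 1)) := fun N => sq_sqrt (by positivity)
  have hblim : b ⇝ 0 := by
    have := (tendsto_one_div_add_atTop_nhds_zero_nat (𝕜 := ℝ)).const_mul M
    rw [mul_zero] at this
    simpa only [hb, sqrt_zero] using this.sqrt
  have hv : ∀ i, ∀ t : Icc 0 T, ∃ v, (fun n => u n i t) ⇝ v := fun i t => by
    refine cauchySeq_tendsto_of_complete (cauchySeq_of_le_tendsto_0 b (fun n m N hn hm => ?_) hblim)
    rw [dist_eq_norm]
    refine abs_le_of_sq_le_sq' ?_ (sqrt_nonneg _) |>.2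
    rw [hb2]
    exact (single_le_sum (f := fun i => ‖u n i t - u m i t‖ ^ 2) (fun i _ => sq_nonneg _)
      (Finset.mem_univ i)).trans ((hM n m N hn hm).1 t t.2)
  choose v hv using hv
  have hDn : ∀ n m i, (fun t => ‖Q.Dσ (u n i t) - Q.Dσ (u m i t)‖ ^ 2) ∈L¹ T :=
    fun n m i => ((hD n i).sub (hD m i)).integrable_norm_pow two_ne_zero
  choose W hW hDW hns using fun i => exists_limit_of_integral_norm_sq_le (fun n => hD n i) hblim
    (fun n m N hn hm => by
      rw [hb2]
      refine le_trans (integral_mono (hDn n m i) (integrable_finsetSum _ fun i _ => hDn n m i)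
        fun t => ?_) (hM n m N hn hm).2
      exact single_le_sum (f := fun i => ‖Q.Dσ (u n i t) - Q.Dσ (u m i t)‖ ^ 2)
        (fun i _ => sq_nonneg _) (Finset.mem_univ i)) fun N => sqrt_nonneg _
  classical
  exact A.exists_isMildSol_of_tendsto hC hf hg hu hR0 hR he
    (squeeze_zero (fun n => by positivity) he1 tendsto_one_div_add_atTop_nhds_zero_nat) hge
    (v := fun i t => if h : t ∈ Icc 0 T then v i ⟨t, h⟩ else 0)
    (fun i t ht => by simpa only [dif_pos ht] using hv i ⟨t, ht⟩) hW hDW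

/-- A priori estimates for mild solutions of systems in the energy norm and in the sup norm. -/
theorem exists_apriori : ∃ c > 0, ∀ κ : ℝ → ℝ,
    κ ∈L¹ T → (∀ t, 0 ≤ κ t) → ∃ K > 0, ∀ {φ : Fin l → L2 d}
      {u g : Fin l → ℝ → L2 d} {ρ : ℝ → L2 d}, (∀ i, g i ∈L¹ T) →
      (∀ i, u i = mild S T (φ i) (g i)) → MemLp ρ 2 (dt T) →
      (∀ᵐ t ∂(dt T), ∀ᵐ x,
        2 * inner ℝ (vec g@@t x) (vec u@@t x)
          ≤ ρ t x ^ 2 + κ t * ‖vec u@@t x‖ ^ 2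
            + c * ‖Q.DσMat u@@t x‖ ^ 2) →
      (∀ t ∈ Icc 0 T, ∑ i, ‖u i t‖ ^ 2 ≤ K * (∑ i, ‖φ i‖ ^ 2 + ∫ t in Icc 0 T, ‖ρ t‖ ^ 2)) ∧
      (∫ t in Icc 0 T, ∑ i, Q.energy c₂ (u i t)
        ≤ K * (∑ i, ‖φ i‖ ^ 2 + ∫ t in Icc 0 T, ‖ρ t‖ ^ 2)) ∧
      (∫ t in Icc 0 T, ∑ i, ‖Q.Dσ (u i t)‖ ^ 2
        ≤ K * (∑ i, ‖φ i‖ ^ 2 + ∫ t in Icc 0 T, ‖ρ t‖ ^ 2)) ∧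
      ∀ a b : ℝ, 0 ≤ a → 0 ≤ b → (∀ᵐ x, ‖vec φ x‖ ≤ a) →
        (∀ᵐ t ∂(dt T), ∀ᵐ x, |ρ t x| ≤ b) →
        ∀ t ∈ Icc 0 T, ∀ᵐ x, ‖vec u@@t x‖ ≤ K * (a + b) := by
  obtain ⟨c₁, hc₁, H⟩ := A.exists_estimate
  obtain ⟨Cs, hCs0, hCs⟩ := A.exists_sup_bound (l := l)
  refine ⟨min c₁ 2, by positivity, fun κ hκ hκ0 => ?_⟩
  obtain ⟨Γ, M, hM, -, -, H⟩ := H κ hκ hκ0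
  have hT := A.pos
  set E := expInt κ T * Cs * (1 + T) with hE
  have hE0 : 0 ≤ E := mul_nonneg (mul_nonneg (expInt_pos _ _).le hCs0) (by linarith)
  refine ⟨M + (1 + E), by positivity, ?_⟩
  intro φ u g ρ hg hu hρ hle
  obtain ⟨h1, h2, h3, -⟩ := H hg hu (hρ.integrable_norm_pow two_ne_zero) (fun t => by positivity) (by
    filter_upwards [hle] with t ht
    refine ⟨_, integrable_sq (ρ t), (integral_sq (ρ t)).le, ?_⟩
    filter_upwards [ht] with x hx
    rw [← Q.DσMat_eq]
    linarith [mul_le_mul_of_nonneg_right (min_le_left c₁ 2) (sq_nonneg ‖Q.DσMat u@@t x‖)])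
  have hup : ∀ {x : ℝ}, x ≤ M * (∑ i, ‖φ i‖ ^ 2 + ∫ t in Icc 0 T, ‖ρ t‖ ^ 2) →
      x ≤ (M + (1 + E)) * (∑ i, ‖φ i‖ ^ 2 + ∫ t in Icc 0 T, ‖ρ t‖ ^ 2) := fun hx =>
    hx.trans (mul_le_mul_of_nonneg_right (by linarith) (by positivity))
  refine ⟨fun t ht => hup (h1 t ht), hup h2, hup h3, ?_⟩
  · intro a b ha hb hφ hρb t ht
    have e1 := hCs hg hu hκ hκ0 hρ (by
      filter_upwards [hle] with t ht
      filter_upwards [ht] with x hx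
      have := mul_le_mul_of_nonneg_right (min_le_right c₁ 2)
          (sq_nonneg ‖Q.DσMat u@@t x‖)
      linarith) hφ hρb t ht
    filter_upwards [e1] with x hx
    refine le_trans ?_ (mul_le_mul_of_nonneg_right (by linarith : 1 + E ≤ M + (1 + E)) (by linarith))
    refine abs_le_of_sq_le_sq' (hx.trans ?_) (by positivity) |>.2
    have e3 : expInt κ T * Cs * (a ^ 2 + T * b ^ 2) ≤ expInt κ T * Cs * ((1 + T) * (a + b) ^ 2) :=
      mul_le_mul_of_nonneg_left (by
        nlinarith [mul_nonneg ha hb, mul_nonneg hT.le (mul_nonneg ha hb),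
          mul_nonneg hT.le (sq_nonneg a)]) (mul_nonneg (expInt_pos _ _).le hCs0)
    calc _ ≤ _ := e3
      _ = E * (a + b) ^ 2 := by rw [hE]; ring
      _ ≤ (1 + E) ^ 2 * (a + b) ^ 2 := mul_le_mul_of_nonneg_right (by nlinarith) (sq_nonneg _)
      _ = _ := by ring

/-- Existence for monotone nonlinearities that do not depend on `z`. -/
theorem exists_isMildSol_of_monotone {G : ℝ → Rn d → Rn l → Rn l} (hC : 0 ≤ C) (hG : Nonlin.IsMonotone (k := k) (fun t x y _ => G t x y) T C μ)
    (hμ : μ ∈L¹ T) {φ : Fin l → L2 d} {a b : ℝ} (ha : 0 ≤ a) (hb : 0 ≤ b)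
    (hφ : ∀ᵐ x, ‖vec φ x‖ ≤ a) {ρ₀ : ℝ → L2 d} (hρ₀ : MemLp ρ₀ 2 (dt T))
    (hGρ : ∀ᵐ t ∂(dt T), ∀ᵐ x, ‖G t x 0‖ ≤ ρ₀ t x)
    (hGb : ∀ᵐ t ∂(dt T), ∀ᵐ x, ‖G t x 0‖ ≤ b) :
    ∃ u g, Q.IsMildSol T S φ (fun t x y _ => G t x y) u g := by
  obtain ⟨w, hwm, hw0, hw1, hw2⟩ := exists_weight d
  obtain ⟨c, hc, hap⟩ := A.exists_apriori (l := l)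
  obtain ⟨K, hK, hap⟩ := hap (fun t => 1 + 2 * |μ t|)
    ((integrableOn_const_Icc 1).add (hμ.norm.const_mul 2)) fun t => by positivity
  have hG0 : Measurable fun p : ℝ × Rn d => G p.1 p.2 0 :=
    Measurable.comp (g := fun p : ℝ × Rn d × Rn l × Mat l k => G p.1 p.2.1 p.2.2.1) hG.meas
      (f := fun p : ℝ × Rn d => (p.1, p.2, (0 : Rn l), (0 : Mat l k))) (by fun_prop)
  obtain ⟨ρ, hρ, hρe⟩ := exists_path_of_norm_le (F := fun p => ‖G p.1 p.2 0‖ + w p.2)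
    (hG0.norm.add (by fun_prop)) (hρ₀.add (memLp_const (hw2.toLp w))) (by
      filter_upwards [hGρ] with t ht
      filter_upwards [ht, ae_add (ρ₀ t) (hw2.toLp w), hw2.coeFn_toLp] with x h1 h2 h3
      rw [Pi.add_apply, h2, h3, norm_of_nonneg (add_nonneg (norm_nonneg _) (hw0 x).le)]
      linarith)
  have hρb : ∀ᵐ t ∂(dt T), ∀ᵐ x, |ρ t x| ≤ b + 1 := by
    filter_upwards [hρe, hGb] with t h1 h2
    filter_upwards [h1, h2] with x h3 h4
    rw [h3, abs_of_nonneg (add_nonneg (norm_nonneg _) (hw0 x).le)]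
    linarith [hw1 x]
  set R := K * (a + (b + 1)) + 1 with hR
  have hR0 : 0 < R := by positivity
  choose L G' e hL0 hG'm hG'L hei he1 hee hG'i using fun n : ℕ =>
    exists_lipschitz_approx hG hR0 hwm hw0 hw2 (ε := 1 / ((n : ℝ) + 1)) (by positivity)
  obtain ⟨h, hh, hdom⟩ := hG.dom R hR0
  choose u g hug using fun n => A.exists_isMildSol_of_lipschitz (hG'm n) (hL0 n) (hG'L n)
    (hh.add (hei n)) (by
      filter_upwards [hdom, hee n] with t h1 h2
      filter_upwards [h1, h2, ae_add (h t) (e n t)] with x h3 h4 h5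
      rw [Pi.add_apply, h5]
      have h6 := h4 0
      rw [radialProj_zero] at h6
      have h7 := norm_le_norm_add_norm_sub' (G' n t x 0) (G t x 0)
      linarith [h3 0 (by simpa using hR0.le)]) φ
  have hb' := fun n => hap (φ := φ) (hug n).1.1 (hug n).2 hρ (by
    filter_upwards [(isSubst_iff.1 (hug n).1).2, hρe, ae_mem_Icc] with t h1 h2 ht
    filter_upwards [h1, h2] with x h3 h4
    rw [h3, h4]
    have h5 := hG'i n t ht x (vec (u n)@@t x)
    have h6 : 0 ≤ c * ‖Q.DσMat (u n)@@t x‖ ^ 2 := by positivity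
    linarith)
  have hbR : ∀ n, ∀ t ∈ Icc 0 T, ∀ᵐ x, ‖vec (u n)@@t x‖ ≤ R := fun n t ht => by
    filter_upwards [(hb' n).2.2.2 a (b + 1) ha (by linarith) hφ hρb t ht] with x hx
    linarith
  exact A.exists_isMildSol_of_approx hC hG hμ (fun n i => (hug n).1.1 i)
    (fun n => (hug n).2) hR0 (K := K * (∑ i, ‖φ i‖ ^ 2 + ∫ t in Icc 0 T, ‖ρ t‖ ^ 2)) (by positivity)
    hbR (fun n => (hb' n).1) (fun n => (hb' n).2.2.1) hei he1 (fun n => by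
      filter_upwards [(isSubst_iff.1 (hug n).1).2, hee n, ae_mem_Icc] with t h1 h2 ht
      filter_upwards [h1, h2, hbR n t ht] with x h3 h4 h5
      have h6 := h4 (vec (u n)@@t x)
      rw [radialProj_of_norm_le h5] at h6
      rwa [h3])

section

variable (hC : 0 ≤ C) (hf : f.IsMonotone T C μ)
  (hμ : μ ∈L¹ T) {φ : Fin l → L2 d} {a b : ℝ} (ha : 0 ≤ a) (hb : 0 ≤ b) (hφ : ∀ᵐ x, ‖vec φ x‖ ≤ a)

include hC hf hμ ha hb hφ

/-- Existence for nonlinearities that are truncated in `z`. -/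
theorem exists_isMildSol_trunc {ρ₀ : ℝ → L2 d} (hρ₀ : MemLp ρ₀ 2 (dt T))
    (hfρ : ∀ᵐ t ∂(dt T), ∀ᵐ x, ‖f t x 0 0‖ ≤ ρ₀ t x)
    (hfb : ∀ᵐ t ∂(dt T), ∀ᵐ x, ‖f t x 0 0‖ ≤ b) {N : ℝ} (hN : 0 < N) :
    ∃ u g, Q.IsMildSol T S φ (fun t x y z => f t x y (radialProj N z)) u g := by
  obtain ⟨c₁, hc₁, hpair⟩ := A.exists_pair_estimate
  obtain ⟨Γ, M, -, hΓ, hΓ1, hpair⟩ := hpair (fun t => 2 * |μ t| + C ^ 2 / (c₁ / 4))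
    (hμ.two_abs_add _) fun t => by positivity
  have hle : ∀ t ∈ Icc 0 T, ∀ x y z, ‖f t x y (radialProj N z)‖ ≤ ‖f t x y 0‖ + C * ‖z‖ :=
    fun t ht x y z => (hf.norm_le ht x y _).trans
      (add_le_add le_rfl (mul_le_mul_of_nonneg_left (norm_radialProj_le_norm _ _) hC))
  let Rel : (Fin l → ℝ → L2v d k) → (Fin l → ℝ → L2v d k) → Prop := fun V W => ∃ u g,
    IsSubstAt T (fun t x y z => f t x y (radialProj N z)) u V g ∧
      (∀ i, u i = mild S T (φ i) (g i)) ∧ ∀ i, W i = fun t => Q.Dσ (u i t)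
  obtain ⟨V, W, -, ⟨u, g, hg, hu, hW⟩, hVW⟩ := exists_fixed_of_contraction hΓ hΓ1 Rel
    (fun V hV => by
      obtain ⟨Z, hZm, hZ⟩ := exists_rep_matOf fun i => (hV i).1
      have hsum : ∀ {h : ℝ → L2 d}, ∀ᵐ t ∂(dt T), ∀ᵐ x,
          h t x + C * ‖Z (t, x)‖ ≤ (h t + C • ∑ i, normL (V i t) : L2 d) x := fun {h} => by
        filter_upwards [hZ] with t h1
        filter_upwards [h1, add_smul_le_coeFn hC (h t) (norm_matOf_le_sum V@@t)] with x h3 h4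
        rwa [h3] at h4
      have hsm := memLp_sum_normL hV
      have hGmono : Nonlin.IsMonotone (k := k)
          (fun t x y _ => f t x y (radialProj N (Z (t, x)))) T C μ :=
        { meas := hf.meas.comp (ζ := fun p => radialProj N (Z (p.1, p.2.1)))
            ((continuous_radialProj hN).measurable.comp (hZm.comp (by fun_prop)))
          lip := fun t ht x y z z' => by rw [sub_self, norm_zero]; positivity
          mono := fun t ht x y y' z => hf.mono t ht x y y' _
          cont := fun t ht x z => hf.cont t ht x _
          dom := fun R hR => by
            obtain ⟨h, hh, hd⟩ := hf.dom R hR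
            refine ⟨fun t => h t + C • ∑ i, normL (V i t),
              hh.add ((integrableOn_of_memLp_two hsm).smul C), ?_⟩
            filter_upwards [hd, hsum (h := h), ae_mem_Icc] with t h1 h2 ht
            filter_upwards [h1, h2] with x h3 h4 y hy
            exact (hle t ht x y _).trans ((add_le_add (h3 y hy) le_rfl).trans h4) }
      obtain ⟨u, g, hs, hu⟩ := A.exists_isMildSol_of_monotone hC hGmono hμ ha
        (b := b + C * N) (by positivity) hφ (hρ₀.add (hsm.const_smul C)) (by
          filter_upwards [hfρ, hsum (h := ρ₀), ae_mem_Icc] with t h1 h2 ht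
          filter_upwards [h1, h2] with x h3 h4
          exact (hle t ht x 0 _).trans ((add_le_add h3 le_rfl).trans h4)) (by
          filter_upwards [hfb, ae_mem_Icc] with t h1 ht
          filter_upwards [h1] with x h3
          exact (hf.norm_le ht x 0 _).trans
            (add_le_add h3 (mul_le_mul_of_nonneg_left (norm_radialProj_le hN _) hC)))
      refine ⟨fun i t => Q.Dσ (u i t), fun i => ?_, u, g, ⟨hs.1, ?_⟩, hu, fun i => rfl⟩
      · simp only [hu i]
        exact A.memLp_Dσ_mild _ (hs.1 i)
      · filter_upwards [(isSubst_iff.1 hs).2, hZ] with t h1 h2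
        filter_upwards [h1, h2] with x h3 h4
        rw [h3, h4])
    (fun V V' W W' hV hV' ⟨u, g, hg, hu, hW⟩ ⟨u', g', hg', hu', hW'⟩ => by
      have hsq : (fun t => ∑ i, ‖V i t - V' i t‖ ^ 2) ∈L¹ T :=
        integrable_finsetSum _ fun i _ => ((hV i).sub (hV' i)).integrable_norm_pow two_ne_zero
      have e := (hpair hg.1 hg'.1 hu hu' (hsq.const_mul (c₁ / 4)) (fun t => by positivity) (by
          filter_upwards [hg.2, hg'.2, ae_mem_Icc] with t h1 h2 ht
          obtain ⟨i1, e1⟩ := sum_norm_sq_matOf fun i => V i t - V' i t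
          refine ⟨_, i1.const_mul (c₁ / 4), by rw [integral_const_mul, ← e1], ?_⟩
          filter_upwards [h1, h2, matOf_sub_ae V@@t V'@@t] with x h3 h4 h5
          rw [h3, h4, h5]
          have h6 := hf.two_inner_sub_le hC (by positivity : 0 < c₁ / 4) ht x (vec u@@t x)
            (vec u'@@t x) (radialProj N (matOf V@@t x)) (radialProj N (matOf V'@@t x))
          have h7 : 0 ≤ c₁ * ‖Q.DσMat u@@t x - Q.DσMat u'@@t x‖ ^ 2 := by positivity
          have h8 := pow_le_pow_left₀ (norm_nonneg _)
            (norm_radialProj_sub_radialProj_le hN (matOf V@@t x) (matOf V'@@t x)) 2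
          have h9 := mul_le_mul_of_nonneg_left h8 (by positivity : 0 ≤ c₁ / 4)
          linarith)).2.2 (fun t => c₁ * ∑ i, ‖Q.Dσ (u i t) - Q.Dσ (u' i t)‖ ^ 2) fun t =>
        ⟨by positivity, by
          rw [sum_add_distrib, mul_sum]
          exact le_add_of_nonneg_right (by positivity)⟩
      simp only [hW, hW']
      have e1 : ∀ (q : ℝ) (F : ℝ → ℝ), ∫ t in Icc 0 T, Γ t * (q * F t)
          = q * ∫ t in Icc 0 T, Γ t * F t := fun q F => by
        rw [← integral_const_mul]
        exact integral_congr_ae (.of_forall fun t => by simp only; ring)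
      rw [e1, e1] at e
      exact le_of_mul_le_mul_left (e.trans (le_of_eq (by ring))) hc₁)
  refine ⟨u, g, isSubst_iff.2 ⟨hg.1, ?_⟩, hu⟩
  filter_upwards [hg.2, hVW] with t h1 h2
  simp only [hW] at h2
  simpa only [h2] using h1

/-- Existence of a mild solution. -/
theorem exists_isMildSol {ρ : ℝ → L2 d} (hρ : MemLp ρ 2 (dt T))
    (hfρ : ∀ᵐ t ∂(dt T), ∀ᵐ x, ρ t x = ‖f t x 0 0‖)
    (hρb : ∀ᵐ t ∂(dt T), ∀ᵐ x, |ρ t x| ≤ b) :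
    ∃ u g, Q.IsMildSol T S φ f u g := by
  obtain ⟨c, hc, hap⟩ := A.exists_apriori (l := l)
  obtain ⟨K, hK, hap⟩ := hap (fun t => 1 + 2 * |μ t| + C ^ 2 / c)
    (((integrableOn_const_Icc 1).add (hμ.norm.const_mul 2)).add
      (integrableOn_const_Icc (C ^ 2 / c))) fun t => by positivity
  have hpos : ∀ n : ℕ, (0 : ℝ) < (n : ℝ) + 1 := fun n => by positivity
  choose u g hug using fun n : ℕ => A.exists_isMildSol_trunc hC hf hμ ha hb hφ hρ
    (hfρ.mono fun t ht => ht.mono fun x hx => hx.ge) (by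
      filter_upwards [hfρ, hρb] with t h1 h2
      filter_upwards [h1, h2] with x h3 h4
      rw [← h3]
      exact (le_abs_self _).trans h4) (hpos n)
  have hb' := fun n => hap (φ := φ) (hug n).1.1 (hug n).2 hρ (by
    filter_upwards [(isSubst_iff.1 (hug n).1).2, hfρ, ae_mem_Icc] with t h1 h2 ht
    filter_upwards [h1, h2] with x h3 h4
    rw [h3, h4]
    have h5 := hf.two_inner_le hC hc ht x (vec (u n)@@t x)
      (radialProj ((n : ℝ) + 1) (matOf (fun j => Q.Dσ (u n j t)) x))
    have h6 := pow_le_pow_left₀ (norm_nonneg _) (norm_radialProj_le_norm ((n : ℝ) + 1)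
      (matOf (fun j => Q.Dσ (u n j t)) x)) 2
    rw [Q.DσMat_eq]
    linarith [mul_le_mul_of_nonneg_left h6 hc.le])
  have hbR : ∀ n, ∀ t ∈ Icc 0 T, ∀ᵐ x, ‖vec (u n)@@t x‖ ≤ K * (a + b) + 1 := fun n t ht => by
    filter_upwards [(hb' n).2.2.2 a b ha hb hφ hρb t ht] with x hx
    linarith
  exact A.exists_isMildSol_of_approx hC hf hμ (fun n i => (hug n).1.1 i)
    (fun n => (hug n).2) (by positivity)
    (K := K * (∑ i, ‖φ i‖ ^ 2 + ∫ t in Icc 0 T, ‖ρ t‖ ^ 2)) (by positivity)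
    hbR (fun n => (hb' n).1) (fun n => (hb' n).2.2.1) (e := fun _ _ => 0)
    (fun n => integrable_zero _ _ _) (fun n => by simp only [norm_zero, integral_zero]; positivity)
    (fun n => by
      filter_upwards [(isSubst_iff.1 (hug n).1).2] with t h1
      filter_upwards [h1, ae_zero (E := ℝ) (p := 2)] with x h3 h4
      rw [h3, h4, Q.DσMat_eq]
      simp)

end

theorem sum_norm_sq_le_normTSq {u : Fin l → ℝ → L2 d}
    (hu : ∀ i, ContinuousOn (u i) (Icc 0 T))
    (hF : ∀ i, ∀ᵐ t ∂(dt T), Q.MemF c₂ (u i t)) {t : ℝ} (ht : t ∈ Icc 0 T) :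
    ∑ i, ‖u i t‖ ^ 2 ≤ Q.normTSq c₂ T u := by
  have hc : ContinuousOn (fun t => ∑ i, ‖u i t‖ ^ 2) (Icc 0 T) :=
    continuousOn_finsetSum _ fun i _ => (hu i).norm.pow 2
  have h1 : BddAbove (range fun t : Icc 0 T => ∑ i, ‖u i t‖ ^ 2) := by
    refine (isCompact_Icc.bddAbove_image hc).mono ?_
    rintro _ ⟨t, rfl⟩
    exact ⟨t, t.2, rfl⟩
  have h2 : 0 ≤ ∫ t in Icc 0 T, ∑ i, Q.energy c₂ (u i t) := by
    refine integral_nonneg_of_ae ?_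
    filter_upwards [ae_all_iff.2 hF] with t h3 using sum_nonneg fun i _ => A.energy_nonneg (h3 i)
  exact (le_ciSup h1 ⟨t, ht⟩).trans (le_add_of_nonneg_right h2)

theorem eq_mild_of_isLinStrongSol {φ : L2 d} {g u : ℝ → L2 d}
    (hg : g ∈L¹ T) (hu : Q.IsLinStrongSol c₂ T P φ g u) {t : ℝ}
    (ht : t ∈ Icc 0 T) : u t = mild S T φ g t := by
  obtain ⟨-, rfl, u', Lu, hd, hi, -, hae⟩ := hu
  refine A.sg.semigroup.eq_mild (Lu := Lu) hd hi hg ?_ ht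
  filter_upwards [hae] with s hs using ⟨(A.sg.gen_iff _ _).1 hs.1, hs.2⟩

/-- Generalized solutions are mild solutions. -/
theorem exists_eq_mild {φ : Fin l → L2 d}
    {v : Fin l → ℝ → L2 d} (hv : Q.IsGeneralizedSol c₂ T P φ f v) :
    ∃ u g, Q.IsMildSol T S φ f u g ∧ ∀ i, ∀ t ∈ Icc 0 T, v i t = u i t := by
  obtain ⟨hvF, g, hg, un, gn, φn, fn, hs, hlim, hφ, hgn⟩ := hv
  obtain ⟨K, hK0, hK⟩ := A.exists_mild_sub_bound
  have key : ∀ i, ∀ t ∈ Icc 0 T, v i t = mild S T (φ i) (g i) t := fun i t ht => by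
    have l1 : (fun n => un n i t) ⇝ v i t := by
      rw [tendsto_iff_norm_sub_tendsto_zero]
      have h1 : (fun n => √(Q.normTSq c₂ T fun i t => un n i t - v i t)) ⇝ 0 := by
        simpa using hlim.sqrt
      refine squeeze_zero (fun n => norm_nonneg _) (fun n => Real.le_sqrt_of_sq_le ?_) h1
      refine (single_le_sum (f := fun i => ‖un n i t - v i t‖ ^ 2) (fun i _ => by positivity)
        (Finset.mem_univ i)).trans (A.sum_norm_sq_le_normTSq (u := fun i t => un n i t - v i t)
          (fun i => ((hs n).2.2 i).1.cont.sub (hvF i).cont) (fun i => ?_) ht)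
      filter_upwards [((hs n).2.2 i).1.mem, (hvF i).mem] with t m1 m2 using (A.sub_mem m1 m2).1
    have l2 : (fun n => un n i t) ⇝ (mild S T (φ i) (g i) t) := by
      rw [tendsto_iff_norm_sub_tendsto_zero]
      have h1 := ((hφ i).add (hgn i)).const_mul K
      rw [add_zero, mul_zero] at h1
      refine squeeze_zero (fun n => norm_nonneg _) (fun n => ?_) h1
      rw [A.eq_mild_of_isLinStrongSol ((hs n).2.1.1 i) ((hs n).2.2 i) ht]
      exact (hK ((hs n).2.1.1 i) (hg.1 i)).1 t ht
    exact tendsto_nhds_unique l1 l2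
  exact ⟨_, g, ⟨hg.congr key, fun i => rfl⟩, key⟩

theorem isLinStrongSol_of_classical {u Lu g : ℝ → L2 d}
    (h : IsBddClassical S T u Lu g) : Q.IsLinStrongSol c₂ T P (u T) g u :=
  ⟨(A.memFhat_mild (u T) h.contg.integrableOn_Icc).congr fun _ ht =>
      h.eq_mild A.sg.semigroup ht, rfl, _, Lu, h.deriv,
    (h.contL.neg.sub h.contg).integrableOn_Icc, h.contL.integrableOn_Icc, by
      filter_upwards [ae_mem_Icc] with s hs
      exact ⟨(A.sg.gen_iff _ _).2 (h.gen s hs), by abel⟩⟩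

section

variable {φ : Fin l → L2 d}

/-- Mild solutions are generalized solutions. -/
theorem isGeneralizedSol_of_isMildSol {u g : Fin l → ℝ → L2 d} (hu : Q.IsMildSol T S φ f u g) :
    Q.IsGeneralizedSol c₂ T P φ f u := by
  have hpos : ∀ n : ℕ, (0 : ℝ) < 1 / ((n : ℝ) + 1) := fun n => by positivity
  have hlim0 := tendsto_one_div_add_atTop_nhds_zero_nat (𝕜 := ℝ)
  choose w Lw γ hw hwφ hγ using fun (n : ℕ) i =>
    A.sg.exists_isBddClassical A.pos (φ i) (hu.1.1 i) (hpos n)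
  have hγi : ∀ n i, γ n i ∈L¹ T := fun n i => (hw n i).contg.integrableOn_Icc
  choose V hV hVe using fun n i => exists_rep (hγi n i).aestronglyMeasurable
  obtain ⟨K, hK0, hK⟩ := A.exists_mild_sub_bound
  have hF : ∀ i, Q.MemFhat c₂ T (u i) := fun i => by
    rw [hu.2 i]
    exact A.memFhat_mild _ (hu.1.1 i)
  have hwF : ∀ n i, Q.MemFhat c₂ T (w n i) := fun n i => (A.isLinStrongSol_of_classical (hw n i)).1
  have hδ : ∀ n i, ‖w n i T - φ i‖ + ∫ s in Icc 0 T, ‖γ n i s - g i s‖ ≤ 2 * (1 / ((n : ℝ) + 1)) :=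
    fun n i => by linarith [hwφ n i, hγ n i]
  have hδ0 : ∀ n i, 0 ≤ ‖w n i T - φ i‖ + ∫ s in Icc 0 T, ‖γ n i s - g i s‖ := fun n i => by
    positivity
  have he : ∀ n i, ∀ t ∈ Icc 0 T,
      w n i t - u i t = mild S T (w n i T) (γ n i) t - mild S T (φ i) (g i) t := fun n i t ht => by
    rw [← (hw n i).eq_mild A.sg.semigroup ht, hu.2 i]
  have hsup : ∀ n, ∀ t ∈ Icc 0 T, ∑ i, ‖w n i t - u i t‖ ^ 2
      ≤ ∑ _ : Fin l, (K * (2 * (1 / ((n : ℝ) + 1)))) ^ 2 := fun n t ht =>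
    sum_le_sum fun i _ => by
      rw [he n i t ht]
      exact pow_le_pow_left₀ (norm_nonneg _) (((hK (hγi n i) (hu.1.1 i)).1 t ht).trans
        (mul_le_mul_of_nonneg_left (hδ n i) hK0)) 2
  have hint : ∀ n i, ∫ t in Icc 0 T, Q.energy c₂ (w n i t - u i t)
      ≤ K * (2 * (1 / ((n : ℝ) + 1))) ^ 2 := fun n i => by
    rw [setIntegral_congr_fun measurableSet_Icc fun t ht => congrArg (Q.energy c₂) (he n i t ht)]
    exact ((hK (hγi n i) (hu.1.1 i)).2.1).trans
      (mul_le_mul_of_nonneg_left (pow_le_pow_left₀ (hδ0 n i) (hδ n i) 2) hK0)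
  have hei : ∀ n i, (fun t => Q.energy c₂ (w n i t - u i t)) ∈L¹ T := fun n i =>
    (A.memFhat_mild (w n i T - φ i) ((hγi n i).sub (hu.1.1 i))).congr (fun t ht => by
      rw [he n i t ht]
      exact (A.sg.semigroup.mild_sub (hγi n i) (hu.1.1 i) ht).symm) |>.int
  refine ⟨hF, g, hu.1, w, γ, fun n i => w n i T, fun n t x _ _ => toLp 2 fun i => V n i (t, x),
    fun n => ⟨?_, ⟨hγi n, ?_⟩, fun i => A.isLinStrongSol_of_classical (hw n i)⟩, ?_, fun i => ?_,
    fun i => ?_⟩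
  · refine (continuous_toLp 2 _).measurable.comp (measurable_pi_lambda _ fun i => ?_)
    exact (hV n i).comp (f := fun p : ℝ × Rn d × Rn l × Mat l k => (p.1, p.2.1)) (by fun_prop)
  · filter_upwards [ae_all_iff.2 (hVe n)] with t ht i using ht i
  · have h1 : (fun n : ℕ => ∑ _ : Fin l, (K * (2 * (1 / ((n : ℝ) + 1)))) ^ 2
        + ∑ _ : Fin l, K * (2 * (1 / ((n : ℝ) + 1))) ^ 2) ⇝ 0 := by
      have h2 := (tendsto_finsetSum Finset.univ fun (_ : Fin l) _ =>
        ((hlim0.const_mul 2).const_mul K).pow 2).add (tendsto_finsetSum Finset.univ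
          fun (_ : Fin l) _ => ((hlim0.const_mul 2).pow 2).const_mul K)
      simpa using h2
    refine squeeze_zero (fun n => ?_) (fun n => normTSq_le A.pos.le (hsup n) ?_) h1
    · refine le_trans ?_ (A.sum_norm_sq_le_normTSq (u := fun i t => w n i t - u i t)
        (fun i => (hwF n i).cont.sub (hF i).cont) (fun i => ?_) (left_mem_Icc.2 A.pos.le))
      · positivity
      · filter_upwards [(hwF n i).mem, (hF i).mem] with t m1 m2 using (A.sub_mem m1 m2).1
    · rw [integral_finsetSum _ fun i _ => hei n i]
      exact sum_le_sum fun i _ => hint n i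
  · exact squeeze_zero (fun n => norm_nonneg _) (fun n => (hwφ n i).le) hlim0
  · exact squeeze_zero (fun n => by positivity) (fun n => (hγ n i).le) hlim0

/-- Uniqueness of mild solutions. -/
theorem isMildSol_unique
    (hC : 0 ≤ C) (hf : f.IsMonotone T C μ) (hμ : μ ∈L¹ T)
    {u u' g g' : Fin l → ℝ → L2 d} (hu : Q.IsMildSol T S φ f u g) (hu' : Q.IsMildSol T S φ f u' g')
    (i : Fin l) {t : ℝ} (ht : t ∈ Icc 0 T) : u i t = u' i t := by
  obtain ⟨c₁, hc₁, hpair⟩ := A.exists_pair_estimate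
  obtain ⟨Γ, M, -, -, -, hpair⟩ := hpair (fun t => 2 * |μ t| + C ^ 2 / c₁)
    (hμ.two_abs_add _) fun t => by positivity
  have e := (hpair (ρ := fun _ => 0) hu.1.1 hu'.1.1 hu.2 hu'.2 (integrable_zero _ _ _)
    (fun _ => le_rfl) (by
      filter_upwards [(isSubst_iff.1 hu.1).2, (isSubst_iff.1 hu'.1).2, ae_mem_Icc] with t h1 h2 ht
      refine ⟨fun _ => 0, integrable_zero _ _ _, by simp, ?_⟩
      filter_upwards [h1, h2] with x h3 h4
      rw [h3, h4, Q.DσMat_eq, Q.DσMat_eq, add_zero]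
      exact hf.two_inner_sub_le hC hc₁ ht x _ _ _ _)).1 t ht
  rw [integral_zero, mul_zero] at e
  have h0 := (Finset.sum_eq_zero_iff_of_nonneg fun i _ => by positivity).1
    (le_antisymm e (sum_nonneg fun i _ => by positivity)) i (Finset.mem_univ i)
  exact sub_eq_zero.1 (norm_eq_zero.1 (pow_eq_zero_iff two_ne_zero |>.1 h0))

end

end Coefficients.Assumptions



theorem theorem3p11 (T : ℝ) (hT : 0 < T) (𝒞 : Coefficients d k)
    (hσ : 𝒞.BddSigma) (hA1 : 𝒞.CondA1) (hA2' : 𝒞.CondA2') (hA3 : 𝒞.CondA3) :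
    (∃ c₂, 𝒞.CondA2 c₂) ∧
    ∀ c₂, 𝒞.CondA2 c₂ → ∀ P : ℝ≥0 → L1 d →L[ℝ] L1 d, 𝒞.CondA4 c₂ T P → 𝒞.CondH6 c₂ →
    ∀ C > 0, ∀ μ : ℝ → ℝ, μ ∈L¹ T →
    ∃ K₁ > 0, ∃ K₂ > 0,
      ∀ (φ : Fin l → L2 d) (f : Nonlin d k l), f.IsMeasurable → f.CondH T C μ φ →
      ∃ u : Fin l → ℝ → L2 d,
        𝒞.IsGeneralizedSol c₂ T P φ f u ∧
        (∀ v, 𝒞.IsGeneralizedSol c₂ T P φ f v → ∀ i, ∀ t ∈ Icc 0 T, v i t = u i t) ∧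
        𝒞.normTSq c₂ T u ≤
          K₁ * ((∑ i, ‖φ i‖ ^ 2) + ∫ t in Icc 0 T, ∫ x, ‖f t x 0 0‖ ^ 2) ∧
        ∀ t ∈ Icc 0 T, eLpNorm (vec fun i => u i t) ⊤ volume ≤
          ofReal K₂ *
            (eLpNorm (vec φ) ⊤ volume + eLpNorm f.f0 ⊤ (Nonlin.slab d T)) := by
  refine ⟨Coefficients.exists_condA2 hA1 hA2', fun c₂ hA2 P hA4 _ C hC μ hμ => ?_⟩
  obtain ⟨S, hS⟩ := hA4.semigroup.exists_l2Semigroup hT hA4.bdd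
  have A : 𝒞.Assumptions c₂ T P S := ⟨hT, hA1, hA2', hA2, hA3, hA4, hS⟩
  obtain ⟨c, hc, hap⟩ := A.exists_apriori (l := l)
  obtain ⟨K, hK, hap⟩ := hap (fun t => 1 + 2 * |μ t| + C ^ 2 / c)
    (((integrableOn_const_Icc 1).add (hμ.norm.const_mul 2)).add
      (integrableOn_const_Icc (C ^ 2 / c))) fun t => by positivity
  refine ⟨2 * K, by positivity, K, hK, fun φ f hm hf => ?_⟩
  have hfM := hf.isMonotone hm
  obtain ⟨ρ, hρ, hρe, hρb, hρi⟩ := hf.exists_norm_f0_path hm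
  have hφ : ∀ᵐ x, ‖vec φ x‖ ≤ (eLpNorm (vec φ) ⊤ volume).toReal := by
    filter_upwards [ae_le_eLpNormEssSup (f := vec φ) (μ := volume)] with x hx
    rw [← toReal_enorm]
    exact toReal_mono hf.H5_φ.2.ne (by rwa [eLpNorm_exponent_top])
  obtain ⟨u, g, hu⟩ := A.exists_isMildSol hC.le hfM hμ toReal_nonneg toReal_nonneg
    hφ hρ hρe hρb
  obtain ⟨h1, h2, -, h3⟩ := hap hu.1.1 hu.2 hρ (by
    filter_upwards [(Coefficients.isSubst_iff.1 hu.1).2, hρe, ae_mem_Icc]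
      with t e1 e2 ht
    filter_upwards [e1, e2] with x e3 e4
    rw [e3, e4, 𝒞.DσMat_eq]
    exact hfM.two_inner_le hC.le hc ht x _ _)
  refine ⟨u, A.isGeneralizedSol_of_isMildSol hu, fun v hv i t ht => ?_, ?_, fun t ht => ?_⟩
  · obtain ⟨w, γ, hw, hvw⟩ := A.exists_eq_mild hv
    rw [hvw i t ht, A.isMildSol_unique hC.le hfM hμ hw hu i ht]
  · rw [← hρi]
    exact (Coefficients.normTSq_le hT.le h1 h2).trans (le_of_eq (by ring))
  · have h4 := h3 _ _ toReal_nonneg toReal_nonneg hφ hρb t ht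
    refine (eLpNorm_le_of_ae_bound h4).trans (le_of_eq ?_)
    rw [ofReal_mul hK.le, ENNReal.ofReal_add toReal_nonneg toReal_nonneg,
      ofReal_toReal hf.H5_φ.2.ne, ofReal_toReal hf.H5_f0.2.ne]
    simp
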